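/- Let $(M,\omega)$ be a symplectic manifold of dimension $2m$ with Poisson tensor $\Lambda$, $\Lambda^{ik}\omega_{jk}=\delta^i_j$, and let $\nabla^M$ be a torsion-free connection on $TM$ with $\nabla^M\omega=0$. Let $E\to M$ be a real vector bundle of rank $n$ with a nondegenerate (not necessarily definite) symmetric fibre metric $q$ and a connection $\nabla^E$ preserving $q$; all data are smooth. The Fedosov algebra $\mathcal W\otimes\Lambda$ is the complex vector space of formal sums $\sum_{s,t\ge 0}w_{st}\lambda^t$ with $w_{st}$ a smooth section of the complexification of $\vee^sT^*M\otimes\Lambda E^*\otimes\Lambda T^*M$, with the undeformed product $(f\otimes\phi\otimes\alpha\,\lambda^{t_1})(g\otimes\psi\otimes\beta\,\lambda^{t_2})=(f\vee g)\otimes(\phi\wedge\psi)\otimes(\alpha\wedge\beta)\,\lambda^{t_1+t_2}$. Let $\deg_s,\deg_E,\deg_a,\deg_\lambda$ be the degree operators for the three tensor factors and for $\lambda$, $\mathrm{Deg}=2\deg_\lambda+\deg_s+\deg_E$, $P_E=(-1)^{\deg_E}$, $P_\lambda=(-1)^{\deg_\lambda}$, and let $C$ be complex conjugation (with $C\lambda=\lambda$).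 Let $i_s(X)$, $i_a(X)$ and $i(e)$ be the insertions in $\vee T^*M$, $\Lambda T^*M$ and $\Lambda E^*$, the latter two being antiderivations of these Grassmann algebras, and put $j(e)=P_E\,i(e)$. In a chart with coordinate fields $\partial_i$, and for a local frame $(e_A)$ of $E$ with $(q^{AB})$ the inverse matrix of $(q(e_A,e_B))$, set $$\delta(f\otimes\phi\otimes\alpha)=i_s(\partial_i)f\otimes\phi\otimes dx^i\wedge\alpha,\qquad \delta^*(f\otimes\phi\otimes\alpha)=dx^i\vee f\otimes\phi\otimes i_a(\partial_i)\alpha,$$ $$\nabla(f\otimes\phi\otimes\alpha)=\big(\nabla^M_{\partial_i}f\otimes\phi+f\otimes\nabla^E_{\partial_i}\phi\big)\otimes dx^i\wedge\alpha+f\otimes\phi\otimes d\alpha,$$ $$F\circ G=\sum_{k,l\ge0}\frac{(i\lambda/2)^{k+l}}{k!\,l!}\Lambda^{i_1j_1}\cdots\Lambda^{i_kj_k}q^{A_1B_1}\cdots q^{A_lB_l}\big(i_s(\partial_{i_1})\cdots i_s(\partial_{i_k})j(e_{A_1})\cdots j(e_{A_l})F\big)\big(i_s(\partial_{j_1})\cdots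 i_s(\partial_{j_k})i(e_{B_1})\cdots i(e_{B_l})G\big).$$ With $R=\Lambda^{ij}i_s(\partial_i)\otimes i_s(\partial_j)$, $S=q^{AB}j(e_A)\otimes i(e_B)$ and $\mu$ the undeformed product, one has $F\circ G=\mu\big(e^{\frac{i\lambda}{2}(R+S)}(F\otimes G)\big)$. A $\circ$-superderivation of type $((-1)^{d'},a')$ is a $\mathbb C$-linear endomorphism $\Phi$ of $\mathcal W\otimes\Lambda$ with $P_E\Phi P_E=(-1)^{d'}\Phi$, $[\deg_a,\Phi]=a'\Phi$ and $\Phi(F\circ G)=\Phi F\circ G+(-1)^{d'd_1+a'a_1}F\circ\Phi G$ whenever $F$ has $E$-parity $(-1)^{d_1}$ and antisymmetric degree $a_1$. The operators above map $\mathcal W\otimes\Lambda$ to itself, and: 1. $\delta^2=0=(\delta^*)^2$ and $\delta\delta^*+\delta^*\delta=\deg_s+\deg_a$. 2. $\delta\nabla+\nabla\delta=0$. 3. $\ker\delta\cap\ker\deg_a=\mathcal C$, where $\mathcal C=\mathcal C_0[[\lambda]]$ and $\mathcal C_0$ is the space of smooth sections of the complexification of $\Lambda E^*$. 4. $\circ$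 is $\mathbb C$-bilinear and associative, $P_E$ is a $\circ$-automorphism, and $\deg_a$ is a $\circ$-derivation; thereby $(\mathcal W\otimes\Lambda,\circ)$ is a $\mathbb Z_2\times\mathbb Z$-graded associative algebra. 5. $\delta$, $\nabla$ and $\mathrm{Deg}$ are $\circ$-superderivations of type $(1,1)$, $(1,1)$ and $(1,0)$, respectively. 6. $P_\lambda$ ($\mathbb C$-linear) and $C$ (conjugate-linear) are graded $\circ$-antiautomorphisms: they are bijective, preserve the $\mathbb Z_2\times\mathbb Z$-grading, and satisfy $\Phi(F\circ G)=(-1)^{d_1d_2+a_1a_2}\,\Phi(G)\circ\Phi(F)$ for $F$, $G$ of $E$-parities $(-1)^{d_1},(-1)^{d_2}$ and antisymmetric degrees $a_1,a_2$. -/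

import Mathlib

open scoped Manifold ContDiff TensorProduct Bundle

noncomputable section

namespace Fedosov

/-! ### Linear algebra in one fibre -/

section Fibre

variable (V : Type*) [AddCommGroup V] [Module ℝ V] (F : Type*) [AddCommGroup F] [Module ℝ F]

/-- `Sym V* ⊗ Λ F* ⊗ Λ V*` over `ℝ`; the product of the two Grassmann factors is the ordinary
(not the graded) tensor product of algebras. -/
abbrev RealFibre : Type _ :=
  SymmetricAlgebra ℝ (Module.Dual ℝ V) ⊗[ℝ]
    (ExteriorAlgebra ℝ (Module.Dual ℝ F) ⊗[ℝ] ExteriorAlgebra ℝ (Module.Dual ℝ V))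

/-- The complexification of `Sym V* ⊗ Λ F* ⊗ Λ V*`, with its undeformed multiplication. -/
abbrev FibreAlg : Type _ := ℂ ⊗[ℝ] RealFibre V F

instance instRingRealFibre : Ring (RealFibre V F) := inferInstance
instance instAlgebraRealFibre : Algebra ℝ (RealFibre V F) := inferInstance
instance instAddCommGroupRealFibre : AddCommGroup (RealFibre V F) := inferInstance
instance instModuleRealFibre : Module ℝ (RealFibre V F) := inferInstance
instance instRingFibreAlg : Ring (FibreAlg V F) := inferInstance
instance instAlgebraFibreAlg : Algebra ℂ (FibreAlg V F) := inferInstance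
instance instAddCommGroupFibreAlg : AddCommGroup (FibreAlg V F) := inferInstance
instance instModuleFibreAlg : Module ℂ (FibreAlg V F) := inferInstance
instance instSemiringFibreAlg : Semiring (FibreAlg V F) := inferInstance
instance instAddCommMonoidFibreAlg : AddCommMonoid (FibreAlg V F) := inferInstance

/-- The complexification of `∨ˢ V* ⊗ Λ F* ⊗ Λ V*` inside `FibreAlg V F`. -/
def symDegree (s : ℕ) : Submodule ℂ (FibreAlg V F) :=
  LinearMap.range ((LinearMap.rTensor
    (ExteriorAlgebra ℝ (Module.Dual ℝ F) ⊗[ℝ] ExteriorAlgebra ℝ (Module.Dual ℝ V))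
    ((LinearMap.range (SymmetricAlgebra.ι ℝ (Module.Dual ℝ V))) ^ s).subtype).baseChange ℂ)

variable {V F}

/-- Extension of an operator on `Sym V*` to the fibre. -/
def onSym (T : Module.End ℝ (SymmetricAlgebra ℝ (Module.Dual ℝ V))) :
    Module.End ℂ (FibreAlg V F) :=
  (LinearMap.rTensor _ T).baseChange ℂ

/-- Extension of an operator on `Λ F*` to the fibre. -/
def onE (T : Module.End ℝ (ExteriorAlgebra ℝ (Module.Dual ℝ F))) :
    Module.End ℂ (FibreAlg V F) :=
  (LinearMap.lTensor _ (LinearMap.rTensor _ T)).baseChange ℂ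

/-- Extension of an operator on `Λ V*` to the fibre. -/
def onForms (T : Module.End ℝ (ExteriorAlgebra ℝ (Module.Dual ℝ V))) :
    Module.End ℂ (FibreAlg V F) :=
  (LinearMap.lTensor _ (LinearMap.lTensor _ T)).baseChange ℂ

/-- The derivation of `Sym V*` with `ξ ↦ ξ X` on `V*`: the `ε`-part of the algebra homomorphism
`Sym V* → Sym V* ⊕ ε Sym V*` with `ξ ↦ ξ + ε (ξ X)`. -/
def symContract (X : V) : Module.End ℝ (SymmetricAlgebra ℝ (Module.Dual ℝ V)) :=
  (TrivSqZeroExt.sndHom (SymmetricAlgebra ℝ (Module.Dual ℝ V))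
      (SymmetricAlgebra ℝ (Module.Dual ℝ V))).restrictScalars ℝ ∘ₗ
    (SymmetricAlgebra.lift
      ((TrivSqZeroExt.inlAlgHom ℝ (SymmetricAlgebra ℝ (Module.Dual ℝ V))
          (SymmetricAlgebra ℝ (Module.Dual ℝ V))).toLinearMap ∘ₗ
            SymmetricAlgebra.ι ℝ (Module.Dual ℝ V) +
        (TrivSqZeroExt.inrHom (SymmetricAlgebra ℝ (Module.Dual ℝ V))
          (SymmetricAlgebra ℝ (Module.Dual ℝ V))).restrictScalars ℝ ∘ₗ
            Algebra.linearMap ℝ (SymmetricAlgebra ℝ (Module.Dual ℝ V)) ∘ₗ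
              Module.Dual.eval ℝ V X)).toLinearMap

theorem symContract_one (X : V) : symContract X 1 = 0 := by
  simp [symContract]

theorem symContract_ι (X : V) (ξ : Module.Dual ℝ V) :
    symContract X (SymmetricAlgebra.ι ℝ _ ξ) = algebraMap ℝ _ (ξ X) := by
  simp [symContract, Algebra.algebraMap_eq_smul_one]

theorem symContract_mul (X : V) (a b : SymmetricAlgebra ℝ (Module.Dual ℝ V)) :
    symContract X (a * b) = a * symContract X b + b * symContract X a := by
  have key : ∀ c : SymmetricAlgebra ℝ (Module.Dual ℝ V),
      TrivSqZeroExt.fst (SymmetricAlgebra.lift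
      ((TrivSqZeroExt.inlAlgHom ℝ (SymmetricAlgebra ℝ (Module.Dual ℝ V))
          (SymmetricAlgebra ℝ (Module.Dual ℝ V))).toLinearMap ∘ₗ
            SymmetricAlgebra.ι ℝ (Module.Dual ℝ V) +
        (TrivSqZeroExt.inrHom (SymmetricAlgebra ℝ (Module.Dual ℝ V))
          (SymmetricAlgebra ℝ (Module.Dual ℝ V))).restrictScalars ℝ ∘ₗ
            Algebra.linearMap ℝ (SymmetricAlgebra ℝ (Module.Dual ℝ V)) ∘ₗ
              Module.Dual.eval ℝ V X) c) = c := by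
    intro c
    induction c using SymmetricAlgebra.induction with
    | algebraMap r => rw [AlgHom.commutes]; rfl
    | ι x => simp
    | mul a b ha hb => simp [ha, hb]
    | add a b ha hb => simp [ha, hb]
  simp [symContract, key, mul_comm]

/-- The operator on a Grassmann algebra which multiplies elements of degree `d` by `c d`. -/
def extWeight (N : Type*) [AddCommGroup N] [Module ℝ N] (c : ℕ → ℝ) :
    Module.End ℝ (ExteriorAlgebra ℝ N) :=
  (DirectSum.toModule ℝ ℕ (ExteriorAlgebra ℝ N) fun d => c d • (⋀[ℝ]^d N).subtype) ∘ₗ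
    (DirectSum.decomposeLinearEquiv (fun d : ℕ => ⋀[ℝ]^d N)).toLinearMap

/-- Symmetric substitution `i_s(X)`. -/
def iS (X : V) : Module.End ℂ (FibreAlg V F) := onSym (symContract X)

/-- The interior product `i_a(X)` in `Λ V*`. -/
def iA (X : V) : Module.End ℂ (FibreAlg V F) :=
  onForms (CliffordAlgebra.contractLeft (Module.Dual.eval ℝ V X))

/-- The interior product `i(e)` in `Λ F*`. -/
def iE (e : F) : Module.End ℂ (FibreAlg V F) :=
  onE (CliffordAlgebra.contractLeft (Module.Dual.eval ℝ F e))

/-- The parity operator `(-1)^{deg_E}` of a fibre. -/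
def parE : Module.End ℂ (FibreAlg V F) := onE (extWeight _ fun d => (-1) ^ d)

/-- The right antiderivation `j(e) = P_E i(e)`. -/
def jE (e : F) : Module.End ℂ (FibreAlg V F) := parE * iE e

/-- Multiplication by `ξ ∈ V*` in the symmetric factor. -/
def mulS (ξ : Module.Dual ℝ V) : Module.End ℂ (FibreAlg V F) :=
  onSym (LinearMap.mulLeft ℝ (SymmetricAlgebra.ι ℝ _ ξ))

/-- Left multiplication by `θ ∈ F*` in the factor `Λ F*`. -/
def mulE (θ : Module.Dual ℝ F) : Module.End ℂ (FibreAlg V F) :=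
  onE (LinearMap.mulLeft ℝ (ExteriorAlgebra.ι ℝ θ))

/-- Left multiplication by `ξ ∈ V*` in the factor `Λ V*`. -/
def mulA (ξ : Module.Dual ℝ V) : Module.End ℂ (FibreAlg V F) :=
  onForms (LinearMap.mulLeft ℝ (ExteriorAlgebra.ι ℝ ξ))

/-- Complex conjugation of a fibre. -/
def conjFibre : FibreAlg V F →ₗ[ℝ] FibreAlg V F :=
  LinearMap.rTensor (RealFibre V F) Complex.conjAe.toLinearMap

/-- The inclusion of the complexification of `Λ F*` into the fibre, `φ ↦ 1 ⊗ φ ⊗ 1`. -/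
def inclE : ℂ ⊗[ℝ] ExteriorAlgebra ℝ (Module.Dual ℝ F) →ₗ[ℂ] FibreAlg V F :=
  (TensorProduct.mk ℝ (SymmetricAlgebra ℝ (Module.Dual ℝ V))
      (ExteriorAlgebra ℝ (Module.Dual ℝ F) ⊗[ℝ] ExteriorAlgebra ℝ (Module.Dual ℝ V)) 1 ∘ₗ
    (TensorProduct.mk ℝ (ExteriorAlgebra ℝ (Module.Dual ℝ F))
      (ExteriorAlgebra ℝ (Module.Dual ℝ V))).flip 1).baseChange ℂ

section Bases

variable {ι κ : Type*} [Fintype ι] [Fintype κ] [DecidableEq ι] [DecidableEq κ]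

/-- `(δ a) = ∑ᵢ (dxⁱ ∧) i_s(∂ᵢ) a` -/
def fibreDelta (b : Module.Basis ι ℝ V) : Module.End ℂ (FibreAlg V F) :=
  ∑ i, mulA (b.coord i) * iS (b i)

/-- `(δ* a) = ∑ᵢ (dxⁱ ∨) i_a(∂ᵢ) a` -/
def fibreDeltaStar (b : Module.Basis ι ℝ V) : Module.End ℂ (FibreAlg V F) :=
  ∑ i, mulS (b.coord i) * iA (b i)

/-- The components `Λⁱʲ` of the Poisson structure, `∑ₖ Λⁱᵏ Ω(bⱼ, bₖ) = δⁱⱼ`. -/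
def poissonMatrix (Ω : V → V → ℝ) (b : Module.Basis ι ℝ V) : Matrix ι ι ℝ :=
  (Matrix.of fun k j => Ω (b j) (b k))⁻¹

/-- The components `q^{AB}` of the induced metric on `F*`. -/
def inverseMetric (q : F → F → ℝ) (c : Module.Basis κ ℝ F) : Matrix κ κ ℝ :=
  (Matrix.of fun A B => q (c A) (c B))⁻¹

/-- The sum over all indices of
`Λ^{i₁j₁} ⋯ Λ^{iₖjₖ} q^{A₁B₁} ⋯ q^{AₗBₗ} (i_s(∂_{i₁}) ⋯ i_s(∂_{iₖ}) j(e_{A₁}) ⋯ j(e_{Aₗ}) a)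
  (i_s(∂_{j₁}) ⋯ i_s(∂_{jₖ}) i(e_{B₁}) ⋯ i(e_{Bₗ}) a')`. -/
def contraction (Ω : V → V → ℝ) (q : F → F → ℝ) (b : Module.Basis ι ℝ V)
    (c : Module.Basis κ ℝ F) (k l : ℕ) (a a' : FibreAlg V F) : FibreAlg V F :=
  ∑ i : Fin k → ι, ∑ j : Fin k → ι, ∑ A : Fin l → κ, ∑ B : Fin l → κ,
    (((∏ r, poissonMatrix Ω b (i r) (j r)) * ∏ r, inverseMetric q c (A r) (B r) : ℝ) : ℂ) •
      (((List.ofFn fun r => iS (b (i r))).prod * (List.ofFn fun r => jE (c (A r))).prod :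
          Module.End ℂ (FibreAlg V F)) a *
        ((List.ofFn fun r => iS (b (j r))).prod * (List.ofFn fun r => iE (c (B r))).prod :
          Module.End ℂ (FibreAlg V F)) a')

/-- `R = Λⁱʲ i_s(∂ᵢ) ⊗ i_s(∂ⱼ)` -/
def fibreR (Ω : V → V → ℝ) (b : Module.Basis ι ℝ V) :
    Module.End ℂ (FibreAlg V F ⊗[ℂ] FibreAlg V F) :=
  ∑ i, ∑ j, ((poissonMatrix Ω b i j : ℝ) : ℂ) • TensorProduct.map (iS (b i)) (iS (b j))

/-- `S = q^{AB} j(e_A) ⊗ i(e_B)` -/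
def fibreS (q : F → F → ℝ) (c : Module.Basis κ ℝ F) :
    Module.End ℂ (FibreAlg V F ⊗[ℂ] FibreAlg V F) :=
  ∑ A, ∑ B, ((inverseMetric q c A B : ℝ) : ℂ) • TensorProduct.map (jE (c A)) (iE (c B))

end Bases

/-- The pull-back of `Sym V'* ⊗ Λ F'* ⊗ Λ V'*` along linear maps `V → V'` and `F → F'`. -/
def pull {V' F' : Type*} [AddCommGroup V'] [Module ℝ V'] [AddCommGroup F'] [Module ℝ F']
    (φ : V →ₗ[ℝ] V') (ψ : F →ₗ[ℝ] F') : FibreAlg V' F' →ₐ[ℂ] FibreAlg V F :=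
  Algebra.TensorProduct.map (AlgHom.id ℂ ℂ)
    (Algebra.TensorProduct.map
      (SymmetricAlgebra.lift (SymmetricAlgebra.ι ℝ (Module.Dual ℝ V) ∘ₗ φ.dualMap))
      (Algebra.TensorProduct.map (ExteriorAlgebra.map ψ.dualMap)
        (ExteriorAlgebra.map φ.dualMap)))

/-- The pull-back of the complexification of `Λ F'*` along a linear map `F → F'`. -/
def pullE {F' : Type*} [AddCommGroup F'] [Module ℝ F'] (ψ : F →ₗ[ℝ] F') :
    ℂ ⊗[ℝ] ExteriorAlgebra ℝ (Module.Dual ℝ F') →ₐ[ℂ]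
      ℂ ⊗[ℝ] ExteriorAlgebra ℝ (Module.Dual ℝ F) :=
  Algebra.TensorProduct.map (AlgHom.id ℂ ℂ) (ExteriorAlgebra.map ψ.dualMap)

end Fibre

/-! ### Formal sections -/

section Sections

variable (B : Type*) [NormedAddCommGroup B] [NormedSpace ℝ B] [FiniteDimensional ℝ B]
  {M : Type*} [TopologicalSpace M] [ChartedSpace B M] [IsManifold 𝓘(ℝ, B) ∞ M]
  (F : Type*) [NormedAddCommGroup F] [NormedSpace ℝ F] [FiniteDimensional ℝ F]
  (E : M → Type*) [∀ x, AddCommGroup (E x)] [∀ x, Module ℝ (E x)]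
  [∀ x, TopologicalSpace (E x)] [TopologicalSpace (Bundle.TotalSpace F E)]
  [FiberBundle F E] [VectorBundle ℝ F E]

/-- Families `w x s t`, to be read as `∑_{s,t} w_{st} λᵗ` with `w_{st}` a (not necessarily smooth)
section of the complexification of `∨ˢ T*M ⊗ Λ E* ⊗ Λ T*M`. Smoothness and homogeneity
are imposed in `fedosovAlgebra`. -/
abbrev RawSection : Type _ :=
  (x : M) → ℕ → ℕ → FibreAlg (TangentSpace 𝓘(ℝ, B) x) (E x)

/-- The basis `∂ᵢ` of `T_x M` given by the preferred chart at `x`. -/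
def tangentBasis (x : M) :
    Module.Basis (Fin (Module.finrank ℝ B)) ℝ (TangentSpace 𝓘(ℝ, B) x) :=
  (trivializationAt B (TangentSpace 𝓘(ℝ, B) : M → Type _) x).basisAt (Module.finBasis ℝ B)
    (FiberBundle.mem_baseSet_trivializationAt' x)

/-- The basis `e_A` of `E_x` given by the preferred trivialization at `x`. -/
def fibreBasis (x : M) : Module.Basis (Fin (Module.finrank ℝ F)) ℝ (E x) :=
  (trivializationAt F E x).basisAt (Module.finBasis ℝ F)
    (FiberBundle.mem_baseSet_trivializationAt' x)

/-- The coordinate vector fields `∂ᵢ` of the preferred chart at `x`, extended by zero. -/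
def tangentFrame (x : M) (i : Fin (Module.finrank ℝ B)) (y : M) : TangentSpace 𝓘(ℝ, B) y :=
  (trivializationAt B (TangentSpace 𝓘(ℝ, B) : M → Type _) x).localFrame (Module.finBasis ℝ B) i y

/-- The local frame `e_A` of the preferred trivialization at `x`, extended by zero. -/
def fibreFrame (x : M) (A : Fin (Module.finrank ℝ F)) (y : M) : E y :=
  (trivializationAt F E x).localFrame (Module.finBasis ℝ F) A y

/-- The linear map `T_x M → T_y M` which maps the coordinate vectors of the preferred chart at `x`
to each other (it is `0` if `y` is outside that chart). -/
def tangentTransport (x y : M) : TangentSpace 𝓘(ℝ, B) x →ₗ[ℝ] TangentSpace 𝓘(ℝ, B) y :=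
  ((trivializationAt B (TangentSpace 𝓘(ℝ, B) : M → Type _) x).symmL ℝ y).toLinearMap ∘ₗ
    ((trivializationAt B (TangentSpace 𝓘(ℝ, B) : M → Type _) x).continuousLinearMapAt
      ℝ x).toLinearMap

/-- The linear map `E_x → E_y` which maps the preferred local frame around `x` at `x` to the
same frame at `y` (it is `0` if `y` is outside the domain of the frame). -/
def fibreTransport (x y : M) : E x →ₗ[ℝ] E y :=
  ((trivializationAt F E x).symmL ℝ y).toLinearMap ∘ₗ
    ((trivializationAt F E x).continuousLinearMapAt ℝ x).toLinearMap

variable {E}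

/-- A section near `x`, written in the preferred local frames around `x`, as a function with
values in the fibre at `x`. -/
def localRep (x : M) (u : (y : M) → FibreAlg (TangentSpace 𝓘(ℝ, B) y) (E y)) (y : M) :
    FibreAlg (TangentSpace 𝓘(ℝ, B) x) (E x) :=
  pull (tangentTransport B x y) (fibreTransport F E x y) (u y)

/-- Smoothness of a section: all components in local frames are smooth. -/
def IsSmooth (u : (y : M) → FibreAlg (TangentSpace 𝓘(ℝ, B) y) (E y)) : Prop :=
  ∀ (x : M) (ℓ : Module.Dual ℂ (FibreAlg (TangentSpace 𝓘(ℝ, B) x) (E x))),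
    ContMDiffAt 𝓘(ℝ, B) 𝓘(ℝ, ℂ) ∞ (fun y => ℓ (localRep B F x u y)) x

/-- Smoothness of a section of the complexification of `Λ E*`. -/
def IsSmoothE (u : (y : M) → ℂ ⊗[ℝ] ExteriorAlgebra ℝ (Module.Dual ℝ (E y))) : Prop :=
  ∀ (x : M) (ℓ : Module.Dual ℂ (ℂ ⊗[ℝ] ExteriorAlgebra ℝ (Module.Dual ℝ (E x)))),
    ContMDiffAt 𝓘(ℝ, B) 𝓘(ℝ, ℂ) ∞ (fun y => ℓ (pullE (fibreTransport F E x y) (u y))) x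

variable (E)

/-- The Fedosov algebra `𝒲 ⊗ Λ`, as a complex vector space. -/
def fedosovAlgebra : Submodule ℂ (RawSection B E) where
  carrier := {w | (∀ x s t, w x s t ∈ symDegree (TangentSpace 𝓘(ℝ, B) x) (E x) s) ∧
    ∀ s t, IsSmooth B F fun x => w x s t}
  zero_mem' := by
    refine ⟨fun x s t => Submodule.zero_mem _, fun s t x ℓ => ?_⟩
    simpa [localRep] using contMDiffAt_const
  add_mem' := by
    rintro v w ⟨hv, hv'⟩ ⟨hw, hw'⟩
    refine ⟨fun x s t => Submodule.add_mem _ (hv x s t) (hw x s t), fun s t x ℓ => ?_⟩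
    have h := (hv' s t x ℓ).add (hw' s t x ℓ)
    simp only [localRep, Pi.add_apply, map_add] at h ⊢
    exact h
  smul_mem' := by
    rintro c w ⟨hw, hw'⟩
    refine ⟨fun x s t => Submodule.smul_mem _ c (hw x s t), fun s t x ℓ => ?_⟩
    have h := ((c • ContinuousLinearMap.id ℝ ℂ).contMDiff.contMDiffAt (n := ∞)).comp x
      (hw' s t x ℓ)
    simp only [localRep, Pi.smul_apply, map_smul] at h ⊢
    exact h

/-- `𝒞 = 𝒞₀[[λ]]`, `𝒞₀` the smooth sections of the complexification of `Λ E*`, as a subset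
of the Fedosov algebra: `∑ₜ φₜ λᵗ` is identified with `∑ₜ 1 ⊗ φₜ ⊗ 1 λᵗ`. -/
def classicalSeries : Set (RawSection B E) :=
  {w | ∃ φ : ℕ → (x : M) → ℂ ⊗[ℝ] ExteriorAlgebra ℝ (Module.Dual ℝ (E x)),
    (∀ t, IsSmoothE B F (φ t)) ∧
    ∀ x s t, w x s t = if s = 0 then inclE (φ t x) else 0}

variable {E B}

/-- The symmetric degree. -/
def degS (w : RawSection B E) : RawSection B E := fun x s t => (s : ℂ) • w x s t

/-- The `λ`-degree. -/
def degLam (w : RawSection B E) : RawSection B E := fun x s t => (t : ℂ) • w x s t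

/-- The `E`-degree. -/
def degE (w : RawSection B E) : RawSection B E :=
  fun x s t => onE (extWeight _ fun d => (d : ℝ)) (w x s t)

/-- The antisymmetric degree. -/
def degA (w : RawSection B E) : RawSection B E :=
  fun x s t => onForms (extWeight _ fun d => (d : ℝ)) (w x s t)

/-- The total degree `Deg = 2 deg_λ + deg_s + deg_E`. -/
def Deg (w : RawSection B E) : RawSection B E := (2 : ℂ) • degLam w + degS w + degE w

/-- The `E`-parity `P_E = (-1)^{deg_E}`. -/
def PE (w : RawSection B E) : RawSection B E := fun x s t => parE (w x s t)

/-- The `λ`-parity `P_λ = (-1)^{deg_λ}`. -/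
def PLam (w : RawSection B E) : RawSection B E := fun x s t => (-1 : ℂ) ^ t • w x s t

/-- Complex conjugation of sections (`λ` is real). -/
def conjSection (w : RawSection B E) : RawSection B E := fun x s t => conjFibre (w x s t)

/-- `δ`; it lowers the symmetric degree by one. -/
def delta (w : RawSection B E) : RawSection B E :=
  fun x s t => fibreDelta (tangentBasis B x) (w x (s + 1) t)

/-- `δ*`; it raises the symmetric degree by one. -/
def deltaStar (w : RawSection B E) : RawSection B E
  | _, 0, _ => 0
  | x, s + 1, t => fibreDeltaStar (tangentBasis B x) (w x s t)

/-- The fibrewise product `F ∘ G`. In the coefficient of `λᵗ` only the terms with `k + l ≤ t` of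
the series over `k, l` occur, and `k` contractions lower the symmetric degree by `2k`. -/
def circ (Ω : (x : M) → TangentSpace 𝓘(ℝ, B) x →L[ℝ] TangentSpace 𝓘(ℝ, B) x →L[ℝ] ℝ)
    (q : (x : M) → E x →L[ℝ] E x →L[ℝ] ℝ) (v w : RawSection B E) : RawSection B E :=
  fun x s t =>
    ∑ k ∈ Finset.range (t + 1), ∑ l ∈ Finset.range (t + 1 - k),
      ((Complex.I / 2) ^ (k + l) / ((Nat.factorial k : ℂ) * (Nat.factorial l : ℂ))) •
        ∑ p ∈ Finset.HasAntidiagonal.antidiagonal (t - (k + l)), ∑ r ∈ Finset.HasAntidiagonal.antidiagonal (s + 2 * k),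
          contraction (fun X Y => Ω x X Y) (fun e e' => q x e e') (tangentBasis B x)
            (fibreBasis F E x) k l (v x r.1 p.1) (w x r.2 p.2)

variable (B E)

/-- Formal series `∑ T_{s,s',t} λᵗ` with `T_{s,s',t}` in the tensor square of the fibre, of
symmetric degree `s` in the first and `s'` in the second factor. -/
abbrev TensorSeries (x : M) : Type _ :=
  ℕ → ℕ → ℕ → FibreAlg (TangentSpace 𝓘(ℝ, B) x) (E x) ⊗[ℂ]
    FibreAlg (TangentSpace 𝓘(ℝ, B) x) (E x)

variable {B E}

/-- `F ⊗ G` at the point `x`, over `ℂ[[λ]]`. -/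
def tensorSeries (v w : RawSection B E) (x : M) : TensorSeries B E x :=
  fun s s' t => ∑ p ∈ Finset.HasAntidiagonal.antidiagonal t, v x s p.1 ⊗ₜ[ℂ] w x s' p.2

/-- `(i/2) (R + S)` on formal series. -/
def halfRS (Ω : (x : M) → TangentSpace 𝓘(ℝ, B) x →L[ℝ] TangentSpace 𝓘(ℝ, B) x →L[ℝ] ℝ)
    (q : (x : M) → E x →L[ℝ] E x →L[ℝ] ℝ) (x : M) (T : TensorSeries B E x) :
    TensorSeries B E x :=
  fun s s' t => (Complex.I / 2) •
    (fibreR (fun X Y => Ω x X Y) (tangentBasis B x) (T (s + 1) (s' + 1) t) +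
      fibreS (fun e e' => q x e e') (fibreBasis F E x) (T s s' t))

/-- `e^{λ Φ} = ∑ₙ λⁿ Φⁿ / n!` for an operator `Φ` on formal series. -/
def expLam {x : M} (Φ : TensorSeries B E x → TensorSeries B E x) (T : TensorSeries B E x) :
    TensorSeries B E x :=
  fun s s' t => ∑ n ∈ Finset.range (t + 1), ((Nat.factorial n : ℂ)⁻¹) • (Φ^[n] T) s s' (t - n)

/-- The undeformed multiplication `μ` on formal series. -/
def muSeries {x : M} (T : TensorSeries B E x) :
    ℕ → ℕ → FibreAlg (TangentSpace 𝓘(ℝ, B) x) (E x) :=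
  fun s t => ∑ r ∈ Finset.HasAntidiagonal.antidiagonal s, LinearMap.mul' ℂ _ (T r.1 r.2 t)

/-- The derivative at `x` in direction `v` of a function with values in the fibre at `x`,
taken component by component. -/
def fibreDeriv (x : M) (f : M → FibreAlg (TangentSpace 𝓘(ℝ, B) x) (E x))
    (v : TangentSpace 𝓘(ℝ, B) x) : FibreAlg (TangentSpace 𝓘(ℝ, B) x) (E x) :=
  open Classical in
  if h : ∃ a, ∀ ℓ : Module.Dual ℂ (FibreAlg (TangentSpace 𝓘(ℝ, B) x) (E x)),
      ℓ a = mvfderiv 𝓘(ℝ, B) (fun y => ℓ (f y)) x v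
  then h.choose else 0

section Connection

variable [∀ x, IsTopologicalAddGroup (E x)] [∀ x, ContinuousSMul ℝ (E x)]
  (covM : CovariantDerivative 𝓘(ℝ, B) B (TangentSpace 𝓘(ℝ, B) : M → Type _))
  (covE : CovariantDerivative 𝓘(ℝ, B) F E)

/-- The covariant derivative in direction `∂ᵢ`, at `x`, of a section of
`∨ T*M ⊗ Λ E* ⊗ Λ T*M`, where the forms `dx^J` of the last factor are treated as constants:
`∂ᵢ` of the components, plus `dxʲ ↦ -Γʲᵢₗ dxˡ` (where `∇_{∂ᵢ} ∂ₗ = Γʲᵢₗ ∂ⱼ`) extended as a derivation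
of the symmetric factor, plus the analogous term for `e^A` in the factor `Λ E*`. -/
def covDir (x : M) (u : (y : M) → FibreAlg (TangentSpace 𝓘(ℝ, B) y) (E y))
    (i : Fin (Module.finrank ℝ B)) : FibreAlg (TangentSpace 𝓘(ℝ, B) x) (E x) :=
  fibreDeriv x (localRep B F x u) (tangentBasis B x i)
  - ∑ j, ∑ l,
      (((tangentBasis B x).coord j
        (covM (tangentFrame B x l) x (tangentBasis B x i)) : ℝ) : ℂ) •
      mulS ((tangentBasis B x).coord l) (iS (tangentBasis B x j) (u x))
  - ∑ A, ∑ C,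
      (((fibreBasis F E x).coord A
        (covE (fibreFrame F E x C) x (tangentBasis B x i)) : ℝ) : ℂ) •
      mulE ((fibreBasis F E x).coord C) (iE (fibreBasis F E x A) (u x))

/-- The connection `∇`: in a chart,
`∇ (f ⊗ φ ⊗ α) = (∇_{∂ᵢ} f ⊗ φ + f ⊗ ∇_{∂ᵢ} φ) ⊗ dxⁱ ∧ α + f ⊗ φ ⊗ dα`. -/
def nabla (w : RawSection B E) : RawSection B E :=
  fun x s t => ∑ i, mulA ((tangentBasis B x).coord i)
    (covDir F covM covE x (fun y => w y s t) i)

end Connection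

variable (B E)

/-- The elements of the Fedosov algebra of `E`-parity `(-1)^d` and antisymmetric degree `a`. -/
def homogeneous (d : ZMod 2) (a : ℤ) : Submodule ℂ (RawSection B E) where
  carrier := {w | w ∈ fedosovAlgebra B F E ∧ PE w = (-1 : ℂ) ^ d.val • w ∧ degA w = (a : ℂ) • w}
  zero_mem' := by
    refine ⟨Submodule.zero_mem _, ?_, ?_⟩ <;> · funext x s t; simp [PE, degA]
  add_mem' := by
    rintro v w ⟨hv, hv1, hv2⟩ ⟨hw, hw1, hw2⟩
    refine ⟨Submodule.add_mem _ hv hw, ?_, ?_⟩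
    · rw [smul_add, ← hv1, ← hw1]; funext x s t; simp [PE]
    · rw [smul_add, ← hv2, ← hw2]; funext x s t; simp [degA]
  smul_mem' := by
    rintro c w ⟨hw, hw1, hw2⟩
    refine ⟨Submodule.smul_mem _ c hw, ?_, ?_⟩
    · rw [smul_comm, ← hw1]; funext x s t; simp [PE]
    · rw [smul_comm, ← hw2]; funext x s t; simp [degA]

variable {B E}

/-- The Fedosov algebra with the multiplication `m` is an associative algebra over `ℂ`, graded by
`ℤ₂ × ℤ` through the `E`-parity and the antisymmetric degree. -/
structure IsGradedAssociativeAlgebra (m : RawSection B E → RawSection B E → RawSection B E) :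
    Prop where
  mem : ∀ v ∈ fedosovAlgebra B F E, ∀ w ∈ fedosovAlgebra B F E, m v w ∈ fedosovAlgebra B F E
  add_left : ∀ u ∈ fedosovAlgebra B F E, ∀ v ∈ fedosovAlgebra B F E,
    ∀ w ∈ fedosovAlgebra B F E, m (u + v) w = m u w + m v w
  add_right : ∀ u ∈ fedosovAlgebra B F E, ∀ v ∈ fedosovAlgebra B F E,
    ∀ w ∈ fedosovAlgebra B F E, m u (v + w) = m u v + m u w
  smul_left : ∀ c : ℂ, ∀ v ∈ fedosovAlgebra B F E, ∀ w ∈ fedosovAlgebra B F E,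
    m (c • v) w = c • m v w
  smul_right : ∀ c : ℂ, ∀ v ∈ fedosovAlgebra B F E, ∀ w ∈ fedosovAlgebra B F E,
    m v (c • w) = c • m v w
  assoc : ∀ u ∈ fedosovAlgebra B F E, ∀ v ∈ fedosovAlgebra B F E,
    ∀ w ∈ fedosovAlgebra B F E, m (m u v) w = m u (m v w)
  independent : iSupIndep fun p : ZMod 2 × ℤ => homogeneous B F E p.1 p.2
  span : (⨆ p : ZMod 2 × ℤ, homogeneous B F E p.1 p.2) = fedosovAlgebra B F E
  graded : ∀ (d₁ d₂ : ZMod 2) (a₁ a₂ : ℤ), ∀ v ∈ homogeneous B F E d₁ a₁,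
    ∀ w ∈ homogeneous B F E d₂ a₂, m v w ∈ homogeneous B F E (d₁ + d₂) (a₁ + a₂)

/-- A `ℂ`-linear endomorphism of the Fedosov algebra. -/
structure IsLinearEndomorphism (Φ : RawSection B E → RawSection B E) : Prop where
  mem : ∀ v ∈ fedosovAlgebra B F E, Φ v ∈ fedosovAlgebra B F E
  add : ∀ v ∈ fedosovAlgebra B F E, ∀ w ∈ fedosovAlgebra B F E, Φ (v + w) = Φ v + Φ w
  smul : ∀ c : ℂ, ∀ v ∈ fedosovAlgebra B F E, Φ (c • v) = c • Φ v

/-- An automorphism of the Fedosov algebra with the multiplication `m`. -/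
structure IsAutomorphism (m : RawSection B E → RawSection B E → RawSection B E)
    (Φ : RawSection B E → RawSection B E) : Prop extends IsLinearEndomorphism F Φ where
  bijOn : Set.BijOn Φ (fedosovAlgebra B F E) (fedosovAlgebra B F E)
  mul : ∀ v ∈ fedosovAlgebra B F E, ∀ w ∈ fedosovAlgebra B F E, Φ (m v w) = m (Φ v) (Φ w)

/-- A derivation of the Fedosov algebra with the multiplication `m`. -/
structure IsDerivation (m : RawSection B E → RawSection B E → RawSection B E)
    (Φ : RawSection B E → RawSection B E) : Prop extends IsLinearEndomorphism F Φ where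
  leibniz : ∀ v ∈ fedosovAlgebra B F E, ∀ w ∈ fedosovAlgebra B F E,
    Φ (m v w) = m (Φ v) w + m v (Φ w)

/-- A linear endomorphism of the Fedosov algebra which is a superderivation of type
`((-1)^d', a')` of the multiplication `m`: it has `E`-parity `(-1)^d'` and antisymmetric degree
`a'`, and `Φ (F G) = (Φ F) G + (-1)^{d' d₁ + a' a₁} F (Φ G)`. -/
structure IsSuperderivation (m : RawSection B E → RawSection B E → RawSection B E)
    (Φ : RawSection B E → RawSection B E) (d' : ℕ) (a' : ℤ) : Prop
    extends IsLinearEndomorphism F Φ where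
  parity : ∀ v ∈ fedosovAlgebra B F E, PE (Φ (PE v)) = (-1 : ℂ) ^ d' • Φ v
  degree : ∀ v ∈ fedosovAlgebra B F E, degA (Φ v) - Φ (degA v) = (a' : ℂ) • Φ v
  leibniz : ∀ (d : ZMod 2) (a : ℤ), ∀ v ∈ homogeneous B F E d a, ∀ w ∈ fedosovAlgebra B F E,
    Φ (m v w) = m (Φ v) w + (-1 : ℂ) ^ ((d' : ℤ) * (d.val : ℤ) + a' * a) • m v (Φ w)

/-- A bijective map of the Fedosov algebra, semilinear with respect to `σ` (the identity or the
complex conjugation of `ℂ`) and compatible with the grading, such that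
`Φ (F G) = (-1)^{d₁ d₂ + a₁ a₂} (Φ G) (Φ F)`. -/
structure IsGradedAntiautomorphism (m : RawSection B E → RawSection B E → RawSection B E)
    (σ : ℂ →+* ℂ) (Φ : RawSection B E → RawSection B E) : Prop where
  bijOn : Set.BijOn Φ (fedosovAlgebra B F E) (fedosovAlgebra B F E)
  add : ∀ v ∈ fedosovAlgebra B F E, ∀ w ∈ fedosovAlgebra B F E, Φ (v + w) = Φ v + Φ w
  smul : ∀ c : ℂ, ∀ v ∈ fedosovAlgebra B F E, Φ (c • v) = σ c • Φ v
  graded : ∀ (d : ZMod 2) (a : ℤ), ∀ v ∈ homogeneous B F E d a, Φ v ∈ homogeneous B F E d a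
  anti : ∀ (d₁ d₂ : ZMod 2) (a₁ a₂ : ℤ), ∀ v ∈ homogeneous B F E d₁ a₁,
    ∀ w ∈ homogeneous B F E d₂ a₂,
      Φ (m v w) = (-1 : ℂ) ^ ((d₁.val : ℤ) * (d₂.val : ℤ) + a₁ * a₂) • m (Φ w) (Φ v)

end Sections

/-! ### The geometric data -/

section Geometry

variable {B : Type*} [NormedAddCommGroup B] [NormedSpace ℝ B]
  {M : Type*} [TopologicalSpace M] [ChartedSpace B M] [IsManifold 𝓘(ℝ, B) ∞ M]

/-- Symplectic forms: smooth, alternating, nondegenerate, closed 2-forms. -/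
structure IsSymplecticForm
    (Ω : (x : M) → TangentSpace 𝓘(ℝ, B) x →L[ℝ] TangentSpace 𝓘(ℝ, B) x →L[ℝ] ℝ) : Prop where
  smooth : ContMDiff 𝓘(ℝ, B) (𝓘(ℝ, B).prod 𝓘(ℝ, B →L[ℝ] B →L[ℝ] ℝ)) ∞
    (fun x => Bundle.TotalSpace.mk' (B →L[ℝ] B →L[ℝ] ℝ)
      (E := fun x : M => TangentSpace 𝓘(ℝ, B) x →L[ℝ] TangentSpace 𝓘(ℝ, B) x →L[ℝ] ℝ) x (Ω x))
  alternating : ∀ x v, Ω x v v = 0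
  nondegenerate : ∀ x v, (∀ u, Ω x v u = 0) → v = 0
  closed : ∀ X Y Z : (x : M) → TangentSpace 𝓘(ℝ, B) x,
    CMDiff ∞ (T% X) → CMDiff ∞ (T% Y) → CMDiff ∞ (T% Z) → ∀ x,
      mvfderiv 𝓘(ℝ, B) (fun y => Ω y (Y y) (Z y)) x (X x)
      + mvfderiv 𝓘(ℝ, B) (fun y => Ω y (Z y) (X y)) x (Y x)
      + mvfderiv 𝓘(ℝ, B) (fun y => Ω y (X y) (Y y)) x (Z x)
      - Ω x (VectorField.mlieBracket 𝓘(ℝ, B) X Y x) (Z x)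
      - Ω x (VectorField.mlieBracket 𝓘(ℝ, B) Y Z x) (X x)
      - Ω x (VectorField.mlieBracket 𝓘(ℝ, B) Z X x) (Y x) = 0

variable {F : Type*} [NormedAddCommGroup F] [NormedSpace ℝ F]
  {E : M → Type*} [∀ x, AddCommGroup (E x)] [∀ x, Module ℝ (E x)]
  [∀ x, TopologicalSpace (E x)] [∀ x, IsTopologicalAddGroup (E x)]
  [∀ x, ContinuousSMul ℝ (E x)] [TopologicalSpace (Bundle.TotalSpace F E)]
  [FiberBundle F E] [VectorBundle ℝ F E]

variable (B F) in
/-- Smooth, symmetric, nondegenerate (not necessarily definite) fibre metrics. -/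
structure IsFibreMetric (q : (x : M) → E x →L[ℝ] E x →L[ℝ] ℝ) : Prop where
  smooth : ContMDiff 𝓘(ℝ, B) (𝓘(ℝ, B).prod 𝓘(ℝ, F →L[ℝ] F →L[ℝ] ℝ)) ∞
    (fun x => Bundle.TotalSpace.mk' (F →L[ℝ] F →L[ℝ] ℝ)
      (E := fun x : M => E x →L[ℝ] E x →L[ℝ] ℝ) x (q x))
  symmetric : ∀ x e e', q x e e' = q x e' e
  nondegenerate : ∀ x e, (∀ e', q x e e' = 0) → e = 0

/-- The connection preserves the bilinear form `β`:
`X (β (e₁, e₂)) = β (∇_X e₁, e₂) + β (e₁, ∇_X e₂)`. -/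
def Preserves (cov : CovariantDerivative 𝓘(ℝ, B) F E)
    (β : (x : M) → E x →L[ℝ] E x →L[ℝ] ℝ) : Prop :=
  ∀ e₁ e₂ : (x : M) → E x, CMDiff ∞ (T% e₁) → CMDiff ∞ (T% e₂) →
    ∀ (x : M) (X : TangentSpace 𝓘(ℝ, B) x),
      mvfderiv 𝓘(ℝ, B) (fun y => β y (e₁ y) (e₂ y)) x X =
        β x (cov e₁ x X) (e₂ x) + β x (e₁ x) (cov e₂ x X)

/-- `∇_X Y - ∇_Y X = [X, Y]` -/
def TorsionFree
    (cov : CovariantDerivative 𝓘(ℝ, B) B (TangentSpace 𝓘(ℝ, B) : M → Type _)) : Prop :=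
  ∀ X Y : (x : M) → TangentSpace 𝓘(ℝ, B) x, CMDiff ∞ (T% X) → CMDiff ∞ (T% Y) →
    ∀ x, cov Y x (X x) - cov X x (Y x) = VectorField.mlieBracket 𝓘(ℝ, B) X Y x

end Geometry

end Fedosov

end

open Fedosov

/-!
Everything except `∇` acts fibre by fibre, so most of the assertions are statements about the
algebra `Sym V* ⊗ ΛF* ⊗ ΛV*` (complexified) of one pair of vector spaces.

The product `∘` is built from the operators `R = Λ^{ij} i_s ⊗ i_s` and `S = q^{AB} j ⊗ i` on the
tensor square. The insertions `i_s` are derivations, `i` and `j` are derivations twisted by `P_E`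
from the left and from the right, and left and right insertions commute. Hence `R` and `S` pull
through the undeformed multiplication of two neighbouring factors as `R₁₃ + R₂₃` or `R₁₂ + R₁₃`,
the summands commute, and both bracketings of a triple product are the exponential of the total
contraction on the tensor cube (`bidiff_assoc`, `contraction_assoc`, `formalProd_assoc`). Graded
symmetry holds because the flip of the factors with its Koszul sign anticommutes with `R`, as `Λ`
is antisymmetric, and with `S`, as `q` is symmetric and the insertions are odd
(`contraction_flip`): each power of `λ` contributes one sign, which `P_λ` and the conjugation of
`iλ/2` absorb. Since the contractions do not depend on the basis (`contraction_change_basis`),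
they may be computed in any frame.

Smoothness is handled without a topology on the infinite-dimensional fibres: in a local frame a
section of bounded symmetric degree is a finite sum of smooth functions times constant vectors,
and so is its derivative (`HasFiniteDeriv`, `localRep`, `mem_fedosovAlgebra_iff`). Natural
operators have constant coefficients in frames; the contractions have the entries of the inverse
matrices of `Ω` and `q` as coefficients, which are smooth.

For `∇`, the full covariant derivative (`covFull`) is locally `d - ρ(A)`, with `ρ` the action of
the connection matrices by derivations of the fibre algebra (`linAction`). Its terms on the form
factor disappear upon antisymmetrization when the torsion vanishes, so
`∇ = Σ dxⁱ ∧ (covariant derivative)ᵢ` (`nabla_eq_sum`). As `Ω` and `q` are parallel, so are their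
inverse matrices, and thus `R` and `S`; this gives the Leibniz rule of the covariant derivative
(`covFull_circ`), and with the sign of moving `dxⁱ` past a form that of `∇` (`nabla_circ`). The
kernel of `δ` in antisymmetric degree zero is read off from `δδ* + δ*δ = deg_s + deg_a`.
-/

noncomputable section

namespace Fedosov

set_option linter.unusedSectionVars false

/-! ### The Grassmann algebra and the symmetric algebra -/

section Exterior

variable {N : Type*} [AddCommGroup N] [Module ℝ N]

theorem extWeight_of_mem (c : ℕ → ℝ) {d : ℕ} {a : ExteriorAlgebra ℝ N} (ha : a ∈ ⋀[ℝ]^d N) :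
    extWeight N c a = c d • a := by
  rw [extWeight, LinearMap.comp_apply, LinearEquiv.coe_coe, DirectSum.decomposeLinearEquiv_apply,
    DirectSum.decompose_of_mem (fun d : ℕ => ⋀[ℝ]^d N) ha, ← DirectSum.lof_eq_of ℝ,
    DirectSum.toModule_lof]
  rfl

theorem exterior_induction {p : ExteriorAlgebra ℝ N → Prop}
    (h : ∀ d, ∀ a ∈ ⋀[ℝ]^d N, p a) (hadd : ∀ a b, p a → p b → p (a + b)) (a) : p a :=
  DirectSum.Decomposition.inductionOn (fun d : ℕ => ⋀[ℝ]^d N) (h 0 0 (Submodule.zero_mem _))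
    (fun {_} m => h _ _ m.2) hadd a

theorem exterior_hom_ext {W : Type*} [AddCommGroup W] [Module ℝ W]
    {S T : ExteriorAlgebra ℝ N →ₗ[ℝ] W} (h : ∀ d, ∀ a ∈ ⋀[ℝ]^d N, S a = T a) : S = T := by
  refine LinearMap.ext fun a => ?_
  exact exterior_induction (p := fun a => S a = T a) h
    (fun a b ha hb => by rw [map_add, map_add, ha, hb]) a

theorem ι_mul_mem_exteriorPower (n : N) {d : ℕ} {a : ExteriorAlgebra ℝ N} (ha : a ∈ ⋀[ℝ]^d N) :
    ExteriorAlgebra.ι ℝ n * a ∈ ⋀[ℝ]^(d + 1) N := by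
  rw [ExteriorAlgebra.exteriorPower, pow_succ']
  exact Submodule.mul_mem_mul ⟨n, rfl⟩ ha

theorem mul_mem_exteriorPower {d e : ℕ} {a b : ExteriorAlgebra ℝ N} (ha : a ∈ ⋀[ℝ]^d N)
    (hb : b ∈ ⋀[ℝ]^e N) : a * b ∈ ⋀[ℝ]^(d + e) N := by
  rw [ExteriorAlgebra.exteriorPower, pow_add]
  exact Submodule.mul_mem_mul ha hb

/-- Induction along the degree: products with vectors span the next exterior power. -/
theorem exteriorPower_induction {p : ℕ → ExteriorAlgebra ℝ N → Prop}
    (h0 : ∀ r : ℝ, p 0 (algebraMap ℝ _ r))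
    (hmul : ∀ d n, ∀ a ∈ ⋀[ℝ]^d N, p d a → p (d + 1) (ExteriorAlgebra.ι ℝ n * a))
    (hadd : ∀ d a b, p d a → p d b → p d (a + b)) :
    ∀ d, ∀ a ∈ ⋀[ℝ]^d N, p d a := by
  intro d
  induction d with
  | zero =>
    intro a ha
    rw [ExteriorAlgebra.exteriorPower, pow_zero] at ha
    obtain ⟨r, rfl⟩ := Submodule.mem_one.1 ha
    exact h0 r
  | succ d ih =>
    intro a ha
    rw [ExteriorAlgebra.exteriorPower, pow_succ'] at ha
    refine Submodule.mul_induction_on ha ?_ (fun a b => hadd _ a b)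
    rintro _ ⟨n, rfl⟩ b hb
    exact hmul d n b hb (ih b hb)

theorem contractLeft_mem_exteriorPower (ξ : Module.Dual ℝ N) {d : ℕ} {a : ExteriorAlgebra ℝ N}
    (ha : a ∈ ⋀[ℝ]^(d + 1) N) :
    CliffordAlgebra.contractLeft (Q := (0 : QuadraticForm ℝ N)) ξ a ∈ ⋀[ℝ]^d N := by
  suffices H : ∀ e, ∀ a ∈ ⋀[ℝ]^e N, ∀ d, e = d + 1 →
      CliffordAlgebra.contractLeft (Q := (0 : QuadraticForm ℝ N)) ξ a ∈ ⋀[ℝ]^d N from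
    H _ a ha _ rfl
  apply exteriorPower_induction
  · intro r d hd
    omega
  · intro d n a ha ih e he
    obtain rfl : d = e := by omega
    erw [CliffordAlgebra.contractLeft_ι_mul]
    refine Submodule.sub_mem _ (Submodule.smul_mem _ _ ha) ?_
    cases d with
    | zero =>
      rw [ExteriorAlgebra.exteriorPower, pow_zero] at ha
      obtain ⟨r, rfl⟩ := Submodule.mem_one.1 ha
      erw [CliffordAlgebra.contractLeft_algebraMap]
      simp
    | succ d => exact ι_mul_mem_exteriorPower n (ih d rfl)
  · intro d a b ha hb e he
    rw [map_add]
    exact Submodule.add_mem _ (ha e he) (hb e he)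

theorem contractLeft_of_mem_zero (ξ : Module.Dual ℝ N) {a : ExteriorAlgebra ℝ N}
    (ha : a ∈ ⋀[ℝ]^0 N) :
    CliffordAlgebra.contractLeft (Q := (0 : QuadraticForm ℝ N)) ξ a = 0 := by
  rw [ExteriorAlgebra.exteriorPower, pow_zero] at ha
  obtain ⟨r, rfl⟩ := Submodule.mem_one.1 ha
  exact CliffordAlgebra.contractLeft_algebraMap (0 : QuadraticForm ℝ N) ξ r

/-- The parity operator of a Grassmann algebra. -/
abbrev extParity (N : Type*) [AddCommGroup N] [Module ℝ N] : Module.End ℝ (ExteriorAlgebra ℝ N) :=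
  extWeight N fun d => (-1) ^ d

/-- Interior product with a vector of the dual of `N`. -/
abbrev extContract (ξ : Module.Dual ℝ N) : Module.End ℝ (ExteriorAlgebra ℝ N) :=
  CliffordAlgebra.contractLeft (Q := (0 : QuadraticForm ℝ N)) ξ

theorem extWeight_mul_extWeight (c c' : ℕ → ℝ) :
    extWeight N c * extWeight N c' = extWeight N fun d => c d * c' d :=
  exterior_hom_ext fun d a ha => by
    rw [Module.End.mul_apply, extWeight_of_mem c' ha, map_smul, extWeight_of_mem c ha,
      extWeight_of_mem _ ha, smul_smul, mul_comm]

theorem extWeight_one : extWeight N (fun _ => 1) = 1 :=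
  exterior_hom_ext fun d a ha => by rw [extWeight_of_mem _ ha]; simp

theorem extParity_mul_self : extParity N * extParity N = 1 := by
  rw [extWeight_mul_extWeight, ← extWeight_one]
  congr 1
  funext d
  rw [← mul_pow]
  simp

theorem extParity_mul (a b : ExteriorAlgebra ℝ N) :
    extParity N (a * b) = extParity N a * extParity N b := by
  induction a using exterior_induction with
  | hadd a a' ha ha' => rw [add_mul, map_add, map_add, add_mul, ha, ha']
  | h d a ha =>
    induction b using exterior_induction with
    | hadd b b' hb hb' => rw [mul_add, map_add, map_add, mul_add, hb, hb']
    | h e b hb =>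
      rw [extWeight_of_mem _ (mul_mem_exteriorPower ha hb), extWeight_of_mem _ ha,
        extWeight_of_mem _ hb, smul_mul_smul_comm, pow_add]

theorem extDegree_mul (a b : ExteriorAlgebra ℝ N) :
    extWeight N (fun d => (d : ℝ)) (a * b) =
      extWeight N (fun d => (d : ℝ)) a * b + a * extWeight N (fun d => (d : ℝ)) b := by
  induction a using exterior_induction with
  | hadd a a' ha ha' => rw [add_mul, map_add, map_add, ha, ha']; noncomm_ring
  | h d a ha =>
    induction b using exterior_induction with
    | hadd b b' hb hb' => rw [mul_add, map_add, map_add, hb, hb']; noncomm_ring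
    | h e b hb =>
      rw [extWeight_of_mem _ (mul_mem_exteriorPower ha hb), extWeight_of_mem _ ha,
        extWeight_of_mem _ hb, smul_mul_assoc, mul_smul_comm, ← add_smul, Nat.cast_add]

theorem extParity_extContract (ξ : Module.Dual ℝ N) :
    extParity N * extContract ξ = -(extContract ξ * extParity N) :=
  exterior_hom_ext fun d a ha => by
    simp only [Module.End.mul_apply, LinearMap.neg_apply]
    cases d with
    | zero => rw [contractLeft_of_mem_zero ξ ha, extWeight_of_mem _ ha, map_smul,
        contractLeft_of_mem_zero ξ ha]; simp
    | succ d =>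
      rw [extWeight_of_mem _ ha, extWeight_of_mem _ (contractLeft_mem_exteriorPower ξ ha),
        map_smul, pow_succ]
      simp

theorem extDegree_extContract (ξ : Module.Dual ℝ N) :
    extWeight N (fun d => (d : ℝ)) * extContract ξ =
      extContract ξ * extWeight N (fun d => (d : ℝ)) - extContract ξ :=
  exterior_hom_ext fun d a ha => by
    simp only [Module.End.mul_apply, LinearMap.sub_apply]
    cases d with
    | zero => rw [contractLeft_of_mem_zero ξ ha, extWeight_of_mem _ ha, map_smul,
        contractLeft_of_mem_zero ξ ha]; simp
    | succ d =>
      rw [extWeight_of_mem _ ha, extWeight_of_mem _ (contractLeft_mem_exteriorPower ξ ha),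
        map_smul, Nat.cast_add, add_smul]
      simp

theorem extContract_ι_mul (ξ : Module.Dual ℝ N) (n : N) (a : ExteriorAlgebra ℝ N) :
    extContract ξ (ExteriorAlgebra.ι ℝ n * a) =
      ξ n • a - ExteriorAlgebra.ι ℝ n * extContract ξ a :=
  CliffordAlgebra.contractLeft_ι_mul ξ n a

theorem extContract_anticomm (ξ η : Module.Dual ℝ N) :
    extContract ξ * extContract η = -(extContract η * extContract ξ) :=
  LinearMap.ext fun a => CliffordAlgebra.contractLeft_comm (d := ξ) (d' := η) a

/-- The right antiderivation `P i(ξ)` of a Grassmann algebra. -/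
abbrev extContractRight (ξ : Module.Dual ℝ N) : Module.End ℝ (ExteriorAlgebra ℝ N) :=
  extParity N * extContract ξ

theorem extContractRight_anticomm (ξ η : Module.Dual ℝ N) :
    extContractRight ξ * extContractRight η = -(extContractRight η * extContractRight ξ) := by
  have h1 : ∀ (ξ : Module.Dual ℝ N) a,
      extParity N (extContract ξ a) = -extContract ξ (extParity N a) :=
    fun ξ a => LinearMap.congr_fun (extParity_extContract ξ) a
  have h2 : ∀ a, extParity N (extParity N a) = a :=
    fun a => LinearMap.congr_fun extParity_mul_self a
  have h3 : ∀ a, extContract ξ (extContract η a) = -extContract η (extContract ξ a) :=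
    fun a => LinearMap.congr_fun (extContract_anticomm ξ η) a
  refine LinearMap.ext fun a => ?_
  simp only [Module.End.mul_apply, LinearMap.neg_apply, h1, map_neg, h2, h3]

/-- Left and right insertions commute, although insertions from one side anticommute: therefore
no signs arise between the two legs of `S`. -/
theorem extContractRight_mul_extContract (ξ η : Module.Dual ℝ N) :
    extContractRight ξ * extContract η = extContract η * extContractRight ξ := by
  have h1 : ∀ (ξ : Module.Dual ℝ N) a,
      extParity N (extContract ξ a) = -extContract ξ (extParity N a) :=
    fun ξ a => LinearMap.congr_fun (extParity_extContract ξ) a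
  have h3 : ∀ a, extContract ξ (extContract η a) = -extContract η (extContract ξ a) :=
    fun a => LinearMap.congr_fun (extContract_anticomm ξ η) a
  refine LinearMap.ext fun a => ?_
  simp only [Module.End.mul_apply, h1, map_neg, h3, neg_neg]

theorem extParity_mul_extContractRight (ξ : Module.Dual ℝ N) :
    extParity N * extContractRight ξ = -(extContractRight ξ * extParity N) := by
  have h1 : ∀ (ξ : Module.Dual ℝ N) a,
      extParity N (extContract ξ a) = -extContract ξ (extParity N a) :=
    fun ξ a => LinearMap.congr_fun (extParity_extContract ξ) a
  refine LinearMap.ext fun a => ?_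
  simp only [Module.End.mul_apply, LinearMap.neg_apply, h1, map_neg]

theorem extDegree_extContractRight (ξ : Module.Dual ℝ N) :
    extWeight N (fun d => (d : ℝ)) * extContractRight ξ =
      extContractRight ξ * extWeight N (fun d => (d : ℝ)) - extContractRight ξ := by
  have h1 : ∀ a, extWeight N (fun d => (d : ℝ)) (extContract ξ a) =
      extContract ξ (extWeight N (fun d => (d : ℝ)) a) - extContract ξ a :=
    fun a => LinearMap.congr_fun (extDegree_extContract ξ) a
  have h2 : ∀ a, extWeight N (fun d => (d : ℝ)) (extParity N a) =
      extParity N (extWeight N (fun d => (d : ℝ)) a) := fun a => by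
    rw [← Module.End.mul_apply, ← Module.End.mul_apply, extWeight_mul_extWeight,
      extWeight_mul_extWeight]
    simp only [mul_comm]
  refine LinearMap.ext fun a => ?_
  simp only [Module.End.mul_apply, LinearMap.sub_apply, h1, h2, map_sub]

/-- Interior products are antiderivations. -/
theorem extContract_mul (ξ : Module.Dual ℝ N) (a b : ExteriorAlgebra ℝ N) :
    extContract ξ (a * b) = extContract ξ a * b + extParity N a * extContract ξ b := by
  induction a using exterior_induction with
  | hadd a a' ha ha' => rw [add_mul, map_add, map_add, map_add, ha, ha']; noncomm_ring
  | h d a ha =>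
    revert d a
    apply exteriorPower_induction
    · intro r
      rw [Algebra.algebraMap_eq_smul_one, map_smul, map_smul, smul_mul_assoc, one_mul, map_smul,
        extWeight_of_mem (d := 0) (a := 1) _ (by simp [ExteriorAlgebra.exteriorPower])]
      erw [CliffordAlgebra.contractLeft_one]
      simp
    · intro d n a ha ih
      rw [mul_assoc, extContract_ι_mul, ih, extContract_ι_mul, extParity_mul,
        extWeight_of_mem (d := 1) (a := ExteriorAlgebra.ι ℝ n) _
          (by rw [ExteriorAlgebra.exteriorPower, pow_one]; exact ⟨n, rfl⟩)]
      simp only [pow_one, neg_smul, one_smul, sub_mul, smul_mul_assoc]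
      noncomm_ring
    · intro d a a' ha ha'
      rw [add_mul, map_add, map_add, map_add, ha, ha']
      noncomm_ring

/-- Supercommutativity of the Grassmann algebra. -/
theorem exterior_mul_comm {d e : ℕ} {a b : ExteriorAlgebra ℝ N} (ha : a ∈ ⋀[ℝ]^d N)
    (hb : b ∈ ⋀[ℝ]^e N) : a * b = ((-1 : ℝ) ^ (d * e)) • (b * a) := by
  have vec : ∀ n : N, ∀ e, ∀ b ∈ ⋀[ℝ]^e N,
      ExteriorAlgebra.ι ℝ n * b = ((-1 : ℝ) ^ e) • (b * ExteriorAlgebra.ι ℝ n) := by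
    intro n
    apply exteriorPower_induction
    · intro r
      rw [Algebra.commutes]; simp
    · intro e n' b hb ih
      rw [← mul_assoc, eq_neg_of_add_eq_zero_left (ExteriorAlgebra.ι_add_mul_swap n n'),
        neg_mul, mul_assoc, ih, mul_smul_comm, mul_assoc, pow_succ, mul_neg_one, neg_smul]
    · intro e b b' hb hb'
      rw [mul_add, add_mul, smul_add, hb, hb']
  revert d a
  suffices H : ∀ d, ∀ a ∈ ⋀[ℝ]^d N, a * b = ((-1 : ℝ) ^ (d * e)) • (b * a) from
    fun {d a} ha => H d a ha
  apply exteriorPower_induction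
  · intro r
    rw [Algebra.commutes]; simp
  · intro d n a ha ih
    rw [mul_assoc, ih, mul_smul_comm, ← mul_assoc, vec n e b hb, smul_mul_assoc, smul_smul,
      mul_assoc, add_mul, one_mul, pow_add]
  · intro d a a' ha ha'
    rw [mul_add, add_mul, smul_add, ha, ha']

theorem extParity_ι_mul (n : N) (a : ExteriorAlgebra ℝ N) :
    a * ExteriorAlgebra.ι ℝ n = ExteriorAlgebra.ι ℝ n * extParity N a := by
  induction a using exterior_induction with
  | hadd a a' ha ha' => rw [add_mul, map_add, mul_add, ha, ha']
  | h d a ha =>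
    rw [exterior_mul_comm ha (e := 1) (b := ExteriorAlgebra.ι ℝ n)
      (by rw [ExteriorAlgebra.exteriorPower, pow_one]; exact ⟨n, rfl⟩), extWeight_of_mem _ ha,
      mul_one, mul_smul_comm]

/-- The number operator of the Grassmann algebra in terms of a basis of the dual space. -/
theorem sum_ι_mul_extContract {ι V : Type*} [Fintype ι] [AddCommGroup V] [Module ℝ V]
    (b : Module.Basis ι ℝ V) (a : ExteriorAlgebra ℝ (Module.Dual ℝ V)) :
    ∑ i, ExteriorAlgebra.ι ℝ (b.coord i) * extContract (Module.Dual.eval ℝ V (b i)) a =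
      extWeight _ (fun d => (d : ℝ)) a := by
  induction a using exterior_induction with
  | hadd a a' ha ha' => simp only [map_add, mul_add, Finset.sum_add_distrib] at *; rw [ha, ha']
  | h d a ha =>
    rw [extWeight_of_mem _ ha]
    revert d a
    apply exteriorPower_induction
    · intro r
      simp only [extContract, Nat.cast_zero, zero_smul]
      exact Finset.sum_eq_zero fun i _ => by
        erw [CliffordAlgebra.contractLeft_algebraMap, mul_zero]
    · intro d ξ a ha ih
      have h1 : ξ = ∑ i, ξ (b i) • b.coord i := b.ext fun j => by
        simp
      simp only [extContract_ι_mul, mul_sub, Finset.sum_sub_distrib, Module.Dual.eval_apply]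
      have h2 : ∀ i, ExteriorAlgebra.ι ℝ (b.coord i) *
          (ExteriorAlgebra.ι ℝ ξ * extContract (Module.Dual.eval ℝ V (b i)) a) =
          -(ExteriorAlgebra.ι ℝ ξ * (ExteriorAlgebra.ι ℝ (b.coord i) *
            extContract (Module.Dual.eval ℝ V (b i)) a)) := fun i => by
        rw [← mul_assoc, eq_neg_of_add_eq_zero_left (ExteriorAlgebra.ι_add_mul_swap _ ξ), neg_mul,
          mul_assoc]
      simp only [h2, Finset.sum_neg_distrib, ← Finset.mul_sum, ih]
      have h3 : ∑ i, ExteriorAlgebra.ι ℝ (b.coord i) * ξ (b i) • a = ExteriorAlgebra.ι ℝ ξ * a := by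
        have := congrArg (fun ζ => ExteriorAlgebra.ι ℝ ζ * a) h1
        simp only [map_sum, map_smul, Finset.sum_mul, smul_mul_assoc] at this
        simp only [this, mul_smul_comm]
      rw [h3, mul_smul_comm, Nat.cast_add, add_smul, sub_neg_eq_add, add_comm]
      simp
    · intro d a a' ha ha'
      simp only [map_add, mul_add, Finset.sum_add_distrib, smul_add] at *
      rw [ha, ha']

theorem exteriorMap_mem {N' : Type*} [AddCommGroup N'] [Module ℝ N'] (g : N →ₗ[ℝ] N') :
    ∀ d, ∀ a ∈ ⋀[ℝ]^d N, ExteriorAlgebra.map g a ∈ ⋀[ℝ]^d N' := by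
  apply exteriorPower_induction
  · intro r
    rw [AlgHom.commutes, ExteriorAlgebra.exteriorPower, pow_zero]
    exact Submodule.mem_one.2 ⟨r, rfl⟩
  · intro d n a ha ih
    rw [map_mul, ExteriorAlgebra.map_apply_ι]
    exact ι_mul_mem_exteriorPower _ ih
  · intro d a b ha hb
    rw [map_add]
    exact Submodule.add_mem _ ha hb

theorem exteriorMap_extWeight {N' : Type*} [AddCommGroup N'] [Module ℝ N'] (g : N →ₗ[ℝ] N')
    (c : ℕ → ℝ) (a : ExteriorAlgebra ℝ N) :
    ExteriorAlgebra.map g (extWeight N c a) = extWeight N' c (ExteriorAlgebra.map g a) := by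
  induction a using exterior_induction with
  | hadd a a' ha ha' => simp only [map_add, ha, ha']
  | h d a ha => rw [extWeight_of_mem _ ha, extWeight_of_mem _ (exteriorMap_mem g d a ha), map_smul]

theorem exteriorMap_extContract {N' : Type*} [AddCommGroup N'] [Module ℝ N'] (g : N →ₗ[ℝ] N')
    (ξ : Module.Dual ℝ N') (a : ExteriorAlgebra ℝ N) :
    ExteriorAlgebra.map g (extContract (ξ ∘ₗ g) a) = extContract ξ (ExteriorAlgebra.map g a) := by
  induction a using exterior_induction with
  | hadd a a' ha ha' => simp only [map_add, ha, ha']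
  | h d a ha =>
    revert d a
    apply exteriorPower_induction
    · intro r
      rw [AlgHom.commutes]
      erw [CliffordAlgebra.contractLeft_algebraMap, CliffordAlgebra.contractLeft_algebraMap]
      simp
    · intro d n a ha ih
      rw [extContract_ι_mul, map_mul, ExteriorAlgebra.map_apply_ι, extContract_ι_mul, ← ih]
      simp
    · intro d a b ha hb
      simp only [map_add, ha, hb]

end Exterior

section Symmetric

variable {V : Type*} [AddCommGroup V] [Module ℝ V]

/-- The symmetric power `∨ˢ V*` in the symmetric algebra. -/
abbrev symPower (V : Type*) [AddCommGroup V] [Module ℝ V] (s : ℕ) :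
    Submodule ℝ (SymmetricAlgebra ℝ (Module.Dual ℝ V)) :=
  LinearMap.range (SymmetricAlgebra.ι ℝ (Module.Dual ℝ V)) ^ s

/-- Induction along the degree: every element of degree `d + 1` is a sum of products of a generator
with elements of degree `d`. -/
theorem symPower_induction {p : ℕ → SymmetricAlgebra ℝ (Module.Dual ℝ V) → Prop}
    (h0 : ∀ r : ℝ, p 0 (algebraMap ℝ _ r))
    (hmul : ∀ d n, ∀ a ∈ symPower V d, p d a → p (d + 1) (SymmetricAlgebra.ι ℝ _ n * a))
    (hadd : ∀ d a b, p d a → p d b → p d (a + b)) :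
    ∀ d, ∀ a ∈ symPower V d, p d a := by
  intro d
  induction d with
  | zero =>
    intro a ha
    rw [symPower, pow_zero] at ha
    obtain ⟨r, rfl⟩ := Submodule.mem_one.1 ha
    exact h0 r
  | succ d ih =>
    intro a ha
    rw [symPower, pow_succ'] at ha
    refine Submodule.mul_induction_on ha ?_ (fun a b => hadd _ a b)
    rintro _ ⟨n, rfl⟩ b hb
    exact hmul d n b hb (ih b hb)

theorem ι_mul_mem_symPower (n : Module.Dual ℝ V) {d : ℕ} {a} (ha : a ∈ symPower V d) :
    SymmetricAlgebra.ι ℝ _ n * a ∈ symPower V (d + 1) := by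
  rw [symPower, pow_succ']
  exact Submodule.mul_mem_mul ⟨n, rfl⟩ ha

theorem mul_mem_symPower {d e : ℕ} {a b} (ha : a ∈ symPower V d) (hb : b ∈ symPower V e) :
    a * b ∈ symPower V (d + e) := by
  rw [symPower, pow_add]
  exact Submodule.mul_mem_mul ha hb

theorem symContract_algebraMap (X : V) (r : ℝ) : symContract X (algebraMap ℝ _ r) = 0 := by
  rw [Algebra.algebraMap_eq_smul_one, map_smul, symContract_one, smul_zero]

theorem symContract_of_mem_zero (X : V) {a} (ha : a ∈ symPower V 0) : symContract X a = 0 := by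
  rw [symPower, pow_zero] at ha
  obtain ⟨r, rfl⟩ := Submodule.mem_one.1 ha
  exact symContract_algebraMap X r

theorem symContract_ι_mul (X : V) (ξ : Module.Dual ℝ V) (a) :
    symContract X (SymmetricAlgebra.ι ℝ _ ξ * a) =
      SymmetricAlgebra.ι ℝ _ ξ * symContract X a + ξ X • a := by
  rw [symContract_mul, symContract_ι, Algebra.smul_def, mul_comm a]

theorem symContract_mem_symPower (X : V) {d : ℕ} {a} (ha : a ∈ symPower V (d + 1)) :
    symContract X a ∈ symPower V d := by
  suffices H : ∀ e, ∀ a ∈ symPower V e, ∀ d, e = d + 1 → symContract X a ∈ symPower V d from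
    H _ a ha _ rfl
  apply symPower_induction
  · intro r d hd
    omega
  · intro d n a ha ih e he
    obtain rfl : d = e := by omega
    rw [symContract_ι_mul]
    refine Submodule.add_mem _ ?_ (Submodule.smul_mem _ _ ha)
    cases d with
    | zero => rw [symContract_of_mem_zero X ha]; simp
    | succ d => exact ι_mul_mem_symPower n (ih d rfl)
  · intro d a b ha hb e he
    rw [map_add]
    exact Submodule.add_mem _ (ha e he) (hb e he)

theorem symAlg_hom_ext {W : Type*} [AddCommGroup W] [Module ℝ W]
    {S T : SymmetricAlgebra ℝ (Module.Dual ℝ V) →ₗ[ℝ] W}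
    (h1 : S 1 = T 1)
    (hmul : ∀ ξ a, S a = T a → S (SymmetricAlgebra.ι ℝ _ ξ * a) = T (SymmetricAlgebra.ι ℝ _ ξ * a)) :
    S = T := by
  suffices H : ∀ a b, S b = T b → S (a * b) = T (a * b) by
    ext a
    simpa using H a 1 h1
  intro a
  induction a using SymmetricAlgebra.induction with
  | algebraMap r => intro b hb; rw [← Algebra.smul_def, map_smul, map_smul, hb]
  | ι x => exact hmul x
  | mul a a' ha ha' => intro b hb; rw [mul_assoc]; exact ha _ (ha' _ hb)
  | add a a' ha ha' => intro b hb; rw [add_mul, map_add, map_add, ha b hb, ha' b hb]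

theorem symContract_comm (X Y : V) : symContract X * symContract Y = symContract Y * symContract X := by
  apply symAlg_hom_ext
  · simp [symContract_one]
  · intro ξ a h
    simp only [Module.End.mul_apply] at *
    simp only [symContract_ι_mul, map_add, map_smul, h]
    abel

theorem symContract_add (X Y : V) : symContract (X + Y) = symContract X + symContract Y := by
  apply symAlg_hom_ext
  · simp [symContract_one]
  · intro ξ a h
    rw [LinearMap.add_apply] at *
    simp only [symContract_ι_mul, h, map_add, mul_add, add_smul]
    abel

theorem symContract_smul (r : ℝ) (X : V) : symContract (r • X) = r • symContract X := by
  apply symAlg_hom_ext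
  · simp [symContract_one]
  · intro ξ a h
    rw [LinearMap.smul_apply] at *
    simp only [symContract_ι_mul, h, map_smul, smul_add, smul_smul, mul_smul_comm, smul_eq_mul]

/-- Euler's identity in the symmetric algebra. -/
theorem sum_ι_mul_symContract {ι : Type*} [Fintype ι] (b : Module.Basis ι ℝ V) :
    ∀ s, ∀ a ∈ symPower V s,
      ∑ i, SymmetricAlgebra.ι ℝ _ (b.coord i) * symContract (b i) a = (s : ℝ) • a := by
  apply symPower_induction
  · intro r
    simp [symContract_algebraMap]
  · intro d ξ a ha ih
    have h1 : ξ = ∑ i, ξ (b i) • b.coord i := b.ext fun j => by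
      simp
    have h3 : ∑ i, SymmetricAlgebra.ι ℝ _ (b.coord i) * ξ (b i) • a
        = SymmetricAlgebra.ι ℝ _ ξ * a := by
      have := congrArg (fun ζ => SymmetricAlgebra.ι ℝ _ ζ * a) h1
      simp only [map_sum, map_smul, Finset.sum_mul, smul_mul_assoc] at this
      simp only [this, mul_smul_comm]
    simp only [symContract_ι_mul, mul_add, Finset.sum_add_distrib, h3]
    have h2 : ∀ i, SymmetricAlgebra.ι ℝ _ (b.coord i) *
        (SymmetricAlgebra.ι ℝ _ ξ * symContract (b i) a) =
        SymmetricAlgebra.ι ℝ _ ξ * (SymmetricAlgebra.ι ℝ _ (b.coord i) * symContract (b i) a) :=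
      fun i => by ring
    simp only [h2, ← Finset.mul_sum, ih, mul_smul_comm, Nat.cast_add, Nat.cast_one, add_smul,
      one_smul]
  · intro d a b ha hb
    simp only [map_add, mul_add, Finset.sum_add_distrib, smul_add, ha, hb]

theorem symLift_mem {V' : Type*} [AddCommGroup V'] [Module ℝ V']
    (g : Module.Dual ℝ V →ₗ[ℝ] Module.Dual ℝ V') :
    ∀ s, ∀ a ∈ symPower V s,
      SymmetricAlgebra.lift (SymmetricAlgebra.ι ℝ (Module.Dual ℝ V') ∘ₗ g) a ∈ symPower V' s := by
  apply symPower_induction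
  · intro r
    rw [AlgHom.commutes, symPower, pow_zero]
    exact Submodule.mem_one.2 ⟨r, rfl⟩
  · intro d n a ha ih
    rw [map_mul, SymmetricAlgebra.lift_ι_apply]
    exact ι_mul_mem_symPower _ ih
  · intro d a b ha hb
    rw [map_add]
    exact Submodule.add_mem _ ha hb

theorem symLift_symContract {V' : Type*} [AddCommGroup V'] [Module ℝ V'] (φ : V →ₗ[ℝ] V') (X : V)
    (a : SymmetricAlgebra ℝ (Module.Dual ℝ V')) :
    SymmetricAlgebra.lift (SymmetricAlgebra.ι ℝ (Module.Dual ℝ V) ∘ₗ φ.dualMap)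
      (symContract (φ X) a) =
    symContract X
      (SymmetricAlgebra.lift (SymmetricAlgebra.ι ℝ (Module.Dual ℝ V) ∘ₗ φ.dualMap) a) := by
  have := symAlg_hom_ext (V := V')
    (S := (SymmetricAlgebra.lift (SymmetricAlgebra.ι ℝ (Module.Dual ℝ V) ∘ₗ
      φ.dualMap)).toLinearMap ∘ₗ symContract (φ X))
    (T := symContract X ∘ₗ (SymmetricAlgebra.lift (SymmetricAlgebra.ι ℝ (Module.Dual ℝ V) ∘ₗ
      φ.dualMap)).toLinearMap) (by simp [symContract_one]) (by
        intro ξ a h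
        simp only [LinearMap.comp_apply, AlgHom.toLinearMap_apply] at *
        rw [symContract_ι_mul, map_add, map_mul, h, map_mul, SymmetricAlgebra.lift_ι_apply,
          LinearMap.comp_apply, symContract_ι_mul, map_smul]
        rfl)
  exact LinearMap.congr_fun this a

end Symmetric

/-! ### Bidifferential operators on an algebra -/

section Pairing

variable {A : Type*} [Ring A] [Algebra ℂ A] {α β : Type*} [Fintype α] [Fintype β]

/-- The operator `∑ cᵢⱼ uᵢ ⊗ u'ⱼ` on the tensor square of an algebra. -/
def pairing (c : α → α → ℂ) (u u' : α → Module.End ℂ A) : Module.End ℂ (A ⊗[ℂ] A) :=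
  ∑ i, ∑ j, c i j • TensorProduct.map (u i) (u' j)

theorem pairing_tmul (c : α → α → ℂ) (u u' : α → Module.End ℂ A) (a b : A) :
    pairing c u u' (a ⊗ₜ b) = ∑ i, ∑ j, c i j • (u i a ⊗ₜ[ℂ] u' j b) := by
  simp [pairing, LinearMap.sum_apply]

/-- Powers of `∑ cᵢⱼ uᵢ ⊗ u'ⱼ` as sums over multi-indices. -/
theorem pairing_pow (c : α → α → ℂ) (u u' : α → Module.End ℂ A) (k : ℕ) :
    pairing c u u' ^ k = ∑ i : Fin k → α, ∑ j : Fin k → α, (∏ r, c (i r) (j r)) •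
      TensorProduct.map (List.ofFn fun r => u (i r)).prod (List.ofFn fun r => u' (j r)).prod := by
  induction k with
  | zero => simp
  | succ k ih =>
    have cons : ∀ f : (Fin (k + 1) → α) → Module.End ℂ (A ⊗[ℂ] A),
        ∑ i, f i = ∑ i₀, ∑ i : Fin k → α, f (Fin.cons i₀ i) := fun f => by
      rw [← (Fin.consEquiv fun _ => α).sum_comp, Fintype.sum_prod_type]
      rfl
    rw [pow_succ', ih, pairing, cons, Finset.sum_mul]
    refine Finset.sum_congr rfl fun i₀ _ => ?_
    simp only [Finset.mul_sum]
    refine Finset.sum_congr rfl fun i _ => ?_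
    rw [cons, Finset.sum_comm]
    refine Finset.sum_congr rfl fun j _ => ?_
    rw [Finset.sum_mul]
    refine Finset.sum_congr rfl fun j₀ _ => ?_
    simp only [Fin.prod_univ_succ, List.ofFn_succ, Fin.cons_zero, Fin.cons_succ, List.prod_cons,
      smul_mul_smul_comm]
    rw [TensorProduct.map_mul]

/-- The operator `f ⊗ g ⊗ h` on the tensor cube of an algebra. -/
abbrev triple (f g h : Module.End ℂ A) : Module.End ℂ ((A ⊗[ℂ] A) ⊗[ℂ] A) :=
  TensorProduct.map (TensorProduct.map f g) h

theorem triple_mul (f g h f' g' h' : Module.End ℂ A) :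
    triple f g h * triple f' g' h' = triple (f * f') (g * g') (h * h') := by
  rw [triple, triple, triple, TensorProduct.map_mul, TensorProduct.map_mul]

/-- Sign rule for the commutation of tensor products of operators. -/
theorem triple_commute {f g h f' g' h' : Module.End ℂ A} {r s t : ℤˣ}
    (hf : f * f' = (r : ℤ) • (f' * f)) (hg : g * g' = (s : ℤ) • (g' * g))
    (hh : h * h' = (t : ℤ) • (h' * h)) (hrst : r * s * t = 1) :
    Commute (triple f g h) (triple f' g' h') := by
  rw [commute_iff_eq, triple_mul, triple_mul, hf, hg, hh]
  rcases Int.units_eq_one_or r with rfl | rfl <;> rcases Int.units_eq_one_or s with rfl | rfl <;>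
    rcases Int.units_eq_one_or t with rfl | rfl <;>
    first
    | exact absurd hrst (by decide)
    | (ext a b c; simp [TensorProduct.neg_tmul, TensorProduct.tmul_neg])

/-- `∑ cᵢⱼ uᵢ ⊗ u'ⱼ` on the first and second factor of the tensor cube. -/
def pairing₁₂ (c : α → α → ℂ) (u u' : α → Module.End ℂ A) : Module.End ℂ ((A ⊗[ℂ] A) ⊗[ℂ] A) :=
  ∑ i, ∑ j, c i j • triple (u i) (u' j) 1

/-- `∑ cᵢⱼ uᵢ ⊗ P ⊗ u'ⱼ`. -/
def pairing₁₃ (c : α → α → ℂ) (u u' : α → Module.End ℂ A) (P : Module.End ℂ A) :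
    Module.End ℂ ((A ⊗[ℂ] A) ⊗[ℂ] A) :=
  ∑ i, ∑ j, c i j • triple (u i) P (u' j)

/-- `∑ cᵢⱼ uᵢ ⊗ u'ⱼ` on the second and third factor of the tensor cube. -/
def pairing₂₃ (c : α → α → ℂ) (u u' : α → Module.End ℂ A) : Module.End ℂ ((A ⊗[ℂ] A) ⊗[ℂ] A) :=
  ∑ i, ∑ j, c i j • triple 1 (u i) (u' j)

theorem commute_sum_sum {c : α → α → ℂ} {d : β → β → ℂ} {T : Type*} [AddCommGroup T] [Module ℂ T]
    {x : α → α → Module.End ℂ T} {y : β → β → Module.End ℂ T}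
    (h : ∀ i j k l, Commute (x i j) (y k l)) :
    Commute (∑ i, ∑ j, c i j • x i j) (∑ k, ∑ l, d k l • y k l) :=
  Commute.sum_left _ _ _ fun i _ => Commute.sum_left _ _ _ fun j _ =>
    Commute.sum_right _ _ _ fun k _ => Commute.sum_right _ _ _ fun l _ =>
      ((h i j k l).smul_left _).smul_right _

variable (A) in
/-- Multiplication of the first two factors of the tensor cube. -/
abbrev mulLeft₃ : (A ⊗[ℂ] A) ⊗[ℂ] A →ₗ[ℂ] A ⊗[ℂ] A := LinearMap.rTensor A (LinearMap.mul' ℂ A)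

variable (A) in
/-- Multiplication of the last two factors of the tensor cube. -/
abbrev mulRight₃ : (A ⊗[ℂ] A) ⊗[ℂ] A →ₗ[ℂ] A ⊗[ℂ] A :=
  LinearMap.lTensor A (LinearMap.mul' ℂ A) ∘ₗ (TensorProduct.assoc ℂ A A A).toLinearMap

theorem mul'_comp_mulRight₃ :
    LinearMap.mul' ℂ A ∘ₗ mulRight₃ A = LinearMap.mul' ℂ A ∘ₗ mulLeft₃ A := by
  ext a b c
  simp [mul_assoc]

/-- `R ∘ (μ ⊗ 1) = (μ ⊗ 1) ∘ (R₁₃ + R₂₃)` if the first leg of `R` is a derivation twisted from the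
right. -/
theorem pairing_comp_mulLeft₃ (c : α → α → ℂ) {u : α → Module.End ℂ A} (u' : α → Module.End ℂ A)
    {P : Module.End ℂ A} (hu : ∀ i a b, u i (a * b) = a * u i b + u i a * P b) :
    pairing c u u' ∘ₗ mulLeft₃ A = mulLeft₃ A ∘ₗ (pairing₁₃ c u u' P + pairing₂₃ c u u') := by
  ext a b d
  simp [pairing₁₃, pairing₂₃, pairing_tmul, LinearMap.sum_apply, hu, TensorProduct.add_tmul,
    Finset.sum_add_distrib, add_comm]

/-- `R ∘ (1 ⊗ μ) = (1 ⊗ μ) ∘ (R₁₂ + R₁₃)` if the second leg of `R` is a derivation twisted from the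
left. -/
theorem pairing_comp_mulRight₃ (c : α → α → ℂ) (u : α → Module.End ℂ A) {u' : α → Module.End ℂ A}
    {P : Module.End ℂ A} (hu : ∀ i a b, u' i (a * b) = u' i a * b + P a * u' i b) :
    pairing c u u' ∘ₗ mulRight₃ A = mulRight₃ A ∘ₗ (pairing₁₂ c u u' + pairing₁₃ c u u' P) := by
  ext a b d
  simp [pairing₁₃, pairing₁₂, pairing_tmul, LinearMap.sum_apply, hu, TensorProduct.tmul_add,
    Finset.sum_add_distrib]

theorem rTensor_pairing (c : α → α → ℂ) (u u' : α → Module.End ℂ A) :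
    LinearMap.rTensor A (pairing c u u') = pairing₁₂ c u u' := by
  ext a b d
  simp [pairing₁₂, pairing_tmul, LinearMap.sum_apply, TensorProduct.sum_tmul,
    TensorProduct.smul_tmul']

theorem lTensor_pairing (c : α → α → ℂ) (u u' : α → Module.End ℂ A) :
    LinearMap.lTensor A (pairing c u u') ∘ₗ (TensorProduct.assoc ℂ A A A).toLinearMap =
      (TensorProduct.assoc ℂ A A A).toLinearMap ∘ₗ pairing₂₃ c u u' := by
  ext a b d
  simp [pairing₂₃, pairing_tmul, TensorProduct.tmul_sum]

theorem comp_pow_of_comp {T T' : Type*} [AddCommGroup T] [Module ℂ T] [AddCommGroup T']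
    [Module ℂ T'] {f : T →ₗ[ℂ] T'} {x : Module.End ℂ T'} {y : Module.End ℂ T}
    (h : x ∘ₗ f = f ∘ₗ y) (k : ℕ) (a : T) : (x ^ k) (f a) = f ((y ^ k) a) := by
  induction k generalizing a with
  | zero => simp
  | succ k ih =>
    rw [pow_succ, pow_succ, Module.End.mul_apply, Module.End.mul_apply,
      show x (f a) = f (y a) from LinearMap.congr_fun h a, ih]

/-- The multiplicativity `e^{x+y} = eˣ eʸ` in terms of divided powers. -/
theorem sum_divided_pow {T : Type*} [Ring T] [Algebra ℂ T] {x y : T} (h : Commute x y) (K : ℕ) :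
    ∑ k ∈ Finset.HasAntidiagonal.antidiagonal K,
      ((k.1.factorial : ℂ)⁻¹ * (k.2.factorial : ℂ)⁻¹) • (x ^ k.1 * y ^ k.2) =
    (K.factorial : ℂ)⁻¹ • (x + y) ^ K := by
  rw [h.add_pow', Finset.smul_sum]
  refine Finset.sum_congr rfl fun k hk => ?_
  rw [Finset.HasAntidiagonal.mem_antidiagonal] at hk
  rw [← Nat.cast_smul_eq_nsmul ℂ, smul_smul, ← hk, Nat.cast_add_choose]
  congr 1
  have := Nat.cast_ne_zero (R := ℂ).2 (k.1 + k.2).factorial_ne_zero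
  field_simp

/-- The bilinear operator `(a, b) ↦ μ (Rᵏ Sˡ (a ⊗ b))`. -/
def bidiff (R S : Module.End ℂ (A ⊗[ℂ] A)) (k l : ℕ) (a b : A) : A :=
  LinearMap.mul' ℂ A ((R ^ k) ((S ^ l) (a ⊗ₜ b)))

/-- Associativity of the deformed product, by orders in the two contractions: if `u` and `u'` are
(twisted) derivations from the right and from the left, `R ∘ (μ ⊗ 1) = (μ ⊗ 1) ∘ (R₁₃ + R₂₃)`,
so that both iterated products are the exponential of `R₁₂ + R₁₃ + R₂₃` on the tensor cube. -/
theorem bidiff_assoc (c : α → α → ℂ) {u u' : α → Module.End ℂ A} {P : Module.End ℂ A}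
    (d : β → β → ℂ) {v v' : β → Module.End ℂ A} {Q : Module.End ℂ A}
    (hu : ∀ i a b, u i (a * b) = a * u i b + u i a * P b)
    (hu' : ∀ i a b, u' i (a * b) = u' i a * b + P a * u' i b)
    (hv : ∀ i a b, v i (a * b) = a * v i b + v i a * Q b)
    (hv' : ∀ i a b, v' i (a * b) = v' i a * b + Q a * v' i b)
    (hR1 : Commute (pairing₁₂ c u u') (pairing₁₃ c u u' P))
    (hR2 : Commute (pairing₁₂ c u u') (pairing₂₃ c u u'))
    (hR3 : Commute (pairing₁₃ c u u' P) (pairing₂₃ c u u'))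
    (hS1 : Commute (pairing₁₂ d v v') (pairing₁₃ d v v' Q))
    (hS2 : Commute (pairing₁₂ d v v') (pairing₂₃ d v v'))
    (hS3 : Commute (pairing₁₃ d v v' Q) (pairing₂₃ d v v'))
    (hRS1 : Commute (pairing₁₂ c u u') (pairing₁₃ d v v' Q + pairing₂₃ d v v'))
    (hRS2 : Commute (pairing₂₃ c u u') (pairing₁₂ d v v' + pairing₁₃ d v v' Q))
    (K L : ℕ) (x y z : A) :
    ∑ k ∈ Finset.HasAntidiagonal.antidiagonal K, ∑ l ∈ Finset.HasAntidiagonal.antidiagonal L,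
      ((k.1.factorial : ℂ)⁻¹ * (k.2.factorial : ℂ)⁻¹ *
        ((l.1.factorial : ℂ)⁻¹ * (l.2.factorial : ℂ)⁻¹)) •
      bidiff (pairing c u u') (pairing d v v') k.1 l.1
        (bidiff (pairing c u u') (pairing d v v') k.2 l.2 x y) z =
    ∑ k ∈ Finset.HasAntidiagonal.antidiagonal K, ∑ l ∈ Finset.HasAntidiagonal.antidiagonal L,
      ((k.1.factorial : ℂ)⁻¹ * (k.2.factorial : ℂ)⁻¹ *
        ((l.1.factorial : ℂ)⁻¹ * (l.2.factorial : ℂ)⁻¹)) •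
      bidiff (pairing c u u') (pairing d v v') k.1 l.1 x
        (bidiff (pairing c u u') (pairing d v v') k.2 l.2 y z) := by
  set R12 := pairing₁₂ c u u'
  set R13 := pairing₁₃ c u u' P
  set R23 := pairing₂₃ c u u'
  set S12 := pairing₁₂ d v v'
  set S13 := pairing₁₃ d v v' Q
  set S23 := pairing₂₃ d v v'
  -- both bracketings as operators on the tensor cube, followed by the threefold product
  have left : ∀ k k' l l', bidiff (pairing c u u') (pairing d v v') k l
      (bidiff (pairing c u u') (pairing d v v') k' l' x y) z =
      (LinearMap.mul' ℂ A ∘ₗ mulLeft₃ A)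
        ((((R13 + R23) ^ k * R12 ^ k') * ((S13 + S23) ^ l * S12 ^ l')) ((x ⊗ₜ y) ⊗ₜ z)) := by
    intro k k' l l'
    have e : (R12 ^ k' * (S13 + S23) ^ l) = (S13 + S23) ^ l * R12 ^ k' :=
      (hRS1.pow_pow k' l).eq
    rw [mul_assoc, ← mul_assoc _ _ (S12 ^ l'), e]
    simp only [bidiff, Module.End.mul_apply, LinearMap.comp_apply]
    have h1 : (R12 ^ k') ((S12 ^ l') ((x ⊗ₜ y) ⊗ₜ z)) =
        ((pairing c u u' ^ k') ((pairing d v v' ^ l') (x ⊗ₜ[ℂ] y))) ⊗ₜ[ℂ] z := by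
      simp only [R12, S12]
      rw [← rTensor_pairing, ← rTensor_pairing, LinearMap.rTensor_pow, LinearMap.rTensor_pow,
        LinearMap.rTensor_tmul, LinearMap.rTensor_tmul]
    rw [h1, ← comp_pow_of_comp (pairing_comp_mulLeft₃ c u' hu),
      ← comp_pow_of_comp (pairing_comp_mulLeft₃ d v' hv), LinearMap.rTensor_tmul]
  have right : ∀ k k' l l', bidiff (pairing c u u') (pairing d v v') k l x
      (bidiff (pairing c u u') (pairing d v v') k' l' y z) =
      (LinearMap.mul' ℂ A ∘ₗ mulLeft₃ A)
        ((((R12 + R13) ^ k * R23 ^ k') * ((S12 + S13) ^ l * S23 ^ l')) ((x ⊗ₜ y) ⊗ₜ z)) := by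
    intro k k' l l'
    have e : (R23 ^ k' * (S12 + S13) ^ l) = (S12 + S13) ^ l * R23 ^ k' :=
      (hRS2.pow_pow k' l).eq
    rw [mul_assoc, ← mul_assoc _ _ (S23 ^ l'), e, ← mul'_comp_mulRight₃]
    simp only [bidiff, Module.End.mul_apply]
    have h1 : TensorProduct.assoc ℂ A A A ((R23 ^ k') ((S23 ^ l') ((x ⊗ₜ y) ⊗ₜ z))) =
        x ⊗ₜ[ℂ] ((pairing c u u' ^ k') ((pairing d v v' ^ l') (y ⊗ₜ[ℂ] z))) := by
      have e1 := comp_pow_of_comp (lTensor_pairing c u u') k'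
      have e2 := comp_pow_of_comp (lTensor_pairing d v v') l'
      simp only [LinearEquiv.coe_coe] at e1 e2
      rw [← e1, ← e2, TensorProduct.assoc_tmul, LinearMap.lTensor_pow, LinearMap.lTensor_pow,
        LinearMap.lTensor_tmul, LinearMap.lTensor_tmul]
    rw [LinearMap.comp_apply, ← comp_pow_of_comp (pairing_comp_mulRight₃ c u hu'),
      ← comp_pow_of_comp (pairing_comp_mulRight₃ d v hv'), LinearMap.comp_apply]
    rw [LinearEquiv.coe_coe, h1, LinearMap.lTensor_tmul]
  -- commuting contractions: the binomial theorem gives powers of the total contraction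
  have collect : ∀ X X' Y Y' : Module.End ℂ ((A ⊗[ℂ] A) ⊗[ℂ] A), Commute X X' → Commute Y Y' →
      ∑ k ∈ Finset.HasAntidiagonal.antidiagonal K, ∑ l ∈ Finset.HasAntidiagonal.antidiagonal L,
      ((k.1.factorial : ℂ)⁻¹ * (k.2.factorial : ℂ)⁻¹ *
        ((l.1.factorial : ℂ)⁻¹ * (l.2.factorial : ℂ)⁻¹)) •
      (LinearMap.mul' ℂ A ∘ₗ mulLeft₃ A)
        (((X ^ k.1 * X' ^ k.2) * (Y ^ l.1 * Y' ^ l.2)) ((x ⊗ₜ y) ⊗ₜ z)) =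
      (LinearMap.mul' ℂ A ∘ₗ mulLeft₃ A)
        ((((K.factorial : ℂ)⁻¹ • (X + X') ^ K) * ((L.factorial : ℂ)⁻¹ • (Y + Y') ^ L))
          ((x ⊗ₜ y) ⊗ₜ z)) := by
    intro X X' Y Y' hX hY
    rw [← sum_divided_pow (T := Module.End ℂ ((A ⊗[ℂ] A) ⊗[ℂ] A)) hX,
      ← sum_divided_pow (T := Module.End ℂ ((A ⊗[ℂ] A) ⊗[ℂ] A)) hY, Finset.sum_mul_sum]
    simp only [LinearMap.sum_apply, map_sum, smul_mul_smul_comm, LinearMap.smul_apply, map_smul]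
  simp only [left, right]
  rw [collect _ _ _ _ (hR1.add_right hR2).symm (hS1.add_right hS2).symm,
    collect _ _ _ _ (hR2.add_left hR3) (hS2.add_left hS3)]
  rw [add_comm (R13 + R23), add_comm (S13 + S23), ← add_assoc, ← add_assoc]

end Pairing

/-! ### Operators on the fibre algebra -/

section FibreOperators

variable {V : Type*} [AddCommGroup V] [Module ℝ V] {F : Type*} [AddCommGroup F] [Module ℝ F]

/-- The decomposable element `z f ⊗ φ ⊗ α` of the fibre. -/
abbrev decomp (z : ℂ) (f : SymmetricAlgebra ℝ (Module.Dual ℝ V))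
    (φ : ExteriorAlgebra ℝ (Module.Dual ℝ F)) (α : ExteriorAlgebra ℝ (Module.Dual ℝ V)) :
    FibreAlg V F :=
  z ⊗ₜ (f ⊗ₜ (φ ⊗ₜ α))

@[elab_as_elim]
theorem fibre_induction {p : FibreAlg V F → Prop} (a : FibreAlg V F)
    (h : ∀ z f φ α, p (decomp z f φ α)) (hadd : ∀ a b, p a → p b → p (a + b)) : p a := by
  have h0 : p 0 := by simpa [decomp] using h 0 0 0 0
  refine TensorProduct.induction_on a h0 (fun z x => ?_) hadd
  refine TensorProduct.induction_on x (by rwa [TensorProduct.tmul_zero]) (fun f y => ?_)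
    fun x y hx hy => by rw [TensorProduct.tmul_add]; exact hadd _ _ hx hy
  refine TensorProduct.induction_on y (by rwa [TensorProduct.tmul_zero, TensorProduct.tmul_zero])
    (fun φ α => h z f φ α)
    fun x y hx hy => by
      rw [TensorProduct.tmul_add, TensorProduct.tmul_add]; exact hadd _ _ hx hy

/-- Induction over decomposable elements with homogeneous Grassmann factors. -/
@[elab_as_elim]
theorem fibre_induction_homogeneous {p : FibreAlg V F → Prop} (a : FibreAlg V F)
    (h : ∀ z f d e, ∀ φ ∈ ⋀[ℝ]^d (Module.Dual ℝ F), ∀ α ∈ ⋀[ℝ]^e (Module.Dual ℝ V),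
      p (decomp z f φ α)) (hadd : ∀ a b, p a → p b → p (a + b)) : p a := by
  induction a using fibre_induction with
  | hadd a b ha hb => exact hadd a b ha hb
  | h z f φ α =>
    induction φ using exterior_induction with
    | hadd φ φ' hφ hφ' =>
      rw [decomp, TensorProduct.add_tmul, TensorProduct.tmul_add, TensorProduct.tmul_add]
      exact hadd _ _ hφ hφ'
    | h d φ hφ =>
      induction α using exterior_induction with
      | hadd α α' hα hα' =>
        rw [decomp, TensorProduct.tmul_add, TensorProduct.tmul_add, TensorProduct.tmul_add]
        exact hadd _ _ hα hα'
      | h e α hα => exact h z f d e φ hφ α hα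

theorem fibre_hom_ext {W : Type*} [AddCommMonoid W] [Module ℂ W] {S T : FibreAlg V F →ₗ[ℂ] W}
    (h : ∀ z f φ α, S (decomp z f φ α) = T (decomp z f φ α)) : S = T :=
  LinearMap.ext fun a => by
    induction a using fibre_induction with
    | h z f φ α => exact h z f φ α
    | hadd a b ha hb => rw [map_add, map_add, ha, hb]

theorem decomp_mul (z z' : ℂ) (f f' : SymmetricAlgebra ℝ (Module.Dual ℝ V))
    (φ φ' : ExteriorAlgebra ℝ (Module.Dual ℝ F)) (α α' : ExteriorAlgebra ℝ (Module.Dual ℝ V)) :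
    decomp z f φ α * decomp z' f' φ' α' = decomp (z * z') (f * f') (φ * φ') (α * α') := by
  simp [decomp]

theorem onSym_decomp (T : Module.End ℝ (SymmetricAlgebra ℝ (Module.Dual ℝ V))) (z : ℂ)
    (f : SymmetricAlgebra ℝ (Module.Dual ℝ V)) (φ : ExteriorAlgebra ℝ (Module.Dual ℝ F))
    (α : ExteriorAlgebra ℝ (Module.Dual ℝ V)) :
    onSym T (decomp z f φ α) = decomp z (T f) φ α := rfl

theorem onE_decomp (T : Module.End ℝ (ExteriorAlgebra ℝ (Module.Dual ℝ F))) (z : ℂ)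
    (f : SymmetricAlgebra ℝ (Module.Dual ℝ V)) (φ : ExteriorAlgebra ℝ (Module.Dual ℝ F))
    (α : ExteriorAlgebra ℝ (Module.Dual ℝ V)) :
    onE T (decomp z f φ α) = decomp z f (T φ) α := rfl

theorem onForms_decomp (T : Module.End ℝ (ExteriorAlgebra ℝ (Module.Dual ℝ V))) (z : ℂ)
    (f : SymmetricAlgebra ℝ (Module.Dual ℝ V)) (φ : ExteriorAlgebra ℝ (Module.Dual ℝ F))
    (α : ExteriorAlgebra ℝ (Module.Dual ℝ V)) :
    onForms T (decomp z f φ α) = decomp z f φ (T α) := rfl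

theorem onSym_mul (T T' : Module.End ℝ (SymmetricAlgebra ℝ (Module.Dual ℝ V))) :
    (onSym (T * T') : Module.End ℂ (FibreAlg V F)) = onSym T * onSym T' :=
  fibre_hom_ext fun z f φ α => by simp only [Module.End.mul_apply, onSym_decomp]

theorem onE_mul (T T' : Module.End ℝ (ExteriorAlgebra ℝ (Module.Dual ℝ F))) :
    (onE (T * T') : Module.End ℂ (FibreAlg V F)) = onE T * onE T' :=
  fibre_hom_ext fun z f φ α => by simp only [Module.End.mul_apply, onE_decomp]

theorem onForms_mul (T T' : Module.End ℝ (ExteriorAlgebra ℝ (Module.Dual ℝ V))) :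
    (onForms (T * T') : Module.End ℂ (FibreAlg V F)) = onForms T * onForms T' :=
  fibre_hom_ext fun z f φ α => by simp only [Module.End.mul_apply, onForms_decomp]

theorem onSym_add (T T' : Module.End ℝ (SymmetricAlgebra ℝ (Module.Dual ℝ V))) :
    (onSym (T + T') : Module.End ℂ (FibreAlg V F)) = onSym T + onSym T' := by
  simp only [onSym, LinearMap.rTensor_add, LinearMap.baseChange_add]

theorem onSym_smul (r : ℝ) (T : Module.End ℝ (SymmetricAlgebra ℝ (Module.Dual ℝ V))) :
    (onSym (r • T) : Module.End ℂ (FibreAlg V F)) = (r : ℂ) • onSym T := by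
  simp only [onSym, LinearMap.rTensor_smul, LinearMap.baseChange_smul]
  rfl

theorem onE_neg (T : Module.End ℝ (ExteriorAlgebra ℝ (Module.Dual ℝ F))) :
    (onE (-T) : Module.End ℂ (FibreAlg V F)) = -onE T := by
  simp only [onE, LinearMap.rTensor_neg, LinearMap.lTensor_neg, LinearMap.baseChange_neg]

theorem onE_sub (T T' : Module.End ℝ (ExteriorAlgebra ℝ (Module.Dual ℝ F))) :
    (onE (T - T') : Module.End ℂ (FibreAlg V F)) = onE T - onE T' := by
  simp only [onE, LinearMap.rTensor_sub, LinearMap.lTensor_sub, LinearMap.baseChange_sub]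

theorem onForms_neg (T : Module.End ℝ (ExteriorAlgebra ℝ (Module.Dual ℝ V))) :
    (onForms (-T) : Module.End ℂ (FibreAlg V F)) = -onForms T := by
  simp only [onForms, LinearMap.lTensor_neg, LinearMap.baseChange_neg]

theorem onE_one : (onE 1 : Module.End ℂ (FibreAlg V F)) = 1 := fibre_hom_ext fun _ _ _ _ => rfl

theorem onForms_one : (onForms 1 : Module.End ℂ (FibreAlg V F)) = 1 :=
  fibre_hom_ext fun _ _ _ _ => rfl

theorem onSym_commute_onE (T : Module.End ℝ (SymmetricAlgebra ℝ (Module.Dual ℝ V)))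
    (T' : Module.End ℝ (ExteriorAlgebra ℝ (Module.Dual ℝ F))) :
    Commute (onSym T : Module.End ℂ (FibreAlg V F)) (onE T') := by
  rw [commute_iff_eq]
  exact fibre_hom_ext fun z f φ α => by
    simp only [Module.End.mul_apply, onSym_decomp, onE_decomp]

theorem onSym_commute_onForms (T : Module.End ℝ (SymmetricAlgebra ℝ (Module.Dual ℝ V)))
    (T' : Module.End ℝ (ExteriorAlgebra ℝ (Module.Dual ℝ V))) :
    Commute (onSym T : Module.End ℂ (FibreAlg V F)) (onForms T') := by
  rw [commute_iff_eq]
  exact fibre_hom_ext fun z f φ α => by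
    simp only [Module.End.mul_apply, onSym_decomp, onForms_decomp]

theorem onE_commute_onForms (T : Module.End ℝ (ExteriorAlgebra ℝ (Module.Dual ℝ F)))
    (T' : Module.End ℝ (ExteriorAlgebra ℝ (Module.Dual ℝ V))) :
    Commute (onE T : Module.End ℂ (FibreAlg V F)) (onForms T') := by
  rw [commute_iff_eq]
  exact fibre_hom_ext fun z f φ α => by
    simp only [Module.End.mul_apply, onE_decomp, onForms_decomp]

/-- The parity operator `(-1)^{deg_a}` of a fibre. -/
def parA : Module.End ℂ (FibreAlg V F) := onForms (extParity (Module.Dual ℝ V))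

/-- The operator `deg_E` on a fibre. -/
abbrev numE : Module.End ℂ (FibreAlg V F) := onE (extWeight _ fun d => (d : ℝ))

/-- The operator `deg_a` on a fibre. -/
abbrev numA : Module.End ℂ (FibreAlg V F) := onForms (extWeight _ fun d => (d : ℝ))

theorem iS_commute_iS (X Y : V) : Commute (iS X : Module.End ℂ (FibreAlg V F)) (iS Y) := by
  rw [commute_iff_eq, iS, iS, ← onSym_mul, symContract_comm, onSym_mul]

theorem iS_commute_parE (X : V) : Commute (iS X : Module.End ℂ (FibreAlg V F)) parE :=
  onSym_commute_onE _ _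

theorem iS_commute_iE (X : V) (e : F) : Commute (iS X : Module.End ℂ (FibreAlg V F)) (iE e) :=
  onSym_commute_onE _ _

theorem iS_commute_jE (X : V) (e : F) : Commute (iS X : Module.End ℂ (FibreAlg V F)) (jE e) :=
  (iS_commute_parE X).mul_right (iS_commute_iE X e)

theorem parE_mul_self : (parE * parE : Module.End ℂ (FibreAlg V F)) = 1 := by
  rw [parE, ← onE_mul, extParity_mul_self, onE_one]

theorem parA_mul_self : (parA * parA : Module.End ℂ (FibreAlg V F)) = 1 := by
  rw [parA, ← onForms_mul, extParity_mul_self, onForms_one]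

theorem parE_parE (a : FibreAlg V F) : parE (parE a) = a :=
  LinearMap.congr_fun parE_mul_self a

theorem parE_mul_iE (e : F) :
    (parE * iE e : Module.End ℂ (FibreAlg V F)) = -(iE e * parE) := by
  rw [parE, iE, ← onE_mul, ← onE_mul, ← onE_neg, ← extParity_extContract]

theorem iE_mul_iE (e e' : F) :
    (iE e * iE e' : Module.End ℂ (FibreAlg V F)) = -(iE e' * iE e) := by
  rw [iE, iE, ← onE_mul, ← onE_mul, ← onE_neg, ← extContract_anticomm]

theorem iE_mul_parE (e : F) :
    (iE e * parE : Module.End ℂ (FibreAlg V F)) = -(parE * iE e) := by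
  rw [parE_mul_iE, neg_neg]

theorem jE_eq (e : F) : (jE e : Module.End ℂ (FibreAlg V F)) =
    onE (extContractRight (Module.Dual.eval ℝ F e)) := by
  rw [jE, parE, iE, ← onE_mul]

theorem jE_mul_jE (e e' : F) :
    (jE e * jE e' : Module.End ℂ (FibreAlg V F)) = -(jE e' * jE e) := by
  rw [jE_eq, jE_eq, ← onE_mul, ← onE_mul, ← onE_neg, ← extContractRight_anticomm]

theorem jE_mul_iE (e e' : F) :
    (jE e * iE e' : Module.End ℂ (FibreAlg V F)) = iE e' * jE e := by
  rw [jE_eq, iE, ← onE_mul, ← onE_mul, ← extContractRight_mul_extContract]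

theorem parE_mul_jE (e : F) :
    (parE * jE e : Module.End ℂ (FibreAlg V F)) = -(jE e * parE) := by
  rw [jE_eq, parE, ← onE_mul, ← onE_mul, ← onE_neg, ← extParity_mul_extContractRight]

theorem numE_mul_iE (e : F) :
    (numE * iE e : Module.End ℂ (FibreAlg V F)) = iE e * numE - iE e := by
  rw [numE, iE, ← onE_mul, ← onE_mul, ← onE_sub, ← extDegree_extContract]

theorem numE_mul_jE (e : F) :
    (numE * jE e : Module.End ℂ (FibreAlg V F)) = jE e * numE - jE e := by
  rw [numE, jE_eq, ← onE_mul, ← onE_mul, ← onE_sub, ← extDegree_extContractRight]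

/-- A twisted Leibniz rule holds if it holds on decomposable elements. -/
theorem leibniz_of_decomp {D P D' L Q : Module.End ℂ (FibreAlg V F)}
    (h : ∀ z f φ α z' f' φ' α', D (decomp z f φ α * decomp z' f' φ' α') =
      L (decomp z f φ α) * Q (decomp z' f' φ' α') +
        P (decomp z f φ α) * D' (decomp z' f' φ' α')) (a b : FibreAlg V F) :
    D (a * b) = L a * Q b + P a * D' b := by
  induction a using fibre_induction with
  | hadd a a' ha ha' =>
    rw [add_mul, map_add, map_add, map_add, ha, ha', add_mul, add_mul, add_add_add_comm]
  | h z f φ α =>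
    induction b using fibre_induction with
    | hadd b b' hb hb' =>
      rw [mul_add, map_add, map_add, map_add, hb, hb', mul_add, mul_add, add_add_add_comm]
    | h z' f' φ' α' => exact h z f φ α z' f' φ' α'

theorem iS_leibniz (X : V) (a b : FibreAlg V F) : iS X (a * b) = a * iS X b + iS X a * b := by
  have := leibniz_of_decomp (D := iS X) (L := 1) (Q := iS X) (P := iS X) (D' := 1)
    (fun z f φ α z' f' φ' α' => by
      simp only [iS, decomp_mul, onSym_decomp, symContract_mul, Module.End.one_apply]
      rw [← TensorProduct.tmul_add, ← TensorProduct.add_tmul, mul_comm f']) a b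
  simpa only [Module.End.one_apply] using this

theorem parE_mul (a b : FibreAlg V F) : parE (a * b) = parE a * parE b := by
  induction a using fibre_induction with
  | hadd a a' ha ha' => rw [add_mul, map_add, map_add, add_mul, ha, ha']
  | h z f φ α =>
    induction b using fibre_induction with
    | hadd b b' hb hb' => rw [mul_add, map_add, map_add, mul_add, hb, hb']
    | h z' f' φ' α' => simp only [parE, decomp_mul, onE_decomp, extParity_mul]

theorem iE_leibniz (e : F) (a b : FibreAlg V F) :
    iE e (a * b) = iE e a * b + parE a * iE e b :=
  leibniz_of_decomp (L := iE e) (Q := 1) (fun z f φ α z' f' φ' α' => by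
    simp only [iE, parE, decomp_mul, onE_decomp, Module.End.one_apply]
    rw [extContract_mul, ← TensorProduct.tmul_add, ← TensorProduct.tmul_add,
      ← TensorProduct.add_tmul]) a b

theorem jE_leibniz (e : F) (a b : FibreAlg V F) :
    jE e (a * b) = a * jE e b + jE e a * parE b := by
  rw [jE, Module.End.mul_apply, iE_leibniz, map_add, parE_mul, parE_mul, parE_parE, add_comm]
  rfl

theorem numE_leibniz (a b : FibreAlg V F) : numE (a * b) = numE a * b + a * numE b :=
  leibniz_of_decomp (L := numE) (Q := 1) (P := 1) (fun z f φ α z' f' φ' α' => by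
    simp only [numE, decomp_mul, onE_decomp, Module.End.one_apply]
    rw [extDegree_mul, ← TensorProduct.tmul_add, ← TensorProduct.tmul_add,
      ← TensorProduct.add_tmul]) a b

theorem numA_leibniz (a b : FibreAlg V F) : numA (a * b) = numA a * b + a * numA b :=
  leibniz_of_decomp (L := numA) (Q := 1) (P := 1) (fun z f φ α z' f' φ' α' => by
    simp only [numA, decomp_mul, onForms_decomp, Module.End.one_apply]
    rw [extDegree_mul, ← TensorProduct.tmul_add, ← TensorProduct.tmul_add,
      ← TensorProduct.tmul_add]) a b

theorem mulA_mul (ξ : Module.Dual ℝ V) (a b : FibreAlg V F) : mulA ξ (a * b) = mulA ξ a * b := by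
  induction a using fibre_induction with
  | hadd a a' ha ha' => rw [add_mul, map_add, map_add, ha, ha', add_mul]
  | h z f φ α =>
    induction b using fibre_induction with
    | hadd b b' hb hb' => rw [mul_add, map_add, mul_add, hb, hb']
    | h z' f' φ' α' =>
      simp only [mulA, decomp_mul, onForms_decomp, LinearMap.mulLeft_apply, mul_assoc]

theorem mul_mulA (ξ : Module.Dual ℝ V) (a b : FibreAlg V F) :
    a * mulA ξ b = mulA ξ (parA a * b) := by
  induction a using fibre_induction with
  | hadd a a' ha ha' => rw [add_mul, map_add, add_mul, map_add, ha, ha']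
  | h z f φ α =>
    induction b using fibre_induction with
    | hadd b b' hb hb' => rw [mul_add, map_add, mul_add, map_add, hb, hb']
    | h z' f' φ' α' =>
      simp only [mulA, parA, decomp_mul, onForms_decomp, LinearMap.mulLeft_apply]
      rw [← mul_assoc, ← mul_assoc, extParity_ι_mul]

theorem mulS_leibniz_iS (ξ : Module.Dual ℝ V) (X : V) (a b : FibreAlg V F) :
    mulS ξ (iS X (a * b)) = mulS ξ (iS X a) * b + a * mulS ξ (iS X b) := by
  have := leibniz_of_decomp (D := (mulS ξ * iS X : Module.End ℂ (FibreAlg V F)))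
    (L := (mulS ξ * iS X : Module.End ℂ (FibreAlg V F))) (Q := 1) (P := 1)
    (D' := (mulS ξ * iS X : Module.End ℂ (FibreAlg V F))) (fun z f φ α z' f' φ' α' => by
    simp only [iS, mulS, ← onSym_mul, decomp_mul, onSym_decomp, symContract_mul,
      LinearMap.mulLeft_apply, Module.End.one_apply, Module.End.mul_apply]
    rw [← TensorProduct.tmul_add, ← TensorProduct.add_tmul]
    congr 3
    ring) a b
  simpa only [Module.End.mul_apply, Module.End.one_apply] using this

theorem mulE_leibniz_iE (θ : Module.Dual ℝ F) (e : F) (a b : FibreAlg V F) :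
    mulE θ (iE e (a * b)) = mulE θ (iE e a) * b + a * mulE θ (iE e b) := by
  have := leibniz_of_decomp (D := (mulE θ * iE e : Module.End ℂ (FibreAlg V F)))
    (L := (mulE θ * iE e : Module.End ℂ (FibreAlg V F))) (Q := 1) (P := 1)
    (D' := (mulE θ * iE e : Module.End ℂ (FibreAlg V F))) (fun z f φ α z' f' φ' α' => by
    simp only [iE, mulE, ← onE_mul, decomp_mul, onE_decomp, extContract_mul,
      LinearMap.mulLeft_apply, Module.End.one_apply, Module.End.mul_apply]
    rw [← TensorProduct.tmul_add, ← TensorProduct.tmul_add, ← TensorProduct.add_tmul]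
    congr 1
    rw [mul_add, ← mul_assoc, ← mul_assoc, ← extParity_ι_mul, mul_assoc _ (ExteriorAlgebra.ι ℝ θ)]) a b
  simpa only [Module.End.mul_apply, Module.End.one_apply] using this

theorem mulA_leibniz_iA (ξ : Module.Dual ℝ V) (X : V) (a b : FibreAlg V F) :
    mulA ξ (iA X (a * b)) = mulA ξ (iA X a) * b + a * mulA ξ (iA X b) := by
  have := leibniz_of_decomp (D := (mulA ξ * iA X : Module.End ℂ (FibreAlg V F)))
    (L := (mulA ξ * iA X : Module.End ℂ (FibreAlg V F))) (Q := 1) (P := 1)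
    (D' := (mulA ξ * iA X : Module.End ℂ (FibreAlg V F))) (fun z f φ α z' f' φ' α' => by
    simp only [iA, mulA, ← onForms_mul, decomp_mul, onForms_decomp, extContract_mul,
      LinearMap.mulLeft_apply, Module.End.one_apply, Module.End.mul_apply]
    rw [← TensorProduct.tmul_add, ← TensorProduct.tmul_add, ← TensorProduct.tmul_add]
    congr 1
    rw [mul_add, ← mul_assoc, ← mul_assoc, ← extParity_ι_mul, mul_assoc _ (ExteriorAlgebra.ι ℝ ξ)]) a b
  simpa only [Module.End.mul_apply, Module.End.one_apply] using this

end FibreOperators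

/-! ### Symmetries of the deformed products -/

section PairingSymmetry

variable {A : Type*} [Ring A] [Algebra ℂ A] {α : Type*} [Fintype α]

/-- An operator on the tensor square which commutes with both contractions acts on the
deformed products through its action on the undeformed one. -/
theorem bidiff_intertwine {R S X X' : Module.End ℂ (A ⊗[ℂ] A)} {Y : Module.End ℂ A}
    (hY : ∀ a b, Y (LinearMap.mul' ℂ A (X' (a ⊗ₜ b))) = LinearMap.mul' ℂ A (X (a ⊗ₜ b)))
    (hR : Commute R X) (hS : Commute S X) (hR' : Commute R X') (hS' : Commute S X')
    (k l : ℕ) (t : A ⊗[ℂ] A) :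
    Y (LinearMap.mul' ℂ A ((R ^ k) ((S ^ l) (X' t)))) =
      LinearMap.mul' ℂ A ((R ^ k) ((S ^ l) (X t))) := by
  have e : Y ∘ₗ LinearMap.mul' ℂ A ∘ₗ X' = LinearMap.mul' ℂ A ∘ₗ X := TensorProduct.ext' hY
  have c : ∀ X : Module.End ℂ (A ⊗[ℂ] A), Commute R X → Commute S X →
      (R ^ k) ((S ^ l) (X t)) = X ((R ^ k) ((S ^ l) t)) := fun X h h' =>
    LinearMap.congr_fun ((h.pow_left k).mul_left (h'.pow_left l)).eq t
  rw [c X hR hS, c X' hR' hS']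
  exact LinearMap.congr_fun e _

theorem pairing_commute_map (c : α → α → ℂ) {u u' : α → Module.End ℂ A} {f g : Module.End ℂ A}
    (s : ℤˣ) (hu : ∀ i, u i * f = (s : ℤ) • (f * u i)) (hu' : ∀ i, u' i * g = (s : ℤ) • (g * u' i)) :
    Commute (pairing c u u') (TensorProduct.map f g) := by
  refine Commute.sum_left _ _ _ fun i _ => Commute.sum_left _ _ _ fun j _ =>
    Commute.smul_left ?_ _
  rw [commute_iff_eq, ← TensorProduct.map_mul, ← TensorProduct.map_mul, hu, hu']
  rcases Int.units_eq_one_or s with rfl | rfl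
  · simp
  · ext a b
    simp [TensorProduct.neg_tmul, TensorProduct.tmul_neg]

theorem pairing_commute_map_of_commute (c : α → α → ℂ) {u u' : α → Module.End ℂ A}
    {f g : Module.End ℂ A} (hu : ∀ i, Commute (u i) f) (hu' : ∀ i, Commute (u' i) g) :
    Commute (pairing c u u') (TensorProduct.map f g) :=
  pairing_commute_map c 1 (by simpa using fun i => (hu i).eq) (by simpa using fun i => (hu' i).eq)

theorem comm_comp_pairing (c : α → α → ℂ) (u u' : α → Module.End ℂ A) :
    (TensorProduct.comm ℂ A A).toLinearMap ∘ₗ pairing c u u' =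
      pairing (fun i j => c j i) u' u ∘ₗ (TensorProduct.comm ℂ A A).toLinearMap := by
  refine TensorProduct.ext' fun a b => ?_
  simp only [LinearMap.comp_apply, pairing_tmul, map_sum, map_smul, LinearEquiv.coe_coe,
    TensorProduct.comm_tmul]
  exact Finset.sum_comm

theorem pairing_neg (c : α → α → ℂ) (u u' : α → Module.End ℂ A) :
    pairing (fun i j => -c i j) u u' = -pairing c u u' := by
  refine TensorProduct.ext' fun a b => ?_
  simp only [LinearMap.neg_apply, pairing_tmul, neg_smul, Finset.sum_neg_distrib]


/-- The Koszul sign `(-1)^{d₁ d₂}` on the tensor square of an algebra with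
parity operator `P`: the stated combination of `P` is `1` unless both factors are odd, when it is
`-1`. -/
def koszul (P : Module.End ℂ A) : Module.End ℂ (A ⊗[ℂ] A) :=
  (2⁻¹ : ℂ) • (1 + TensorProduct.map P 1 + TensorProduct.map 1 P - TensorProduct.map P P)

theorem koszul_tmul (P : Module.End ℂ A) {a b : A} {d e : ℕ} (ha : P a = (-1 : ℂ) ^ d • a)
    (hb : P b = (-1 : ℂ) ^ e • b) :
    koszul P (a ⊗ₜ b) = (-1 : ℂ) ^ (d * e) • (a ⊗ₜ[ℂ] b) := by
  simp only [koszul, LinearMap.smul_apply, LinearMap.sub_apply, LinearMap.add_apply,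
    TensorProduct.map_tmul, ha, hb, Module.End.one_apply,
    TensorProduct.tmul_smul, ← TensorProduct.smul_tmul']
  rw [pow_mul]
  rcases neg_one_pow_eq_or ℂ d with h | h <;> rcases neg_one_pow_eq_or ℂ e with h' | h' <;>
    simp only [h, h', one_pow] <;> module

theorem pairing_commute_koszul (c : α → α → ℂ) {u u' : α → Module.End ℂ A} {P : Module.End ℂ A}
    (hu : ∀ i, Commute (u i) P) (hu' : ∀ i, Commute (u' i) P) :
    Commute (pairing c u u') (koszul P) := by
  refine Commute.smul_right ?_ _
  exact (((Commute.one_right _).add_right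
    (pairing_commute_map_of_commute c hu fun _ => Commute.one_right _)).add_right
    (pairing_commute_map_of_commute c (fun _ => Commute.one_right _) hu')).sub_right
    (pairing_commute_map_of_commute c hu hu')

/-- The Koszul sign turns `P u ⊗ v` into `-(u ⊗ P v)` for odd `u` and `v`: here `p = P ⊗ 1`,
`q = 1 ⊗ P`, and `I = u ⊗ v` anticommutes with both. -/
theorem koszul_ring_identity {T : Type*} [Ring T] {p q I : T} (hpp : p * p = 1) (hqq : q * q = 1)
    (hpq : q * p = p * q) (hp : I * p = -(p * I)) (hq : I * q = -(q * I)) :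
    (1 + p + q - p * q) * (p * I) = -((q * I) * (1 + p + q - p * q)) := by
  have h1 : p * (p * I) = I := by rw [← mul_assoc, hpp, one_mul]
  have h2 : q * (q * I) = I := by rw [← mul_assoc, hqq, one_mul]
  have h3 : p * q * (p * I) = q * I := by
    rw [mul_assoc, ← mul_assoc q, hpq, mul_assoc p, ← mul_assoc p p, hpp, one_mul]
  have h4 : q * I * p = -(p * (q * I)) := by rw [mul_assoc, hp, mul_neg, ← mul_assoc, hpq, mul_assoc]
  have h5 : q * I * q = -I := by rw [mul_assoc, hq, mul_neg, h2]
  have h6 : q * I * (p * q) = p * I := by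
    rw [← mul_assoc, h4, neg_mul, mul_assoc p, h5, mul_neg, neg_neg]
  have h7 : q * (p * I) = p * (q * I) := by rw [← mul_assoc, hpq, mul_assoc]
  simp only [add_mul, sub_mul, mul_add, mul_sub, one_mul, mul_one, h1, h3, h4, h5, h6, h7]
  abel

/-- The contraction of odd operators anticommutes with the graded flip. -/
theorem koszul_mul_pairing_odd (c : α → α → ℂ) {u : α → Module.End ℂ A} {P : Module.End ℂ A}
    (hP : P * P = 1) (hu : ∀ i, u i * P = -(P * u i)) :
    koszul P * pairing c (fun i => P * u i) u = -(pairing c u (fun i => P * u i) * koszul P) := by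
  have e1 : pairing c (fun i => P * u i) u = TensorProduct.map P 1 * pairing c u u := by
    simp only [pairing, Finset.mul_sum, mul_smul_comm, ← TensorProduct.map_mul, one_mul]
  have e2 : pairing c u (fun i => P * u i) = TensorProduct.map 1 P * pairing c u u := by
    simp only [pairing, Finset.mul_sum, mul_smul_comm, ← TensorProduct.map_mul, one_mul]
  have hp : pairing c u u * TensorProduct.map P 1 = -(TensorProduct.map P 1 * pairing c u u) := by
    refine TensorProduct.ext' fun a b => ?_
    have hu' : ∀ i a, u i (P a) = -P (u i a) := fun i a => LinearMap.congr_fun (hu i) a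
    simp only [Module.End.mul_apply, LinearMap.neg_apply, pairing_tmul, TensorProduct.map_tmul,
      map_sum, map_smul, hu', TensorProduct.neg_tmul, Module.End.one_apply, smul_neg,
      Finset.sum_neg_distrib]
  have hq : pairing c u u * TensorProduct.map 1 P = -(TensorProduct.map 1 P * pairing c u u) := by
    refine TensorProduct.ext' fun a b => ?_
    have hu' : ∀ i a, u i (P a) = -P (u i a) := fun i a => LinearMap.congr_fun (hu i) a
    simp only [Module.End.mul_apply, LinearMap.neg_apply, pairing_tmul, TensorProduct.map_tmul,
      map_sum, map_smul, hu', TensorProduct.tmul_neg, Module.End.one_apply, smul_neg,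
      Finset.sum_neg_distrib]
  have e3 : TensorProduct.map P P = TensorProduct.map P 1 * TensorProduct.map 1 P := by
    rw [← TensorProduct.map_mul, one_mul, mul_one]
  have h1 : TensorProduct.map P 1 * TensorProduct.map P 1 = (1 : Module.End ℂ (A ⊗[ℂ] A)) := by
    rw [← TensorProduct.map_mul, one_mul, hP, TensorProduct.map_one]
  have h2 : TensorProduct.map 1 P * TensorProduct.map 1 P = (1 : Module.End ℂ (A ⊗[ℂ] A)) := by
    rw [← TensorProduct.map_mul, one_mul, hP, TensorProduct.map_one]
  have h3 : TensorProduct.map 1 P * TensorProduct.map P 1 =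
      TensorProduct.map P 1 * (TensorProduct.map 1 P : Module.End ℂ (A ⊗[ℂ] A)) := by
    simp only [← TensorProduct.map_mul, one_mul, mul_one]
  rw [e1, e2, koszul, e3, smul_mul_assoc, mul_smul_comm,
    koszul_ring_identity (T := Module.End ℂ (A ⊗[ℂ] A)) h1 h2 h3 hp hq]
  exact smul_neg _ _

/-- If a flip `τ` leaves the undeformed product invariant and anticommutes with the contractions,
then it changes the deformed products by the sign `(-1)^{k+l}`. -/
theorem bidiff_of_anticommute {R S τ : Module.End ℂ (A ⊗[ℂ] A)}
    (hτ : ∀ a b, LinearMap.mul' ℂ A (τ (a ⊗ₜ b)) = a * b)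
    (hR : τ * R = -(R * τ)) (hS : τ * S = -(S * τ)) (k l : ℕ) (t : A ⊗[ℂ] A) :
    LinearMap.mul' ℂ A ((R ^ k) ((S ^ l) t)) =
      (-1 : ℂ) ^ (k + l) • LinearMap.mul' ℂ A ((R ^ k) ((S ^ l) (τ t))) := by
  have e : LinearMap.mul' ℂ A ∘ₗ τ = LinearMap.mul' ℂ A := TensorProduct.ext' fun a b => by
    rw [LinearMap.comp_apply, hτ, LinearMap.mul'_apply]
  have p : ∀ {R : Module.End ℂ (A ⊗[ℂ] A)}, τ * R = -(R * τ) → ∀ k t,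
      τ ((R ^ k) t) = (-1 : ℂ) ^ k • (R ^ k) (τ t) := by
    intro R h k
    induction k with
    | zero => simp
    | succ k ih =>
      intro t
      rw [pow_succ', Module.End.mul_apply, Module.End.mul_apply,
        show τ (R ((R ^ k) t)) = -R (τ ((R ^ k) t)) from LinearMap.congr_fun h _, ih, map_smul,
        pow_succ, mul_neg_one, neg_smul]
  have := LinearMap.congr_fun e ((R ^ k) ((S ^ l) t))
  rw [← this, LinearMap.comp_apply, p hR, p hS]
  simp only [map_smul, smul_smul, pow_add]

/-- If `N` is a derivation of the undeformed product which lowers the degree of both legs of `S`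
by one and commutes with those of `R`, then `Rᵏ Sˡ` has degree `-2l`. -/
theorem bidiff_of_degree {R S X : Module.End ℂ (A ⊗[ℂ] A)} (hR : Commute R X)
    (hS : X * S = S * X - (2 : ℂ) • S) (k l : ℕ) (t : A ⊗[ℂ] A) :
    X ((R ^ k) ((S ^ l) t)) = (R ^ k) ((S ^ l) (X t)) - (2 * l : ℂ) • (R ^ k) ((S ^ l) t) := by
  have p : ∀ (l : ℕ) (t), X ((S ^ l) t) = (S ^ l) (X t) - (2 * l : ℂ) • (S ^ l) t := by
    intro l
    induction l with
    | zero => simp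
    | succ l ih =>
      intro t
      rw [pow_succ', Module.End.mul_apply, Module.End.mul_apply,
        show X (S ((S ^ l) t)) = S (X ((S ^ l) t)) - (2 : ℂ) • S ((S ^ l) t) from
          LinearMap.congr_fun hS _, ih, map_sub, map_smul]
      push_cast
      module
  rw [show X ((R ^ k) ((S ^ l) t)) = (R ^ k) (X ((S ^ l) t)) from
    (LinearMap.congr_fun (hR.pow_left k).eq _).symm, p, map_sub, map_smul]

theorem list_prod_intertwine {A B : Type*} [AddCommGroup A] [Module ℂ A] [AddCommGroup B]
    [Module ℂ B] (f : A → B) {k : ℕ} {u : Fin k → Module.End ℂ A} {v : Fin k → Module.End ℂ B}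
    (h : ∀ i a, f (u i a) = v i (f a)) (a : A) :
    f ((List.ofFn u).prod a) = (List.ofFn v).prod (f a) := by
  induction k generalizing a with
  | zero => simp
  | succ k ih =>
    rw [List.ofFn_succ, List.ofFn_succ, List.prod_cons, List.prod_cons, Module.End.mul_apply,
      Module.End.mul_apply, h, ih fun i => h i.succ]

end PairingSymmetry

/-! ### Contractions with the Poisson tensor and the fibre metric -/

section Contraction

variable {V : Type*} [AddCommGroup V] [Module ℝ V] {F : Type*} [AddCommGroup F] [Module ℝ F]
  {ι κ : Type*} [Fintype ι] [Fintype κ] [DecidableEq ι] [DecidableEq κ]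
  (Ω : V → V → ℝ) (q : F → F → ℝ) (b : Module.Basis ι ℝ V) (c : Module.Basis κ ℝ F)

theorem fibreR_eq_pairing : (fibreR Ω b : Module.End ℂ (FibreAlg V F ⊗[ℂ] FibreAlg V F)) =
    pairing (fun i j => ((poissonMatrix Ω b i j : ℝ) : ℂ)) (fun i => iS (b i))
      (fun i => iS (b i)) := rfl

theorem fibreS_eq_pairing : (fibreS q c : Module.End ℂ (FibreAlg V F ⊗[ℂ] FibreAlg V F)) =
    pairing (fun i j => ((inverseMetric q c i j : ℝ) : ℂ)) (fun i => jE (c i))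
      (fun i => iE (c i)) := rfl

theorem contraction_eq_bidiff (k l : ℕ) (a a' : FibreAlg V F) :
    contraction Ω q b c k l a a' = bidiff (fibreR Ω b) (fibreS q c) k l a a' := by
  rw [bidiff, fibreR_eq_pairing, pairing_pow, contraction]
  simp only [LinearMap.sum_apply, LinearMap.smul_apply, map_sum, map_smul]
  refine Finset.sum_congr rfl fun i _ => Finset.sum_congr rfl fun j _ => ?_
  rw [fibreS_eq_pairing, pairing_pow]
  simp only [LinearMap.sum_apply, LinearMap.smul_apply, TensorProduct.map_tmul, map_sum, map_smul,
    LinearMap.mul'_apply, Finset.smul_sum, smul_smul, Module.End.mul_apply, Complex.ofReal_mul,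
    Complex.ofReal_prod]

theorem eq_neg_one_smul {T : Type*} [Ring T] {x y : T} (h : x = -y) :
    x = ((-1 : ℤˣ) : ℤ) • y := by
  simpa using h

theorem eq_one_smul {T : Type*} [Ring T] {x y : T} (h : x = y) : x = ((1 : ℤˣ) : ℤ) • y := by
  simpa using h

/-- Associativity of the deformed product in one fibre, by orders in the two contractions. -/
theorem contraction_assoc (K L : ℕ) (x y z : FibreAlg V F) :
    ∑ k ∈ Finset.HasAntidiagonal.antidiagonal K, ∑ l ∈ Finset.HasAntidiagonal.antidiagonal L,
      ((k.1.factorial : ℂ)⁻¹ * (k.2.factorial : ℂ)⁻¹ *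
        ((l.1.factorial : ℂ)⁻¹ * (l.2.factorial : ℂ)⁻¹)) •
      contraction Ω q b c k.1 l.1 (contraction Ω q b c k.2 l.2 x y) z =
    ∑ k ∈ Finset.HasAntidiagonal.antidiagonal K, ∑ l ∈ Finset.HasAntidiagonal.antidiagonal L,
      ((k.1.factorial : ℂ)⁻¹ * (k.2.factorial : ℂ)⁻¹ *
        ((l.1.factorial : ℂ)⁻¹ * (l.2.factorial : ℂ)⁻¹)) •
      contraction Ω q b c k.1 l.1 x (contraction Ω q b c k.2 l.2 y z) := by
  simp only [contraction_eq_bidiff, fibreR_eq_pairing, fibreS_eq_pairing]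
  -- The commutation relations of the legs, each with its sign. Two triples of legs commute on
  -- the tensor cube if the product of the three signs is `1`.
  have ss : ∀ i j, (iS (b i) * iS (b j) : Module.End ℂ (FibreAlg V F)) =
      ((1 : ℤˣ) : ℤ) • (iS (b j) * iS (b i)) := fun i j => eq_one_smul (iS_commute_iS _ _).eq
  have l1 : ∀ f : Module.End ℂ (FibreAlg V F), 1 * f = ((1 : ℤˣ) : ℤ) • (f * 1) := fun f =>
    eq_one_smul (Commute.one_left f).eq
  have r1 : ∀ f : Module.End ℂ (FibreAlg V F), f * 1 = ((1 : ℤˣ) : ℤ) • (1 * f) := fun f =>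
    eq_one_smul (Commute.one_right f).eq
  have sj : ∀ i A, (iS (b i) * jE (c A) : Module.End ℂ (FibreAlg V F)) =
      ((1 : ℤˣ) : ℤ) • (jE (c A) * iS (b i)) := fun i j => eq_one_smul (iS_commute_jE _ _).eq
  have si : ∀ i A, (iS (b i) * iE (c A) : Module.End ℂ (FibreAlg V F)) =
      ((1 : ℤˣ) : ℤ) • (iE (c A) * iS (b i)) := fun i j => eq_one_smul (iS_commute_iE _ _).eq
  have sp : ∀ i, (iS (b i) * parE : Module.End ℂ (FibreAlg V F)) =
      ((1 : ℤˣ) : ℤ) • (parE * iS (b i)) := fun i => eq_one_smul (iS_commute_parE _).eq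
  have ii : ∀ A B, (iE (c A) * iE (c B) : Module.End ℂ (FibreAlg V F)) =
      ((-1 : ℤˣ) : ℤ) • (iE (c B) * iE (c A)) := fun A B => eq_neg_one_smul (iE_mul_iE _ _)
  have jj : ∀ A B, (jE (c A) * jE (c B) : Module.End ℂ (FibreAlg V F)) =
      ((-1 : ℤˣ) : ℤ) • (jE (c B) * jE (c A)) := fun A B => eq_neg_one_smul (jE_mul_jE _ _)
  have ij : ∀ A B, (iE (c A) * jE (c B) : Module.End ℂ (FibreAlg V F)) =
      ((1 : ℤˣ) : ℤ) • (jE (c B) * iE (c A)) := fun A B => eq_one_smul (jE_mul_iE _ _).symm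
  have ip : ∀ A, (iE (c A) * parE : Module.End ℂ (FibreAlg V F)) =
      ((-1 : ℤˣ) : ℤ) • (parE * iE (c A)) := fun A => eq_neg_one_smul (iE_mul_parE _)
  have pj : ∀ A, (parE * jE (c A) : Module.End ℂ (FibreAlg V F)) =
      ((-1 : ℤˣ) : ℤ) • (jE (c A) * parE) := fun A => eq_neg_one_smul (parE_mul_jE _)
  refine bidiff_assoc _ (P := 1) _ (Q := parE) ?_ ?_ (fun _ => jE_leibniz _)
    (fun _ => iE_leibniz _) ?_ ?_ ?_ ?_ ?_ ?_ ?_ ?_ K L x y z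
  · exact fun _ a b => by rw [Module.End.one_apply, iS_leibniz]
  · exact fun _ a b => by rw [Module.End.one_apply, iS_leibniz, add_comm]
  · exact commute_sum_sum fun i j k l => triple_commute (ss _ _) (r1 _) (l1 _) (by decide)
  · exact commute_sum_sum fun i j k l => triple_commute (r1 _) (ss _ _) (l1 _) (by decide)
  · exact commute_sum_sum fun i j k l => triple_commute (r1 _) (l1 _) (ss _ _) (by decide)
  · exact commute_sum_sum fun i j k l => triple_commute (jj _ _) (ip _) (l1 _) (by decide)
  · exact commute_sum_sum fun i j k l => triple_commute (r1 _) (ij _ _) (l1 _) (by decide)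
  · exact commute_sum_sum fun i j k l => triple_commute (r1 _) (pj _) (ii _ _) (by decide)
  · exact (commute_sum_sum fun i j k l => triple_commute (sj _ _) (sp _) (l1 _)
      (by decide)).add_right
        (commute_sum_sum fun i j k l => triple_commute (r1 _) (sj _ _) (l1 _) (by decide))
  · exact (commute_sum_sum fun i j k l => triple_commute (l1 _) (si _ _) (r1 _)
      (by decide)).add_right
        (commute_sum_sum fun i j k l => triple_commute (l1 _) (sp _) (si _ _) (by decide))

/-- `contraction` as a bilinear map. -/
def contractionHom (k l : ℕ) : FibreAlg V F →ₗ[ℂ] FibreAlg V F →ₗ[ℂ] FibreAlg V F :=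
  TensorProduct.curry (LinearMap.mul' ℂ (FibreAlg V F) ∘ₗ
    ((fibreR Ω b ^ k * fibreS q c ^ l : Module.End ℂ (FibreAlg V F ⊗[ℂ] FibreAlg V F))))

theorem contractionHom_apply (k l : ℕ) (a a' : FibreAlg V F) :
    contractionHom Ω q b c k l a a' = contraction Ω q b c k l a a' := by
  rw [contraction_eq_bidiff]
  rfl

/-- If the operators on the two factors commute with the insertions in `ΛF*` up to the same sign,
the signs of the two legs of `S` cancel, and an intertwining relation for the undeformed product
passes to all contractions. -/
theorem contraction_intertwine {f g f' g' Y : Module.End ℂ (FibreAlg V F)}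
    (hY : ∀ a a', Y (f' a * g' a') = f a * g a') (r s : ℤˣ)
    (h1 : ∀ X, Commute (iS X) f) (h2 : ∀ X, Commute (iS X) g)
    (h3 : ∀ e, jE e * f = (r : ℤ) • (f * jE e)) (h4 : ∀ e, iE e * g = (r : ℤ) • (g * iE e))
    (h1' : ∀ X, Commute (iS X) f') (h2' : ∀ X, Commute (iS X) g')
    (h3' : ∀ e, jE e * f' = (s : ℤ) • (f' * jE e)) (h4' : ∀ e, iE e * g' = (s : ℤ) • (g' * iE e))
    (k l : ℕ) (a a' : FibreAlg V F) :
    Y (contraction Ω q b c k l (f' a) (g' a')) = contraction Ω q b c k l (f a) (g a') := by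
  simp only [contraction_eq_bidiff, bidiff]
  rw [← TensorProduct.map_tmul f', ← TensorProduct.map_tmul f]
  refine bidiff_intertwine (R := fibreR Ω b) (S := fibreS q c) ?_ ?_ ?_ ?_ ?_ k l _
  · intro a a'
    rw [TensorProduct.map_tmul, TensorProduct.map_tmul, LinearMap.mul'_apply,
      LinearMap.mul'_apply, hY]
  · exact pairing_commute_map_of_commute _ (fun i => h1 _) fun i => h2 _
  · exact pairing_commute_map _ r (fun i => h3 _) fun i => h4 _
  · exact pairing_commute_map_of_commute _ (fun i => h1' _) fun i => h2' _
  · exact pairing_commute_map _ s (fun i => h3' _) fun i => h4' _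

theorem commute_eq_one_smul {T : Type*} [Ring T] {x y : T} (h : Commute x y) :
    x * y = ((1 : ℤˣ) : ℤ) • (y * x) := eq_one_smul h.eq

/-- Operators commuting with all insertions. -/
structure CommutesInsertions (f : Module.End ℂ (FibreAlg V F)) : Prop where
  iS : ∀ X, Commute (iS X) f
  iE : ∀ e, Commute (iE e) f
  jE : ∀ e, Commute (jE e) f

theorem CommutesInsertions.one : CommutesInsertions (1 : Module.End ℂ (FibreAlg V F)) :=
  ⟨fun _ => Commute.one_right _, fun _ => Commute.one_right _, fun _ => Commute.one_right _⟩

theorem CommutesInsertions.onForms (T : Module.End ℝ (ExteriorAlgebra ℝ (Module.Dual ℝ V))) :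
    CommutesInsertions (onForms T : Module.End ℂ (FibreAlg V F)) :=
  ⟨fun _ => onSym_commute_onForms _ _, fun _ => onE_commute_onForms _ _,
    fun _ => (onE_commute_onForms _ _).mul_left (onE_commute_onForms _ _)⟩

theorem contraction_intertwine_of_commute {f g f' g' Y : Module.End ℂ (FibreAlg V F)}
    (hY : ∀ a a', Y (f' a * g' a') = f a * g a')
    (hf : CommutesInsertions f) (hg : CommutesInsertions g) (hf' : CommutesInsertions f')
    (hg' : CommutesInsertions g') (k l : ℕ) (a a' : FibreAlg V F) :
    Y (contraction Ω q b c k l (f' a) (g' a')) = contraction Ω q b c k l (f a) (g a') :=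
  contraction_intertwine Ω q b c hY 1 1 hf.iS hg.iS
    (fun _ => commute_eq_one_smul (hf.jE _)) (fun _ => commute_eq_one_smul (hg.iE _))
    hf'.iS hg'.iS
    (fun _ => commute_eq_one_smul (hf'.jE _)) (fun _ => commute_eq_one_smul (hg'.iE _)) k l a a'

theorem parE_contraction (k l : ℕ) (a a' : FibreAlg V F) :
    parE (contraction Ω q b c k l a a') = contraction Ω q b c k l (parE a) (parE a') :=
  contraction_intertwine Ω q b c (f' := 1) (g' := 1) parE_mul (-1) 1 iS_commute_parE
    iS_commute_parE (fun e => eq_neg_one_smul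
      (LinearMap.ext fun a => by
        have := LinearMap.congr_fun (parE_mul_jE (V := V) e) a
        simp only [LinearMap.neg_apply] at this ⊢
        rw [this, neg_neg]))
    (fun e => eq_neg_one_smul (iE_mul_parE e)) (fun _ => Commute.one_right _)
    (fun _ => Commute.one_right _) (fun _ => commute_eq_one_smul (Commute.one_right _))
    (fun _ => commute_eq_one_smul (Commute.one_right _)) k l a a'

theorem mulA_contraction (ξ : Module.Dual ℝ V) (k l : ℕ) (a a' : FibreAlg V F) :
    mulA ξ (contraction Ω q b c k l a a') = contraction Ω q b c k l (mulA ξ a) a' :=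
  contraction_intertwine_of_commute Ω q b c (f' := 1) (g' := 1) (g := 1) (mulA_mul ξ)
    (.onForms _) .one .one .one k l a a'

/-- Moving a one-form past the first factor costs the parity of its antisymmetric degree. -/
theorem contraction_mulA (ξ : Module.Dual ℝ V) (k l : ℕ) (a a' : FibreAlg V F) :
    contraction Ω q b c k l a (mulA ξ a') = mulA ξ (contraction Ω q b c k l (parA a) a') :=
  (contraction_intertwine_of_commute Ω q b c (Y := mulA ξ) (f := 1) (f' := parA) (g' := 1)
    (fun a a' => (mul_mulA ξ a a').symm) .one (.onForms _) (.onForms _) .one k l a a').symm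

/-- Derivations of the undeformed product which commute with all insertions are derivations of
the contractions. -/
theorem contraction_leibniz {N : Module.End ℂ (FibreAlg V F)} (hN : CommutesInsertions N)
    (h : ∀ a a', N (a * a') = N a * a' + a * N a') (k l : ℕ) (a a' : FibreAlg V F) :
    N (contraction Ω q b c k l a a') =
      contraction Ω q b c k l (N a) a' + contraction Ω q b c k l a (N a') := by
  have h1 : Commute (fibreR Ω b) (TensorProduct.map N 1 + TensorProduct.map 1 N) :=
    (pairing_commute_map_of_commute _ (fun i => hN.iS _) fun i => Commute.one_right _).add_right
      (pairing_commute_map_of_commute _ (fun i => Commute.one_right _) fun i => hN.iS _)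
  have h2 : Commute (fibreS q c) (TensorProduct.map N 1 + TensorProduct.map 1 N) :=
    (pairing_commute_map_of_commute _ (fun i => hN.jE _) fun i => Commute.one_right _).add_right
      (pairing_commute_map_of_commute _ (fun i => Commute.one_right _) fun i => hN.iE _)
  have := bidiff_intertwine (Y := N) (X' := 1) (fun a b => by
    simp only [Module.End.one_apply, LinearMap.add_apply, TensorProduct.map_tmul, map_add,
      LinearMap.mul'_apply, h]) h1 h2 (Commute.one_right _) (Commute.one_right _) k l (a ⊗ₜ a')
  simpa only [contraction_eq_bidiff, bidiff, Module.End.one_apply, LinearMap.add_apply,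
    TensorProduct.map_tmul, map_add] using this

theorem CommutesInsertions.iS_right (X : V) :
    CommutesInsertions (Fedosov.iS X : Module.End ℂ (FibreAlg V F)) :=
  ⟨fun Y => iS_commute_iS Y X, fun _ => (iS_commute_iE _ _).symm, fun _ => (iS_commute_jE _ _).symm⟩

theorem iS_contraction (X : V) (k l : ℕ) (a a' : FibreAlg V F) :
    iS X (contraction Ω q b c k l a a') =
      contraction Ω q b c k l (iS X a) a' + contraction Ω q b c k l a (iS X a') :=
  contraction_leibniz Ω q b c (.iS_right X) (fun a a' => by rw [iS_leibniz, add_comm]) k l a a'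

theorem numA_contraction (k l : ℕ) (a a' : FibreAlg V F) :
    numA (contraction Ω q b c k l a a') =
      contraction Ω q b c k l (numA a) a' + contraction Ω q b c k l a (numA a') :=
  contraction_leibniz Ω q b c (.onForms _) numA_leibniz k l a a'

theorem parA_parA (a : FibreAlg V F) : parA (parA a) = a :=
  LinearMap.congr_fun parA_mul_self a

theorem contraction_sum_right {σ : Type*} (s : Finset σ) (k l : ℕ) (a : FibreAlg V F)
    (f : σ → FibreAlg V F) : contraction Ω q b c k l a (∑ i ∈ s, f i) =
      ∑ i ∈ s, contraction Ω q b c k l a (f i) := by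
  simp only [← contractionHom_apply, map_sum]

theorem contraction_sum_left {σ : Type*} (s : Finset σ) (k l : ℕ) (a : FibreAlg V F)
    (f : σ → FibreAlg V F) : contraction Ω q b c k l (∑ i ∈ s, f i) a =
      ∑ i ∈ s, contraction Ω q b c k l (f i) a := by
  simp only [← contractionHom_apply, map_sum, LinearMap.sum_apply]

/-- `δ` is a sum of operators `dxⁱ ∧ i_s(∂ᵢ)`, in which `i_s` is a derivation of the contractions and
`dxⁱ` has to pass the first factor. -/
theorem fibreDelta_contraction {ι' : Type*} [Fintype ι'] [DecidableEq ι']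
    (b' : Module.Basis ι' ℝ V) (k l : ℕ)
    (a a' : FibreAlg V F) :
    fibreDelta b' (contraction Ω q b c k l a a') =
      contraction Ω q b c k l (fibreDelta b' a) a' +
        contraction Ω q b c k l (parA a) (fibreDelta b' a') := by
  simp only [fibreDelta, LinearMap.sum_apply, Module.End.mul_apply, contraction_sum_left,
    contraction_sum_right, ← Finset.sum_add_distrib, iS_contraction, map_add, mulA_contraction,
    contraction_mulA, parA_parA]

/-- A contraction with `l` factors `S` lowers `deg_E` by `2 l`. -/
theorem numE_contraction (k l : ℕ) (a a' : FibreAlg V F) :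
    numE (contraction Ω q b c k l a a') =
      contraction Ω q b c k l (numE a) a' + contraction Ω q b c k l a (numE a') -
        (2 * l : ℂ) • contraction Ω q b c k l a a' := by
  have h1 : Commute (fibreR Ω b) (TensorProduct.map numE (1 : Module.End ℂ (FibreAlg V F)) +
      TensorProduct.map 1 numE) :=
    (pairing_commute_map_of_commute _ (fun i => onSym_commute_onE _ _)
      fun i => Commute.one_right _).add_right
      (pairing_commute_map_of_commute _ (fun i => Commute.one_right _)
        fun i => onSym_commute_onE _ _)
  have h2 : (TensorProduct.map numE (1 : Module.End ℂ (FibreAlg V F)) +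
      TensorProduct.map 1 numE) * fibreS q c = fibreS q c *
        (TensorProduct.map numE (1 : Module.End ℂ (FibreAlg V F)) +
      TensorProduct.map 1 numE) - (2 : ℂ) • fibreS q c := by
    refine TensorProduct.ext' fun a a' => ?_
    have i1 : ∀ e (a : FibreAlg V F), numE (iE e a) = iE e (numE a) - iE e a := fun e a =>
      LinearMap.congr_fun (numE_mul_iE e) a
    have j1 : ∀ e (a : FibreAlg V F), numE (jE e a) = jE e (numE a) - jE e a := fun e a =>
      LinearMap.congr_fun (numE_mul_jE e) a
    simp only [fibreS_eq_pairing, LinearMap.sub_apply, LinearMap.smul_apply, Module.End.mul_apply,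
      pairing_tmul, LinearMap.add_apply, TensorProduct.map_tmul, map_sum, map_smul, map_add,
      Module.End.one_apply, i1, j1, Finset.smul_sum, ← Finset.sum_add_distrib,
      ← Finset.sum_sub_distrib, TensorProduct.sub_tmul, TensorProduct.tmul_sub]
    refine Finset.sum_congr rfl fun i _ => Finset.sum_congr rfl fun j _ => ?_
    module
  have h3 := bidiff_of_degree h1 h2 k l (a ⊗ₜ a')
  have h4 : numE ∘ₗ LinearMap.mul' ℂ (FibreAlg V F) = LinearMap.mul' ℂ (FibreAlg V F) ∘ₗ
      (TensorProduct.map numE (1 : Module.End ℂ (FibreAlg V F)) + TensorProduct.map 1 numE) :=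
    TensorProduct.ext' fun a a' => by
      simp only [LinearMap.comp_apply, LinearMap.mul'_apply, numE_leibniz, LinearMap.add_apply,
        TensorProduct.map_tmul, map_add, Module.End.one_apply]
  have h5 := LinearMap.congr_fun h4 ((fibreR Ω b ^ k) ((fibreS q c ^ l) (a ⊗ₜ a')))
  rw [LinearMap.comp_apply, LinearMap.comp_apply, h3] at h5
  simpa only [contraction_eq_bidiff, bidiff, Module.End.one_apply, LinearMap.add_apply,
    TensorProduct.map_tmul, map_add, map_sub, map_smul] using h5

end Contraction

/-! ### Graded commutativity and complex conjugation -/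

section GradedFlip

variable {V : Type*} [AddCommGroup V] [Module ℝ V] {F : Type*} [AddCommGroup F] [Module ℝ F]

theorem decomp_smul_E (r : ℝ) (z : ℂ) (f : SymmetricAlgebra ℝ (Module.Dual ℝ V))
    (φ : ExteriorAlgebra ℝ (Module.Dual ℝ F)) (α : ExteriorAlgebra ℝ (Module.Dual ℝ V)) :
    decomp z f (r • φ) α = (r : ℂ) • decomp z f φ α := by
  rw [decomp, ← TensorProduct.smul_tmul', TensorProduct.tmul_smul, TensorProduct.tmul_smul,
    TensorProduct.smul_tmul', Complex.real_smul, decomp, TensorProduct.smul_tmul', smul_eq_mul]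

theorem decomp_smul_forms (r : ℝ) (z : ℂ) (f : SymmetricAlgebra ℝ (Module.Dual ℝ V))
    (φ : ExteriorAlgebra ℝ (Module.Dual ℝ F)) (α : ExteriorAlgebra ℝ (Module.Dual ℝ V)) :
    decomp z f φ (r • α) = (r : ℂ) • decomp z f φ α := by
  rw [decomp, TensorProduct.tmul_smul, TensorProduct.tmul_smul, TensorProduct.tmul_smul,
    TensorProduct.smul_tmul', Complex.real_smul, decomp, TensorProduct.smul_tmul', smul_eq_mul]

theorem parE_decomp {d : ℕ} {φ : ExteriorAlgebra ℝ (Module.Dual ℝ F)}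
    (hφ : φ ∈ ⋀[ℝ]^d (Module.Dual ℝ F)) (z : ℂ) (f : SymmetricAlgebra ℝ (Module.Dual ℝ V))
    (α : ExteriorAlgebra ℝ (Module.Dual ℝ V)) :
    parE (decomp z f φ α) = (-1 : ℂ) ^ d • decomp z f φ α := by
  rw [parE, onE_decomp, extWeight_of_mem _ hφ, decomp_smul_E, Complex.ofReal_pow,
    Complex.ofReal_neg, Complex.ofReal_one]

theorem parA_decomp {d : ℕ} {α : ExteriorAlgebra ℝ (Module.Dual ℝ V)}
    (hα : α ∈ ⋀[ℝ]^d (Module.Dual ℝ V)) (z : ℂ) (f : SymmetricAlgebra ℝ (Module.Dual ℝ V))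
    (φ : ExteriorAlgebra ℝ (Module.Dual ℝ F)) :
    parA (decomp z f φ α) = (-1 : ℂ) ^ d • decomp z f φ α := by
  rw [parA, onForms_decomp, extWeight_of_mem _ hα, decomp_smul_forms, Complex.ofReal_pow,
    Complex.ofReal_neg, Complex.ofReal_one]

/-- The graded flip `a ⊗ b ↦ (-1)^{d₁ d₂ + a₁ a₂} b ⊗ a` on the tensor square of the fibre. -/
def gradedFlip : Module.End ℂ (FibreAlg V F ⊗[ℂ] FibreAlg V F) :=
  (TensorProduct.comm ℂ (FibreAlg V F) (FibreAlg V F)).toLinearMap ∘ₗ (koszul parE * koszul parA)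

theorem gradedFlip_tmul {a b : FibreAlg V F} {d₁ d₂ a₁ a₂ : ℕ}
    (h1 : parE a = (-1 : ℂ) ^ d₁ • a) (h2 : parE b = (-1 : ℂ) ^ d₂ • b)
    (h3 : parA a = (-1 : ℂ) ^ a₁ • a) (h4 : parA b = (-1 : ℂ) ^ a₂ • b) :
    gradedFlip (a ⊗ₜ b) = (-1 : ℂ) ^ (d₁ * d₂ + a₁ * a₂) • (b ⊗ₜ[ℂ] a) := by
  rw [gradedFlip, LinearMap.comp_apply, Module.End.mul_apply, koszul_tmul _ h3 h4, map_smul,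
    koszul_tmul _ h1 h2, map_smul, map_smul, LinearEquiv.coe_coe, TensorProduct.comm_tmul,
    smul_smul, pow_add, mul_comm]

/-- The undeformed product is graded commutative. -/
theorem mul'_gradedFlip (a b : FibreAlg V F) :
    LinearMap.mul' ℂ (FibreAlg V F) (gradedFlip (a ⊗ₜ b)) = a * b := by
  induction a using fibre_induction_homogeneous with
  | hadd a a' ha ha' => rw [TensorProduct.add_tmul, map_add, map_add, ha, ha', add_mul]
  | h z f d e φ hφ α hα =>
    induction b using fibre_induction_homogeneous with
    | hadd b b' hb hb' => rw [TensorProduct.tmul_add, map_add, map_add, hb, hb', mul_add]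
    | h z' f' d' e' φ' hφ' α' hα' =>
      rw [gradedFlip_tmul (parE_decomp hφ _ _ _) (parE_decomp hφ' _ _ _) (parA_decomp hα _ _ _)
        (parA_decomp hα' _ _ _), map_smul, LinearMap.mul'_apply, decomp_mul, decomp_mul,
        exterior_mul_comm hφ hφ', exterior_mul_comm hα hα', mul_comm z', mul_comm f']
      rw [decomp_smul_E, decomp_smul_forms, smul_smul, pow_add, Complex.ofReal_pow,
        Complex.ofReal_pow, Complex.ofReal_neg, Complex.ofReal_one]

variable {ι κ : Type*} [Fintype ι] [Fintype κ] [DecidableEq ι] [DecidableEq κ]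
  {Ω : V → V → ℝ} {q : F → F → ℝ} (b : Module.Basis ι ℝ V) (c : Module.Basis κ ℝ F)

theorem poissonMatrix_transpose (hΩ : ∀ X Y, Ω X Y = -Ω Y X) (i j : ι) :
    poissonMatrix Ω b j i = -poissonMatrix Ω b i j := by
  have h : (Matrix.of fun k j => Ω (b j) (b k)).transpose =
      -(Matrix.of fun k j => Ω (b j) (b k)) := by
    ext i j
    simp only [Matrix.transpose_apply, Matrix.of_apply, Matrix.neg_apply]
    exact hΩ _ _
  have h2 : (poissonMatrix Ω b).transpose = -poissonMatrix Ω b := by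
    rw [poissonMatrix, Matrix.transpose_nonsing_inv, h]
    by_cases hd : IsUnit (Matrix.of fun k j => Ω (b j) (b k)).det
    · exact Matrix.inv_eq_right_inv (by rw [neg_mul_neg, Matrix.mul_nonsing_inv _ hd])
    · rw [Matrix.nonsing_inv_apply_not_isUnit _ hd, Matrix.nonsing_inv_apply_not_isUnit, neg_zero]
      rw [Matrix.det_neg]
      intro h
      exact hd (isUnit_of_mul_isUnit_right h)
  exact congrFun (congrFun h2 i) j

theorem inverseMetric_transpose (hq : ∀ X Y, q X Y = q Y X) (A B : κ) :
    inverseMetric q c B A = inverseMetric q c A B := by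
  have h : (Matrix.of fun A B => q (c A) (c B)).transpose = Matrix.of fun A B => q (c A) (c B) := by
    ext i j
    simp only [Matrix.transpose_apply, Matrix.of_apply]
    exact hq _ _
  have h2 : (inverseMetric q c).transpose = inverseMetric q c := by
    rw [inverseMetric, Matrix.transpose_nonsing_inv, h]
  exact congrFun (congrFun h2 A) B

/-- The sign comes from the antisymmetry of the Poisson tensor. -/
theorem gradedFlip_mul_fibreR (hΩ : ∀ X Y, Ω X Y = -Ω Y X) :
    (gradedFlip * fibreR Ω b : Module.End ℂ (FibreAlg V F ⊗[ℂ] FibreAlg V F)) =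
      -(fibreR Ω b * gradedFlip) := by
  have h1 : Commute (fibreR Ω b) (koszul parE * koszul parA :
      Module.End ℂ (FibreAlg V F ⊗[ℂ] FibreAlg V F)) :=
    (pairing_commute_koszul _ (fun i => iS_commute_parE _) fun i => iS_commute_parE _).mul_right
      (pairing_commute_koszul _ (fun i => onSym_commute_onForms _ _)
        fun i => onSym_commute_onForms _ _)
  have h2 : (TensorProduct.comm ℂ (FibreAlg V F) (FibreAlg V F)).toLinearMap ∘ₗ fibreR Ω b =
      (-fibreR Ω b) ∘ₗ (TensorProduct.comm ℂ (FibreAlg V F) (FibreAlg V F)).toLinearMap := by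
    refine (comm_comp_pairing _ _ _).trans ?_
    rw [fibreR_eq_pairing, ← pairing_neg]
    congr 2
    funext i j
    rw [poissonMatrix_transpose b hΩ, Complex.ofReal_neg]
  refine LinearMap.ext fun t => ?_
  have e1 := LinearMap.congr_fun h1.eq t
  have e2 := fun t => LinearMap.congr_fun h2 t
  simp only [LinearMap.neg_apply, Module.End.mul_apply, gradedFlip, LinearMap.comp_apply] at e1 e2 ⊢
  rw [← e1, e2]

/-- The inverse metric is symmetric; the sign comes from the oddness of the two insertions. -/
theorem gradedFlip_mul_fibreS (hq : ∀ X Y, q X Y = q Y X) :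
    (gradedFlip * fibreS q c : Module.End ℂ (FibreAlg V F ⊗[ℂ] FibreAlg V F)) =
      -(fibreS q c * gradedFlip) := by
  have h1 : Commute (fibreS q c) (koszul parA :
      Module.End ℂ (FibreAlg V F ⊗[ℂ] FibreAlg V F)) :=
    pairing_commute_koszul _ (fun i => (CommutesInsertions.onForms _).jE _)
      fun i => (CommutesInsertions.onForms _).iE _
  have h2 : (TensorProduct.comm ℂ (FibreAlg V F) (FibreAlg V F)).toLinearMap ∘ₗ
      pairing (fun i j => ((inverseMetric q c i j : ℝ) : ℂ))
        (fun i => (iE (c i) : Module.End ℂ (FibreAlg V F))) (fun i => jE (c i)) =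
      fibreS q c ∘ₗ (TensorProduct.comm ℂ (FibreAlg V F) (FibreAlg V F)).toLinearMap := by
    refine (comm_comp_pairing _ _ _).trans ?_
    rw [fibreS_eq_pairing]
    congr 2
    funext i j
    rw [inverseMetric_transpose c hq]
  have h3 := koszul_mul_pairing_odd (fun i j => ((inverseMetric q c i j : ℝ) : ℂ))
    (u := fun i => (iE (c i) : Module.End ℂ (FibreAlg V F))) parE_mul_self
    fun i => iE_mul_parE (c i)
  refine LinearMap.ext fun t => ?_
  have e1 := LinearMap.congr_fun h1.eq t
  have e2 := fun t => LinearMap.congr_fun h2 t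
  have e3 := fun t => LinearMap.congr_fun h3 t
  have e4 : ∀ t, (koszul parE) (fibreS q c t) = -(pairing
    (fun i j => ((inverseMetric q c i j : ℝ) : ℂ)) (fun i => iE (c i)) (fun i => jE (c i)))
      (koszul parE t) := e3
  simp only [LinearMap.neg_apply, Module.End.mul_apply, gradedFlip, LinearMap.comp_apply]
    at e1 e2 ⊢
  rw [← e1, e4, map_neg, e2]

/-- The contractions of order `k` and `l` are graded commutative up to the sign `(-1)^{k+l}`. -/
theorem contraction_flip (hΩ : ∀ X Y, Ω X Y = -Ω Y X) (hq : ∀ X Y, q X Y = q Y X) (k l : ℕ)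
    {a a' : FibreAlg V F} {d₁ d₂ a₁ a₂ : ℕ}
    (h1 : parE a = (-1 : ℂ) ^ d₁ • a) (h2 : parE a' = (-1 : ℂ) ^ d₂ • a')
    (h3 : parA a = (-1 : ℂ) ^ a₁ • a) (h4 : parA a' = (-1 : ℂ) ^ a₂ • a') :
    contraction Ω q b c k l a a' =
      ((-1 : ℂ) ^ (k + l) * (-1 : ℂ) ^ (d₁ * d₂ + a₁ * a₂)) • contraction Ω q b c k l a' a := by
  rw [contraction_eq_bidiff, contraction_eq_bidiff, bidiff, bidiff,
    bidiff_of_anticommute mul'_gradedFlip (gradedFlip_mul_fibreR b hΩ)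
      (gradedFlip_mul_fibreS c hq), gradedFlip_tmul h1 h2 h3 h4, map_smul, map_smul, map_smul,
    smul_smul]

end GradedFlip

section Conjugation

variable {V : Type*} [AddCommGroup V] [Module ℝ V] {F : Type*} [AddCommGroup F] [Module ℝ F]

theorem conjFibre_decomp (z : ℂ) (f : SymmetricAlgebra ℝ (Module.Dual ℝ V))
    (φ : ExteriorAlgebra ℝ (Module.Dual ℝ F)) (α : ExteriorAlgebra ℝ (Module.Dual ℝ V)) :
    conjFibre (decomp z f φ α) = decomp (starRingEnd ℂ z) f φ α := rfl

theorem conjFibre_mul (a b : FibreAlg V F) : conjFibre (a * b) = conjFibre a * conjFibre b := by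
  induction a using fibre_induction with
  | hadd a a' ha ha' => rw [add_mul, map_add, map_add, add_mul, ha, ha']
  | h z f φ α =>
    induction b using fibre_induction with
    | hadd b b' hb hb' => rw [mul_add, map_add, map_add, mul_add, hb, hb']
    | h z' f' φ' α' => simp only [decomp_mul, conjFibre_decomp, map_mul]

theorem conjFibre_smul (z : ℂ) (a : FibreAlg V F) :
    conjFibre (z • a) = starRingEnd ℂ z • conjFibre a := by
  induction a using fibre_induction with
  | hadd a a' ha ha' => rw [smul_add, map_add, map_add, smul_add, ha, ha']
  | h w f φ α =>
    rw [decomp, TensorProduct.smul_tmul', smul_eq_mul, conjFibre_decomp, conjFibre_decomp, decomp,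
      decomp, TensorProduct.smul_tmul', smul_eq_mul, map_mul]

theorem conjFibre_conjFibre (a : FibreAlg V F) : conjFibre (conjFibre a) = a := by
  induction a using fibre_induction with
  | hadd a a' ha ha' => rw [map_add, map_add, ha, ha']
  | h w f φ α => rw [conjFibre_decomp, conjFibre_decomp, Complex.conj_conj]

theorem conjFibre_onSym (T : Module.End ℝ (SymmetricAlgebra ℝ (Module.Dual ℝ V)))
    (a : FibreAlg V F) : conjFibre (onSym T a) = onSym T (conjFibre a) := by
  induction a using fibre_induction with
  | hadd a a' ha ha' => rw [map_add, map_add, map_add, map_add, ha, ha']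
  | h w f φ α => rw [onSym_decomp, conjFibre_decomp, conjFibre_decomp, onSym_decomp]

theorem conjFibre_onE (T : Module.End ℝ (ExteriorAlgebra ℝ (Module.Dual ℝ F)))
    (a : FibreAlg V F) : conjFibre (onE T a) = onE T (conjFibre a) := by
  induction a using fibre_induction with
  | hadd a a' ha ha' => rw [map_add, map_add, map_add, map_add, ha, ha']
  | h w f φ α => rw [onE_decomp, conjFibre_decomp, conjFibre_decomp, onE_decomp]

theorem conjFibre_onForms (T : Module.End ℝ (ExteriorAlgebra ℝ (Module.Dual ℝ V)))
    (a : FibreAlg V F) : conjFibre (onForms T a) = onForms T (conjFibre a) := by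
  induction a using fibre_induction with
  | hadd a a' ha ha' => rw [map_add, map_add, map_add, map_add, ha, ha']
  | h w f φ α => rw [onForms_decomp, conjFibre_decomp, conjFibre_decomp, onForms_decomp]

theorem conjFibre_iS (X : V) (a : FibreAlg V F) : conjFibre (iS X a) = iS X (conjFibre a) :=
  conjFibre_onSym _ _

theorem conjFibre_iE (e : F) (a : FibreAlg V F) : conjFibre (iE e a) = iE e (conjFibre a) :=
  conjFibre_onE _ _

theorem conjFibre_jE (e : F) (a : FibreAlg V F) : conjFibre (jE e a) = jE e (conjFibre a) := by
  rw [jE_eq, conjFibre_onE]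

theorem conjFibre_contraction {ι κ : Type*} [Fintype ι] [Fintype κ] [DecidableEq ι]
    [DecidableEq κ] (Ω : V → V → ℝ) (q : F → F → ℝ) (b : Module.Basis ι ℝ V)
    (c : Module.Basis κ ℝ F) (k l : ℕ) (a a' : FibreAlg V F) :
    conjFibre (contraction Ω q b c k l a a') =
      contraction Ω q b c k l (conjFibre a) (conjFibre a') := by
  simp only [contraction, map_sum, conjFibre_smul, conjFibre_mul, Complex.conj_ofReal,
    Module.End.mul_apply]
  refine Finset.sum_congr rfl fun i _ => Finset.sum_congr rfl fun j _ =>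
    Finset.sum_congr rfl fun A _ => Finset.sum_congr rfl fun B _ => ?_
  rw [list_prod_intertwine conjFibre (fun r => conjFibre_iS (b (i r))),
    list_prod_intertwine conjFibre (fun r => conjFibre_jE (c (A r))),
    list_prod_intertwine conjFibre (fun r => conjFibre_iS (b (j r))),
    list_prod_intertwine conjFibre (fun r => conjFibre_iE (c (B r)))]

end Conjugation

/-! ### The symmetric degree, `δ` and `δ*` in one fibre -/

section SymmetricDegree

variable {V : Type*} [AddCommGroup V] [Module ℝ V] {F : Type*} [AddCommGroup F] [Module ℝ F]

theorem decomp_mem_symDegree {s : ℕ} {f : SymmetricAlgebra ℝ (Module.Dual ℝ V)}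
    (hf : f ∈ symPower V s) (z : ℂ) (φ : ExteriorAlgebra ℝ (Module.Dual ℝ F))
    (α : ExteriorAlgebra ℝ (Module.Dual ℝ V)) : decomp z f φ α ∈ symDegree V F s :=
  ⟨z ⊗ₜ ((⟨f, hf⟩ : symPower V s) ⊗ₜ (φ ⊗ₜ α)), rfl⟩

@[elab_as_elim]
theorem symDegree_induction {s : ℕ} {p : FibreAlg V F → Prop} (a : FibreAlg V F)
    (ha : a ∈ symDegree V F s) (h : ∀ z, ∀ f ∈ symPower V s, ∀ φ α, p (decomp z f φ α))
    (hadd : ∀ a b, p a → p b → p (a + b)) : p a := by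
  obtain ⟨y, rfl⟩ := ha
  have h0 : p 0 := by
    have := h 0 0 (Submodule.zero_mem _) 0 0
    rwa [decomp, TensorProduct.zero_tmul] at this
  refine TensorProduct.induction_on y (by rwa [map_zero]) (fun z x => ?_) fun x y hx hy => by
    rw [map_add]; exact hadd _ _ hx hy
  rw [LinearMap.baseChange_tmul]
  refine TensorProduct.induction_on x (by rwa [map_zero, TensorProduct.tmul_zero])
    (fun f y => ?_) fun x y hx hy => by
      rw [map_add, TensorProduct.tmul_add]; exact hadd _ _ hx hy
  rw [LinearMap.rTensor_tmul]
  refine TensorProduct.induction_on y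
    (by rwa [TensorProduct.tmul_zero, TensorProduct.tmul_zero])
    (fun φ α => h z f f.2 φ α) fun x y hx hy => by
      rw [TensorProduct.tmul_add, TensorProduct.tmul_add]; exact hadd _ _ hx hy

theorem onE_mem_symDegree (T : Module.End ℝ (ExteriorAlgebra ℝ (Module.Dual ℝ F))) {s : ℕ}
    {a : FibreAlg V F} (ha : a ∈ symDegree V F s) : onE T a ∈ symDegree V F s := by
  refine symDegree_induction a ha (fun z f hf φ α => ?_) (fun a b ha hb => ?_)
  · rw [onE_decomp]; exact decomp_mem_symDegree hf _ _ _
  · rw [map_add]; exact Submodule.add_mem _ ha hb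

theorem onForms_mem_symDegree (T : Module.End ℝ (ExteriorAlgebra ℝ (Module.Dual ℝ V))) {s : ℕ}
    {a : FibreAlg V F} (ha : a ∈ symDegree V F s) : onForms T a ∈ symDegree V F s := by
  refine symDegree_induction a ha (fun z f hf φ α => ?_) (fun a b ha hb => ?_)
  · rw [onForms_decomp]; exact decomp_mem_symDegree hf _ _ _
  · rw [map_add]; exact Submodule.add_mem _ ha hb

theorem iS_mem_symDegree (X : V) {s : ℕ} {a : FibreAlg V F} (ha : a ∈ symDegree V F (s + 1)) :
    iS X a ∈ symDegree V F s := by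
  refine symDegree_induction a ha (fun z f hf φ α => ?_) (fun a b ha hb => ?_)
  · rw [iS, onSym_decomp]; exact decomp_mem_symDegree (symContract_mem_symPower X hf) _ _ _
  · rw [map_add]; exact Submodule.add_mem _ ha hb

theorem iS_of_mem_zero (X : V) {a : FibreAlg V F} (ha : a ∈ symDegree V F 0) : iS X a = 0 := by
  refine symDegree_induction a ha (fun z f hf φ α => ?_) (fun a b ha hb => ?_)
  · rw [iS, onSym_decomp, symContract_of_mem_zero X hf, decomp, TensorProduct.zero_tmul,
      TensorProduct.tmul_zero]
  · rw [map_add, ha, hb, add_zero]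

theorem mulS_mem_symDegree (ξ : Module.Dual ℝ V) {s : ℕ} {a : FibreAlg V F}
    (ha : a ∈ symDegree V F s) : mulS ξ a ∈ symDegree V F (s + 1) := by
  refine symDegree_induction a ha (fun z f hf φ α => ?_) (fun a b ha hb => ?_)
  · rw [mulS, onSym_decomp]; exact decomp_mem_symDegree (ι_mul_mem_symPower ξ hf) _ _ _
  · rw [map_add]; exact Submodule.add_mem _ ha hb

theorem mul_mem_symDegree {r s : ℕ} {a b : FibreAlg V F} (ha : a ∈ symDegree V F r)
    (hb : b ∈ symDegree V F s) : a * b ∈ symDegree V F (r + s) := by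
  refine symDegree_induction a ha (fun z f hf φ α => ?_) (fun a a' ha ha' => ?_)
  · refine symDegree_induction b hb (fun z' f' hf' φ' α' => ?_) (fun b b' hb hb' => ?_)
    · rw [decomp_mul]; exact decomp_mem_symDegree (mul_mem_symPower hf hf') _ _ _
    · rw [mul_add]; exact Submodule.add_mem _ hb hb'
  · rw [add_mul]; exact Submodule.add_mem _ ha ha'

theorem conjFibre_mem_symDegree {s : ℕ} {a : FibreAlg V F} (ha : a ∈ symDegree V F s) :
    conjFibre a ∈ symDegree V F s := by
  refine symDegree_induction a ha (fun z f hf φ α => ?_) (fun a b ha hb => ?_)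
  · rw [conjFibre_decomp]; exact decomp_mem_symDegree hf _ _ _
  · rw [map_add]; exact Submodule.add_mem _ ha hb

theorem iS_list_mem (X : ℕ → V) (k : ℕ) : ∀ {s : ℕ} {a : FibreAlg V F}, a ∈ symDegree V F (s + k) →
    (List.ofFn fun r : Fin k => iS (X r)).prod a ∈ symDegree V F s := by
  induction k generalizing X with
  | zero => intro s a ha; simpa using ha
  | succ k ih =>
    intro s a ha
    rw [List.ofFn_succ, List.prod_cons, Module.End.mul_apply]
    refine iS_mem_symDegree _ ?_
    have := ih (fun r => X (r + 1)) (s := s + 1) (a := a) (by rwa [add_assoc, add_comm 1])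
    simpa using this

theorem iS_list_mem_symDegree {k : ℕ} (X : Fin k → V) {s : ℕ} {a : FibreAlg V F}
    (ha : a ∈ symDegree V F (s + k)) :
    (List.ofFn fun r => iS (X r)).prod a ∈ symDegree V F s := by
  have := iS_list_mem (fun r => if h : r < k then X ⟨r, h⟩ else 0) k ha
  simpa using this

theorem iS_list_of_lt {k : ℕ} (X : Fin k → V) {s : ℕ} (hs : s < k) {a : FibreAlg V F}
    (ha : a ∈ symDegree V F s) : (List.ofFn fun r => iS (X r)).prod a = 0 := by
  induction k generalizing s a with
  | zero => omega
  | succ k ih =>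
    rw [List.ofFn_succ', List.concat_eq_append, List.prod_append, List.prod_singleton,
      Module.End.mul_apply]
    cases s with
    | zero => rw [iS_of_mem_zero _ ha, map_zero]
    | succ s => exact ih _ (by omega) (iS_mem_symDegree _ ha)

theorem onE_list_mem {k : ℕ} (T : Fin k → Module.End ℝ (ExteriorAlgebra ℝ (Module.Dual ℝ F)))
    {s : ℕ} {a : FibreAlg V F} (ha : a ∈ symDegree V F s) :
    (List.ofFn fun r => onE (T r)).prod a ∈ symDegree V F s := by
  induction k with
  | zero => simpa using ha
  | succ k ih =>
    rw [List.ofFn_succ, List.prod_cons, Module.End.mul_apply]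
    exact onE_mem_symDegree _ (ih _)

section Bases

variable {ι κ : Type*} [Fintype ι] [Fintype κ] [DecidableEq ι] [DecidableEq κ]
  {Ω : V → V → ℝ} {q : F → F → ℝ} {b : Module.Basis ι ℝ V} {c : Module.Basis κ ℝ F}

theorem contraction_mem_symDegree {k l r s : ℕ} {a a' : FibreAlg V F}
    (ha : a ∈ symDegree V F (r + k)) (ha' : a' ∈ symDegree V F (s + k)) :
    contraction Ω q b c k l a a' ∈ symDegree V F (r + s) := by
  refine Submodule.sum_mem _ fun i _ => Submodule.sum_mem _ fun j _ => Submodule.sum_mem _ fun A _ =>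
    Submodule.sum_mem _ fun B _ => Submodule.smul_mem _ _ (mul_mem_symDegree ?_ ?_)
  · simp only [jE_eq, Module.End.mul_apply]
    exact iS_list_mem_symDegree _ (onE_list_mem _ ha)
  · exact iS_list_mem_symDegree _ (onE_list_mem _ ha')

theorem contraction_eq_zero_of_lt {k l r s : ℕ} {a a' : FibreAlg V F}
    (ha : a ∈ symDegree V F r) (ha' : a' ∈ symDegree V F s) (h : r < k ∨ s < k) :
    contraction Ω q b c k l a a' = 0 := by
  refine Finset.sum_eq_zero fun i _ => Finset.sum_eq_zero fun j _ => Finset.sum_eq_zero fun A _ =>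
    Finset.sum_eq_zero fun B _ => ?_
  rcases h with h | h
  · simp only [jE_eq, Module.End.mul_apply]
    rw [iS_list_of_lt _ h (onE_list_mem _ ha), zero_mul, smul_zero]
  · simp only [iE, Module.End.mul_apply]
    rw [iS_list_of_lt _ h (onE_list_mem _ ha'), mul_zero, smul_zero]

/-- The degree of a `k`-fold contraction. Contractions that would lower the degree of a factor below
zero vanish. -/
theorem contraction_mem_of_add_eq {k l r s n : ℕ} {a a' : FibreAlg V F}
    (ha : a ∈ symDegree V F r) (ha' : a' ∈ symDegree V F s) (h : r + s = n + 2 * k) :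
    contraction Ω q b c k l a a' ∈ symDegree V F n := by
  by_cases hr : r < k
  · rw [contraction_eq_zero_of_lt ha ha' (.inl hr)]; exact Submodule.zero_mem _
  by_cases hs : s < k
  · rw [contraction_eq_zero_of_lt ha ha' (.inr hs)]; exact Submodule.zero_mem _
  obtain ⟨r, rfl⟩ := Nat.exists_eq_add_of_le' (not_lt.1 hr)
  obtain ⟨s, rfl⟩ := Nat.exists_eq_add_of_le' (not_lt.1 hs)
  obtain rfl : n = r + s := by omega
  exact contraction_mem_symDegree ha ha'

end Bases

section Differentials

variable {ι : Type*} [Fintype ι] {b : Module.Basis ι ℝ V}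

theorem fibreDelta_mem {s : ℕ} {a : FibreAlg V F} (ha : a ∈ symDegree V F (s + 1)) :
    fibreDelta b a ∈ symDegree V F s := by
  rw [fibreDelta, LinearMap.sum_apply]
  exact Submodule.sum_mem _ fun i _ => onForms_mem_symDegree _ (iS_mem_symDegree _ ha)

theorem fibreDelta_of_mem_zero {a : FibreAlg V F} (ha : a ∈ symDegree V F 0) :
    fibreDelta b a = 0 := by
  rw [fibreDelta, LinearMap.sum_apply]
  exact Finset.sum_eq_zero fun i _ => by rw [Module.End.mul_apply, iS_of_mem_zero _ ha, map_zero]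

theorem fibreDeltaStar_mem {s : ℕ} {a : FibreAlg V F} (ha : a ∈ symDegree V F s) :
    fibreDeltaStar b a ∈ symDegree V F (s + 1) := by
  rw [fibreDeltaStar, LinearMap.sum_apply]
  exact Submodule.sum_mem _ fun i _ => mulS_mem_symDegree _ (onForms_mem_symDegree _ ha)

theorem sum_sum_antisymm {W : Type*} [AddCommGroup W] [Module ℂ W] {f : ι → ι → W}
    (h : ∀ i j, f i j = -f j i) : ∑ i, ∑ j, f i j = 0 := by
  have h1 : ∑ i, ∑ j, f i j = -∑ i, ∑ j, f i j := by
    conv_lhs => rw [Finset.sum_comm]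
    simp only [← Finset.sum_neg_distrib]
    exact Finset.sum_congr rfl fun i _ => Finset.sum_congr rfl fun j _ => h _ _
  have h2 : (2 : ℂ) • ∑ i, ∑ j, f i j = 0 := by
    rw [two_smul]
    nth_rewrite 1 [h1]
    exact neg_add_cancel _
  exact (smul_eq_zero.1 h2).resolve_left two_ne_zero

theorem iS_iS (X Y : V) (a : FibreAlg V F) : iS X (iS Y a) = iS Y (iS X a) :=
  LinearMap.congr_fun (iS_commute_iS X Y).eq a

theorem iS_mulA (X : V) (ξ : Module.Dual ℝ V) (a : FibreAlg V F) :
    iS X (mulA ξ a) = mulA ξ (iS X a) :=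
  LinearMap.congr_fun (onSym_commute_onForms _ _).eq a

theorem mulS_mulA (η ξ : Module.Dual ℝ V) (a : FibreAlg V F) :
    mulS η (mulA ξ a) = mulA ξ (mulS η a) :=
  LinearMap.congr_fun (onSym_commute_onForms _ _).eq a

theorem iS_iA (X Y : V) (a : FibreAlg V F) : iS X (iA Y a) = iA Y (iS X a) :=
  LinearMap.congr_fun (onSym_commute_onForms _ _).eq a

theorem mulS_iA (η : Module.Dual ℝ V) (X : V) (a : FibreAlg V F) :
    mulS η (iA X a) = iA X (mulS η a) :=
  LinearMap.congr_fun (onSym_commute_onForms _ _).eq a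

theorem mulA_mulA (ξ η : Module.Dual ℝ V) (a : FibreAlg V F) :
    mulA ξ (mulA η a) = -mulA η (mulA ξ a) := by
  have : (mulA ξ * mulA η : Module.End ℂ (FibreAlg V F)) = -(mulA η * mulA ξ) := by
    rw [mulA, mulA, ← onForms_mul, ← onForms_mul, ← onForms_neg]
    congr 1
    refine LinearMap.ext fun α => ?_
    rw [Module.End.mul_apply, LinearMap.neg_apply, Module.End.mul_apply, LinearMap.mulLeft_apply,
      LinearMap.mulLeft_apply, LinearMap.mulLeft_apply, LinearMap.mulLeft_apply, ← mul_assoc,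
      ← mul_assoc, eq_neg_of_add_eq_zero_left (ExteriorAlgebra.ι_add_mul_swap ξ η), neg_mul]
  exact LinearMap.congr_fun this a

theorem iA_iA (X Y : V) (a : FibreAlg V F) : iA X (iA Y a) = -iA Y (iA X a) := by
  have : (iA X * iA Y : Module.End ℂ (FibreAlg V F)) = -(iA Y * iA X) := by
    rw [iA, iA, ← onForms_mul, ← onForms_mul, ← onForms_neg, ← extContract_anticomm]
  exact LinearMap.congr_fun this a

theorem mulS_comm (ξ η : Module.Dual ℝ V) (a : FibreAlg V F) :
    mulS ξ (mulS η a) = mulS η (mulS ξ a) := by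
  have : (mulS ξ * mulS η : Module.End ℂ (FibreAlg V F)) = mulS η * mulS ξ := by
    rw [mulS, mulS, ← onSym_mul, ← onSym_mul]
    congr 1
    refine LinearMap.ext fun α => ?_
    simp only [Module.End.mul_apply, LinearMap.mulLeft_apply]
    ring
  exact LinearMap.congr_fun this a

theorem iS_mulS (X : V) (ξ : Module.Dual ℝ V) (a : FibreAlg V F) :
    iS X (mulS ξ a) = mulS ξ (iS X a) + (ξ X : ℂ) • a := by
  induction a using fibre_induction with
  | hadd a a' ha ha' =>
    rw [map_add, map_add, map_add, map_add, ha, ha', smul_add, add_add_add_comm]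
  | h z f φ α =>
    simp only [iS, mulS, onSym_decomp, LinearMap.mulLeft_apply, symContract_ι_mul]
    rw [decomp, TensorProduct.add_tmul, TensorProduct.tmul_add, decomp, decomp,
      ← TensorProduct.smul_tmul', TensorProduct.tmul_smul, TensorProduct.smul_tmul',
      TensorProduct.smul_tmul', Complex.real_smul, smul_eq_mul]

theorem iA_mulA (X : V) (ξ : Module.Dual ℝ V) (a : FibreAlg V F) :
    iA X (mulA ξ a) = (ξ X : ℂ) • a - mulA ξ (iA X a) := by
  induction a using fibre_induction with
  | hadd a a' ha ha' =>
    rw [map_add, map_add, map_add, map_add, ha, ha', smul_add, add_sub_add_comm]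
  | h z f φ α =>
    simp only [iA, mulA, onForms_decomp, LinearMap.mulLeft_apply]
    rw [extContract_ι_mul, decomp, TensorProduct.tmul_sub, TensorProduct.tmul_sub,
      TensorProduct.tmul_sub]
    congr 1
    exact decomp_smul_forms _ _ _ _ _

theorem fibreDelta_fibreDelta (a : FibreAlg V F) : fibreDelta b (fibreDelta b a) = 0 := by
  simp only [fibreDelta, LinearMap.sum_apply, Module.End.mul_apply, map_sum, iS_mulA]
  exact sum_sum_antisymm fun i j => by rw [mulA_mulA, iS_iS]

theorem fibreDeltaStar_fibreDeltaStar (a : FibreAlg V F) :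
    fibreDeltaStar b (fibreDeltaStar b a) = 0 := by
  simp only [fibreDeltaStar, LinearMap.sum_apply, Module.End.mul_apply, map_sum, ← mulS_iA]
  exact sum_sum_antisymm fun i j => by rw [mulS_comm, iA_iA, map_neg, map_neg]

theorem sum_mulS_iS {s : ℕ} {a : FibreAlg V F} (ha : a ∈ symDegree V F s) :
    ∑ i, mulS (b.coord i) (iS (b i) a) = (s : ℂ) • a := by
  refine symDegree_induction a ha (fun z f hf φ α => ?_) (fun a a' ha ha' => ?_)
  · simp only [mulS, iS, onSym_decomp, LinearMap.mulLeft_apply]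
    simp only [decomp, ← TensorProduct.tmul_sum, ← TensorProduct.sum_tmul,
      sum_ι_mul_symContract b s f hf]
    rw [← TensorProduct.smul_tmul', TensorProduct.tmul_smul, TensorProduct.smul_tmul',
      TensorProduct.smul_tmul', Complex.real_smul, smul_eq_mul, Complex.ofReal_natCast]
  · simp only [map_add, Finset.sum_add_distrib, smul_add, ha, ha']

theorem sum_mulA_iA (a : FibreAlg V F) : ∑ i, mulA (b.coord i) (iA (b i) a) = numA a := by
  induction a using fibre_induction with
  | hadd a a' ha ha' => simp only [map_add, Finset.sum_add_distrib, ha, ha']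
  | h z f φ α =>
    simp only [mulA, iA, numA, onForms_decomp, LinearMap.mulLeft_apply]
    simp only [decomp, ← TensorProduct.tmul_sum]
    rw [← sum_ι_mul_extContract b α]

/-- The Hodge-type identity `δ δ* + δ* δ = deg_s + deg_a`. -/
theorem fibreDelta_fibreDeltaStar {s : ℕ} {a : FibreAlg V F} (ha : a ∈ symDegree V F s) :
    fibreDelta b (fibreDeltaStar b a) + fibreDeltaStar b (fibreDelta b a) =
      (s : ℂ) • a + numA a := by
  classical
  have e : ∀ i j, (b.coord j) (b i) = if i = j then 1 else 0 := fun i j => by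
    rw [Module.Basis.coord_apply, Module.Basis.repr_self, Finsupp.single_apply]
  rw [← sum_mulS_iS (b := b) ha, ← sum_mulA_iA (b := b) a]
  simp only [fibreDelta, fibreDeltaStar, LinearMap.sum_apply, Module.End.mul_apply, map_sum,
    iS_mulS, iA_mulA, map_add, map_sub, Finset.sum_add_distrib, Finset.sum_sub_distrib, map_smul,
    e]
  simp only [apply_ite Complex.ofReal, Complex.ofReal_one, Complex.ofReal_zero, ite_smul, one_smul,
    zero_smul, Finset.sum_ite_eq', Finset.mem_univ, if_true, mulS_mulA, iS_iA]
  rw [Finset.sum_comm (f := fun x y => mulA (b.coord x) (mulS (b.coord y) (iA (b y) (iS (b x) a))))]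
  abel

end Differentials

section Projections

/-- The component of antisymmetric degree `d`. -/
def projA (d : ℕ) : Module.End ℂ (FibreAlg V F) :=
  onForms (extWeight _ fun e => if e = d then 1 else 0)

theorem numA_projA (d : ℕ) (a : FibreAlg V F) : numA (projA d a) = (d : ℂ) • projA d a := by
  induction a using fibre_induction_homogeneous with
  | hadd a b ha hb => simp only [map_add, smul_add, ha, hb]
  | h z f e e' φ hφ α hα =>
    rw [projA, onForms_decomp, extWeight_of_mem _ hα, decomp_smul_forms, map_smul, numA,
      onForms_decomp, extWeight_of_mem _ hα, decomp_smul_forms]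
    split_ifs with h
    · rw [h, Complex.ofReal_one, one_smul, one_smul, Complex.ofReal_natCast]
    · rw [Complex.ofReal_zero, zero_smul, zero_smul, smul_zero]

theorem projA_numA (d : ℕ) (a : FibreAlg V F) : projA d (numA a) = (d : ℂ) • projA d a := by
  rw [← numA_projA, projA, numA, ← Module.End.mul_apply, ← Module.End.mul_apply, ← onForms_mul,
    ← onForms_mul, extWeight_mul_extWeight, extWeight_mul_extWeight]
  simp only [mul_comm]

theorem parA_projA (d : ℕ) (a : FibreAlg V F) : parA (projA d a) = (-1 : ℂ) ^ d • projA d a := by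
  induction a using fibre_induction_homogeneous with
  | hadd a b ha hb => simp only [map_add, smul_add, ha, hb]
  | h z f e e' φ hφ α hα =>
    rw [projA, onForms_decomp, extWeight_of_mem _ hα, decomp_smul_forms, map_smul,
      parA_decomp hα]
    split_ifs with h
    · rw [h, Complex.ofReal_one, one_smul, one_smul]
    · rw [Complex.ofReal_zero, zero_smul, zero_smul, smul_zero]

theorem exists_sum_projA (a : FibreAlg V F) : ∃ n, ∀ m ≥ n, ∑ d ∈ Finset.range m, projA d a = a := by
  induction a using fibre_induction_homogeneous with
  | hadd a b ha hb =>
    obtain ⟨n, hn⟩ := ha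
    obtain ⟨n', hn'⟩ := hb
    refine ⟨max n n', fun m hm => ?_⟩
    simp only [map_add, Finset.sum_add_distrib]
    rw [hn m (le_trans (le_max_left _ _) hm), hn' m (le_trans (le_max_right _ _) hm)]
  | h z f e e' φ hφ α hα =>
    refine ⟨e' + 1, fun m hm => ?_⟩
    rw [Finset.sum_eq_single e']
    · rw [projA, onForms_decomp, extWeight_of_mem _ hα, if_pos rfl, one_smul]
    · intro d _ hd
      rw [projA, onForms_decomp, extWeight_of_mem _ hα, if_neg (Ne.symm hd), decomp_smul_forms,
        Complex.ofReal_zero, zero_smul]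
    · intro h
      exact absurd (Finset.mem_range.2 (by omega)) h

theorem exteriorPower_eq_zero_of_finrank_lt {N : Type*} [AddCommGroup N] [Module ℝ N]
    [FiniteDimensional ℝ N] {d : ℕ} (hd : Module.finrank ℝ N < d) {a : ExteriorAlgebra ℝ N}
    (ha : a ∈ ⋀[ℝ]^d N) : a = 0 := by
  rw [← ExteriorAlgebra.ιMulti_span_fixedDegree] at ha
  refine Submodule.span_induction (p := fun a _ => a = 0) ?_ rfl
    (fun a b _ _ ha hb => by rw [ha, hb, add_zero]) (fun r a _ ha => by rw [ha, smul_zero]) ha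
  rintro _ ⟨v, rfl⟩
  refine AlternatingMap.map_linearDependent _ v fun h => ?_
  have := h.fintype_card_le_finrank
  rw [Fintype.card_fin] at this
  omega

theorem projA_eq_zero_of_finrank_lt [FiniteDimensional ℝ V] {d : ℕ} (hd : Module.finrank ℝ V < d)
    (a : FibreAlg V F) : projA d a = 0 := by
  induction a using fibre_induction_homogeneous with
  | hadd a b ha hb => rw [map_add, ha, hb, add_zero]
  | h z f e e' φ hφ α hα =>
    rw [projA, onForms_decomp, extWeight_of_mem _ hα, decomp_smul_forms]
    split_ifs with h
    · subst h
      rw [exteriorPower_eq_zero_of_finrank_lt (by rwa [Subspace.dual_finrank_eq]) hα, decomp,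
        TensorProduct.tmul_zero, TensorProduct.tmul_zero, TensorProduct.tmul_zero, smul_zero]
    · rw [Complex.ofReal_zero, zero_smul]

theorem sum_projA [FiniteDimensional ℝ V] (a : FibreAlg V F) :
    ∑ d ∈ Finset.range (Module.finrank ℝ V + 1), projA d a = a := by
  obtain ⟨n, hn⟩ := exists_sum_projA a
  rw [← hn (max n (Module.finrank ℝ V + 1)) (le_max_left _ _)]
  conv_lhs => rw [hn (max n (Module.finrank ℝ V + 1)) (le_max_left _ _)]
  refine Finset.sum_subset (Finset.range_mono (le_max_right _ _)) fun d _ hd => ?_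
  exact projA_eq_zero_of_finrank_lt (by rw [Finset.mem_range] at hd; omega) a

/-- An eigenvector of `deg_a` with integral eigenvalue is homogeneous. -/
theorem projA_of_numA {a : FibreAlg V F} {n : ℤ} (h : numA a = (n : ℂ) • a) (d : ℕ) :
    projA d a = if n = d then a else 0 := by
  have h1 : ∀ d : ℕ, n ≠ d → projA d a = 0 := fun d hd => by
    have := projA_numA d a
    rw [h, map_smul, ← sub_eq_zero, ← sub_smul] at this
    refine (smul_eq_zero.1 this).resolve_left (sub_ne_zero.2 ?_)
    exact_mod_cast hd
  split_ifs with hd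
  · obtain ⟨m, hm⟩ := exists_sum_projA a
    conv_rhs => rw [← hm (max m (d + 1)) (le_max_left _ _)]
    rw [Finset.sum_eq_single d]
    · exact fun e _ he => h1 e (by omega)
    · exact fun h => absurd (Finset.mem_range.2 (by omega)) h
  · exact h1 d hd

/-- For negative `n` the hypothesis forces `a = 0`. -/
theorem parA_of_numA {a : FibreAlg V F} {n : ℤ} (h : numA a = (n : ℂ) • a) :
    parA a = (-1 : ℂ) ^ n • a := by
  by_cases hn : ∃ d : ℕ, n = d
  · obtain ⟨d, rfl⟩ := hn
    have := projA_of_numA h d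
    rw [if_pos rfl] at this
    rw [← this, parA_projA, zpow_natCast]
  · obtain ⟨m, hm⟩ := exists_sum_projA a
    have : a = 0 := by
      rw [← hm m le_rfl]
      exact Finset.sum_eq_zero fun d _ => by
        rw [projA_of_numA h, if_neg fun h => hn ⟨d, h⟩]
    rw [this, map_zero, smul_zero]

end Projections

end SymmetricDegree

/-! ### Pull-backs and changes of basis -/

section PullBack

variable {V : Type*} [AddCommGroup V] [Module ℝ V] {F : Type*} [AddCommGroup F] [Module ℝ F]
  {V' : Type*} [AddCommGroup V'] [Module ℝ V'] {F' : Type*} [AddCommGroup F'] [Module ℝ F']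
  {V'' : Type*} [AddCommGroup V''] [Module ℝ V''] {F'' : Type*} [AddCommGroup F''] [Module ℝ F'']

theorem pull_decomp (g : V →ₗ[ℝ] V') (h : F →ₗ[ℝ] F') (z : ℂ)
    (f : SymmetricAlgebra ℝ (Module.Dual ℝ V'))
    (φ : ExteriorAlgebra ℝ (Module.Dual ℝ F')) (α : ExteriorAlgebra ℝ (Module.Dual ℝ V')) :
    pull g h (decomp z f φ α) =
      decomp z (SymmetricAlgebra.lift (SymmetricAlgebra.ι ℝ (Module.Dual ℝ V) ∘ₗ g.dualMap) f)
        (ExteriorAlgebra.map h.dualMap φ) (ExteriorAlgebra.map g.dualMap α) := rfl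

theorem pull_intertwine {g : V →ₗ[ℝ] V'} {h : F →ₗ[ℝ] F'} {S : Module.End ℂ (FibreAlg V' F')}
    {T : Module.End ℂ (FibreAlg V F)}
    (H : ∀ z f φ α, pull g h (S (decomp z f φ α)) = T (pull g h (decomp z f φ α)))
    (a : FibreAlg V' F') : pull g h (S a) = T (pull g h a) := by
  induction a using fibre_induction with
  | hadd a b ha hb => rw [map_add, map_add, map_add, map_add, ha, hb]
  | h z f φ α => exact H z f φ α

theorem pull_iS (g : V →ₗ[ℝ] V') (h : F →ₗ[ℝ] F') (X : V) (a : FibreAlg V' F') :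
    pull g h (iS (g X) a) = iS X (pull g h a) :=
  pull_intertwine (fun z f φ α => by
    rw [iS, iS, onSym_decomp, pull_decomp, pull_decomp, onSym_decomp, symLift_symContract]) a

theorem pull_iE (g : V →ₗ[ℝ] V') (h : F →ₗ[ℝ] F') (e : F) (a : FibreAlg V' F') :
    pull g h (iE (h e) a) = iE e (pull g h a) :=
  pull_intertwine (fun z f φ α => by
    rw [iE, iE, onE_decomp, pull_decomp, pull_decomp, onE_decomp]
    congr 3
    exact exteriorMap_extContract h.dualMap (Module.Dual.eval ℝ F e) φ) a

theorem pull_iA (g : V →ₗ[ℝ] V') (h : F →ₗ[ℝ] F') (X : V) (a : FibreAlg V' F') :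
    pull g h (iA (g X) a) = iA X (pull g h a) :=
  pull_intertwine (fun z f φ α => by
    rw [iA, iA, onForms_decomp, pull_decomp, pull_decomp, onForms_decomp]
    congr 3
    exact exteriorMap_extContract g.dualMap (Module.Dual.eval ℝ V X) α) a

theorem pull_onE_extWeight (g : V →ₗ[ℝ] V') (h : F →ₗ[ℝ] F') (c : ℕ → ℝ) (a : FibreAlg V' F') :
    pull g h (onE (extWeight _ c) a) = onE (extWeight _ c) (pull g h a) :=
  pull_intertwine (fun z f φ α => by
    rw [onE_decomp, pull_decomp, pull_decomp, onE_decomp, exteriorMap_extWeight]) a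

theorem pull_onForms_extWeight (g : V →ₗ[ℝ] V') (h : F →ₗ[ℝ] F') (c : ℕ → ℝ)
    (a : FibreAlg V' F') :
    pull g h (onForms (extWeight _ c) a) = onForms (extWeight _ c) (pull g h a) :=
  pull_intertwine (fun z f φ α => by
    rw [onForms_decomp, pull_decomp, pull_decomp, onForms_decomp, exteriorMap_extWeight]) a

theorem pull_jE (g : V →ₗ[ℝ] V') (h : F →ₗ[ℝ] F') (e : F) (a : FibreAlg V' F') :
    pull g h (jE (h e) a) = jE e (pull g h a) := by
  rw [jE, jE, Module.End.mul_apply, Module.End.mul_apply, parE, pull_onE_extWeight, pull_iE, parE]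

theorem pull_mulS (g : V →ₗ[ℝ] V') (h : F →ₗ[ℝ] F') (ξ : Module.Dual ℝ V') (a : FibreAlg V' F') :
    pull g h (mulS ξ a) = mulS (ξ ∘ₗ g) (pull g h a) :=
  pull_intertwine (fun z f φ α => by
    rw [mulS, mulS, onSym_decomp, pull_decomp, pull_decomp, onSym_decomp, LinearMap.mulLeft_apply,
      LinearMap.mulLeft_apply, map_mul, SymmetricAlgebra.lift_ι_apply]
    rfl) a

theorem pull_mulE (g : V →ₗ[ℝ] V') (h : F →ₗ[ℝ] F') (θ : Module.Dual ℝ F') (a : FibreAlg V' F') :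
    pull g h (mulE θ a) = mulE (θ ∘ₗ h) (pull g h a) :=
  pull_intertwine (fun z f φ α => by
    rw [mulE, mulE, onE_decomp, pull_decomp, pull_decomp, onE_decomp, LinearMap.mulLeft_apply,
      LinearMap.mulLeft_apply, map_mul, ExteriorAlgebra.map_apply_ι]
    rfl) a

theorem pull_mulA (g : V →ₗ[ℝ] V') (h : F →ₗ[ℝ] F') (ξ : Module.Dual ℝ V') (a : FibreAlg V' F') :
    pull g h (mulA ξ a) = mulA (ξ ∘ₗ g) (pull g h a) :=
  pull_intertwine (fun z f φ α => by
    rw [mulA, mulA, onForms_decomp, pull_decomp, pull_decomp, onForms_decomp,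
      LinearMap.mulLeft_apply, LinearMap.mulLeft_apply, map_mul, ExteriorAlgebra.map_apply_ι]
    rfl) a

theorem symLift_symLift (g : V →ₗ[ℝ] V') (g' : V' →ₗ[ℝ] V'')
    (f : SymmetricAlgebra ℝ (Module.Dual ℝ V'')) :
    SymmetricAlgebra.lift (SymmetricAlgebra.ι ℝ (Module.Dual ℝ V) ∘ₗ g.dualMap)
      (SymmetricAlgebra.lift (SymmetricAlgebra.ι ℝ (Module.Dual ℝ V') ∘ₗ g'.dualMap) f) =
    SymmetricAlgebra.lift (SymmetricAlgebra.ι ℝ (Module.Dual ℝ V) ∘ₗ (g' ∘ₗ g).dualMap) f := by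
  induction f using SymmetricAlgebra.induction with
  | algebraMap r => simp only [AlgHom.commutes]
  | ι x => simp only [SymmetricAlgebra.lift_ι_apply, LinearMap.comp_apply]; rfl
  | mul a b ha hb => simp only [map_mul, ha, hb]
  | add a b ha hb => simp only [map_add, ha, hb]

theorem symLift_id (f : SymmetricAlgebra ℝ (Module.Dual ℝ V)) :
    SymmetricAlgebra.lift (SymmetricAlgebra.ι ℝ (Module.Dual ℝ V) ∘ₗ
      (LinearMap.id : V →ₗ[ℝ] V).dualMap) f = f := by
  induction f using SymmetricAlgebra.induction with
  | algebraMap r => simp only [AlgHom.commutes]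
  | ι x => simp only [SymmetricAlgebra.lift_ι_apply, LinearMap.comp_apply]; rfl
  | mul a b ha hb => simp only [map_mul, ha, hb]
  | add a b ha hb => simp only [map_add, ha, hb]

theorem exteriorMap_map {N N' N'' : Type*} [AddCommGroup N] [Module ℝ N] [AddCommGroup N']
    [Module ℝ N'] [AddCommGroup N''] [Module ℝ N''] (g : N →ₗ[ℝ] N') (g' : N' →ₗ[ℝ] N'')
    (a : ExteriorAlgebra ℝ N) :
    ExteriorAlgebra.map g' (ExteriorAlgebra.map g a) = ExteriorAlgebra.map (g' ∘ₗ g) a := by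
  rw [← ExteriorAlgebra.map_comp_map]
  rfl

theorem pull_pull (g : V →ₗ[ℝ] V') (h : F →ₗ[ℝ] F') (g' : V' →ₗ[ℝ] V'') (h' : F' →ₗ[ℝ] F'')
    (a : FibreAlg V'' F'') : pull g h (pull g' h' a) = pull (g' ∘ₗ g) (h' ∘ₗ h) a := by
  induction a using fibre_induction with
  | hadd a b ha hb => rw [map_add, map_add, map_add, ha, hb]
  | h z f φ α =>
    rw [pull_decomp, pull_decomp, pull_decomp, symLift_symLift, exteriorMap_map, exteriorMap_map]
    rfl

theorem pull_id (a : FibreAlg V F) : pull LinearMap.id LinearMap.id a = a := by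
  induction a using fibre_induction with
  | hadd a b ha hb => rw [map_add, ha, hb]
  | h z f φ α =>
    rw [pull_decomp, symLift_id]
    rw [show (LinearMap.id : F →ₗ[ℝ] F).dualMap = LinearMap.id from rfl,
      show (LinearMap.id : V →ₗ[ℝ] V).dualMap = LinearMap.id from rfl,
      ExteriorAlgebra.map_id, ExteriorAlgebra.map_id]
    rfl

theorem pull_mem_symDegree (g : V →ₗ[ℝ] V') (h : F →ₗ[ℝ] F') {s : ℕ} {a : FibreAlg V' F'}
    (ha : a ∈ symDegree V' F' s) : pull g h a ∈ symDegree V F s := by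
  refine symDegree_induction a ha (fun z f hf φ α => ?_) (fun a b ha hb => ?_)
  · rw [pull_decomp]; exact decomp_mem_symDegree (symLift_mem _ s f hf) _ _ _
  · rw [map_add]; exact Submodule.add_mem _ ha hb

theorem conjFibre_pull (g : V →ₗ[ℝ] V') (h : F →ₗ[ℝ] F') (a : FibreAlg V' F') :
    conjFibre (pull g h a) = pull g h (conjFibre a) := by
  induction a using fibre_induction with
  | hadd a b ha hb => rw [map_add, map_add, map_add, map_add, ha, hb]
  | h z f φ α => rw [pull_decomp, conjFibre_decomp, conjFibre_decomp, pull_decomp]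

section Bases

variable {ι κ : Type*} [Fintype ι] [Fintype κ]

theorem pull_fibreDelta (g : V ≃ₗ[ℝ] V') (h : F →ₗ[ℝ] F') (b : Module.Basis ι ℝ V)
    (a : FibreAlg V' F') : pull g.toLinearMap h (fibreDelta (b.map g) a) =
      fibreDelta b (pull g.toLinearMap h a) := by
  simp only [fibreDelta, LinearMap.sum_apply, map_sum, Module.End.mul_apply, pull_mulA]
  refine Finset.sum_congr rfl fun i _ => ?_
  have h1 : (b.map g).coord i ∘ₗ g.toLinearMap = b.coord i := by
    ext X; simp
  rw [h1, Module.Basis.map_apply, ← LinearEquiv.coe_coe, pull_iS]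

theorem pull_fibreDeltaStar (g : V ≃ₗ[ℝ] V') (h : F →ₗ[ℝ] F') (b : Module.Basis ι ℝ V)
    (a : FibreAlg V' F') : pull g.toLinearMap h (fibreDeltaStar (b.map g) a) =
      fibreDeltaStar b (pull g.toLinearMap h a) := by
  simp only [fibreDeltaStar, LinearMap.sum_apply, map_sum, Module.End.mul_apply, pull_mulS]
  refine Finset.sum_congr rfl fun i _ => ?_
  have h1 : (b.map g).coord i ∘ₗ g.toLinearMap = b.coord i := by
    ext X; simp
  rw [h1, Module.Basis.map_apply, ← LinearEquiv.coe_coe, pull_iA]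

variable [DecidableEq ι] [DecidableEq κ]

theorem pull_contraction (g : V ≃ₗ[ℝ] V') (h : F ≃ₗ[ℝ] F') (Ω : V' → V' → ℝ) (q : F' → F' → ℝ)
    (b : Module.Basis ι ℝ V) (c : Module.Basis κ ℝ F) (k l : ℕ) (a a' : FibreAlg V' F') :
    pull g.toLinearMap h.toLinearMap (contraction Ω q (b.map g) (c.map h) k l a a') =
      contraction (fun X Y => Ω (g X) (g Y)) (fun X Y => q (h X) (h Y)) b c k l
        (pull g.toLinearMap h.toLinearMap a) (pull g.toLinearMap h.toLinearMap a') := by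
  have hS : ∀ i a, pull g.toLinearMap h.toLinearMap (iS (b.map g i) a) =
      iS (b i) (pull g.toLinearMap h.toLinearMap a) := fun i a => by
    rw [Module.Basis.map_apply, ← LinearEquiv.coe_coe, pull_iS]
  have hE : ∀ i a, pull g.toLinearMap h.toLinearMap (iE (c.map h i) a) =
      iE (c i) (pull g.toLinearMap h.toLinearMap a) := fun i a => by
    rw [Module.Basis.map_apply, ← LinearEquiv.coe_coe, pull_iE]
  have hJ : ∀ i a, pull g.toLinearMap h.toLinearMap (jE (c.map h i) a) =
      jE (c i) (pull g.toLinearMap h.toLinearMap a) := fun i a => by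
    rw [Module.Basis.map_apply, ← LinearEquiv.coe_coe, pull_jE]
  have e1 : poissonMatrix Ω (b.map g) = poissonMatrix (fun X Y => Ω (g X) (g Y)) b := by
    simp only [poissonMatrix, Module.Basis.map_apply]
  have e2 : inverseMetric q (c.map h) = inverseMetric (fun X Y => q (h X) (h Y)) c := by
    simp only [inverseMetric, Module.Basis.map_apply]
  simp only [contraction, map_sum, map_smul, map_mul, e1, e2, Module.End.mul_apply]
  refine Finset.sum_congr rfl fun i _ => Finset.sum_congr rfl fun j _ =>
    Finset.sum_congr rfl fun A _ => Finset.sum_congr rfl fun B _ => ?_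
  rw [list_prod_intertwine (pull g.toLinearMap h.toLinearMap) (fun r => hS (i r)),
    list_prod_intertwine (pull g.toLinearMap h.toLinearMap) (fun r => hJ (A r)),
    list_prod_intertwine (pull g.toLinearMap h.toLinearMap) (fun r => hS (j r)),
    list_prod_intertwine (pull g.toLinearMap h.toLinearMap) (fun r => hE (B r))]

end Bases

end PullBack

section ChangeOfBasis

/-- A pairing does not change if the bases are transformed by `P` and the coefficients
contragrediently. -/
theorem pairing_change_basis {A : Type*} [Ring A] [Algebra ℂ A] {α : Type*} [Fintype α]
    {c c' P : α → α → ℂ} {u u' v v' : α → Module.End ℂ A}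
    (hu : ∀ i, u' i = ∑ k, P k i • u k) (hv : ∀ i, v' i = ∑ k, P k i • v k)
    (hc : ∀ k l, c k l = ∑ i, ∑ j, P k i * c' i j * P l j) :
    pairing c' u' v' = pairing c u v := by
  refine TensorProduct.ext' fun a b => ?_
  have L : ∀ i j, c' i j • (u' i a ⊗ₜ[ℂ] v' j b) =
      ∑ k, ∑ l, (P k i * c' i j * P l j) • (u k a ⊗ₜ[ℂ] v l b) := fun i j => by
    rw [hu, hv, LinearMap.sum_apply, LinearMap.sum_apply, TensorProduct.sum_tmul, Finset.smul_sum]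
    refine Finset.sum_congr rfl fun k _ => ?_
    rw [TensorProduct.tmul_sum, Finset.smul_sum]
    refine Finset.sum_congr rfl fun l _ => ?_
    rw [LinearMap.smul_apply, LinearMap.smul_apply, ← TensorProduct.smul_tmul',
      TensorProduct.tmul_smul, smul_smul, smul_smul, mul_comm (c' i j)]
  have e1 : ∀ f : α → α → α → α → A ⊗[ℂ] A, ∑ i, ∑ j, ∑ k, ∑ l, f i j k l =
      ∑ k, ∑ l, ∑ i, ∑ j, f i j k l := fun f => by
    rw [Finset.sum_congr rfl fun i _ => Finset.sum_comm, Finset.sum_comm]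
    refine Finset.sum_congr rfl fun k _ => ?_
    rw [Finset.sum_congr rfl fun i _ => Finset.sum_comm, Finset.sum_comm]
  rw [pairing_tmul, pairing_tmul, Finset.sum_congr rfl fun i _ => Finset.sum_congr rfl
    fun j _ => L i j, e1]
  simp only [hc, Finset.sum_smul]

variable {V : Type*} [AddCommGroup V] [Module ℝ V] {F : Type*} [AddCommGroup F] [Module ℝ F]

theorem iS_sum_smul {σ : Type*} (s : Finset σ) (r : σ → ℝ) (X : σ → V) :
    (iS (∑ k ∈ s, r k • X k) : Module.End ℂ (FibreAlg V F)) = ∑ k ∈ s, (r k : ℂ) • iS (X k) := by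
  classical
  induction s using Finset.induction_on with
  | empty =>
    have : (0 : V) = (0 : ℝ) • (0 : V) := by simp
    rw [Finset.sum_empty, Finset.sum_empty, this, iS, symContract_smul, onSym_smul,
      Complex.ofReal_zero, zero_smul]
  | insert a s ha ih =>
    rw [Finset.sum_insert ha, Finset.sum_insert ha, ← ih, iS, symContract_add, onSym_add,
      symContract_smul, onSym_smul, iS, iS]

theorem iE_sum_smul {σ : Type*} (s : Finset σ) (r : σ → ℝ) (X : σ → F) :
    (iE (∑ k ∈ s, r k • X k) : Module.End ℂ (FibreAlg V F)) = ∑ k ∈ s, (r k : ℂ) • iE (X k) := by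
  refine fibre_hom_ext fun z f φ α => ?_
  simp only [iE, LinearMap.sum_apply, LinearMap.smul_apply, onE_decomp, ← decomp_smul_E, map_sum,
    map_smul, LinearMap.smul_apply]
  simp only [decomp, TensorProduct.sum_tmul, TensorProduct.tmul_sum]

theorem iA_sum_smul {σ : Type*} (s : Finset σ) (r : σ → ℝ) (X : σ → V) :
    (iA (∑ k ∈ s, r k • X k) : Module.End ℂ (FibreAlg V F)) = ∑ k ∈ s, (r k : ℂ) • iA (X k) := by
  refine fibre_hom_ext fun z f φ α => ?_
  simp only [iA, LinearMap.sum_apply, LinearMap.smul_apply, onForms_decomp, ← decomp_smul_forms,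
    map_sum, map_smul, LinearMap.smul_apply]
  simp only [decomp, TensorProduct.tmul_sum]

theorem mulA_sum_smul {σ : Type*} (s : Finset σ) (r : σ → ℝ) (X : σ → Module.Dual ℝ V) :
    (mulA (∑ k ∈ s, r k • X k) : Module.End ℂ (FibreAlg V F)) =
      ∑ k ∈ s, (r k : ℂ) • mulA (X k) := by
  refine fibre_hom_ext fun z f φ α => ?_
  simp only [mulA, LinearMap.sum_apply, LinearMap.smul_apply, onForms_decomp, ← decomp_smul_forms,
    map_sum, map_smul, LinearMap.mulLeft_apply, Finset.sum_mul, smul_mul_assoc]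
  simp only [decomp, TensorProduct.tmul_sum]

theorem mulE_sum_smul {σ : Type*} (s : Finset σ) (r : σ → ℝ) (X : σ → Module.Dual ℝ F) :
    (mulE (∑ k ∈ s, r k • X k) : Module.End ℂ (FibreAlg V F)) =
      ∑ k ∈ s, (r k : ℂ) • mulE (X k) := by
  refine fibre_hom_ext fun z f φ α => ?_
  simp only [mulE, LinearMap.sum_apply, LinearMap.smul_apply, onE_decomp, ← decomp_smul_E,
    map_sum, map_smul, LinearMap.mulLeft_apply, Finset.sum_mul, smul_mul_assoc]
  simp only [decomp, TensorProduct.tmul_sum, TensorProduct.sum_tmul]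

theorem decomp_smul_S (r : ℝ) (z : ℂ) (f : SymmetricAlgebra ℝ (Module.Dual ℝ V))
    (φ : ExteriorAlgebra ℝ (Module.Dual ℝ F)) (α : ExteriorAlgebra ℝ (Module.Dual ℝ V)) :
    decomp z (r • f) φ α = (r : ℂ) • decomp z f φ α := by
  rw [decomp, ← TensorProduct.smul_tmul', TensorProduct.tmul_smul,
    TensorProduct.smul_tmul', Complex.real_smul, decomp, TensorProduct.smul_tmul', smul_eq_mul]

theorem mulS_sum_smul {σ : Type*} (s : Finset σ) (r : σ → ℝ) (X : σ → Module.Dual ℝ V) :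
    (mulS (∑ k ∈ s, r k • X k) : Module.End ℂ (FibreAlg V F)) =
      ∑ k ∈ s, (r k : ℂ) • mulS (X k) := by
  refine fibre_hom_ext fun z f φ α => ?_
  simp only [mulS, LinearMap.sum_apply, LinearMap.smul_apply, onSym_decomp, ← decomp_smul_S,
    map_sum, map_smul, LinearMap.mulLeft_apply, Finset.sum_mul, smul_mul_assoc]
  simp only [decomp, TensorProduct.tmul_sum, TensorProduct.sum_tmul]

theorem jE_sum_smul {σ : Type*} (s : Finset σ) (r : σ → ℝ) (X : σ → F) :
    (jE (∑ k ∈ s, r k • X k) : Module.End ℂ (FibreAlg V F)) = ∑ k ∈ s, (r k : ℂ) • jE (X k) := by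
  refine LinearMap.ext fun a => ?_
  simp only [jE, iE_sum_smul, Module.End.mul_apply, LinearMap.sum_apply, LinearMap.smul_apply,
    map_sum, map_smul]

variable {ι κ : Type*} [Fintype ι] [Fintype κ] [DecidableEq ι] [DecidableEq κ]

/-- The inverse of the Gram matrix of a bilinear form transforms contravariantly. -/
theorem inv_gram_change_basis {N : Type*} [AddCommGroup N] [Module ℝ N] {β : N →ₗ[ℝ] N →ₗ[ℝ] ℝ}
    (b b' : Module.Basis ι ℝ N) :
    (Matrix.of fun i j => β (b i) (b j))⁻¹ =
      b.toMatrix b' * (Matrix.of fun i j => β (b' i) (b' j))⁻¹ * (b.toMatrix b').transpose := by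
  have h : (Matrix.of fun i j => β (b' i) (b' j)) = (b.toMatrix b').transpose *
      (Matrix.of fun i j => β (b i) (b j)) * b.toMatrix b' := by
    ext i j
    have e : ∀ i, b' i = ∑ k, b.toMatrix b' k i • b k := fun i => (b.sum_toMatrix_smul_self b' i).symm
    rw [Matrix.of_apply, e i, e j]
    simp only [map_sum, map_smul, LinearMap.sum_apply, LinearMap.smul_apply, smul_eq_mul,
      Matrix.mul_apply, Matrix.transpose_apply, Matrix.of_apply, Finset.sum_mul, Finset.mul_sum]
    refine Finset.sum_congr rfl fun k _ => Finset.sum_congr rfl fun l _ => by ring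
  have h1 : b.toMatrix b' * b'.toMatrix b = 1 := b.toMatrix_mul_toMatrix_flip b'
  have hu : IsUnit (b.toMatrix b').det := by
    refine (Matrix.isUnit_iff_isUnit_det _).1 ?_
    exact IsUnit.of_mul_eq_one _ h1
  rw [h, Matrix.mul_inv_rev, Matrix.mul_inv_rev, ← mul_assoc, ← mul_assoc,
    Matrix.mul_nonsing_inv _ hu, one_mul, mul_assoc, Matrix.nonsing_inv_mul, mul_one]
  rwa [Matrix.det_transpose]

theorem fibreR_change_basis (β : V →ₗ[ℝ] V →ₗ[ℝ] ℝ) (b b' : Module.Basis ι ℝ V) :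
    (fibreR (fun X Y => β X Y) b' : Module.End ℂ (FibreAlg V F ⊗[ℂ] FibreAlg V F)) =
      fibreR (fun X Y => β X Y) b := by
  have e : ∀ i, (iS (b' i) : Module.End ℂ (FibreAlg V F)) =
      ∑ k, ((b.toMatrix b' k i : ℝ) : ℂ) • iS (b k) := fun i => by
    rw [← iS_sum_smul, b.sum_toMatrix_smul_self]
  refine pairing_change_basis (P := fun k i => ((b.toMatrix b' k i : ℝ) : ℂ)) e e fun k l => ?_
  have := congrFun (congrFun (inv_gram_change_basis (β := β.flip) b b') k) l
  rw [Matrix.mul_apply] at this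
  simp only [Matrix.mul_apply, Matrix.transpose_apply, Finset.sum_mul] at this
  simp only [poissonMatrix]
  rw [Finset.sum_comm]
  exact_mod_cast this

theorem fibreS_change_basis (β : F →ₗ[ℝ] F →ₗ[ℝ] ℝ) (c c' : Module.Basis κ ℝ F) :
    (fibreS (fun X Y => β X Y) c' : Module.End ℂ (FibreAlg V F ⊗[ℂ] FibreAlg V F)) =
      fibreS (fun X Y => β X Y) c := by
  have e : ∀ i, (iE (c' i) : Module.End ℂ (FibreAlg V F)) =
      ∑ k, ((c.toMatrix c' k i : ℝ) : ℂ) • iE (c k) := fun i => by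
    rw [← iE_sum_smul, c.sum_toMatrix_smul_self]
  have e' : ∀ i, (jE (c' i) : Module.End ℂ (FibreAlg V F)) =
      ∑ k, ((c.toMatrix c' k i : ℝ) : ℂ) • jE (c k) := fun i => by
    rw [← jE_sum_smul, c.sum_toMatrix_smul_self]
  refine pairing_change_basis (P := fun k i => ((c.toMatrix c' k i : ℝ) : ℂ)) e' e fun k l => ?_
  have := congrFun (congrFun (inv_gram_change_basis (β := β) c c') k) l
  rw [Matrix.mul_apply] at this
  simp only [Matrix.mul_apply, Matrix.transpose_apply, Finset.sum_mul] at this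
  simp only [inverseMetric]
  rw [Finset.sum_comm]
  exact_mod_cast this

/-- The contractions are independent of the bases. -/
theorem contraction_change_basis (β : V →ₗ[ℝ] V →ₗ[ℝ] ℝ) (γ : F →ₗ[ℝ] F →ₗ[ℝ] ℝ)
    (b b' : Module.Basis ι ℝ V) (c c' : Module.Basis κ ℝ F) (k l : ℕ) (a a' : FibreAlg V F) :
    contraction (fun X Y => β X Y) (fun X Y => γ X Y) b' c' k l a a' =
      contraction (fun X Y => β X Y) (fun X Y => γ X Y) b c k l a a' := by
  rw [contraction_eq_bidiff, contraction_eq_bidiff, fibreR_change_basis β b b',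
    fibreS_change_basis γ c c']

/-- The trace `Σ f(bⁱ, bᵢ)` of a bilinear map over a basis and its dual basis is independent of the
basis. -/
theorem sum_coord_change_basis {T : Type*} [AddCommGroup T] [Module ℂ T] (f : Module.Dual ℝ V → V → T)
    (h1 : ∀ (r : ι → ℝ) (ξ : ι → Module.Dual ℝ V) X, f (∑ k, r k • ξ k) X = ∑ k, (r k : ℂ) • f (ξ k) X)
    (h2 : ∀ (r : ι → ℝ) (Y : ι → V) ξ, f ξ (∑ k, r k • Y k) = ∑ k, (r k : ℂ) • f ξ (Y k))
    (b b' : Module.Basis ι ℝ V) :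
    ∑ i, f (b'.coord i) (b' i) = ∑ i, f (b.coord i) (b i) := by
  have e1 : ∀ i, b' i = ∑ k, b.toMatrix b' k i • b k := fun i => (b.sum_toMatrix_smul_self b' i).symm
  have e2 : ∀ k, b.coord k = ∑ i, b.toMatrix b' k i • b'.coord i := fun k => b'.ext fun j => by
    simp [Module.Basis.toMatrix_apply, LinearMap.sum_apply, Finsupp.single_apply]
  have h3 : ∀ i, f (b'.coord i) (b' i) = ∑ k, ((b.toMatrix b' k i : ℝ) : ℂ) • f (b'.coord i) (b k) :=
    fun i => by rw [← h2, ← e1]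
  have h4 : ∀ k, f (b.coord k) (b k) = ∑ i, ((b.toMatrix b' k i : ℝ) : ℂ) • f (b'.coord i) (b k) :=
    fun k => by rw [← h1, ← e2]
  simp only [h3, h4]
  exact Finset.sum_comm

theorem fibreDelta_change_basis (b b' : Module.Basis ι ℝ V) :
    (fibreDelta b' : Module.End ℂ (FibreAlg V F)) = fibreDelta b := by
  refine LinearMap.ext fun a => ?_
  simp only [fibreDelta, LinearMap.sum_apply, Module.End.mul_apply]
  refine sum_coord_change_basis (fun ξ X => mulA ξ (iS X a)) ?_ ?_ b b'
  · intro r ξ X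
    simp only [mulA_sum_smul, LinearMap.sum_apply, LinearMap.smul_apply]
  · intro r Y ξ
    simp only [iS_sum_smul, LinearMap.sum_apply, LinearMap.smul_apply, map_sum, map_smul]

theorem fibreDeltaStar_change_basis (b b' : Module.Basis ι ℝ V) :
    (fibreDeltaStar b' : Module.End ℂ (FibreAlg V F)) = fibreDeltaStar b := by
  refine LinearMap.ext fun a => ?_
  simp only [fibreDeltaStar, LinearMap.sum_apply, Module.End.mul_apply]
  refine sum_coord_change_basis (fun ξ X => mulS ξ (iA X a)) ?_ ?_ b b'
  · intro r ξ X
    simp only [mulS_sum_smul, LinearMap.sum_apply, LinearMap.smul_apply]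
  · intro r Y ξ
    simp only [iA_sum_smul, LinearMap.sum_apply, LinearMap.smul_apply, map_sum, map_smul]

end ChangeOfBasis

section ClassicalPart

variable {V : Type*} [AddCommGroup V] [Module ℝ V] {F : Type*} [AddCommGroup F] [Module ℝ F]
  {V' : Type*} [AddCommGroup V'] [Module ℝ V'] {F' : Type*} [AddCommGroup F'] [Module ℝ F']

/-- The projection of the fibre onto `Λ F*` which kills all elements of positive degree in the
other two factors. -/
def outE : FibreAlg V F →ₗ[ℂ] ℂ ⊗[ℝ] ExteriorAlgebra ℝ (Module.Dual ℝ F) :=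
  LinearMap.baseChange ℂ
    ((TensorProduct.lid ℝ (ExteriorAlgebra ℝ (Module.Dual ℝ F))).toLinearMap ∘ₗ
      TensorProduct.map
        (SymmetricAlgebra.algebraMapInv : SymmetricAlgebra ℝ (Module.Dual ℝ V) →ₐ[ℝ] ℝ).toLinearMap
        ((TensorProduct.rid ℝ (ExteriorAlgebra ℝ (Module.Dual ℝ F))).toLinearMap ∘ₗ
          LinearMap.lTensor (ExteriorAlgebra ℝ (Module.Dual ℝ F))
            (ExteriorAlgebra.algebraMapInv :
              ExteriorAlgebra ℝ (Module.Dual ℝ V) →ₐ[ℝ] ℝ).toLinearMap))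

theorem outE_decomp (z : ℂ) (f : SymmetricAlgebra ℝ (Module.Dual ℝ V))
    (φ : ExteriorAlgebra ℝ (Module.Dual ℝ F)) (α : ExteriorAlgebra ℝ (Module.Dual ℝ V)) :
    outE (decomp z f φ α) = z ⊗ₜ[ℝ] (SymmetricAlgebra.algebraMapInv f •
      (ExteriorAlgebra.algebraMapInv α • φ)) := rfl

theorem inclE_tmul (z : ℂ) (φ : ExteriorAlgebra ℝ (Module.Dual ℝ F)) :
    (inclE (z ⊗ₜ φ) : FibreAlg V F) = decomp z 1 φ 1 := rfl

theorem pullE_tmul (h : F →ₗ[ℝ] F') (z : ℂ) (φ : ExteriorAlgebra ℝ (Module.Dual ℝ F')) :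
    pullE h (z ⊗ₜ φ) = z ⊗ₜ[ℝ] ExteriorAlgebra.map h.dualMap φ := rfl

theorem outE_pull (g : V →ₗ[ℝ] V') (h : F →ₗ[ℝ] F') (a : FibreAlg V' F') :
    outE (pull g h a) = pullE h (outE a) := by
  have h1 : ∀ f : SymmetricAlgebra ℝ (Module.Dual ℝ V'), SymmetricAlgebra.algebraMapInv
      (SymmetricAlgebra.lift (SymmetricAlgebra.ι ℝ (Module.Dual ℝ V) ∘ₗ g.dualMap) f) =
      SymmetricAlgebra.algebraMapInv f := fun f => by
    induction f using SymmetricAlgebra.induction with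
    | algebraMap r => simp only [AlgHom.commutes]
    | ι x =>
      simp only [SymmetricAlgebra.lift_ι_apply, LinearMap.comp_apply,
        SymmetricAlgebra.algebraMapInv_ι]
    | mul a b ha hb => simp only [map_mul, ha, hb]
    | add a b ha hb => simp only [map_add, ha, hb]
  have h2 : ∀ α : ExteriorAlgebra ℝ (Module.Dual ℝ V'), ExteriorAlgebra.algebraMapInv
      (ExteriorAlgebra.map g.dualMap α) = ExteriorAlgebra.algebraMapInv α := fun α => by
    induction α using ExteriorAlgebra.induction with
    | algebraMap r => simp only [AlgHom.commutes]
    | ι x => simp [ExteriorAlgebra.algebraMapInv]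
    | mul a b ha hb => simp only [map_mul, ha, hb]
    | add a b ha hb => simp only [map_add, ha, hb]
  induction a using fibre_induction with
  | hadd a b ha hb => rw [map_add, map_add, map_add, map_add, ha, hb]
  | h z f φ α => rw [pull_decomp, outE_decomp, outE_decomp, pullE_tmul, map_smul, map_smul, h1, h2]

theorem pull_inclE (g : V →ₗ[ℝ] V') (h : F →ₗ[ℝ] F')
    (x : ℂ ⊗[ℝ] ExteriorAlgebra ℝ (Module.Dual ℝ F')) :
    pull g h (inclE x) = inclE (pullE h x) := by
  refine TensorProduct.induction_on x (by simp only [map_zero]) (fun z φ => ?_) fun x y hx hy => by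
    simp only [map_add, hx, hy]
  rw [inclE_tmul, pullE_tmul, inclE_tmul, pull_decomp, map_one, map_one]

theorem inclE_mem_symDegree (x : ℂ ⊗[ℝ] ExteriorAlgebra ℝ (Module.Dual ℝ F)) :
    (inclE x : FibreAlg V F) ∈ symDegree V F 0 := by
  refine TensorProduct.induction_on x (by rw [map_zero]; exact Submodule.zero_mem _)
    (fun z φ => ?_) fun x y hx hy => by rw [map_add]; exact Submodule.add_mem _ hx hy
  exact decomp_mem_symDegree (by rw [symPower, pow_zero]; exact Submodule.one_le.1 le_rfl) _ _ _

theorem one_mem_exteriorPower_zero {N : Type*} [AddCommGroup N] [Module ℝ N] :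
    (1 : ExteriorAlgebra ℝ N) ∈ ⋀[ℝ]^0 N := by
  rw [ExteriorAlgebra.exteriorPower, pow_zero]; exact Submodule.one_le.1 le_rfl

theorem numA_inclE (x : ℂ ⊗[ℝ] ExteriorAlgebra ℝ (Module.Dual ℝ F)) :
    numA (inclE x : FibreAlg V F) = 0 := by
  refine TensorProduct.induction_on x (by rw [map_zero, map_zero])
    (fun z φ => ?_) fun x y hx hy => by rw [map_add, map_add, hx, hy, add_zero]
  rw [inclE_tmul, numA, onForms_decomp, extWeight_of_mem _ one_mem_exteriorPower_zero,
    decomp_smul_forms, Nat.cast_zero, Complex.ofReal_zero, zero_smul]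

theorem extWeight_zero_eq {N : Type*} [AddCommGroup N] [Module ℝ N] (α : ExteriorAlgebra ℝ N) :
    extWeight N (fun e => if e = 0 then 1 else 0) α =
      algebraMap ℝ _ (ExteriorAlgebra.algebraMapInv α) := by
  induction α using exterior_induction with
  | hadd a b ha hb => rw [map_add, map_add, map_add, ha, hb]
  | h d a ha =>
    rw [extWeight_of_mem _ ha]
    revert d a
    apply exteriorPower_induction
    · intro r
      rw [AlgHom.commutes, if_pos rfl, one_smul, Algebra.algebraMap_self_apply]
    · intro d n a _ _
      rw [if_neg (Nat.succ_ne_zero d), zero_smul, map_mul]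
      simp [ExteriorAlgebra.algebraMapInv]
    · intro d a b ha hb
      rw [smul_add, map_add, map_add, ha, hb]

/-- Elements of symmetric degree zero, up to their part of positive antisymmetric degree, come
from `Λ F*`. -/
theorem inclE_outE {a : FibreAlg V F} (ha : a ∈ symDegree V F 0) :
    inclE (outE a) = projA 0 a := by
  refine symDegree_induction a ha (fun z f hf φ α => ?_) (fun a b ha hb => ?_)
  · rw [symPower, pow_zero] at hf
    obtain ⟨r, rfl⟩ := Submodule.mem_one.1 hf
    rw [outE_decomp, inclE_tmul, projA, onForms_decomp, extWeight_zero_eq, AlgHom.commutes,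
      Algebra.algebraMap_self_apply, decomp_smul_E, decomp_smul_E, Algebra.algebraMap_eq_smul_one,
      Algebra.algebraMap_eq_smul_one, decomp_smul_S, decomp_smul_forms]
  · simp only [map_add, ha, hb]

end ClassicalPart

/-! ### Products of formal series -/

section Sums

variable {W : Type*} [AddCommMonoid W]

theorem sum_range_if_le {N m : ℕ} (h : m < N) (f : ℕ → W) :
    ∑ k ∈ Finset.range (m + 1), f k = ∑ k ∈ Finset.range N, if k ≤ m then f k else 0 := by
  rw [← Finset.sum_filter]
  refine Finset.sum_congr ?_ fun _ _ => rfl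
  ext k
  simp only [Finset.mem_range, Finset.mem_filter]
  omega

theorem sum_antidiagonal_eq_box {N n : ℕ} (h : n < N) (f : ℕ → ℕ → W) :
    ∑ p ∈ Finset.HasAntidiagonal.antidiagonal n, f p.1 p.2 =
      ∑ p ∈ Finset.range N ×ˢ Finset.range N, if p.1 + p.2 = n then f p.1 p.2 else 0 := by
  rw [← Finset.sum_filter]
  refine Finset.sum_congr ?_ fun _ _ => rfl
  ext p
  simp only [Finset.mem_range, Finset.mem_filter, Finset.mem_product,
    Finset.HasAntidiagonal.mem_antidiagonal]
  omega

/-- Sums over pairs, grouped by the sum of the two indices. -/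
theorem sum_box_eq_sum_antidiagonal {N : ℕ} {P : ℕ → Prop} [DecidablePred P]
    (hP : ∀ n, P n → n < N) (f : ℕ → ℕ → W) :
    ∑ k ∈ Finset.range N, ∑ k' ∈ Finset.range N, (if P (k + k') then f k k' else 0) =
      ∑ n ∈ Finset.range N, if P n then
        ∑ k ∈ Finset.HasAntidiagonal.antidiagonal n, f k.1 k.2 else 0 := by
  have h1 : ∀ n ∈ Finset.range N, (if P n then
      ∑ k ∈ Finset.HasAntidiagonal.antidiagonal n, f k.1 k.2 else 0) =
      ∑ k ∈ Finset.range N, ∑ k' ∈ Finset.range N,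
        if k + k' = n then (if P (k + k') then f k k' else 0) else 0 := by
    intro n hn
    rw [← Finset.sum_product', ← sum_antidiagonal_eq_box (Finset.mem_range.1 hn)
      (fun k k' => if P (k + k') then f k k' else 0)]
    split_ifs with hp
    · refine Finset.sum_congr rfl fun k hk => ?_
      rw [Finset.HasAntidiagonal.mem_antidiagonal] at hk
      rw [hk, if_pos hp]
    · refine (Finset.sum_eq_zero fun k hk => ?_).symm
      rw [Finset.HasAntidiagonal.mem_antidiagonal] at hk
      rw [hk, if_neg hp]
  rw [Finset.sum_congr rfl h1]
  conv_rhs => rw [Finset.sum_comm]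
  refine Finset.sum_congr rfl fun k _ => ?_
  conv_rhs => rw [Finset.sum_comm]
  refine Finset.sum_congr rfl fun k' _ => ?_
  rw [Finset.sum_ite_eq]
  split_ifs with h1 h2 h2
  · rfl
  · exact absurd (Finset.mem_range.2 (hP _ h1)) h2
  · rfl
  · rfl

theorem sum_range_range_eq_box {N t : ℕ} (h : t < N) (f : ℕ → ℕ → W) :
    ∑ k ∈ Finset.range (t + 1), ∑ l ∈ Finset.range (t + 1 - k), f k l =
      ∑ k ∈ Finset.range N, ∑ l ∈ Finset.range N, if k + l ≤ t then f k l else 0 := by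
  rw [sum_range_if_le h]
  refine Finset.sum_congr rfl fun k _ => ?_
  split_ifs with hk
  · rw [← Finset.sum_filter]
    refine Finset.sum_congr ?_ fun _ _ => rfl
    ext l
    simp only [Finset.mem_range, Finset.mem_filter]
    omega
  · exact (Finset.sum_eq_zero fun l _ => if_neg (by omega)).symm

/-- A sum over pairs of total degree `n + 2 m` reduces to total degree `n` if both entries must be
at least `m`. -/
theorem sum_antidiagonal_shift {n m : ℕ} {f : ℕ → ℕ → W}
    (h : ∀ r s, r < m ∨ s < m → f r s = 0) :
    ∑ r ∈ Finset.HasAntidiagonal.antidiagonal (n + 2 * m), f r.1 r.2 =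
      ∑ r ∈ Finset.HasAntidiagonal.antidiagonal n, f (r.1 + m) (r.2 + m) := by
  symm
  refine Finset.sum_bij_ne_zero (fun r _ _ => (r.1 + m, r.2 + m)) ?_ ?_ ?_ fun _ _ _ => rfl
  · intro r hr _
    rw [Finset.HasAntidiagonal.mem_antidiagonal] at hr ⊢
    omega
  · rintro ⟨r, r'⟩ _ _ ⟨s, s'⟩ _ _ h
    rw [Prod.mk.injEq] at h ⊢
    omega
  · rintro ⟨r, s⟩ hr hne
    rw [Finset.HasAntidiagonal.mem_antidiagonal] at hr
    have h1 : ¬ (r < m ∨ s < m) := fun h' => hne (h r s h')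
    refine ⟨(r - m, s - m), ?_, ?_, ?_⟩
    · rw [Finset.HasAntidiagonal.mem_antidiagonal]
      simp only at hr ⊢
      omega
    · simp only
      rwa [Nat.sub_add_cancel (by omega), Nat.sub_add_cancel (by omega)]
    · simp only [Prod.mk.injEq]
      omega

theorem sum_comm₆ {α β γ δ ε ζ : Type*} (a : Finset α) (b : Finset β) (c : Finset γ)
    (d : Finset δ) (e : Finset ε) (g : Finset ζ) (f : α → β → γ → δ → ε → ζ → W) :
    ∑ n ∈ a, ∑ h ∈ b, ∑ z ∈ c, ∑ n' ∈ d, ∑ x ∈ e, ∑ y ∈ g, f n h z n' x y =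
      ∑ x ∈ e, ∑ y ∈ g, ∑ z ∈ c, ∑ n ∈ a, ∑ n' ∈ d, ∑ h ∈ b, f n h z n' x y := by
  simp only [← Finset.sum_product']
  refine Finset.sum_nbij'
    (fun i => (i.2.2.2.2.1, i.2.2.2.2.2, i.2.2.1, i.1, i.2.2.2.1, i.2.1))
    (fun i => (i.2.2.2.1, i.2.2.2.2.2, i.2.2.1, i.2.2.2.2.1, i.1, i.2.1)) ?_ ?_ ?_ ?_ ?_
  · simp only [Finset.mem_product]; tauto
  · simp only [Finset.mem_product]; tauto
  · exact fun _ _ => rfl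
  · exact fun _ _ => rfl
  · exact fun _ _ => rfl

theorem ite_sum {σ : Type*} {P : Prop} [Decidable P] (s : Finset σ) (f : σ → W) :
    (if P then ∑ i ∈ s, f i else 0) = ∑ i ∈ s, if P then f i else 0 := by
  split_ifs
  · rfl
  · exact Finset.sum_const_zero.symm

end Sums

section FormalProduct

variable {W : Type*} [AddCommGroup W] [Module ℂ W] (C : ℕ → ℕ → W →ₗ[ℂ] W →ₗ[ℂ] W)

/-- The coefficients of the exponential series of the deformed product. -/
abbrev starCoeff (k l : ℕ) : ℂ :=
  (Complex.I / 2) ^ (k + l) / ((Nat.factorial k : ℂ) * (Nat.factorial l : ℂ))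

/-- The deformed product of formal series with contractions `C k l`, which lower the symmetric
degree by `2 k` and raise the degree in `λ` by `k + l`. -/
def formalProd (v w : ℕ → ℕ → W) : ℕ → ℕ → W := fun s t =>
  ∑ k ∈ Finset.range (t + 1), ∑ l ∈ Finset.range (t + 1 - k), starCoeff k l •
    ∑ p ∈ Finset.HasAntidiagonal.antidiagonal (t - (k + l)),
      ∑ r ∈ Finset.HasAntidiagonal.antidiagonal (s + 2 * k), C k l (v r.1 p.1) (w r.2 p.2)

/-- The condition on the degrees `(s, t)` under which the contraction of order `n = (k, l)` of terms
of degrees `g₁` and `g₂` contributes to degree `g`. -/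
abbrev DegreeRel (n g₁ g₂ g : ℕ × ℕ) : Prop :=
  n.1 + n.2 + g₁.2 + g₂.2 = g.2 ∧ g₁.1 + g₂.1 = g.1 + 2 * n.1

/-- All pairs of indices below `N`. -/
abbrev box (N : ℕ) : Finset (ℕ × ℕ) := Finset.range N ×ˢ Finset.range N

theorem formalProd_eq_box (v w : ℕ → ℕ → W) {N : ℕ} (g : ℕ × ℕ) (hN : g.1 + 2 * g.2 < N) :
    formalProd C v w g.1 g.2 = ∑ n ∈ box N, ∑ g₁ ∈ box N, ∑ g₂ ∈ box N,
      if DegreeRel n g₁ g₂ g then starCoeff n.1 n.2 • C n.1 n.2 (v g₁.1 g₁.2) (w g₂.1 g₂.2)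
      else 0 := by
  obtain ⟨s, t⟩ := g
  simp only at hN ⊢
  rw [formalProd, sum_range_range_eq_box (show t < N by omega), box, Finset.sum_product]
  refine Finset.sum_congr rfl fun k _ => Finset.sum_congr rfl fun l _ => ?_
  split_ifs with hkl
  · have e1 : ∀ p : ℕ × ℕ, ∑ r ∈ Finset.HasAntidiagonal.antidiagonal (s + 2 * k),
        C k l (v r.1 p.1) (w r.2 p.2) =
        ∑ r ∈ box N, if r.1 + r.2 = s + 2 * k then C k l (v r.1 p.1) (w r.2 p.2) else 0 :=
      fun p => sum_antidiagonal_eq_box (N := N) (by omega) fun r s => C k l (v r p.1) (w s p.2)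
    simp only [e1]
    rw [sum_antidiagonal_eq_box (N := N) (by omega) (fun p p' => ∑ r ∈ box N,
      if r.1 + r.2 = s + 2 * k then C k l (v r.1 p) (w r.2 p') else 0)]
    simp only [Finset.smul_sum, smul_ite, smul_zero, box, Finset.sum_product, DegreeRel]
    have e2 : ∀ f : ℕ → ℕ → ℕ → ℕ → W, ∑ p ∈ Finset.range N, ∑ p' ∈ Finset.range N,
        ∑ r ∈ Finset.range N, ∑ r' ∈ Finset.range N, f p p' r r' =
        ∑ r ∈ Finset.range N, ∑ p ∈ Finset.range N, ∑ r' ∈ Finset.range N,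
          ∑ p' ∈ Finset.range N, f p p' r r' := fun f => by
      rw [Finset.sum_congr rfl fun p _ => Finset.sum_comm, Finset.sum_comm]
      refine Finset.sum_congr rfl fun r _ => Finset.sum_congr rfl fun p _ => Finset.sum_comm
    have e3 : ∀ p p', (if p + p' = t - (k + l) then ∑ r ∈ Finset.range N, ∑ r' ∈ Finset.range N,
        (if r + r' = s + 2 * k then starCoeff k l • C k l (v r p) (w r' p') else 0) else 0) =
        ∑ r ∈ Finset.range N, ∑ r' ∈ Finset.range N,
          (if k + l + p + p' = t ∧ r + r' = s + 2 * k then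
            starCoeff k l • C k l (v r p) (w r' p') else 0) := fun p p' => by
      split_ifs with h
      · have h' : k + l + p + p' = t := by omega
        simp only [h', true_and]
      · have h' : ¬ (k + l + p + p' = t) := by omega
        simp only [h', false_and, if_false, Finset.sum_const_zero]
    rw [← e2]
    exact Finset.sum_congr rfl fun p _ => Finset.sum_congr rfl fun p' _ => by
      rw [← e3]
  · symm
    refine Finset.sum_eq_zero fun g₁ _ => Finset.sum_eq_zero fun g₂ _ => if_neg ?_
    rintro ⟨h, -⟩
    simp only at h
    omega

/-- The condition on the degrees under which a double contraction of total order `n` of three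
factors contributes to degree `g`. -/
abbrev DegreeRel₃ (n g₁ g₂ g₃ g : ℕ × ℕ) : Prop :=
  n.1 + n.2 + g₁.2 + g₂.2 + g₃.2 = g.2 ∧ g₁.1 + g₂.1 + g₃.1 = g.1 + 2 * n.1

variable {C} in
/-- If contractions are associative order by order, the product of formal series is associative.
The hypothesis `hC` removes the terms of negative degree, which a sum indexed by natural numbers
cannot record. -/
theorem formalProd_assoc {G : ℕ → Submodule ℂ W}
    (hC : ∀ {k l r s a b}, a ∈ G r → b ∈ G s → r + s < 2 * k → C k l a b = 0)
    (hassoc : ∀ K L x y z,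
      ∑ k ∈ Finset.HasAntidiagonal.antidiagonal K, ∑ l ∈ Finset.HasAntidiagonal.antidiagonal L,
        ((k.1.factorial : ℂ)⁻¹ * (k.2.factorial : ℂ)⁻¹ *
          ((l.1.factorial : ℂ)⁻¹ * (l.2.factorial : ℂ)⁻¹)) • C k.1 l.1 (C k.2 l.2 x y) z =
      ∑ k ∈ Finset.HasAntidiagonal.antidiagonal K, ∑ l ∈ Finset.HasAntidiagonal.antidiagonal L,
        ((k.1.factorial : ℂ)⁻¹ * (k.2.factorial : ℂ)⁻¹ *
          ((l.1.factorial : ℂ)⁻¹ * (l.2.factorial : ℂ)⁻¹)) • C k.1 l.1 x (C k.2 l.2 y z))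
    {u v w : ℕ → ℕ → W} (hu : ∀ s t, u s t ∈ G s) (hv : ∀ s t, v s t ∈ G s)
    (hw : ∀ s t, w s t ∈ G s) :
    formalProd C (formalProd C u v) w = formalProd C u (formalProd C v w) := by
  funext s t
  -- a bound for all degrees and orders which occur
  obtain ⟨N, hN⟩ : ∃ N, s + 2 * t < N := ⟨_, Nat.lt_succ_self _⟩
  -- both sides in the form of a sum over the degrees of the three factors and two contractions
  have total : ∀ (X : ℕ × ℕ → ℕ × ℕ → W) (g₁ g₂ g₃ : ℕ × ℕ),
      ∑ n ∈ box N, ∑ n' ∈ box N,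
        (if DegreeRel₃ (n + n') g₁ g₂ g₃ (s, t) then X n n' else 0) =
      ∑ K ∈ Finset.range N, ∑ L ∈ Finset.range N, if DegreeRel₃ (K, L) g₁ g₂ g₃ (s, t) then
        ∑ k ∈ Finset.HasAntidiagonal.antidiagonal K, ∑ l ∈ Finset.HasAntidiagonal.antidiagonal L,
          X (k.1, l.1) (k.2, l.2) else 0 := by
    intro X g₁ g₂ g₃
    have e1 : ∀ k k', ∑ l ∈ Finset.range N, ∑ l' ∈ Finset.range N,
        (if DegreeRel₃ (k + k', l + l') g₁ g₂ g₃ (s, t) then X (k, l) (k', l') else 0) =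
        ∑ L ∈ Finset.range N, if DegreeRel₃ (k + k', L) g₁ g₂ g₃ (s, t) then
          ∑ l ∈ Finset.HasAntidiagonal.antidiagonal L, X (k, l.1) (k', l.2) else 0 := fun k k' =>
      sum_box_eq_sum_antidiagonal (P := fun L => DegreeRel₃ (k + k', L) g₁ g₂ g₃ (s, t))
        (fun n h => by obtain ⟨h, -⟩ := h; simp only at h; omega) fun l l' => X (k, l) (k', l')
    rw [box, Finset.sum_product]
    simp only [Finset.sum_product]
    have e0 : ∀ k, ∑ l ∈ Finset.range N, ∑ k' ∈ Finset.range N, ∑ l' ∈ Finset.range N,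
        (if DegreeRel₃ ((k, l) + (k', l')) g₁ g₂ g₃ (s, t) then X (k, l) (k', l') else 0) =
        ∑ k' ∈ Finset.range N, ∑ L ∈ Finset.range N,
          if DegreeRel₃ (k + k', L) g₁ g₂ g₃ (s, t) then
          ∑ l ∈ Finset.HasAntidiagonal.antidiagonal L, X (k, l.1) (k', l.2) else 0 := fun k => by
      rw [Finset.sum_comm]
      exact Finset.sum_congr rfl fun k' _ => e1 k k'
    rw [Finset.sum_congr rfl fun k _ => e0 k, Finset.sum_congr rfl fun k _ => Finset.sum_comm,
      Finset.sum_comm]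
    conv_rhs => rw [Finset.sum_comm]
    refine Finset.sum_congr rfl fun L _ => ?_
    exact sum_box_eq_sum_antidiagonal (P := fun K => DegreeRel₃ (K, L) g₁ g₂ g₃ (s, t))
        (fun n h => by obtain ⟨h, -⟩ := h; simp only at h; omega)
          fun k k' => ∑ l ∈ Finset.HasAntidiagonal.antidiagonal L, X (k, l.1) (k', l.2)
  -- the intermediate degree is determined by the others
  have collapse : ∀ {P Q : ℕ × ℕ → Prop} [DecidablePred P] [DecidablePred Q] {T : Prop}
      [Decidable T] (X : W) (h₀ : ℕ × ℕ), (∀ h, P h → Q h → h = h₀) →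
      (X ≠ 0 → ((P h₀ ∧ Q h₀) ↔ T)) → (P h₀ → h₀ ∈ box N) →
      ∑ h ∈ box N, (if P h then (if Q h then X else 0) else 0) = if T then X else 0 := by
    intro P Q _ _ T _ X h₀ h1 h2 h3
    by_cases hX : X = 0
    · simp only [hX, ite_self, Finset.sum_const_zero]
    by_cases hPQ : P h₀ ∧ Q h₀
    · rw [Finset.sum_eq_single_of_mem h₀ (h3 hPQ.1), if_pos hPQ.1, if_pos hPQ.2,
        if_pos ((h2 hX).1 hPQ)]
      intro h _ hne
      split_ifs with hp hq
      · exact absurd (h1 h hp hq) hne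
      · rfl
      · rfl
    · rw [if_neg fun hT => hPQ ((h2 hX).2 hT)]
      refine Finset.sum_eq_zero fun h _ => ?_
      split_ifs with hp hq
      · obtain rfl := h1 h hp hq
        exact absurd ⟨hp, hq⟩ hPQ
      · rfl
      · rfl
  have left : formalProd C (formalProd C u v) w s t =
      ∑ g₁ ∈ box N, ∑ g₂ ∈ box N, ∑ g₃ ∈ box N, ∑ n ∈ box N, ∑ n' ∈ box N,
        if DegreeRel₃ (n + n') g₁ g₂ g₃ (s, t) then (starCoeff n.1 n.2 * starCoeff n'.1 n'.2) •
          C n.1 n.2 (C n'.1 n'.2 (u g₁.1 g₁.2) (v g₂.1 g₂.2)) (w g₃.1 g₃.2) else 0 := by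
    rw [formalProd_eq_box C _ w (s, t) hN]
    have e : ∀ n h g₃ : ℕ × ℕ, (if DegreeRel n h g₃ (s, t) then
        starCoeff n.1 n.2 • C n.1 n.2 (formalProd C u v h.1 h.2) (w g₃.1 g₃.2) else 0) =
        ∑ n' ∈ box N, ∑ g₁ ∈ box N, ∑ g₂ ∈ box N, if DegreeRel n h g₃ (s, t) then
          (if DegreeRel n' g₁ g₂ h then (starCoeff n.1 n.2 * starCoeff n'.1 n'.2) •
          C n.1 n.2 (C n'.1 n'.2 (u g₁.1 g₁.2) (v g₂.1 g₂.2)) (w g₃.1 g₃.2) else 0) else 0 := by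
      intro n h g₃
      simp only [← ite_sum]
      by_cases hr : DegreeRel n h g₃ (s, t)
      · rw [if_pos hr, if_pos hr, formalProd_eq_box C u v h (N := N) (by
          obtain ⟨h1, h2⟩ := hr; simp only at h1 h2; omega)]
        simp only [map_sum, LinearMap.sum_apply, Finset.smul_sum, apply_ite, map_smul, map_zero]
        refine Finset.sum_congr rfl fun n' _ => Finset.sum_congr rfl fun g₁ _ =>
          Finset.sum_congr rfl fun g₂ _ => ?_
        split_ifs
        · rw [LinearMap.smul_apply, smul_smul]
        · rw [LinearMap.zero_apply, smul_zero]
      · rw [if_neg hr, if_neg hr]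
    simp only [e]
    rw [sum_comm₆]
    refine Finset.sum_congr rfl fun g₁ _ => Finset.sum_congr rfl fun g₂ _ =>
      Finset.sum_congr rfl fun g₃ _ => Finset.sum_congr rfl fun n _ =>
      Finset.sum_congr rfl fun n' _ => ?_
    refine collapse _ (g₁.1 + g₂.1 - 2 * n'.1, n'.1 + n'.2 + g₁.2 + g₂.2) ?_ ?_ ?_
    · rintro ⟨a, b⟩ ⟨h1, h2⟩ ⟨h3, h4⟩
      simp only [Prod.mk.injEq] at h1 h2 h3 h4 ⊢
      omega
    · intro hX
      have h1 : ¬ (g₁.1 + g₂.1 < 2 * n'.1) := fun h => hX (by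
        rw [hC (hu _ _) (hv _ _) h, map_zero, LinearMap.zero_apply, smul_zero])
      simp only [DegreeRel, DegreeRel₃, Prod.fst_add, Prod.snd_add]
      constructor
      · rintro ⟨⟨h2, h3⟩, h4, h5⟩
        constructor <;> omega
      · rintro ⟨h2, h3⟩
        refine ⟨⟨?_, ?_⟩, ?_, ?_⟩
        · omega
        · omega
        · trivial
        · omega
    · rintro ⟨h1, h2⟩
      simp only at h1 h2
      refine Finset.mem_product.2 ⟨Finset.mem_range.2 ?_, Finset.mem_range.2 ?_⟩
      · simp only
        omega
      · simp only
        omega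
  have right : formalProd C u (formalProd C v w) s t =
      ∑ g₁ ∈ box N, ∑ g₂ ∈ box N, ∑ g₃ ∈ box N, ∑ n ∈ box N, ∑ n' ∈ box N,
        if DegreeRel₃ (n + n') g₁ g₂ g₃ (s, t) then (starCoeff n.1 n.2 * starCoeff n'.1 n'.2) •
          C n.1 n.2 (u g₁.1 g₁.2) (C n'.1 n'.2 (v g₂.1 g₂.2) (w g₃.1 g₃.2)) else 0 := by
    rw [formalProd_eq_box C u _ (s, t) hN]
    have e : ∀ n g₁ h : ℕ × ℕ, (if DegreeRel n g₁ h (s, t) then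
        starCoeff n.1 n.2 • C n.1 n.2 (u g₁.1 g₁.2) (formalProd C v w h.1 h.2) else 0) =
        ∑ n' ∈ box N, ∑ g₂ ∈ box N, ∑ g₃ ∈ box N, if DegreeRel n g₁ h (s, t) then
          (if DegreeRel n' g₂ g₃ h then (starCoeff n.1 n.2 * starCoeff n'.1 n'.2) •
          C n.1 n.2 (u g₁.1 g₁.2) (C n'.1 n'.2 (v g₂.1 g₂.2) (w g₃.1 g₃.2)) else 0) else 0 := by
      intro n g₁ h
      simp only [← ite_sum]
      by_cases hr : DegreeRel n g₁ h (s, t)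
      · rw [if_pos hr, if_pos hr, formalProd_eq_box C v w h (N := N) (by
          obtain ⟨h1, h2⟩ := hr; simp only at h1 h2; omega)]
        simp only [map_sum, Finset.smul_sum, apply_ite, map_smul, smul_smul, map_zero, smul_zero]
      · rw [if_neg hr, if_neg hr]
    simp only [e]
    have perm : ∀ f : ℕ × ℕ → ℕ × ℕ → ℕ × ℕ → ℕ × ℕ → ℕ × ℕ → ℕ × ℕ → W,
        ∑ n ∈ box N, ∑ g₁ ∈ box N, ∑ h ∈ box N, ∑ n' ∈ box N, ∑ g₂ ∈ box N, ∑ g₃ ∈ box N,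
          f n g₁ h n' g₂ g₃ = ∑ g₁ ∈ box N, ∑ g₂ ∈ box N, ∑ g₃ ∈ box N, ∑ n ∈ box N,
          ∑ n' ∈ box N, ∑ h ∈ box N, f n g₁ h n' g₂ g₃ := fun f => by
      rw [Finset.sum_comm]
      refine Finset.sum_congr rfl fun g₁ _ => ?_
      have := sum_comm₆ (box N) (box N) (Finset.range 1) (box N) (box N) (box N)
        fun n h _ n' g₂ g₃ => f n g₁ h n' g₂ g₃
      simpa only [Finset.sum_range_one] using this
    rw [perm]
    refine Finset.sum_congr rfl fun g₁ _ => Finset.sum_congr rfl fun g₂ _ =>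
      Finset.sum_congr rfl fun g₃ _ => Finset.sum_congr rfl fun n _ =>
      Finset.sum_congr rfl fun n' _ => ?_
    refine collapse _ (g₂.1 + g₃.1 - 2 * n'.1, n'.1 + n'.2 + g₂.2 + g₃.2) ?_ ?_ ?_
    · rintro ⟨a, b⟩ ⟨h1, h2⟩ ⟨h3, h4⟩
      simp only [Prod.mk.injEq] at h1 h2 h3 h4 ⊢
      omega
    · intro hX
      have h1 : ¬ (g₂.1 + g₃.1 < 2 * n'.1) := fun h => hX (by
        rw [hC (hv _ _) (hw _ _) h, map_zero, smul_zero])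
      simp only [DegreeRel, DegreeRel₃, Prod.fst_add, Prod.snd_add]
      constructor
      · rintro ⟨⟨h2, h3⟩, h4, h5⟩
        constructor <;> omega
      · rintro ⟨h2, h3⟩
        refine ⟨⟨?_, ?_⟩, ?_, ?_⟩
        · omega
        · omega
        · trivial
        · omega
    · rintro ⟨h1, h2⟩
      simp only at h1 h2
      refine Finset.mem_product.2 ⟨Finset.mem_range.2 ?_, Finset.mem_range.2 ?_⟩
      · simp only
        omega
      · simp only
        omega
  rw [left, right]
  refine Finset.sum_congr rfl fun g₁ _ => Finset.sum_congr rfl fun g₂ _ =>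
      Finset.sum_congr rfl fun g₃ _ => ?_
  rw [total (fun n n' => (starCoeff n.1 n.2 * starCoeff n'.1 n'.2) •
      C n.1 n.2 (C n'.1 n'.2 (u g₁.1 g₁.2) (v g₂.1 g₂.2)) (w g₃.1 g₃.2)),
    total (fun n n' => (starCoeff n.1 n.2 * starCoeff n'.1 n'.2) •
      C n.1 n.2 (u g₁.1 g₁.2) (C n'.1 n'.2 (v g₂.1 g₂.2) (w g₃.1 g₃.2)))]
  refine Finset.sum_congr rfl fun K _ => Finset.sum_congr rfl fun L _ => ?_
  congr 1
  have coeff : ∀ {k l : ℕ × ℕ}, k ∈ Finset.HasAntidiagonal.antidiagonal K →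
      l ∈ Finset.HasAntidiagonal.antidiagonal L →
      starCoeff k.1 l.1 * starCoeff k.2 l.2 = (Complex.I / 2) ^ (K + L) *
        ((k.1.factorial : ℂ)⁻¹ * (k.2.factorial : ℂ)⁻¹ *
          ((l.1.factorial : ℂ)⁻¹ * (l.2.factorial : ℂ)⁻¹)) := by
    intro k l hk hl
    rw [Finset.HasAntidiagonal.mem_antidiagonal] at hk hl
    rw [← hk, ← hl, starCoeff, starCoeff, div_mul_div_comm, ← pow_add, div_eq_mul_inv]
    congr 1
    · congr 1
      omega
    · rw [mul_inv, mul_inv, mul_inv]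
      ring
  have fin := congrArg (fun x => (Complex.I / 2) ^ (K + L) • x)
    (hassoc K L (u g₁.1 g₁.2) (v g₂.1 g₂.2) (w g₃.1 g₃.2))
  simp only [Finset.smul_sum, smul_smul] at fin
  refine Eq.trans (Finset.sum_congr rfl fun k hk => Finset.sum_congr rfl fun l hl => ?_)
    (fin.trans (Finset.sum_congr rfl fun k hk => Finset.sum_congr rfl fun l hl => ?_))
  · rw [coeff hk hl]
  · rw [coeff hk hl]

end FormalProduct

section FormalProduct

variable {W : Type*} [AddCommGroup W] [Module ℂ W] (C : ℕ → ℕ → W →ₗ[ℂ] W →ₗ[ℂ] W)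

theorem formalProd_eq_sum (v w : ℕ → ℕ → W) (s t : ℕ) : formalProd C v w s t =
    ∑ k ∈ Finset.range (t + 1), ∑ l ∈ Finset.range (t + 1 - k),
    ∑ p ∈ Finset.HasAntidiagonal.antidiagonal (t - (k + l)),
      ∑ r ∈ Finset.HasAntidiagonal.antidiagonal (s + 2 * k),
        starCoeff k l • C k l (v r.1 p.1) (w r.2 p.2) := by
  simp only [formalProd, Finset.smul_sum]

theorem formalProd_add_left (u v w : ℕ → ℕ → W) :
    formalProd C (u + v) w = formalProd C u w + formalProd C v w := by
  funext s t
  simp only [formalProd, Pi.add_apply, map_add, LinearMap.add_apply, Finset.sum_add_distrib,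
    smul_add]

theorem formalProd_add_right (u v w : ℕ → ℕ → W) :
    formalProd C u (v + w) = formalProd C u v + formalProd C u w := by
  funext s t
  simp only [formalProd, Pi.add_apply, map_add, Finset.sum_add_distrib, smul_add]

theorem formalProd_smul_left (c : ℂ) (v w : ℕ → ℕ → W) :
    formalProd C (c • v) w = c • formalProd C v w := by
  funext s t
  simp only [formalProd_eq_sum, Pi.smul_apply, map_smul, LinearMap.smul_apply, Finset.smul_sum,
    smul_comm c]

theorem formalProd_smul_right (c : ℂ) (v w : ℕ → ℕ → W) :
    formalProd C v (c • w) = c • formalProd C v w := by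
  funext s t
  simp only [formalProd_eq_sum, Pi.smul_apply, map_smul, Finset.smul_sum, smul_comm c]

variable {C}

theorem formalProd_mem {G : ℕ → Submodule ℂ W}
    (hC : ∀ {k l r s n a b}, a ∈ G r → b ∈ G s → r + s = n + 2 * k → C k l a b ∈ G n)
    {v w : ℕ → ℕ → W} (hv : ∀ s t, v s t ∈ G s) (hw : ∀ s t, w s t ∈ G s) (s t : ℕ) :
    formalProd C v w s t ∈ G s := by
  rw [formalProd_eq_sum]
  refine Submodule.sum_mem _ fun k _ => Submodule.sum_mem _ fun l _ => Submodule.sum_mem _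
    fun p _ => Submodule.sum_mem _ fun r hr => Submodule.smul_mem _ _ (hC (hv _ _) (hw _ _) ?_)
  exact Finset.HasAntidiagonal.mem_antidiagonal.1 hr

theorem formalProd_map {Y f g : Module.End ℂ W}
    (h : ∀ k l a b, Y (C k l a b) = C k l (f a) (g b)) (v w : ℕ → ℕ → W) (s t : ℕ) :
    Y (formalProd C v w s t) = formalProd C (fun s t => f (v s t)) (fun s t => g (w s t)) s t := by
  simp only [formalProd_eq_sum, map_sum, map_smul, h]

theorem formalProd_leibniz {D P : Module.End ℂ W}
    (h : ∀ k l a b, D (C k l a b) = C k l (D a) b + C k l (P a) (D b)) (v w : ℕ → ℕ → W)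
    (s t : ℕ) : D (formalProd C v w s t) = formalProd C (fun s t => D (v s t)) w s t +
      formalProd C (fun s t => P (v s t)) (fun s t => D (w s t)) s t := by
  simp only [formalProd_eq_sum, map_sum, map_smul, h, smul_add, Finset.sum_add_distrib]

/-- The Leibniz rule for operators which lower the symmetric degree by one. -/
theorem formalProd_leibniz_shift {D P : Module.End ℂ W} {v w : ℕ → ℕ → W}
    (h : ∀ k l a b, D (C k l a b) = C k l (D a) b + C k l (P a) (D b))
    (hv : ∀ t, D (v 0 t) = 0) (hw : ∀ t, D (w 0 t) = 0)
    (s t : ℕ) : D (formalProd C v w (s + 1) t) =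
      formalProd C (fun s t => D (v (s + 1) t)) w s t +
      formalProd C (fun s t => P (v s t)) (fun s t => D (w (s + 1) t)) s t := by
  simp only [formalProd, map_sum, map_smul, h]
  simp only [← Finset.sum_add_distrib, ← smul_add]
  refine Finset.sum_congr rfl fun k _ => Finset.sum_congr rfl fun l _ => ?_
  congr 1
  refine Finset.sum_congr rfl fun p _ => ?_
  rw [Finset.sum_add_distrib, Finset.sum_add_distrib, add_right_comm s 1,
    Finset.Nat.sum_antidiagonal_succ, Finset.Nat.sum_antidiagonal_succ']
  simp only [hv, hw, map_zero, LinearMap.zero_apply, zero_add]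

/-- The total degree is a derivation: `k + l` contractions raise `2 deg_λ` by `2 (k + l)` and lower
the other two degrees by `2 k` and `2 l`. -/
theorem formalProd_degree {N : Module.End ℂ W}
    (h : ∀ k l a b, N (C k l a b) = C k l (N a) b + C k l a (N b) - (2 * l : ℂ) • C k l a b)
    (v w : ℕ → ℕ → W) (s t : ℕ) :
    (2 * t + s : ℂ) • formalProd C v w s t + N (formalProd C v w s t) =
      formalProd C (fun s t => (2 * t + s : ℂ) • v s t + N (v s t)) w s t +
      formalProd C v (fun s t => (2 * t + s : ℂ) • w s t + N (w s t)) s t := by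
  simp only [formalProd_eq_sum, map_sum, map_smul, Finset.smul_sum]
  simp only [← Finset.sum_add_distrib]
  refine Finset.sum_congr rfl fun k hk => Finset.sum_congr rfl fun l hl =>
    Finset.sum_congr rfl fun p hp => Finset.sum_congr rfl fun r hr => ?_
  rw [Finset.mem_range] at hk hl
  rw [Finset.HasAntidiagonal.mem_antidiagonal] at hp hr
  have ht : (t : ℂ) = p.1 + p.2 + k + l := by
    have : t = p.1 + p.2 + k + l := by omega
    exact_mod_cast this
  have hs : (s : ℂ) = r.1 + r.2 - 2 * k := by
    rw [eq_sub_iff_add_eq]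
    exact_mod_cast hr.symm
  rw [h, ht, hs]
  simp only [map_add, map_smul, LinearMap.add_apply, LinearMap.smul_apply]
  module

/-- Reversal of the factors. `Φ` is `P_λ` or the complex conjugation, up to the sign `ε`. -/
theorem formalProd_reverse {v w v' w' : ℕ → ℕ → W} {ε : ℂ}
    {Φ : ℕ → W →+ W}
    (h : ∀ k l r r' p p', Φ (k + l + p + p') (starCoeff k l • C k l (v r p) (w r' p')) =
      (ε * starCoeff k l) • C k l (w' r' p') (v' r p)) (s t : ℕ) :
    Φ t (formalProd C v w s t) = ε • formalProd C w' v' s t := by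
  simp only [formalProd_eq_sum, map_sum, Finset.smul_sum]
  refine Finset.sum_congr rfl fun k hk => Finset.sum_congr rfl fun l hl => ?_
  rw [← Finset.Nat.sum_antidiagonal_swap]
  refine Finset.sum_congr rfl fun p hp => ?_
  rw [← Finset.Nat.sum_antidiagonal_swap]
  refine Finset.sum_congr rfl fun r _ => ?_
  rw [Finset.mem_range] at hk hl
  rw [Finset.HasAntidiagonal.mem_antidiagonal] at hp
  have ht : t = k + l + p.2 + p.1 := by omega
  rw [ht, Prod.fst_swap, Prod.snd_swap, Prod.fst_swap, Prod.snd_swap, h, smul_smul]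

end FormalProduct

/-! ### The exponential series of the deformed product -/

section Exponential

variable {W : Type*} [AddCommGroup W] [Module ℂ W]

/-- The operator `T` on the symmetric degrees `s, s'` of a formal series in the tensor square,
lowering both degrees by `d`. -/
def shiftEnd (d : ℕ) (T : Module.End ℂ (W ⊗[ℂ] W)) :
    Module.End ℂ (ℕ → ℕ → ℕ → W ⊗[ℂ] W) where
  toFun X := fun s s' t => T (X (s + d) (s' + d) t)
  map_add' X Y := by funext s s' t; simp only [Pi.add_apply, map_add]
  map_smul' c X := by funext s s' t; simp only [Pi.smul_apply, map_smul, RingHom.id_apply]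

theorem shiftEnd_apply (d : ℕ) (T : Module.End ℂ (W ⊗[ℂ] W)) (X : ℕ → ℕ → ℕ → W ⊗[ℂ] W)
    (s s' t : ℕ) : shiftEnd d T X s s' t = T (X (s + d) (s' + d) t) := rfl

theorem shiftEnd_pow (d : ℕ) (T : Module.End ℂ (W ⊗[ℂ] W)) (k : ℕ) :
    shiftEnd d T ^ k = shiftEnd (k * d) (T ^ k) := by
  induction k with
  | zero => ext X s s' t; simp [shiftEnd_apply]
  | succ k ih =>
    refine LinearMap.ext fun X => ?_
    funext s s' t
    rw [pow_succ, pow_succ, Module.End.mul_apply, ih, shiftEnd_apply, shiftEnd_apply,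
      shiftEnd_apply, Module.End.mul_apply, add_mul, one_mul, add_assoc, add_assoc]

theorem shiftEnd_commute {T T' : Module.End ℂ (W ⊗[ℂ] W)} (h : Commute T T') (d d' : ℕ) :
    Commute (shiftEnd d T) (shiftEnd d' T') := by
  refine LinearMap.ext fun X => ?_
  funext s s' t
  have := LinearMap.congr_fun h.eq (X (s + d + d') (s' + d + d') t)
  rw [Module.End.mul_apply, Module.End.mul_apply] at this
  rw [Module.End.mul_apply, Module.End.mul_apply, shiftEnd_apply, shiftEnd_apply, shiftEnd_apply,
    shiftEnd_apply, this, add_right_comm s, add_right_comm s']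

theorem shiftEnd_zero (T : Module.End ℂ (W ⊗[ℂ] W)) (l : ℕ) :
    shiftEnd 0 T ^ l = shiftEnd 0 (T ^ l) := by
  rw [shiftEnd_pow, mul_zero]

/-- The exponential series of `λ (i/2) (R + S)`, composed with the multiplication, is the deformed
product. -/
theorem formalProd_eq_exp {C : ℕ → ℕ → W →ₗ[ℂ] W →ₗ[ℂ] W} {R S : Module.End ℂ (W ⊗[ℂ] W)}
    (hRS : Commute R S) (μ : W ⊗[ℂ] W →ₗ[ℂ] W)
    (hC : ∀ k l a b, C k l a b = μ ((R ^ k) ((S ^ l) (a ⊗ₜ b)))) {v w : ℕ → ℕ → W}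
    (h0 : ∀ k l r s p p', r < k ∨ s < k → C k l (v r p) (w s p') = 0) (s t : ℕ) :
    formalProd C v w s t = ∑ r ∈ Finset.HasAntidiagonal.antidiagonal s,
      μ (∑ n ∈ Finset.range (t + 1), (n.factorial : ℂ)⁻¹ •
        (((Complex.I / 2) • (shiftEnd 1 R + shiftEnd 0 S)) ^ n)
          (fun s s' t => ∑ p ∈ Finset.HasAntidiagonal.antidiagonal t, v s p.1 ⊗ₜ[ℂ] w s' p.2)
          r.1 r.2 (t - n)) := by
  have e1 : ∀ n : ℕ, (n.factorial : ℂ)⁻¹ •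
      ((Complex.I / 2) • (shiftEnd 1 R + shiftEnd 0 S)) ^ n =
      ∑ k ∈ Finset.HasAntidiagonal.antidiagonal n, starCoeff k.1 k.2 •
        (shiftEnd k.1 (R ^ k.1) * shiftEnd 0 (S ^ k.2)) := fun n => by
    rw [smul_pow, smul_comm, ← sum_divided_pow (shiftEnd_commute hRS 1 0), Finset.smul_sum]
    refine Finset.sum_congr rfl fun k hk => ?_
    rw [Finset.HasAntidiagonal.mem_antidiagonal] at hk
    rw [smul_smul, shiftEnd_pow, mul_one, shiftEnd_zero, ← hk, ← mul_inv,
      show starCoeff k.1 k.2 = _ from div_eq_mul_inv _ _]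
  have e2 : ∀ (k l r r' m : ℕ), μ ((shiftEnd k (R ^ k) * shiftEnd 0 (S ^ l))
      (fun s s' t => ∑ p ∈ Finset.HasAntidiagonal.antidiagonal t, v s p.1 ⊗ₜ[ℂ] w s' p.2) r r' m) =
      ∑ p ∈ Finset.HasAntidiagonal.antidiagonal m, C k l (v (r + k) p.1) (w (r' + k) p.2) := by
    intro k l r r' m
    rw [Module.End.mul_apply, shiftEnd_apply, shiftEnd_apply]
    simp only [map_sum, hC, add_zero]
  have e3 : ∀ (n r r' m : ℕ), μ ((n.factorial : ℂ)⁻¹ •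
        (((Complex.I / 2) • (shiftEnd 1 R + shiftEnd 0 S)) ^ n)
          (fun s s' t => ∑ p ∈ Finset.HasAntidiagonal.antidiagonal t, v s p.1 ⊗ₜ[ℂ] w s' p.2)
          r r' m) = ∑ k ∈ Finset.HasAntidiagonal.antidiagonal n, starCoeff k.1 k.2 •
      ∑ p ∈ Finset.HasAntidiagonal.antidiagonal m,
        C k.1 k.2 (v (r + k.1) p.1) (w (r' + k.1) p.2) := by
    intro n r r' m
    have := congrArg (fun T : Module.End ℂ (ℕ → ℕ → ℕ → W ⊗[ℂ] W) => μ (T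
      (fun s s' t => ∑ p ∈ Finset.HasAntidiagonal.antidiagonal t, v s p.1 ⊗ₜ[ℂ] w s' p.2) r r' m))
      (e1 n)
    simp only [LinearMap.smul_apply, LinearMap.sum_apply, Finset.sum_apply, Pi.smul_apply, map_sum,
      map_smul, e2] at this
    simpa only [map_smul] using this
  simp only [map_sum, e3]
  rw [formalProd, sum_range_range_eq_box (Nat.lt_succ_self t), sum_box_eq_sum_antidiagonal
    (fun n hn => Nat.lt_succ_iff.2 hn) (fun k l => starCoeff k l •
      ∑ p ∈ Finset.HasAntidiagonal.antidiagonal (t - (k + l)),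
        ∑ r ∈ Finset.HasAntidiagonal.antidiagonal (s + 2 * k), C k l (v r.1 p.1) (w r.2 p.2)),
    Finset.sum_comm]
  refine Finset.sum_congr rfl fun n hn => ?_
  rw [if_pos (Nat.lt_succ_iff.1 (Finset.mem_range.1 hn)), Finset.sum_comm]
  refine Finset.sum_congr rfl fun k hk => ?_
  rw [Finset.HasAntidiagonal.mem_antidiagonal] at hk
  rw [hk, ← Finset.smul_sum]
  congr 1
  exact (Finset.sum_congr rfl fun p _ => sum_antidiagonal_shift
    fun r r' h => h0 _ _ _ _ _ _ h).trans Finset.sum_comm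

end Exponential

/-! ### Smooth functions with finite-dimensional range -/

section Finite

theorem finite_exteriorAlgebra {N : Type*} [AddCommGroup N] [Module ℝ N] [FiniteDimensional ℝ N] :
    FiniteDimensional ℝ (ExteriorAlgebra ℝ N) := by
  have h : (⨆ d : Fin (Module.finrank ℝ N + 1), ⋀[ℝ]^(d : ℕ) N) = ⊤ := by
    refine eq_top_iff.2 fun α _ => ?_
    induction α using exterior_induction with
    | hadd α β hα hβ => exact Submodule.add_mem _ (hα trivial) (hβ trivial)
    | h d α hα =>
      by_cases hd : d < Module.finrank ℝ N + 1
      · exact Submodule.mem_iSup_of_mem (⟨d, hd⟩ : Fin _) hα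
      · rw [exteriorPower_eq_zero_of_finrank_lt (by omega) hα]
        exact Submodule.zero_mem _
  have : FiniteDimensional ℝ (⊤ : Submodule ℝ (ExteriorAlgebra ℝ N)) := by
    rw [← h]
    infer_instance
  exact Module.finite_def.2 (Submodule.fg_top _ |>.1 this.fg_top)

instance finite_symDegree {V : Type*} [AddCommGroup V] [Module ℝ V] {F : Type*} [AddCommGroup F]
    [Module ℝ F] [FiniteDimensional ℝ V] [FiniteDimensional ℝ F] (s : ℕ) :
    FiniteDimensional ℂ (symDegree V F s) := by
  have h1 : Module.Finite ℝ ↥((LinearMap.range (SymmetricAlgebra.ι ℝ (Module.Dual ℝ V))) ^ s) := by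
    rw [Module.Finite.iff_fg, LinearMap.range_eq_map]
    exact Submodule.FG.pow (Submodule.FG.map _ Module.Finite.fg_top) s
  have h2 : FiniteDimensional ℝ (ExteriorAlgebra ℝ (Module.Dual ℝ F)) := finite_exteriorAlgebra
  have h3 : FiniteDimensional ℝ (ExteriorAlgebra ℝ (Module.Dual ℝ V)) := finite_exteriorAlgebra
  unfold symDegree
  infer_instance

end Finite

section Calculus

variable {B : Type*} [NormedAddCommGroup B] [NormedSpace ℝ B]
  {M : Type*} [TopologicalSpace M] [ChartedSpace B M]

/-- `f` is near `x` a finite sum `∑ cᵢ wᵢ` with `cᵢ` real functions which are smooth at `x` and `wᵢ`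
constant vectors, and `f'` is the corresponding derivative `∑ dcᵢ wᵢ` at `x`. No topology on the
vector space `W` is involved. -/
inductive HasFiniteDeriv {W : Type*} [AddCommGroup W] [Module ℂ W] (x : M) :
    (M → W) → (TangentSpace 𝓘(ℝ, B) x → W) → Prop
  | smul_const (c : M → ℝ) (hc : ContMDiffAt 𝓘(ℝ, B) 𝓘(ℝ, ℝ) ∞ c x) (w : W) :
      HasFiniteDeriv x (fun y => (c y : ℂ) • w)
        (fun X => ((mvfderiv 𝓘(ℝ, B) c x X : ℝ) : ℂ) • w)
  | add {f g : M → W} {f' g' : TangentSpace 𝓘(ℝ, B) x → W} : HasFiniteDeriv x f f' →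
      HasFiniteDeriv x g g' → HasFiniteDeriv x (fun y => f y + g y) (fun X => f' X + g' X)
  | congr {f g : M → W} {f' : TangentSpace 𝓘(ℝ, B) x → W} : HasFiniteDeriv x f f' →
      (∀ᶠ y in nhds x, g y = f y) → HasFiniteDeriv x g f'

variable {W : Type*} [AddCommGroup W] [Module ℂ W] {W₁ : Type*} [AddCommGroup W₁] [Module ℂ W₁]
  {W₂ : Type*} [AddCommGroup W₂] [Module ℂ W₂] {x : M} {f g : M → W}
  {f' g' : TangentSpace 𝓘(ℝ, B) x → W}

namespace HasFiniteDeriv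

theorem congr_deriv (h : HasFiniteDeriv x f f') (e : ∀ X, f' X = g' X) :
    HasFiniteDeriv x f g' := by
  rwa [← funext e]

theorem const (w : W) : HasFiniteDeriv (B := B) x (fun _ => w) (fun _ => 0) := by
  have h := HasFiniteDeriv.smul_const (B := B) (x := x) (fun _ => 1) contMDiffAt_const w
  refine (h.congr (Filter.Eventually.of_forall fun y => ?_)).congr_deriv fun X => ?_
  · simp only [Complex.ofReal_one, one_smul]
  · rw [mvfderiv_const, zero_apply, Complex.ofReal_zero, zero_smul]

theorem sum {σ : Type*} {f : σ → M → W} {f' : σ → TangentSpace 𝓘(ℝ, B) x → W} (s : Finset σ)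
    (h : ∀ i ∈ s, HasFiniteDeriv x (f i) (f' i)) :
    HasFiniteDeriv x (fun y => ∑ i ∈ s, f i y) (fun X => ∑ i ∈ s, f' i X) := by
  classical
  induction s using Finset.induction_on with
  | empty =>
    simp only [Finset.sum_empty]
    exact const 0
  | insert a s ha ih =>
    simp only [Finset.sum_insert ha]
    exact (h a (Finset.mem_insert_self _ _)).add (ih fun i hi => h i (Finset.mem_insert_of_mem hi))

/-- Composition with an additive map which commutes with real scalars. -/
theorem map_real (h : HasFiniteDeriv x f f') (L : W →+ W₁)
    (hL : ∀ (r : ℝ) w, L ((r : ℂ) • w) = (r : ℂ) • L w) :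
    HasFiniteDeriv x (fun y => L (f y)) (fun X => L (f' X)) := by
  induction h with
  | smul_const c hc w => simpa only [hL] using smul_const c hc (L w)
  | add _ _ h1 h2 => simpa only [map_add] using h1.add h2
  | congr _ h ih => exact ih.congr (h.mono fun y hy => by rw [hy])

theorem map (h : HasFiniteDeriv x f f') (L : W →ₗ[ℂ] W₁) :
    HasFiniteDeriv x (fun y => L (f y)) (fun X => L (f' X)) :=
  h.map_real L.toAddMonoidHom fun _ w => L.map_smul _ w

theorem real_smul (h : HasFiniteDeriv x f f') {c : M → ℝ}
    (hc : ContMDiffAt 𝓘(ℝ, B) 𝓘(ℝ, ℝ) ∞ c x) :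
    HasFiniteDeriv x (fun y => (c y : ℂ) • f y)
      (fun X => ((mvfderiv 𝓘(ℝ, B) c x X : ℝ) : ℂ) • f x + (c x : ℂ) • f' X) := by
  induction h with
  | smul_const d hd w =>
    have h := smul_const (fun y => c y * d y) (hc.mul hd) w
    refine (h.congr (Filter.Eventually.of_forall fun y => ?_)).congr_deriv fun X => ?_
    · rw [smul_smul, Complex.ofReal_mul]
    · rw [mvfderiv_fun_mul (hc.mdifferentiableAt (by simp)) (hd.mdifferentiableAt (by simp))]
      simp only [_root_.add_apply, _root_.smul_apply, smul_eq_mul,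
        Complex.ofReal_add, Complex.ofReal_mul, smul_smul, ← add_smul]
      ring_nf
  | add _ _ h1 h2 =>
    refine ((h1.add h2).congr (Filter.Eventually.of_forall fun y => smul_add _ _ _)).congr_deriv
      fun X => ?_
    module
  | congr _ h ih =>
    rw [h.self_of_nhds]
    exact ih.congr (h.mono fun y hy => by rw [hy])

theorem bilinear {f : M → W₁} {f' : TangentSpace 𝓘(ℝ, B) x → W₁} {g : M → W₂}
    {g' : TangentSpace 𝓘(ℝ, B) x → W₂} (hf : HasFiniteDeriv x f f') (hg : HasFiniteDeriv x g g')
    (L : W₁ →ₗ[ℂ] W₂ →ₗ[ℂ] W) :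
    HasFiniteDeriv x (fun y => L (f y) (g y)) (fun X => L (f' X) (g x) + L (f x) (g' X)) := by
  induction hf with
  | smul_const c hc w =>
    refine (((hg.map (L w)).real_smul hc).congr (Filter.Eventually.of_forall fun y => ?_)).congr_deriv
      fun X => ?_
    · rw [map_smul, LinearMap.smul_apply]
    · rw [map_smul, map_smul, LinearMap.smul_apply, LinearMap.smul_apply]
  | add _ _ h1 h2 =>
    refine ((h1.add h2).congr (Filter.Eventually.of_forall fun y => ?_)).congr_deriv fun X => ?_
    · rw [map_add, LinearMap.add_apply]
    · simp only [map_add, LinearMap.add_apply]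
      abel
  | congr _ h ih =>
    rw [h.self_of_nhds]
    exact ih.congr (h.mono fun y hy => by rw [hy])

theorem apply_complex {f : M → ℂ} {f' : TangentSpace 𝓘(ℝ, B) x → ℂ} (h : HasFiniteDeriv x f f') :
    ContMDiffAt 𝓘(ℝ, B) 𝓘(ℝ, ℂ) ∞ f x ∧ ∀ X, mvfderiv 𝓘(ℝ, B) f x X = f' X := by
  induction h with
  | smul_const c hc w =>
    simp only [smul_eq_mul, ← Complex.real_smul]
    refine ⟨hc.smul contMDiffAt_const, fun X => ?_⟩
    rw [mvfderiv_fun_smul (hc.mdifferentiableAt (by simp)) mdifferentiableAt_const]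
    simp [mvfderiv_const]
  | add _ _ h1 h2 =>
    refine ⟨h1.1.add h2.1, fun X => ?_⟩
    rw [mvfderiv_fun_add (h1.1.mdifferentiableAt (by simp)) (h2.1.mdifferentiableAt (by simp)),
      _root_.add_apply, h1.2, h2.2]
  | congr _ h ih =>
    refine ⟨ih.1.congr_of_eventuallyEq h, fun X => ?_⟩
    rw [← ih.2 X, mvfderiv, mvfderiv, Filter.EventuallyEq.mfderiv_eq h]
    have := h.self_of_nhds
    simp only [ContinuousLinearMap.comp_apply]
    congr 1

end HasFiniteDeriv

theorem mvfderiv_congr {G : Type*} [NormedAddCommGroup G] [NormedSpace ℝ G] {f g : M → G}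
    (h : ∀ᶠ y in nhds x, g y = f y) : mvfderiv 𝓘(ℝ, B) g x = mvfderiv 𝓘(ℝ, B) f x := by
  ext X
  rw [mvfderiv, mvfderiv, Filter.EventuallyEq.mfderiv_eq h]
  rfl

theorem HasFiniteDeriv.dual (h : HasFiniteDeriv x f f') (ℓ : Module.Dual ℂ W) :
    ContMDiffAt 𝓘(ℝ, B) 𝓘(ℝ, ℂ) ∞ (fun y => ℓ (f y)) x :=
  (h.map ℓ).apply_complex.1

theorem HasFiniteDeriv.dual_deriv (h : HasFiniteDeriv x f f') (ℓ : Module.Dual ℂ W)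
    (X : TangentSpace 𝓘(ℝ, B) x) : mvfderiv 𝓘(ℝ, B) (fun y => ℓ (f y)) x X = ℓ (f' X) :=
  (h.map ℓ).apply_complex.2 X

theorem HasFiniteDeriv.of_real {c : M → ℝ} (hc : ContMDiffAt 𝓘(ℝ, B) 𝓘(ℝ, ℝ) ∞ c x) :
    HasFiniteDeriv x (fun y => (c y : ℂ)) (fun X => ((mvfderiv 𝓘(ℝ, B) c x X : ℝ) : ℂ)) := by
  simpa only [smul_eq_mul, mul_one] using HasFiniteDeriv.smul_const c hc (1 : ℂ)

theorem HasFiniteDeriv.complex_smul (hf : HasFiniteDeriv x f f') {c : M → ℂ}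
    {c' : TangentSpace 𝓘(ℝ, B) x → ℂ} (hc : HasFiniteDeriv x c c') :
    HasFiniteDeriv x (fun y => c y • f y) (fun X => c' X • f x + c x • f' X) :=
  hc.bilinear hf (LinearMap.lsmul ℂ W)

/-- The real and imaginary part of a smooth complex function as a finite sum. -/
theorem HasFiniteDeriv.of_complex {c : M → ℂ} (hc : ContMDiffAt 𝓘(ℝ, B) 𝓘(ℝ, ℂ) ∞ c x) :
    HasFiniteDeriv x c (fun X => mvfderiv 𝓘(ℝ, B) c x X) := by
  have hre : ContMDiffAt 𝓘(ℝ, B) 𝓘(ℝ, ℝ) ∞ (fun y => (c y).re) x :=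
    (Complex.reCLM.contMDiff.contMDiffAt).comp x hc
  have him : ContMDiffAt 𝓘(ℝ, B) 𝓘(ℝ, ℝ) ∞ (fun y => (c y).im) x :=
    (Complex.imCLM.contMDiff.contMDiffAt).comp x hc
  have h := ((HasFiniteDeriv.smul_const _ hre (1 : ℂ)).add
    (HasFiniteDeriv.smul_const _ him Complex.I)).congr (g := c)
    (Filter.Eventually.of_forall fun y => by
      simp only [smul_eq_mul, mul_one, Complex.re_add_im])
  exact h.congr_deriv fun X => (h.apply_complex.2 X).symm

variable (x) in
/-- Functions which are near `x` finite sums of smooth functions times constant vectors. -/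
def IsFiniteSmoothAt (f : M → W) : Prop := ∃ f' : TangentSpace 𝓘(ℝ, B) x → W, HasFiniteDeriv x f f'

/-- A finite-dimensional subspace has finitely many vectors and global linear forms which recover its
elements. -/
theorem exists_coefficients (S : Submodule ℂ W) [FiniteDimensional ℂ S] :
    ∃ (n : ℕ) (ℓ : Fin n → Module.Dual ℂ W) (w : Fin n → W), (∀ i, w i ∈ S) ∧
      ∀ a ∈ S, ∑ i, ℓ i a • w i = a := by
  obtain ⟨p, hp⟩ := S.subtype.exists_leftInverse_of_injective S.ker_subtype
  refine ⟨_, fun i => (Module.finBasis ℂ S).coord i ∘ₗ p, fun i => (Module.finBasis ℂ S i : W),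
    fun i => (Module.finBasis ℂ S i).2, fun a ha => ?_⟩
  have h := congrArg (fun a : S => (a : W)) ((Module.finBasis ℂ S).sum_repr ⟨a, ha⟩)
  simp only [Submodule.coe_sum, Submodule.coe_smul] at h
  have hp' : p a = ⟨a, ha⟩ := LinearMap.congr_fun hp ⟨a, ha⟩
  simpa only [LinearMap.comp_apply, hp', Module.Basis.coord_apply] using h

/-- Functions with values in a finite-dimensional subspace are finitely smooth as soon as all
components are smooth. -/
theorem isFiniteSmoothAt_of_dual (S : Submodule ℂ W) [FiniteDimensional ℂ S]
    (hS : ∀ᶠ y in nhds x, f y ∈ S)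
    (hf : ∀ ℓ : Module.Dual ℂ W, ContMDiffAt 𝓘(ℝ, B) 𝓘(ℝ, ℂ) ∞ (fun y => ℓ (f y)) x) :
    IsFiniteSmoothAt (B := B) x f := by
  obtain ⟨n, ℓ, w, -, hw⟩ := exists_coefficients S
  exact ⟨_, (HasFiniteDeriv.sum Finset.univ fun i _ => (HasFiniteDeriv.const (w i)).complex_smul
    (HasFiniteDeriv.of_complex (hf (ℓ i)))).congr (hS.mono fun y hy => (hw _ hy).symm)⟩

namespace IsFiniteSmoothAt

variable {f g : M → W}

theorem dual (h : IsFiniteSmoothAt (B := B) x f) (ℓ : Module.Dual ℂ W) :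
    ContMDiffAt 𝓘(ℝ, B) 𝓘(ℝ, ℂ) ∞ (fun y => ℓ (f y)) x :=
  h.choose_spec.dual ℓ

theorem add (hf : IsFiniteSmoothAt (B := B) x f) (hg : IsFiniteSmoothAt (B := B) x g) :
    IsFiniteSmoothAt (B := B) x (fun y => f y + g y) :=
  let ⟨_, hf⟩ := hf; let ⟨_, hg⟩ := hg; ⟨_, hf.add hg⟩

theorem congr (hf : IsFiniteSmoothAt (B := B) x f) (h : ∀ᶠ y in nhds x, g y = f y) :
    IsFiniteSmoothAt (B := B) x g :=
  let ⟨_, hf⟩ := hf; ⟨_, hf.congr h⟩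

theorem sum {σ : Type*} {f : σ → M → W} (s : Finset σ)
    (h : ∀ i ∈ s, IsFiniteSmoothAt (B := B) x (f i)) :
    IsFiniteSmoothAt (B := B) x (fun y => ∑ i ∈ s, f i y) := by
  classical
  induction s using Finset.induction_on with
  | empty =>
    simp only [Finset.sum_empty]
    exact ⟨_, .const 0⟩
  | insert a s ha ih =>
    simp only [Finset.sum_insert ha]
    exact (h a (Finset.mem_insert_self _ _)).add (ih fun i hi => h i (Finset.mem_insert_of_mem hi))

theorem map (hf : IsFiniteSmoothAt (B := B) x f) (L : W →ₗ[ℂ] W₁) :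
    IsFiniteSmoothAt (B := B) x (fun y => L (f y)) :=
  let ⟨_, hf⟩ := hf; ⟨_, hf.map L⟩

theorem bilinear {f : M → W₁} {g : M → W₂} (hf : IsFiniteSmoothAt (B := B) x f)
    (hg : IsFiniteSmoothAt (B := B) x g) (L : W₁ →ₗ[ℂ] W₂ →ₗ[ℂ] W) :
    IsFiniteSmoothAt (B := B) x (fun y => L (f y) (g y)) :=
  let ⟨_, hf⟩ := hf; let ⟨_, hg⟩ := hg; ⟨_, hf.bilinear hg L⟩

theorem real_smul (hf : IsFiniteSmoothAt (B := B) x f) {c : M → ℝ}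
    (hc : ContMDiffAt 𝓘(ℝ, B) 𝓘(ℝ, ℝ) ∞ c x) :
    IsFiniteSmoothAt (B := B) x (fun y => (c y : ℂ) • f y) :=
  let ⟨_, hf⟩ := hf; ⟨_, hf.real_smul hc⟩

theorem const (w : W) : IsFiniteSmoothAt (B := B) x (fun _ => w) := ⟨_, .const w⟩

end IsFiniteSmoothAt

section Field

variable [IsManifold 𝓘(ℝ, B) ∞ M]

/-- The derivative of a smooth function along a coordinate field is smooth. -/
theorem contMDiffAt_mvfderiv {G : Type*} [NormedAddCommGroup G] [NormedSpace ℝ G] {c : M → G}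
    (hc : ContMDiffAt 𝓘(ℝ, B) 𝓘(ℝ, G) ∞ c x) (v : B) :
    ContMDiffAt 𝓘(ℝ, B) 𝓘(ℝ, G) ∞ (fun y => mvfderiv 𝓘(ℝ, B) c y
      ((trivializationAt B (TangentSpace 𝓘(ℝ, B) : M → Type _) x).symmL ℝ y v)) x := by
  have : IsManifold 𝓘(ℝ, B) 1 M := .of_le (n := ∞) (by simp)
  have h := (hc.mfderiv_const (m := ∞) (by simp)).clm_apply (contMDiffAt_const (c := v))
  refine h.congr_of_eventuallyEq (Filter.Eventually.of_forall fun y => ?_)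
  simp only [inTangentCoordinates, ContinuousLinearMap.inCoordinates,
    TangentBundle.continuousLinearMapAt_model_space]
  rfl

/-- The derivative of a smooth function with values in a finite-dimensional subspace, as a field. -/
theorem exists_deriv_field (S : Submodule ℂ W) [FiniteDimensional ℂ S] {U : Set M}
    (hS : ∀ y, f y ∈ S)
    (hf : ∀ y ∈ U, ∀ ℓ : Module.Dual ℂ W,
      ContMDiffAt 𝓘(ℝ, B) 𝓘(ℝ, ℂ) ∞ (fun y => ℓ (f y)) y) :
    ∃ D : (y : M) → TangentSpace 𝓘(ℝ, B) y → W, (∀ y ∈ U, HasFiniteDeriv y f (D y)) ∧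
      ∀ y ∈ U, ∀ v : B, IsFiniteSmoothAt (B := B) y (fun z => D z
        ((trivializationAt B (TangentSpace 𝓘(ℝ, B) : M → Type _) y).symmL ℝ z v)) := by
  obtain ⟨n, ℓ, w, -, hw⟩ := exists_coefficients S
  refine ⟨fun y X => ∑ i, mvfderiv 𝓘(ℝ, B) (fun y => ℓ i (f y)) y X • w i, fun y hy => ?_,
    fun y hy v => ?_⟩
  · refine ((HasFiniteDeriv.sum Finset.univ fun i _ => (HasFiniteDeriv.const (w i)).complex_smul
      (HasFiniteDeriv.of_complex (hf y hy (ℓ i)))).congr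
        (Filter.Eventually.of_forall fun y => (hw _ (hS y)).symm)).congr_deriv fun X => ?_
    simp only [smul_zero, add_zero]
  · refine IsFiniteSmoothAt.sum _ fun i _ => ⟨_, (HasFiniteDeriv.const (w i)).complex_smul
      (HasFiniteDeriv.of_complex (contMDiffAt_mvfderiv (hf y hy (ℓ i)) v))⟩

end Field

end Calculus

/-! ### Local representatives of sections -/

section Transport

variable {M : Type*} [TopologicalSpace M]
  (F : Type*) [NormedAddCommGroup F] [NormedSpace ℝ F]
  (E : M → Type*) [∀ x, AddCommGroup (E x)] [∀ x, Module ℝ (E x)]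
  [∀ x, TopologicalSpace (E x)] [TopologicalSpace (Bundle.TotalSpace F E)]
  [FiberBundle F E] [VectorBundle ℝ F E]

/-- The domain of the preferred trivialization at `x`. -/
abbrev frameDomain (x : M) : Set M := (trivializationAt F E x).baseSet

theorem mem_frameDomain (x : M) : x ∈ frameDomain F E x :=
  FiberBundle.mem_baseSet_trivializationAt' x

theorem frameDomain_mem_nhds (x : M) : frameDomain F E x ∈ nhds x :=
  (trivializationAt F E x).open_baseSet.mem_nhds (mem_frameDomain F E x)

/-- The isomorphism `E_x ≃ E_y` given by the preferred local frame around `x`. -/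
def transportEquiv (x : M) {y : M} (hy : y ∈ frameDomain F E x) : E x ≃ₗ[ℝ] E y :=
  ((trivializationAt F E x).linearEquivAt ℝ x (mem_frameDomain F E x)).trans
    ((trivializationAt F E x).linearEquivAt ℝ y hy).symm

theorem transportEquiv_toLinearMap (x : M) {y : M} (hy : y ∈ frameDomain F E x) :
    (transportEquiv F E x hy).toLinearMap = fibreTransport F E x y := by
  ext e
  have h1 := (trivializationAt F E x).linearMapAt_def_of_mem (R := ℝ) (mem_frameDomain F E x)
  have h2 := (trivializationAt F E x).symmₗ_apply (R := ℝ) hy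
  change ((trivializationAt F E x).linearEquivAt ℝ y hy).symm
    ((trivializationAt F E x).linearEquivAt ℝ x (mem_frameDomain F E x) e) =
    (trivializationAt F E x).symmₗ ℝ y ((trivializationAt F E x).linearMapAt ℝ x e)
  rw [h1, h2]
  rfl

theorem fibreTransport_self (x : M) : fibreTransport F E x x = LinearMap.id := by
  rw [← transportEquiv_toLinearMap F E x (mem_frameDomain F E x)]
  ext e
  exact LinearEquiv.symm_apply_apply _ _

variable [FiniteDimensional ℝ F]

theorem fibreBasis_map_transportEquiv (x : M) {y : M} (hy : y ∈ frameDomain F E x) :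
    (fibreBasis F E x).map (transportEquiv F E x hy) =
      (trivializationAt F E x).basisAt (Module.finBasis ℝ F) hy := by
  ext A
  rw [Module.Basis.map_apply]
  change ((trivializationAt F E x).linearEquivAt ℝ y hy).symm
    ((trivializationAt F E x).linearEquivAt ℝ x (mem_frameDomain F E x)
      (((trivializationAt F E x).linearEquivAt ℝ x (mem_frameDomain F E x)).symm
        (Module.finBasis ℝ F A))) = _
  rw [LinearEquiv.apply_symm_apply]
  rfl

theorem transportEquiv_fibreBasis (x : M) {y : M} (hy : y ∈ frameDomain F E x)
    (A : Fin (Module.finrank ℝ F)) :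
    transportEquiv F E x hy (fibreBasis F E x A) = fibreFrame F E x A y := by
  rw [← Module.Basis.map_apply, fibreBasis_map_transportEquiv, fibreFrame,
    (trivializationAt F E x).localFrame_apply_of_mem_baseSet _ hy]

theorem fibreTransport_fibreBasis (x : M) {y : M} (hy : y ∈ frameDomain F E x)
    (A : Fin (Module.finrank ℝ F)) :
    fibreTransport F E x y (fibreBasis F E x A) = fibreFrame F E x A y := by
  rw [← transportEquiv_toLinearMap F E x hy, LinearEquiv.coe_coe, transportEquiv_fibreBasis]

theorem fibreFrame_self (x : M) (A : Fin (Module.finrank ℝ F)) :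
    fibreFrame F E x A x = fibreBasis F E x A := by
  rw [← fibreTransport_fibreBasis F E x (mem_frameDomain F E x), fibreTransport_self,
    LinearMap.id_apply]

theorem fibreFrame_eq_symmL (x : M) {y : M} (hy : y ∈ frameDomain F E x)
    (A : Fin (Module.finrank ℝ F)) :
    fibreFrame F E x A y = (trivializationAt F E x).symmL ℝ y (Module.finBasis ℝ F A) := by
  rw [fibreFrame, (trivializationAt F E x).localFrame_apply_of_mem_baseSet _ hy]
  exact ((trivializationAt F E x).symmₗ_apply (R := ℝ) hy _).symm

end Transport

theorem finite_fibre {M : Type*} [TopologicalSpace M]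
    (F : Type*) [NormedAddCommGroup F] [NormedSpace ℝ F] [FiniteDimensional ℝ F]
    (E : M → Type*) [∀ x, AddCommGroup (E x)] [∀ x, Module ℝ (E x)]
    [∀ x, TopologicalSpace (E x)] [TopologicalSpace (Bundle.TotalSpace F E)]
    [FiberBundle F E] [VectorBundle ℝ F E] (x : M) : FiniteDimensional ℝ (E x) :=
  Module.Finite.of_basis (fibreBasis F E x)

section LocalRep

variable {B : Type*} [NormedAddCommGroup B] [NormedSpace ℝ B] [FiniteDimensional ℝ B]
  {M : Type*} [TopologicalSpace M] [ChartedSpace B M] [IsManifold 𝓘(ℝ, B) ∞ M]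
  (F : Type*) [NormedAddCommGroup F] [NormedSpace ℝ F] [FiniteDimensional ℝ F]
  {E : M → Type*} [∀ x, AddCommGroup (E x)] [∀ x, Module ℝ (E x)]
  [∀ x, TopologicalSpace (E x)] [TopologicalSpace (Bundle.TotalSpace F E)]
  [FiberBundle F E] [VectorBundle ℝ F E]

/-- The tangent bundle as a family of vector spaces. -/
abbrev TangentFamily (B : Type*) [NormedAddCommGroup B] [NormedSpace ℝ B] (M : Type*)
    [TopologicalSpace M] [ChartedSpace B M] : M → Type _ := TangentSpace 𝓘(ℝ, B)

theorem tangentTransport_eq (x y : M) :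
    tangentTransport B x y = fibreTransport B (TangentFamily B M) x y := rfl

theorem tangentBasis_eq (x : M) : tangentBasis B x = fibreBasis B (TangentFamily B M) x := rfl

theorem tangentFrame_eq (x : M) (i : Fin (Module.finrank ℝ B)) :
    tangentFrame B x i = fibreFrame B (TangentFamily B M) x i := rfl

variable (B E) in
/-- The intersection of the domains of the preferred trivializations of `TM` and `E` at `x`. -/
def commonDomain (x : M) : Set M := frameDomain B (TangentFamily B M) x ∩ frameDomain F E x

variable (B E) in
theorem commonDomain_mem_nhds (x : M) : commonDomain B F E x ∈ nhds x :=
  Filter.inter_mem (frameDomain_mem_nhds _ _ x) (frameDomain_mem_nhds _ _ x)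

theorem localRep_eq (x : M) (u : (y : M) → FibreAlg (TangentSpace 𝓘(ℝ, B) y) (E y)) {y : M}
    (hy : y ∈ commonDomain B F E x) : localRep B F x u y =
      pull (transportEquiv B (TangentFamily B M) x hy.1).toLinearMap
        (transportEquiv F E x hy.2).toLinearMap (u y) := by
  rw [localRep, transportEquiv_toLinearMap, transportEquiv_toLinearMap, tangentTransport_eq]

theorem localRep_self (x : M) (u : (y : M) → FibreAlg (TangentSpace 𝓘(ℝ, B) y) (E y)) :
    localRep B F x u x = u x := by
  rw [localRep, tangentTransport_eq, fibreTransport_self, fibreTransport_self, pull_id]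

/-- The components of `u` in local frames are smooth and lie in a finite-dimensional space. -/
theorem isFiniteSmoothAt_localRep {s : ℕ}
    {u : (y : M) → FibreAlg (TangentSpace 𝓘(ℝ, B) y) (E y)}
    (hu : ∀ y, u y ∈ symDegree (TangentSpace 𝓘(ℝ, B) y) (E y) s) (h : IsSmooth B F u) (x : M) :
    IsFiniteSmoothAt (B := B) x (localRep B F x u) := by
  have := finite_fibre F E x
  have : FiniteDimensional ℝ (TangentSpace 𝓘(ℝ, B) x) := finite_fibre B (TangentFamily B M) x
  exact isFiniteSmoothAt_of_dual (symDegree _ _ s)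
    (Filter.Eventually.of_forall fun y => pull_mem_symDegree _ _ (hu y)) (h x)

theorem isSmooth_of_isFiniteSmoothAt {u : (y : M) → FibreAlg (TangentSpace 𝓘(ℝ, B) y) (E y)}
    (h : ∀ x, IsFiniteSmoothAt (B := B) x (localRep B F x u)) : IsSmooth B F u :=
  fun x ℓ => (h x).dual ℓ

/-- As the forms of a given symmetric degree span a finite-dimensional space, smoothness of all
components is the same as being locally a finite sum of smooth functions times constant vectors. -/
theorem mem_fedosovAlgebra_iff {w : RawSection B E} : w ∈ fedosovAlgebra B F E ↔
    (∀ x s t, w x s t ∈ symDegree (TangentSpace 𝓘(ℝ, B) x) (E x) s) ∧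
    ∀ s t x, IsFiniteSmoothAt (B := B) x (localRep B F x fun y => w y s t) :=
  ⟨fun h => ⟨h.1, fun s t => isFiniteSmoothAt_localRep F (fun y => h.1 y s t) (h.2 s t)⟩,
    fun h => ⟨h.1, fun s t => isSmooth_of_isFiniteSmoothAt F (h.2 s t)⟩⟩

/-- A fibrewise linear operator which has constant coefficients in local frames maps smooth
sections to smooth sections. -/
theorem isFiniteSmoothAt_of_intertwine {x : M}
    {u u' : (y : M) → FibreAlg (TangentSpace 𝓘(ℝ, B) y) (E y)}
    (T : Module.End ℂ (FibreAlg (TangentSpace 𝓘(ℝ, B) x) (E x)))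
    (hu : IsFiniteSmoothAt (B := B) x (localRep B F x u))
    (h : ∀ y ∈ commonDomain B F E x, localRep B F x u' y = T (localRep B F x u y)) :
    IsFiniteSmoothAt (B := B) x (localRep B F x u') :=
  (hu.map T).congr (Filter.mem_of_superset (commonDomain_mem_nhds B F E x) h)

theorem localRep_onE_extWeight (x y : M) (u : (y : M) → FibreAlg (TangentSpace 𝓘(ℝ, B) y) (E y))
    (c : ℕ → ℝ) : localRep B F x (fun y => onE (extWeight _ c) (u y)) y =
      onE (extWeight _ c) (localRep B F x u y) :=
  pull_onE_extWeight _ _ _ _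

theorem localRep_onForms_extWeight (x y : M)
    (u : (y : M) → FibreAlg (TangentSpace 𝓘(ℝ, B) y) (E y))
    (c : ℕ → ℝ) : localRep B F x (fun y => onForms (extWeight _ c) (u y)) y =
      onForms (extWeight _ c) (localRep B F x u y) :=
  pull_onForms_extWeight _ _ _ _

theorem localRep_fibreDelta {x y : M} (hy : y ∈ commonDomain B F E x)
    (u : (y : M) → FibreAlg (TangentSpace 𝓘(ℝ, B) y) (E y)) :
    localRep B F x (fun y => fibreDelta (tangentBasis B y) (u y)) y =
      fibreDelta (tangentBasis B x) (localRep B F x u y) := by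
  rw [localRep_eq F x _ hy, localRep_eq F x _ hy, fibreDelta_change_basis
    ((tangentBasis B x).map (transportEquiv B (TangentFamily B M) x hy.1)), pull_fibreDelta]

theorem localRep_fibreDeltaStar {x y : M} (hy : y ∈ commonDomain B F E x)
    (u : (y : M) → FibreAlg (TangentSpace 𝓘(ℝ, B) y) (E y)) :
    localRep B F x (fun y => fibreDeltaStar (tangentBasis B y) (u y)) y =
      fibreDeltaStar (tangentBasis B x) (localRep B F x u y) := by
  rw [localRep_eq F x _ hy, localRep_eq F x _ hy, fibreDeltaStar_change_basis
    ((tangentBasis B x).map (transportEquiv B (TangentFamily B M) x hy.1)), pull_fibreDeltaStar]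

end LocalRep

/-! ### Smoothness of the Poisson tensor and of the deformed product -/

section InverseMatrix

variable {B : Type*} [NormedAddCommGroup B] [NormedSpace ℝ B]
  {M : Type*} [TopologicalSpace M] [ChartedSpace B M] {ι : Type*} [Fintype ι] [DecidableEq ι]
  {x : M} {G : M → Matrix ι ι ℝ}

theorem contMDiffAt_det (hG : ∀ i j, ContMDiffAt 𝓘(ℝ, B) 𝓘(ℝ, ℝ) ∞ (fun y => G y i j) x) :
    ContMDiffAt 𝓘(ℝ, B) 𝓘(ℝ, ℝ) ∞ (fun y => (G y).det) x := by
  simp only [Matrix.det_apply, Units.smul_def, zsmul_eq_mul]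
  exact ContMDiffAt.sum fun σ _ => contMDiffAt_const.mul (contMDiffAt_finsetProd fun i _ => hG _ _)

/-- The entries of the inverse are smooth by Cramer's rule. -/
theorem contMDiffAt_inv_matrix
    (hG : ∀ i j, ContMDiffAt 𝓘(ℝ, B) 𝓘(ℝ, ℝ) ∞ (fun y => G y i j) x)
    (h : IsUnit (G x).det) (i j : ι) :
    ContMDiffAt 𝓘(ℝ, B) 𝓘(ℝ, ℝ) ∞ (fun y => (G y)⁻¹ i j) x := by
  have h1 : ContMDiffAt 𝓘(ℝ, B) 𝓘(ℝ, ℝ) ∞ (fun y => (G y).adjugate i j) x := by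
    simp only [Matrix.adjugate_apply]
    refine contMDiffAt_det fun k l => ?_
    by_cases hk : k = j
    · subst hk
      simp only [Matrix.updateRow_self]
      exact contMDiffAt_const
    · simp only [Matrix.updateRow_ne hk]
      exact hG k l
  have h2 : ContMDiffAt 𝓘(ℝ, B) 𝓘(ℝ, ℝ) ∞ (fun y => ((G y).det)⁻¹) x :=
    (contMDiffAt_det hG).inv₀ h.ne_zero
  refine (h2.mul h1).congr_of_eventuallyEq (Filter.Eventually.of_forall fun y => ?_)
  simp only [Matrix.inv_def, Ring.inverse_eq_inv', Matrix.smul_apply, smul_eq_mul]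
  rfl

/-- The derivative of the inverse matrix is `-G⁻¹ dG G⁻¹`. -/
theorem mvfderiv_inv_matrix
    (hG : ∀ i j, ContMDiffAt 𝓘(ℝ, B) 𝓘(ℝ, ℝ) ∞ (fun y => G y i j) x)
    (h : IsUnit (G x).det) (X : TangentSpace 𝓘(ℝ, B) x) :
    (Matrix.of fun i j => mvfderiv 𝓘(ℝ, B) (fun y => (G y)⁻¹ i j) x X) =
      -((G x)⁻¹ * (Matrix.of fun i j => mvfderiv 𝓘(ℝ, B) (fun y => G y i j) x X) * (G x)⁻¹) := by
  have hn : ∀ᶠ y in nhds x, (G y).det ≠ 0 :=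
    (contMDiffAt_det hG).continuousAt.eventually_ne h.ne_zero
  have h1 : ∀ i j, ∑ k, (mvfderiv 𝓘(ℝ, B) (fun y => (G y)⁻¹ i k) x X * G x k j +
      (G x)⁻¹ i k * mvfderiv 𝓘(ℝ, B) (fun y => G y k j) x X) = 0 := by
    intro i j
    have e : ∀ᶠ y in nhds x, (1 : Matrix ι ι ℝ) i j = ∑ k, (G y)⁻¹ i k * G y k j :=
      hn.mono fun y hy => by
        rw [← Matrix.mul_apply, Matrix.nonsing_inv_mul _ (isUnit_iff_ne_zero.2 hy)]
    have hs : HasFiniteDeriv x (fun y => ((∑ k, (G y)⁻¹ i k * G y k j : ℝ) : ℂ))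
        (fun X => ∑ k, ((mvfderiv 𝓘(ℝ, B) (fun y => (G y)⁻¹ i k) x X : ℝ) * (G x k j : ℂ) +
        ((G x)⁻¹ i k : ℂ) * ((mvfderiv 𝓘(ℝ, B) (fun y => G y k j) x X : ℝ) : ℂ))) := by
      refine (HasFiniteDeriv.sum Finset.univ fun k _ =>
        ((HasFiniteDeriv.of_real (hG k j)).complex_smul
          (HasFiniteDeriv.of_real (contMDiffAt_inv_matrix hG h i k)))).congr
          (Filter.Eventually.of_forall fun y => ?_)
      push_cast
      rfl
    have h2 := ((HasFiniteDeriv.const (((1 : Matrix ι ι ℝ) i j : ℝ) : ℂ)).congr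
      (e.mono fun y hy => congrArg Complex.ofReal hy.symm)).apply_complex.2 X
    rw [hs.apply_complex.2 X] at h2
    exact_mod_cast h2
  have h2 : (Matrix.of fun i j => mvfderiv 𝓘(ℝ, B) (fun y => (G y)⁻¹ i j) x X) * G x =
      -((G x)⁻¹ * (Matrix.of fun i j => mvfderiv 𝓘(ℝ, B) (fun y => G y i j) x X)) := by
    rw [eq_neg_iff_add_eq_zero]
    ext i j
    have := h1 i j
    rw [Finset.sum_add_distrib] at this
    simpa only [Matrix.add_apply, Matrix.mul_apply, Matrix.of_apply, Matrix.zero_apply] using this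
  rw [← Matrix.neg_mul, ← h2, Matrix.mul_assoc, Matrix.mul_nonsing_inv _ h, Matrix.mul_one]

end InverseMatrix

section Form

variable {B : Type*} [NormedAddCommGroup B] [NormedSpace ℝ B]
  {M : Type*} [TopologicalSpace M] [ChartedSpace B M] [IsManifold 𝓘(ℝ, B) ∞ M]
  {F : Type*} [NormedAddCommGroup F] [NormedSpace ℝ F]
  {E : M → Type*} [∀ x, AddCommGroup (E x)] [∀ x, Module ℝ (E x)]
  [∀ x, TopologicalSpace (E x)] [TopologicalSpace (Bundle.TotalSpace F E)]
  [∀ x, IsTopologicalAddGroup (E x)] [∀ x, ContinuousSMul ℝ (E x)]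
  [FiberBundle F E] [VectorBundle ℝ F E] [ContMDiffVectorBundle ∞ F E 𝓘(ℝ, B)]
  {β : (x : M) → E x →L[ℝ] E x →L[ℝ] ℝ}

/-- Smoothness of a bilinear form on the fibres of a vector bundle. -/
abbrev IsSmoothForm (B : Type*) [NormedAddCommGroup B] [NormedSpace ℝ B]
    {M : Type*} [TopologicalSpace M] [ChartedSpace B M]
    (F : Type*) [NormedAddCommGroup F] [NormedSpace ℝ F]
    {E : M → Type*} [∀ x, AddCommGroup (E x)] [∀ x, Module ℝ (E x)]
    [∀ x, TopologicalSpace (E x)] [TopologicalSpace (Bundle.TotalSpace F E)]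
    [∀ x, IsTopologicalAddGroup (E x)] [∀ x, ContinuousSMul ℝ (E x)]
    [FiberBundle F E] [VectorBundle ℝ F E] (β : (x : M) → E x →L[ℝ] E x →L[ℝ] ℝ) : Prop :=
  ContMDiff 𝓘(ℝ, B) (𝓘(ℝ, B).prod 𝓘(ℝ, F →L[ℝ] F →L[ℝ] ℝ)) ∞
    (fun x => Bundle.TotalSpace.mk' (F →L[ℝ] F →L[ℝ] ℝ)
      (E := fun x : M => E x →L[ℝ] E x →L[ℝ] ℝ) x (β x))

theorem IsSmoothForm.apply (hβ : IsSmoothForm B F β) {e e' : (x : M) → E x} {x : M}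
    (he : CMDiffAt ∞ (T% e) x) (he' : CMDiffAt ∞ (T% e') x) :
    ContMDiffAt 𝓘(ℝ, B) 𝓘(ℝ, ℝ) ∞ (fun y => β y (e y) (e' y)) x := by
  have := ContMDiffAt.clm_bundle_apply₂ (F₁ := F) (F₂ := F) (F₃ := ℝ) (E₃ := Bundle.Trivial M ℝ)
    (hβ x) he he'
  simp only [Bundle.contMDiffAt_totalSpace] at this
  exact this.2

variable [FiniteDimensional ℝ F]

theorem contMDiffAt_fibreFrame (x : M) {y : M} (hy : y ∈ frameDomain F E x)
    (A : Fin (Module.finrank ℝ F)) : CMDiffAt ∞ (T% (fibreFrame F E x A)) y :=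
  contMDiffAt_localFrame_of_mem (I := 𝓘(ℝ, B)) ∞ (trivializationAt F E x) (Module.finBasis ℝ F) A hy

/-- The matrix of a bilinear form in the preferred frame around `x`. -/
def frameGram (β : (x : M) → E x →L[ℝ] E x →L[ℝ] ℝ) (x y : M) :
    Matrix (Fin (Module.finrank ℝ F)) (Fin (Module.finrank ℝ F)) ℝ :=
  Matrix.of fun A C => β y (fibreFrame F E x A y) (fibreFrame F E x C y)

theorem contMDiffAt_frameGram (hβ : IsSmoothForm B F β) (x : M) {y : M}
    (hy : y ∈ frameDomain F E x)
    (A C : Fin (Module.finrank ℝ F)) :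
    ContMDiffAt 𝓘(ℝ, B) 𝓘(ℝ, ℝ) ∞ (fun y => frameGram (F := F) β x y A C) y :=
  hβ.apply (contMDiffAt_fibreFrame x hy A) (contMDiffAt_fibreFrame x hy C)

theorem isUnit_det_gram {V ι : Type*} [AddCommGroup V] [Module ℝ V] [Fintype ι] [DecidableEq ι]
    {β : V →ₗ[ℝ] V →ₗ[ℝ] ℝ} (hβ : ∀ v, (∀ u, β v u = 0) → v = 0) (b : Module.Basis ι ℝ V) :
    IsUnit (Matrix.of fun i j => β (b i) (b j)).det := by
  rw [isUnit_iff_ne_zero]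
  intro h
  obtain ⟨v, hv, h0⟩ := Matrix.exists_vecMul_eq_zero_iff.2 h
  have h1 : ∑ i, v i • b i = 0 := hβ _ fun u => by
    have h2 : β (∑ i, v i • b i) = 0 := b.ext fun j => by
      have := congrFun h0 j
      simpa [Matrix.vecMul, dotProduct, LinearMap.sum_apply] using this
    rw [h2, LinearMap.zero_apply]
  exact hv (funext fun i => Fintype.linearIndependent_iff.1 b.linearIndependent v h1 i)

theorem isUnit_det_frameGram (hβ : ∀ x v, (∀ u, β x v u = 0) → v = 0) (x : M) {y : M}
    (hy : y ∈ frameDomain F E x) : IsUnit (frameGram (F := F) β x y).det := by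
  have h := isUnit_det_gram (β := (ContinuousLinearMap.coeLM ℝ).comp (β y).toLinearMap) (hβ y)
    ((fibreBasis F E x).map (transportEquiv F E x hy))
  simp only [Module.Basis.map_apply, transportEquiv_fibreBasis] at h
  exact h

end Form

/-! ### Bidifferential operators in local frames -/

section Powers

variable {B : Type*} [NormedAddCommGroup B] [NormedSpace ℝ B]
  {M : Type*} [TopologicalSpace M] [ChartedSpace B M] {x : M}

section Apply

variable {W : Type*} [AddCommGroup W] [Module ℂ W]

theorem IsFiniteSmoothAt.apply {f : M → Module.End ℂ W} {g : M → W}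
    (hf : IsFiniteSmoothAt (B := B) x f) (hg : IsFiniteSmoothAt (B := B) x g) :
    IsFiniteSmoothAt (B := B) x (fun y => f y (g y)) :=
  hf.bilinear hg LinearMap.id

theorem IsFiniteSmoothAt.pow_apply {f : M → Module.End ℂ W} (hf : IsFiniteSmoothAt (B := B) x f)
    (k : ℕ) {g : M → W} (hg : IsFiniteSmoothAt (B := B) x g) :
    IsFiniteSmoothAt (B := B) x (fun y => (f y ^ k) (g y)) := by
  induction k with
  | zero => simpa only [pow_zero, Module.End.one_apply] using hg
  | succ k ih => simpa only [pow_succ', Module.End.mul_apply] using hf.apply ih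

theorem HasFiniteDeriv.apply {f : M → Module.End ℂ W} {g : M → W}
    {f' : TangentSpace 𝓘(ℝ, B) x → Module.End ℂ W} {g' : TangentSpace 𝓘(ℝ, B) x → W}
    (hf : HasFiniteDeriv x f f') (hg : HasFiniteDeriv x g g') :
    HasFiniteDeriv x (fun y => f y (g y)) (fun X => f' X (g x) + f x (g' X)) :=
  hf.bilinear hg LinearMap.id

/-- If `f` is parallel for the connection with local form `d - ρ` on `W`, then the operators `fᵏ`
commute with the covariant derivative. -/
theorem HasFiniteDeriv.pow_apply {f : M → Module.End ℂ W}
    {f' ρ : TangentSpace 𝓘(ℝ, B) x → Module.End ℂ W} (hf : HasFiniteDeriv x f f')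
    (hρ : ∀ X a, f' X a = ρ X (f x a) - f x (ρ X a)) (k : ℕ)
    {g : M → W} {g' : TangentSpace 𝓘(ℝ, B) x → W}
    (hg : HasFiniteDeriv x g (fun X => ρ X (g x) + g' X)) :
    HasFiniteDeriv x (fun y => (f y ^ k) (g y))
      (fun X => ρ X ((f x ^ k) (g x)) + (f x ^ k) (g' X)) := by
  induction k with
  | zero => simpa only [pow_zero, Module.End.one_apply] using hg
  | succ k ih =>
    simp only [pow_succ', Module.End.mul_apply]
    refine (hf.apply ih).congr_deriv fun X => ?_
    rw [hρ, map_add]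
    abel

end Apply

section Bidiff

variable {A : Type*} [Ring A] [Algebra ℂ A]

/-- The extension `T ⊗ 1 + 1 ⊗ T` of an operator to the tensor square. -/
def diagonal (T : Module.End ℂ A) : Module.End ℂ (A ⊗[ℂ] A) :=
  TensorProduct.map T 1 + TensorProduct.map 1 T

variable {R S : M → Module.End ℂ (A ⊗[ℂ] A)} {f g : M → A}

theorem IsFiniteSmoothAt.bidiff (hR : IsFiniteSmoothAt (B := B) x R)
    (hS : IsFiniteSmoothAt (B := B) x S) (k l : ℕ) (hf : IsFiniteSmoothAt (B := B) x f)
    (hg : IsFiniteSmoothAt (B := B) x g) :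
    IsFiniteSmoothAt (B := B) x (fun y => bidiff (R y) (S y) k l (f y) (g y)) :=
  (hR.pow_apply k (hS.pow_apply l (hf.bilinear hg (TensorProduct.mk ℂ A A)))).map _

/-- The Leibniz rule for the bidifferential operators built from parallel `R` and `S`, with respect
to the connection with local form `d - ρ`, `ρ` a derivation. -/
theorem HasFiniteDeriv.bidiff {ρ : TangentSpace 𝓘(ℝ, B) x → Module.End ℂ A}
    {R' S' : TangentSpace 𝓘(ℝ, B) x → Module.End ℂ (A ⊗[ℂ] A)}
    (hρ : ∀ X a b, ρ X (a * b) = ρ X a * b + a * ρ X b)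
    (hR : HasFiniteDeriv x R R') (hS : HasFiniteDeriv x S S')
    (hR' : ∀ X a, R' X a = diagonal (ρ X) (R x a) - R x (diagonal (ρ X) a))
    (hS' : ∀ X a, S' X a = diagonal (ρ X) (S x a) - S x (diagonal (ρ X) a))
    (k l : ℕ) {f' g' : TangentSpace 𝓘(ℝ, B) x → A}
    (hf : HasFiniteDeriv x f (fun X => ρ X (f x) + f' X))
    (hg : HasFiniteDeriv x g (fun X => ρ X (g x) + g' X)) :
    HasFiniteDeriv x (fun y => bidiff (R y) (S y) k l (f y) (g y))
      (fun X => ρ X (bidiff (R x) (S x) k l (f x) (g x)) +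
        (bidiff (R x) (S x) k l (f' X) (g x) + bidiff (R x) (S x) k l (f x) (g' X))) := by
  have h0 := (hf.bilinear hg (TensorProduct.mk ℂ A A)).congr_deriv
    (g' := fun X => diagonal (ρ X) (f x ⊗ₜ g x) + (f' X ⊗ₜ g x + f x ⊗ₜ g' X)) fun X => by
    simp only [diagonal, TensorProduct.mk_apply, LinearMap.add_apply, TensorProduct.map_tmul,
      Module.End.one_apply, TensorProduct.add_tmul, TensorProduct.tmul_add]
    abel
  have hμ : ∀ X (z : A ⊗[ℂ] A), LinearMap.mul' ℂ A (diagonal (ρ X) z) =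
      ρ X (LinearMap.mul' ℂ A z) := fun X z => by
    induction z with
    | zero => simp only [map_zero]
    | tmul a b => simp only [diagonal, LinearMap.add_apply, TensorProduct.map_tmul, map_add,
        LinearMap.mul'_apply, Module.End.one_apply, hρ]
    | add a b ha hb => simp only [map_add] at ha hb ⊢; rw [ha, hb]
  refine ((hR.pow_apply hR' k (hS.pow_apply hS' l h0)).map (LinearMap.mul' ℂ A)).congr_deriv
    fun X => ?_
  simp only [Fedosov.bidiff, map_add, hμ, TensorProduct.mk_apply]

end Bidiff

variable {A : Type*} [Ring A] [Algebra ℂ A] {α : Type*} [Fintype α]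

theorem HasFiniteDeriv.pairing {c : M → α → α → ℝ} (u v : α → Module.End ℂ A)
    (hc : ∀ i j, ContMDiffAt 𝓘(ℝ, B) 𝓘(ℝ, ℝ) ∞ (fun y => c y i j) x) :
    HasFiniteDeriv x (fun y => pairing (fun i j => ((c y i j : ℝ) : ℂ)) u v)
      (fun X => Fedosov.pairing (fun i j => ((mvfderiv 𝓘(ℝ, B) (fun y => c y i j) x X : ℝ) : ℂ))
        u v) :=
  HasFiniteDeriv.sum _ fun i _ => HasFiniteDeriv.sum _ fun j _ =>
    HasFiniteDeriv.smul_const _ (hc i j) _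

end Powers

section LocalContraction

variable {B : Type*} [NormedAddCommGroup B] [NormedSpace ℝ B] [FiniteDimensional ℝ B]
  {M : Type*} [TopologicalSpace M] [ChartedSpace B M] [IsManifold 𝓘(ℝ, B) ∞ M]
  (F : Type*) [NormedAddCommGroup F] [NormedSpace ℝ F] [FiniteDimensional ℝ F]
  {E : M → Type*} [∀ x, AddCommGroup (E x)] [∀ x, Module ℝ (E x)]
  [∀ x, TopologicalSpace (E x)] [TopologicalSpace (Bundle.TotalSpace F E)]
  [FiberBundle F E] [VectorBundle ℝ F E]
  (Ω : (x : M) → TangentSpace 𝓘(ℝ, B) x →L[ℝ] TangentSpace 𝓘(ℝ, B) x →L[ℝ] ℝ)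
  (q : (x : M) → E x →L[ℝ] E x →L[ℝ] ℝ)

/-- The components of the Poisson tensor in the coordinates around `x`. -/
def localPoisson (x y : M) : Matrix (Fin (Module.finrank ℝ B)) (Fin (Module.finrank ℝ B)) ℝ :=
  (frameGram (F := B) (E := TangentFamily B M) Ω x y).transpose⁻¹

/-- The components of the dual metric in the preferred frame around `x`. -/
def localMetric (x y : M) : Matrix (Fin (Module.finrank ℝ F)) (Fin (Module.finrank ℝ F)) ℝ :=
  (frameGram (F := F) q x y)⁻¹

/-- The operator `R` in the preferred frames around `x`. -/
def localR (x y : M) : Module.End ℂ (FibreAlg (TangentSpace 𝓘(ℝ, B) x) (E x) ⊗[ℂ]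
    FibreAlg (TangentSpace 𝓘(ℝ, B) x) (E x)) :=
  pairing (fun i j => ((localPoisson Ω x y i j : ℝ) : ℂ)) (fun i => iS (tangentBasis B x i))
    (fun i => iS (tangentBasis B x i))

/-- The operator `S` in the preferred frames around `x`. -/
def localS (x y : M) : Module.End ℂ (FibreAlg (TangentSpace 𝓘(ℝ, B) x) (E x) ⊗[ℂ]
    FibreAlg (TangentSpace 𝓘(ℝ, B) x) (E x)) :=
  pairing (fun i j => ((localMetric F q x y i j : ℝ) : ℂ)) (fun A => jE (fibreBasis F E x A))
    (fun A => iE (fibreBasis F E x A))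

/-- In frames around `x` the insertions become constant operators, and only the coefficients vary with
the point. -/
theorem localRep_contraction {x y : M} (hy : y ∈ commonDomain B F E x) (k l : ℕ)
    (u v : (y : M) → FibreAlg (TangentSpace 𝓘(ℝ, B) y) (E y)) :
    localRep B F x (fun y => contraction (fun X Y => Ω y X Y) (fun e e' => q y e e')
      (tangentBasis B y) (fibreBasis F E y) k l (u y) (v y)) y =
      bidiff (localR Ω x y) (localS F q x y) k l (localRep B F x u y) (localRep B F x v y) := by
  rw [localRep_eq F x _ hy, localRep_eq F x _ hy, localRep_eq F x _ hy]
  have h := contraction_change_basis (V := TangentSpace 𝓘(ℝ, B) y) (F := E y)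
    ((ContinuousLinearMap.coeLM ℝ).comp (Ω y).toLinearMap)
    ((ContinuousLinearMap.coeLM ℝ).comp (q y).toLinearMap)
    ((tangentBasis B x).map (transportEquiv B (TangentFamily B M) x hy.1)) (tangentBasis B y)
    ((fibreBasis F E x).map (transportEquiv F E x hy.2)) (fibreBasis F E y) k l (u y) (v y)
  refine (congrArg _ h).trans ?_
  rw [pull_contraction, contraction_eq_bidiff]
  have e1 : poissonMatrix (fun X Y => ((ContinuousLinearMap.coeLM ℝ).comp (Ω y).toLinearMap)
      (transportEquiv B (TangentFamily B M) x hy.1 X)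
      (transportEquiv B (TangentFamily B M) x hy.1 Y)) (tangentBasis B x) = localPoisson Ω x y := by
    rw [poissonMatrix, localPoisson]
    congr 1
    ext i j
    rw [Matrix.transpose_apply, frameGram, Matrix.of_apply, Matrix.of_apply, tangentBasis_eq,
      transportEquiv_fibreBasis, transportEquiv_fibreBasis]
    rfl
  have e2 : inverseMetric (fun X Y => ((ContinuousLinearMap.coeLM ℝ).comp (q y).toLinearMap)
      (transportEquiv F E x hy.2 X)
      (transportEquiv F E x hy.2 Y)) (fibreBasis F E x) = localMetric F q x y := by
    rw [inverseMetric, localMetric]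
    congr 1
    ext i j
    rw [frameGram, Matrix.of_apply, Matrix.of_apply,
      transportEquiv_fibreBasis, transportEquiv_fibreBasis]
    rfl
  rw [fibreR_eq_pairing, fibreS_eq_pairing, e1, e2, localR, localS]

variable [∀ x, IsTopologicalAddGroup (E x)] [∀ x, ContinuousSMul ℝ (E x)]
  [ContMDiffVectorBundle ∞ F E 𝓘(ℝ, B)] {Ω q}

theorem contMDiffAt_localPoisson (hΩ : IsSymplecticForm Ω) (x : M)
    (i j : Fin (Module.finrank ℝ B)) :
    ContMDiffAt 𝓘(ℝ, B) 𝓘(ℝ, ℝ) ∞ (fun y => localPoisson Ω x y i j) x := by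
  refine contMDiffAt_inv_matrix (G := fun y =>
    (frameGram (F := B) (E := TangentFamily B M) Ω x y).transpose) (fun i j => ?_) ?_ i j
  · exact contMDiffAt_frameGram (E := TangentFamily B M) hΩ.smooth x (mem_frameDomain _ _ x) j i
  · rw [Matrix.det_transpose]
    exact isUnit_det_frameGram (E := TangentFamily B M) hΩ.nondegenerate x (mem_frameDomain _ _ x)

theorem contMDiffAt_localMetric (hq : IsFibreMetric B F q) (x : M)
    (i j : Fin (Module.finrank ℝ F)) :
    ContMDiffAt 𝓘(ℝ, B) 𝓘(ℝ, ℝ) ∞ (fun y => localMetric F q x y i j) x :=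
  contMDiffAt_inv_matrix (fun i j => contMDiffAt_frameGram hq.smooth x (mem_frameDomain _ _ x) i j)
    (isUnit_det_frameGram hq.nondegenerate x (mem_frameDomain _ _ x)) i j

theorem isFiniteSmoothAt_contraction (hΩ : IsSymplecticForm Ω) (hq : IsFibreMetric B F q) (x : M)
    (k l : ℕ) {u v : (y : M) → FibreAlg (TangentSpace 𝓘(ℝ, B) y) (E y)}
    (hu : IsFiniteSmoothAt (B := B) x (localRep B F x u))
    (hv : IsFiniteSmoothAt (B := B) x (localRep B F x v)) :
    IsFiniteSmoothAt (B := B) x (localRep B F x fun y =>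
      contraction (fun X Y => Ω y X Y) (fun e e' => q y e e')
      (tangentBasis B y) (fibreBasis F E y) k l (u y) (v y)) := by
  have hR : IsFiniteSmoothAt (B := B) x (localR Ω x : M → Module.End ℂ
      (FibreAlg (TangentSpace 𝓘(ℝ, B) x) (E x) ⊗[ℂ] FibreAlg (TangentSpace 𝓘(ℝ, B) x) (E x))) :=
    ⟨_, HasFiniteDeriv.pairing _ _ (contMDiffAt_localPoisson hΩ x)⟩
  have hS : IsFiniteSmoothAt (B := B) x (localS F q x : M → Module.End ℂ
      (FibreAlg (TangentSpace 𝓘(ℝ, B) x) (E x) ⊗[ℂ] FibreAlg (TangentSpace 𝓘(ℝ, B) x) (E x))) :=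
    ⟨_, HasFiniteDeriv.pairing _ _ (contMDiffAt_localMetric F hq x)⟩
  have h := hR.bidiff hS k l hu hv
  exact h.congr (Filter.mem_of_superset (commonDomain_mem_nhds B F E x) fun y hy =>
    localRep_contraction F Ω q hy k l u v)

end LocalContraction

/-! ### The structure maps preserve the Fedosov algebra -/

section Signs

theorem neg_one_zpow_eq_natAbs (n : ℤ) : (-1 : ℂ) ^ n = (-1 : ℂ) ^ n.natAbs := by
  rcases Int.even_or_odd n with h | h
  · rw [h.neg_one_zpow, (Int.natAbs_even.2 h).neg_one_pow]
  · rw [h.neg_one_zpow, (Int.natAbs_odd.2 h).neg_one_pow]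

theorem neg_one_zpow_sign (d₁ d₂ : ℕ) (a₁ a₂ : ℤ) : (-1 : ℂ) ^ ((d₁ : ℤ) * (d₂ : ℤ) + a₁ * a₂) =
    (-1 : ℂ) ^ (d₁ * d₂ + a₁.natAbs * a₂.natAbs) := by
  have h0 : (-1 : ℂ) ≠ 0 := neg_ne_zero.2 one_ne_zero
  rw [zpow_add₀ h0, neg_one_zpow_eq_natAbs (a₁ * a₂), Int.natAbs_mul, pow_add]
  exact_mod_cast rfl

theorem neg_one_pow_val_add (d₁ d₂ : ZMod 2) :
    (-1 : ℂ) ^ (d₁ + d₂).val = (-1 : ℂ) ^ d₁.val * (-1 : ℂ) ^ d₂.val := by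
  rw [ZMod.val_add, ← pow_add]
  exact (neg_one_pow_eq_pow_mod_two _).symm

end Signs

section SectionAlgebra

variable {B : Type*} [NormedAddCommGroup B] [NormedSpace ℝ B] [FiniteDimensional ℝ B]
  {M : Type*} [TopologicalSpace M] [ChartedSpace B M] [IsManifold 𝓘(ℝ, B) ∞ M]
  (F : Type*) [NormedAddCommGroup F] [NormedSpace ℝ F] [FiniteDimensional ℝ F]
  {E : M → Type*} [∀ x, AddCommGroup (E x)] [∀ x, Module ℝ (E x)]
  [∀ x, TopologicalSpace (E x)] [TopologicalSpace (Bundle.TotalSpace F E)]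
  [FiberBundle F E] [VectorBundle ℝ F E]
  (Ω : (x : M) → TangentSpace 𝓘(ℝ, B) x →L[ℝ] TangentSpace 𝓘(ℝ, B) x →L[ℝ] ℝ)
  (q : (x : M) → E x →L[ℝ] E x →L[ℝ] ℝ)

/-- The contractions of the fibre at `x`, in the preferred bases. -/
def fibreProd (x : M) (k l : ℕ) : FibreAlg (TangentSpace 𝓘(ℝ, B) x) (E x) →ₗ[ℂ]
    FibreAlg (TangentSpace 𝓘(ℝ, B) x) (E x) →ₗ[ℂ] FibreAlg (TangentSpace 𝓘(ℝ, B) x) (E x) :=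
  contractionHom (fun X Y => Ω x X Y) (fun e e' => q x e e') (tangentBasis B x)
    (fibreBasis F E x) k l

theorem circ_eq_formalProd (v w : RawSection B E) (x : M) :
    circ F Ω q v w x = formalProd (fibreProd F Ω q x) (v x) (w x) := by
  funext s t
  simp only [formalProd, fibreProd, contractionHom_apply]
  rfl

variable {F}

theorem onE_extWeight_mem {w w' : RawSection B E} (hw : w ∈ fedosovAlgebra B F E) (c : ℕ → ℝ)
    (h : ∀ x s t, w' x s t = onE (extWeight _ c) (w x s t)) : w' ∈ fedosovAlgebra B F E := by
  have : w' = fun x s t => onE (extWeight _ c) (w x s t) := by funext x s t; exact h x s t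
  subst this
  rw [mem_fedosovAlgebra_iff] at hw ⊢
  exact ⟨fun x s t => onE_mem_symDegree _ (hw.1 x s t), fun s t x =>
    isFiniteSmoothAt_of_intertwine F _ (hw.2 s t x) fun y _ => localRep_onE_extWeight F x y _ c⟩

theorem onForms_extWeight_mem {w w' : RawSection B E} (hw : w ∈ fedosovAlgebra B F E) (c : ℕ → ℝ)
    (h : ∀ x s t, w' x s t = onForms (extWeight _ c) (w x s t)) : w' ∈ fedosovAlgebra B F E := by
  have : w' = fun x s t => onForms (extWeight _ c) (w x s t) := by funext x s t; exact h x s t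
  subst this
  rw [mem_fedosovAlgebra_iff] at hw ⊢
  exact ⟨fun x s t => onForms_mem_symDegree _ (hw.1 x s t), fun s t x =>
    isFiniteSmoothAt_of_intertwine F _ (hw.2 s t x) fun y _ => localRep_onForms_extWeight F x y _ c⟩

theorem PE_mem {w : RawSection B E} (hw : w ∈ fedosovAlgebra B F E) : PE w ∈ fedosovAlgebra B F E :=
  onE_extWeight_mem hw _ fun _ _ _ => rfl

theorem degA_mem {w : RawSection B E} (hw : w ∈ fedosovAlgebra B F E) :
    degA w ∈ fedosovAlgebra B F E :=
  onForms_extWeight_mem hw _ fun _ _ _ => rfl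

theorem degE_mem {w : RawSection B E} (hw : w ∈ fedosovAlgebra B F E) :
    degE w ∈ fedosovAlgebra B F E :=
  onE_extWeight_mem hw _ fun _ _ _ => rfl

theorem rescale_mem {w w' : RawSection B E} (hw : w ∈ fedosovAlgebra B F E) (c : ℕ → ℕ → ℂ)
    (h : ∀ x s t, w' x s t = c s t • w x s t) : w' ∈ fedosovAlgebra B F E := by
  have : w' = fun x s t => c s t • w x s t := by funext x s t; exact h x s t
  subst this
  rw [mem_fedosovAlgebra_iff] at hw ⊢
  refine ⟨fun x s t => Submodule.smul_mem _ _ (hw.1 x s t), fun s t x => ?_⟩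
  exact isFiniteSmoothAt_of_intertwine F (LinearMap.lsmul ℂ _ (c s t)) (hw.2 s t x)
    fun y _ => by rw [localRep, localRep, map_smul, LinearMap.lsmul_apply]

theorem PLam_mem {w : RawSection B E} (hw : w ∈ fedosovAlgebra B F E) :
    PLam w ∈ fedosovAlgebra B F E :=
  rescale_mem hw (fun _ t => (-1) ^ t) fun _ _ _ => rfl

theorem Deg_mem {w : RawSection B E} (hw : w ∈ fedosovAlgebra B F E) :
    Deg w ∈ fedosovAlgebra B F E :=
  Submodule.add_mem _ (Submodule.add_mem _ (Submodule.smul_mem _ _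
    (rescale_mem hw (fun _ t => t) fun _ _ _ => rfl)) (rescale_mem hw (fun s _ => s)
      fun _ _ _ => rfl)) (degE_mem hw)

theorem conjSection_mem {w : RawSection B E} (hw : w ∈ fedosovAlgebra B F E) :
    conjSection w ∈ fedosovAlgebra B F E := by
  rw [mem_fedosovAlgebra_iff] at hw ⊢
  refine ⟨fun x s t => conjFibre_mem_symDegree (hw.1 x s t), fun s t x => ?_⟩
  obtain ⟨f', h⟩ := hw.2 s t x
  exact ⟨_, (h.map_real conjFibre.toAddMonoidHom fun r w =>
    (conjFibre_smul _ _).trans (by rw [Complex.conj_ofReal]; rfl)).congr (Filter.Eventually.of_forall fun y =>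
    (conjFibre_pull _ _ _).symm)⟩

theorem delta_mem {w : RawSection B E} (hw : w ∈ fedosovAlgebra B F E) :
    delta w ∈ fedosovAlgebra B F E := by
  rw [mem_fedosovAlgebra_iff] at hw ⊢
  exact ⟨fun x s t => fibreDelta_mem (hw.1 x (s + 1) t), fun s t x =>
    isFiniteSmoothAt_of_intertwine F _ (hw.2 (s + 1) t x) fun y hy => localRep_fibreDelta F hy _⟩

theorem deltaStar_mem {w : RawSection B E} (hw : w ∈ fedosovAlgebra B F E) :
    deltaStar w ∈ fedosovAlgebra B F E := by
  rw [mem_fedosovAlgebra_iff] at hw ⊢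
  refine ⟨fun x s t => ?_, fun s t x => ?_⟩
  · cases s with
    | zero => exact Submodule.zero_mem _
    | succ s => exact fibreDeltaStar_mem (hw.1 x s t)
  · cases s with
    | zero =>
      exact (IsFiniteSmoothAt.const 0).congr (Filter.Eventually.of_forall fun y => map_zero _)
    | succ s =>
      exact isFiniteSmoothAt_of_intertwine F _ (hw.2 s t x) fun y hy => localRep_fibreDeltaStar F hy _

variable [∀ x, IsTopologicalAddGroup (E x)] [∀ x, ContinuousSMul ℝ (E x)]
  [ContMDiffVectorBundle ∞ F E 𝓘(ℝ, B)] {Ω q}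

theorem localRep_add (x y : M) (u v : (y : M) → FibreAlg (TangentSpace 𝓘(ℝ, B) y) (E y)) :
    localRep B F x (fun y => u y + v y) y = localRep B F x u y + localRep B F x v y :=
  map_add _ _ _

theorem localRep_smul (x y : M) (c : ℂ) (u : (y : M) → FibreAlg (TangentSpace 𝓘(ℝ, B) y) (E y)) :
    localRep B F x (fun y => c • u y) y = c • localRep B F x u y :=
  map_smul _ _ _

theorem localRep_sum {σ : Type*} (S : Finset σ) (x y : M)
    (u : σ → (y : M) → FibreAlg (TangentSpace 𝓘(ℝ, B) y) (E y)) :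
    localRep B F x (fun y => ∑ i ∈ S, u i y) y = ∑ i ∈ S, localRep B F x (u i) y :=
  map_sum _ _ _

theorem isFiniteSmoothAt_localRep_sum {σ : Type*} (S : Finset σ) {x : M}
    {u : σ → (y : M) → FibreAlg (TangentSpace 𝓘(ℝ, B) y) (E y)}
    (h : ∀ i ∈ S, IsFiniteSmoothAt (B := B) x (localRep B F x (u i))) :
    IsFiniteSmoothAt (B := B) x (localRep B F x fun y => ∑ i ∈ S, u i y) :=
  (IsFiniteSmoothAt.sum S h).congr (Filter.Eventually.of_forall fun y => localRep_sum S x y u)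

theorem circ_mem (hΩ : IsSymplecticForm Ω) (hq : IsFibreMetric B F q) {v w : RawSection B E}
    (hv : v ∈ fedosovAlgebra B F E) (hw : w ∈ fedosovAlgebra B F E) :
    circ F Ω q v w ∈ fedosovAlgebra B F E := by
  rw [mem_fedosovAlgebra_iff] at hv hw ⊢
  refine ⟨fun x s t => ?_, fun s t x => ?_⟩
  · rw [circ_eq_formalProd]
    refine formalProd_mem (fun {k l r s n a b} ha hb h => ?_) (hv.1 x) (hw.1 x) s t
    rw [fibreProd, contractionHom_apply]
    exact contraction_mem_of_add_eq ha hb h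
  · refine isFiniteSmoothAt_localRep_sum _ fun k _ => isFiniteSmoothAt_localRep_sum _ fun l _ => ?_
    refine isFiniteSmoothAt_of_intertwine F (LinearMap.lsmul ℂ _ ((Complex.I / 2) ^ (k + l) /
      ((Nat.factorial k : ℂ) * (Nat.factorial l : ℂ)))) ?_ fun y _ => localRep_smul x y _ _
    exact isFiniteSmoothAt_localRep_sum _ fun p _ => isFiniteSmoothAt_localRep_sum _ fun r _ =>
      isFiniteSmoothAt_contraction F hΩ hq x k l (hv.2 _ _ x) (hw.2 _ _ x)

end SectionAlgebra

/-! ### The Koszul differentials on sections -/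

theorem pairing_commute_pairing {A : Type*} [Ring A] [Algebra ℂ A] {α β : Type*} [Fintype α]
    [Fintype β] (c : α → α → ℂ) (d : β → β → ℂ) {u u' : α → Module.End ℂ A}
    {v v' : β → Module.End ℂ A} (h : ∀ i j, Commute (u i) (v j))
    (h' : ∀ i j, Commute (u' i) (v' j)) : Commute (pairing c u u') (pairing d v v') :=
  commute_sum_sum fun i j k l => by
    rw [commute_iff_eq, ← TensorProduct.map_mul, ← TensorProduct.map_mul, (h i k).eq, (h' j l).eq]

section Fibre

variable {V : Type*} [AddCommGroup V] [Module ℝ V] {F : Type*} [AddCommGroup F] [Module ℝ F]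

theorem parE_mulA (ξ : Module.Dual ℝ V) (a : FibreAlg V F) :
    parE (mulA ξ a) = mulA ξ (parE a) :=
  LinearMap.congr_fun (onE_commute_onForms _ _).eq a

theorem parE_iS (X : V) (a : FibreAlg V F) : parE (iS X a) = iS X (parE a) :=
  (LinearMap.congr_fun (iS_commute_parE X).eq a).symm

theorem numA_iS (X : V) (a : FibreAlg V F) : numA (iS X a) = iS X (numA a) :=
  (LinearMap.congr_fun (onSym_commute_onForms _ _).eq a).symm

theorem numA_parE (a : FibreAlg V F) : numA (parE a) = parE (numA a) :=
  (LinearMap.congr_fun (onE_commute_onForms _ _).eq a).symm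

theorem numA_mulA (ξ : Module.Dual ℝ V) (a : FibreAlg V F) :
    numA (mulA ξ a) = mulA ξ (numA a) + mulA ξ a := by
  have h0 : (1 : FibreAlg V F) = decomp 1 1 1 1 := rfl
  have h1 : mulA ξ (1 : FibreAlg V F) = decomp 1 1 1 (ExteriorAlgebra.ι ℝ ξ) := by
    rw [h0, mulA, onForms_decomp, LinearMap.mulLeft_apply, mul_one]
  have h2 : numA (mulA ξ (1 : FibreAlg V F)) = mulA ξ 1 := by
    rw [h1, numA, onForms_decomp, extWeight_of_mem (d := 1) _
      (by rw [ExteriorAlgebra.exteriorPower, pow_one]; exact LinearMap.mem_range_self _ ξ),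
      Nat.cast_one, one_smul]
  have h3 : ∀ a : FibreAlg V F, mulA ξ a = mulA ξ 1 * a := fun a => by rw [← mulA_mul, one_mul]
  rw [h3 a, numA_leibniz, h2, h3 (numA a), add_comm]

variable {ι : Type*} [Fintype ι] (b : Module.Basis ι ℝ V)

theorem parE_fibreDelta (a : FibreAlg V F) : parE (fibreDelta b a) = fibreDelta b (parE a) := by
  simp only [fibreDelta, LinearMap.sum_apply, Module.End.mul_apply, map_sum, parE_mulA, parE_iS]

theorem numA_fibreDelta (a : FibreAlg V F) :
    numA (fibreDelta b a) = fibreDelta b (numA a) + fibreDelta b a := by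
  simp only [fibreDelta, LinearMap.sum_apply, Module.End.mul_apply, map_sum, numA_mulA, numA_iS,
    Finset.sum_add_distrib]

variable [DecidableEq ι]

/-- `i_a` lowers the antisymmetric degree by one. -/
theorem numA_iA_basis (j : ι) (a : FibreAlg V F) :
    numA (iA (b j) a) = iA (b j) (numA a) - iA (b j) a := by
  rw [← sum_mulA_iA (b := b), ← sum_mulA_iA (b := b) a, map_sum, eq_sub_iff_add_eq]
  have h : ∀ i, iA (b j) (mulA (b.coord i) (iA (b i) a)) =
      mulA (b.coord i) (iA (b i) (iA (b j) a)) + (if j = i then iA (b i) a else 0) := fun i => by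
    rw [iA_mulA, iA_iA, map_neg, Module.Basis.coord_apply, Module.Basis.repr_self,
      Finsupp.single_apply]
    split_ifs
    · rw [Complex.ofReal_one, one_smul]; abel
    · rw [Complex.ofReal_zero, zero_smul]; abel
  simp only [h, Finset.sum_add_distrib, Finset.sum_ite_eq, Finset.mem_univ, if_true]

/-- An insertion into an element of antisymmetric degree zero has degree `-1`, hence vanishes. -/
theorem fibreDeltaStar_of_numA_eq_zero [FiniteDimensional ℝ V] {a : FibreAlg V F}
    (ha : numA a = 0) : fibreDeltaStar b a = 0 := by
  have h : ∀ j, iA (b j) a = 0 := fun j => by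
    have h1 : numA (iA (b j) a) = ((-1 : ℤ) : ℂ) • iA (b j) a := by
      rw [numA_iA_basis, ha, map_zero, zero_sub, Int.cast_neg, Int.cast_one, neg_smul, one_smul]
    rw [← sum_projA (iA (b j) a)]
    refine Finset.sum_eq_zero fun d _ => ?_
    rw [projA_of_numA h1, if_neg (by omega)]
  simp only [fibreDeltaStar, LinearMap.sum_apply, Module.End.mul_apply, h, map_zero,
    Finset.sum_const_zero]

variable {κ : Type*} [Fintype κ] [DecidableEq κ]

theorem fibreR_commute_fibreS (Ω : V → V → ℝ) (q : F → F → ℝ) (c : Module.Basis κ ℝ F) :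
    Commute (fibreR Ω b : Module.End ℂ (FibreAlg V F ⊗[ℂ] FibreAlg V F)) (fibreS q c) :=
  pairing_commute_pairing _ _ (fun _ _ => iS_commute_jE _ _) fun _ _ => iS_commute_iE _ _

end Fibre

section SectionAlgebra

variable {B : Type*} [NormedAddCommGroup B] [NormedSpace ℝ B] [FiniteDimensional ℝ B]
  {M : Type*} [TopologicalSpace M] [ChartedSpace B M] [IsManifold 𝓘(ℝ, B) ∞ M]
  {F : Type*} [NormedAddCommGroup F] [NormedSpace ℝ F] [FiniteDimensional ℝ F]
  {E : M → Type*} [∀ x, AddCommGroup (E x)] [∀ x, Module ℝ (E x)]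
  [∀ x, TopologicalSpace (E x)] [TopologicalSpace (Bundle.TotalSpace F E)]
  [FiberBundle F E] [VectorBundle ℝ F E]

theorem delta_identities {w : RawSection B E} (hw : w ∈ fedosovAlgebra B F E) :
    delta (delta w) = 0 ∧ deltaStar (deltaStar w) = 0 ∧
      delta (deltaStar w) + deltaStar (delta w) = degS w + degA w := by
  refine ⟨?_, ?_, ?_⟩
  · funext x s t
    exact fibreDelta_fibreDelta _
  · funext x s t
    match s with
    | 0 => rfl
    | 1 => exact map_zero _
    | s + 2 => exact fibreDeltaStar_fibreDeltaStar _
  · funext x s t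
    have h := fibreDelta_fibreDeltaStar (b := tangentBasis B x) (hw.1 x s t)
    refine Eq.trans ?_ h
    match s with
    | 0 =>
      have h0 : fibreDelta (tangentBasis B x) (w x 0 t) = 0 := fibreDelta_of_mem_zero (hw.1 x 0 t)
      rw [h0, map_zero, add_zero]
      exact add_zero _
    | s + 1 => rfl

theorem pullE_outE (x y : M) (u : (y : M) → FibreAlg (TangentSpace 𝓘(ℝ, B) y) (E y)) :
    pullE (fibreTransport F E x y) (outE (u y)) = outE (localRep B F x u y) :=
  (outE_pull _ _ _).symm

theorem isSmoothE_outE {u : (y : M) → FibreAlg (TangentSpace 𝓘(ℝ, B) y) (E y)}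
    (hu : IsSmooth B F u) : IsSmoothE B F fun x => outE (u x) := fun x ℓ => by
  simp only [pullE_outE]
  exact hu x (ℓ ∘ₗ outE)

theorem isSmooth_inclE {φ : (x : M) → ℂ ⊗[ℝ] ExteriorAlgebra ℝ (Module.Dual ℝ (E x))}
    (hφ : IsSmoothE B F φ) :
    IsSmooth B F fun x => (inclE (φ x) : FibreAlg (TangentSpace 𝓘(ℝ, B) x) (E x)) := fun x ℓ => by
  simp only [localRep, pull_inclE]
  exact hφ x (ℓ ∘ₗ inclE)

theorem isSmooth_zero :
    IsSmooth B F fun x => (0 : FibreAlg (TangentSpace 𝓘(ℝ, B) x) (E x)) := fun x ℓ => by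
  simp only [localRep, map_zero]
  exact contMDiffAt_const

variable (B F E) in
/-- The kernel of `δ` in antisymmetric degree zero: by the homotopy formula, elements of it have
symmetric degree zero. -/
theorem ker_delta_eq_classicalSeries :
    {w : RawSection B E | w ∈ fedosovAlgebra B F E ∧ delta w = 0 ∧ degA w = 0} =
      classicalSeries B F E := by
  ext w
  refine ⟨fun ⟨hw, h1, h2⟩ => ?_, fun ⟨φ, hφ, hw⟩ => ⟨⟨fun x s t => ?_, fun s t => ?_⟩, ?_, ?_⟩⟩
  · have hA : ∀ x s t, numA (w x s t) = 0 := fun x s t => congr_fun (congr_fun (congr_fun h2 x) s) t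
    refine ⟨fun t x => outE (w x 0 t), fun t => isSmoothE_outE (hw.2 0 t), fun x s t => ?_⟩
    match s with
    | 0 =>
      rw [if_pos rfl, inclE_outE (hw.1 x 0 t), projA_of_numA (n := 0), if_pos Nat.cast_zero.symm]
      rw [hA, Int.cast_zero, zero_smul]
    | s + 1 =>
      rw [if_neg (Nat.succ_ne_zero s)]
      have h := fibreDelta_fibreDeltaStar (b := tangentBasis B x) (hw.1 x (s + 1) t)
      have hd : fibreDelta (tangentBasis B x) (w x (s + 1) t) = 0 :=
        congr_fun (congr_fun (congr_fun h1 x) s) t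
      have := finite_fibre B (TangentFamily B M) x
      have hd' := fibreDeltaStar_of_numA_eq_zero (tangentBasis B x) (hA x (s + 1) t)
      rw [hd, hd', map_zero, map_zero, add_zero, hA, add_zero] at h
      exact (smul_eq_zero.1 h.symm).resolve_left (Nat.cast_ne_zero.2 (Nat.succ_ne_zero s))
  · rw [hw]
    split_ifs with h
    · rw [h]; exact inclE_mem_symDegree _
    · exact Submodule.zero_mem _
  · simp only [hw]
    split_ifs
    · exact isSmooth_inclE (hφ t)
    · exact isSmooth_zero
  · funext x s t
    refine (congrArg _ ((hw x (s + 1) t).trans (if_neg (Nat.succ_ne_zero s)))).trans (map_zero _)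
  · funext x s t
    refine (congrArg numA (hw x s t)).trans ?_
    split_ifs
    · exact numA_inclE _
    · exact map_zero _

end SectionAlgebra

/-! ### The deformed product on sections -/

theorem numE_parE {V : Type*} [AddCommGroup V] [Module ℝ V] {F : Type*} [AddCommGroup F]
    [Module ℝ F] (a : FibreAlg V F) : numE (parE a) = parE (numE a) := by
  have h : (numE * parE : Module.End ℂ (FibreAlg V F)) = parE * numE := by
    rw [numE, parE, ← onE_mul, ← onE_mul, extWeight_mul_extWeight, extWeight_mul_extWeight]
    simp only [mul_comm]
  exact LinearMap.congr_fun h a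

theorem parA_of_numA_natAbs {V : Type*} [AddCommGroup V] [Module ℝ V] {F : Type*} [AddCommGroup F]
    [Module ℝ F] {a : FibreAlg V F} {n : ℤ} (h : numA a = (n : ℂ) • a) :
    parA a = (-1 : ℂ) ^ n.natAbs • a := by
  rw [parA_of_numA h, neg_one_zpow_eq_natAbs]

section DeformedAlgebra

variable {B : Type*} [NormedAddCommGroup B] [NormedSpace ℝ B] [FiniteDimensional ℝ B]
  {M : Type*} [TopologicalSpace M] [ChartedSpace B M] [IsManifold 𝓘(ℝ, B) ∞ M]
  {F : Type*} [NormedAddCommGroup F] [NormedSpace ℝ F] [FiniteDimensional ℝ F]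
  {E : M → Type*} [∀ x, AddCommGroup (E x)] [∀ x, Module ℝ (E x)]
  [∀ x, TopologicalSpace (E x)] [TopologicalSpace (Bundle.TotalSpace F E)]
  [FiberBundle F E] [VectorBundle ℝ F E]
  {Ω : (x : M) → TangentSpace 𝓘(ℝ, B) x →L[ℝ] TangentSpace 𝓘(ℝ, B) x →L[ℝ] ℝ}
  {q : (x : M) → E x →L[ℝ] E x →L[ℝ] ℝ}

theorem mem_homogeneous_iff {d : ZMod 2} {a : ℤ} {w : RawSection B E} :
    w ∈ homogeneous B F E d a ↔ w ∈ fedosovAlgebra B F E ∧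
      (∀ x s t, parE (w x s t) = (-1 : ℂ) ^ d.val • w x s t) ∧
      ∀ x s t, numA (w x s t) = (a : ℂ) • w x s t :=
  ⟨fun h => ⟨h.1, fun x s t => congr_fun (congr_fun (congr_fun h.2.1 x) s) t,
      fun x s t => congr_fun (congr_fun (congr_fun h.2.2 x) s) t⟩,
    fun h => ⟨h.1, funext fun x => funext fun s => funext fun t => h.2.1 x s t,
      funext fun x => funext fun s => funext fun t => h.2.2 x s t⟩⟩

theorem fibreProd_apply (x : M) (k l : ℕ) (a b : FibreAlg (TangentSpace 𝓘(ℝ, B) x) (E x)) :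
    fibreProd F Ω q x k l a b = contraction (fun X Y => Ω x X Y) (fun e e' => q x e e')
      (tangentBasis B x) (fibreBasis F E x) k l a b := contractionHom_apply _ _ _ _ _ _ _ _

theorem circ_add_left (u v w : RawSection B E) :
    circ F Ω q (u + v) w = circ F Ω q u w + circ F Ω q v w := by
  funext x
  rw [Pi.add_apply, circ_eq_formalProd, circ_eq_formalProd, circ_eq_formalProd]
  exact formalProd_add_left _ _ _ _

theorem circ_add_right (u v w : RawSection B E) :
    circ F Ω q u (v + w) = circ F Ω q u v + circ F Ω q u w := by
  funext x
  rw [Pi.add_apply, circ_eq_formalProd, circ_eq_formalProd, circ_eq_formalProd]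
  exact formalProd_add_right _ _ _ _

theorem circ_smul_left (c : ℂ) (v w : RawSection B E) :
    circ F Ω q (c • v) w = c • circ F Ω q v w := by
  funext x
  rw [Pi.smul_apply, circ_eq_formalProd, circ_eq_formalProd]
  exact formalProd_smul_left _ _ _ _

theorem circ_smul_right (c : ℂ) (v w : RawSection B E) :
    circ F Ω q v (c • w) = c • circ F Ω q v w := by
  funext x
  rw [Pi.smul_apply, circ_eq_formalProd, circ_eq_formalProd]
  exact formalProd_smul_right _ _ _ _

theorem circ_assoc {u v w : RawSection B E} (hu : u ∈ fedosovAlgebra B F E)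
    (hv : v ∈ fedosovAlgebra B F E) (hw : w ∈ fedosovAlgebra B F E) :
    circ F Ω q (circ F Ω q u v) w = circ F Ω q u (circ F Ω q v w) := by
  funext x
  rw [circ_eq_formalProd, circ_eq_formalProd, circ_eq_formalProd, circ_eq_formalProd]
  refine formalProd_assoc (fun {k l r s a b} ha hb h => ?_) (fun K L x' y z => ?_) (hu.1 x) (hv.1 x)
    (hw.1 x)
  · rw [fibreProd_apply]
    exact contraction_eq_zero_of_lt ha hb (by omega)
  · simp only [fibreProd_apply]
    exact contraction_assoc _ _ _ _ K L x' y z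

theorem circ_eq_exp {v w : RawSection B E} (hv : v ∈ fedosovAlgebra B F E)
    (hw : w ∈ fedosovAlgebra B F E) (x : M) :
    circ F Ω q v w x = muSeries (expLam (halfRS F Ω q x) (tensorSeries v w x)) := by
  funext s t
  rw [circ_eq_formalProd]
  refine (formalProd_eq_exp (fibreR_commute_fibreS (tangentBasis B x) (fun X Y => Ω x X Y)
    (fun e e' => q x e e') (fibreBasis F E x)) (LinearMap.mul' ℂ _) (fun k l a b => ?_)
    (fun k l r s p p' h => ?_) s t).trans ?_
  · rw [fibreProd_apply, contraction_eq_bidiff, bidiff]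
  · rw [fibreProd_apply]
    exact contraction_eq_zero_of_lt (hv.1 _ _ _) (hw.1 _ _ _) h
  · refine Finset.sum_congr rfl fun r _ => congrArg _ (Finset.sum_congr rfl fun n _ => ?_)
    rw [Module.End.pow_apply]
    rfl

theorem PE_circ (v w : RawSection B E) : PE (circ F Ω q v w) = circ F Ω q (PE v) (PE w) := by
  funext x s t
  rw [circ_eq_formalProd]
  refine Eq.trans ?_ (formalProd_map (Y := parE) (f := parE) (g := parE)
    (fun k l a b => ?_) (v x) (w x) s t)
  · rw [← circ_eq_formalProd]; rfl
  · rw [fibreProd_apply, fibreProd_apply, parE_contraction]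

theorem degA_circ (v w : RawSection B E) :
    degA (circ F Ω q v w) = circ F Ω q (degA v) w + circ F Ω q v (degA w) := by
  funext x s t
  rw [Pi.add_apply, circ_eq_formalProd, circ_eq_formalProd, Pi.add_apply, Pi.add_apply]
  refine Eq.trans ?_ (formalProd_leibniz (D := numA) (P := 1)
    (fun k l a b => ?_) (v x) (w x) s t)
  · rw [← circ_eq_formalProd]; rfl
  · rw [fibreProd_apply, fibreProd_apply, fibreProd_apply, numA_contraction, Module.End.one_apply]

theorem circ_mem_homogeneous [∀ x, IsTopologicalAddGroup (E x)] [∀ x, ContinuousSMul ℝ (E x)]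
    [ContMDiffVectorBundle ∞ F E 𝓘(ℝ, B)] (hΩ : IsSymplecticForm Ω) (hq : IsFibreMetric B F q)
    {d₁ d₂ : ZMod 2} {a₁ a₂ : ℤ} {v w : RawSection B E} (hv : v ∈ homogeneous B F E d₁ a₁)
    (hw : w ∈ homogeneous B F E d₂ a₂) :
    circ F Ω q v w ∈ homogeneous B F E (d₁ + d₂) (a₁ + a₂) := by
  refine ⟨circ_mem hΩ hq hv.1 hw.1, ?_, ?_⟩
  · rw [PE_circ, hv.2.1, hw.2.1, circ_smul_left, circ_smul_right, smul_smul, neg_one_pow_val_add]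
  · rw [degA_circ, hv.2.2, hw.2.2, circ_smul_left, circ_smul_right, ← add_smul, Int.cast_add]

variable (B F E) in
/-- The homogeneous subspaces are independent: they lie in eigenspaces of the operator
`2 deg_a + (1 - P_E) / 2` for different eigenvalues. -/
theorem iSupIndep_homogeneous :
    iSupIndep fun p : ZMod 2 × ℤ => homogeneous B F E p.1 p.2 := by
  let T : Module.End ℂ (RawSection B E) :=
    { toFun := fun w x s t => (2 : ℂ) • numA (w x s t) + (1 / 2 : ℂ) • (w x s t - parE (w x s t))
      map_add' := fun v w => by
        funext x s t
        simp only [Pi.add_apply, map_add]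
        module
      map_smul' := fun c v => by
        funext x s t
        simp only [Pi.smul_apply, map_smul, RingHom.id_apply]
        module }
  have h1 : Function.Injective fun p : ZMod 2 × ℤ => (2 * p.2 + p.1.val : ℂ) := by
    rintro ⟨d, a⟩ ⟨d', a'⟩ h
    have h' : 2 * a + (d.val : ℤ) = 2 * a' + (d'.val : ℤ) := by
      simp only at h
      exact_mod_cast h
    have hd := ZMod.val_lt d
    have hd' := ZMod.val_lt d'
    have e : d.val = d'.val := by omega
    rw [ZMod.val_injective 2 e, show a = a' by omega]
  refine ((Module.End.eigenspaces_iSupIndep T).comp h1).mono fun p w hw => ?_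
  rw [mem_homogeneous_iff] at hw
  rw [Function.comp_apply, Module.End.mem_eigenspace_iff]
  funext x s t
  change (2 : ℂ) • numA (w x s t) + (1 / 2 : ℂ) • (w x s t - parE (w x s t)) =
    (2 * p.2 + p.1.val : ℂ) • w x s t
  rw [hw.2.1, hw.2.2]
  obtain ⟨d, a⟩ := p
  have hd : d.val = 0 ∨ d.val = 1 := by have := ZMod.val_lt d; omega
  rcases hd with hd | hd <;> rw [hd]
  · rw [pow_zero, Nat.cast_zero]; module
  · rw [pow_one, Nat.cast_one]; module

variable (B F E) in
theorem iSup_homogeneous :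
    (⨆ p : ZMod 2 × ℤ, homogeneous B F E p.1 p.2) = fedosovAlgebra B F E := by
  refine le_antisymm (iSup_le fun p w hw => hw.1) fun w hw => ?_
  -- the component of parity `d` and degree `a`
  let c : ZMod 2 → ℕ → RawSection B E := fun d a x s t =>
    (1 / 2 : ℂ) • (projA a (w x s t) + (-1 : ℂ) ^ d.val • parE (projA a (w x s t)))
  have hp : ∀ a, (fun x s t => projA a (w x s t) : RawSection B E) ∈ fedosovAlgebra B F E :=
    fun a => onForms_extWeight_mem hw _ fun _ _ _ => rfl
  have hc : ∀ d (a : ℕ), c d a ∈ homogeneous B F E d a := fun d a => by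
    refine mem_homogeneous_iff.2 ⟨Submodule.smul_mem _ _ (Submodule.add_mem _ (hp a)
      (Submodule.smul_mem _ _ (PE_mem (hp a)))), fun x s t => ?_, fun x s t => ?_⟩
    · change parE ((1 / 2 : ℂ) • (projA a (w x s t) + (-1 : ℂ) ^ d.val • parE (projA a (w x s t)))) =
        (-1 : ℂ) ^ d.val • ((1 / 2 : ℂ) • (projA a (w x s t) +
          (-1 : ℂ) ^ d.val • parE (projA a (w x s t))))
      have e : (-1 : ℂ) ^ d.val * (-1 : ℂ) ^ d.val = 1 := by
        rw [← mul_pow, neg_one_mul, neg_neg, one_pow]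
      rw [map_smul, map_add, map_smul, parE_parE, smul_comm ((-1 : ℂ) ^ d.val) (1 / 2 : ℂ),
        smul_add ((-1 : ℂ) ^ d.val), smul_smul ((-1 : ℂ) ^ d.val) ((-1 : ℂ) ^ d.val), e, one_smul,
        add_comm]
    · change numA ((1 / 2 : ℂ) • (projA a (w x s t) + (-1 : ℂ) ^ d.val • parE (projA a (w x s t)))) =
        ((a : ℤ) : ℂ) • ((1 / 2 : ℂ) • (projA a (w x s t) +
          (-1 : ℂ) ^ d.val • parE (projA a (w x s t))))
      rw [map_smul, map_add, map_smul, numA_parE, numA_projA, map_smul, Int.cast_natCast]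
      module
  have hw' : w = ∑ a ∈ Finset.range (Module.finrank ℝ B + 1), (c 0 a + c 1 a) := by
    funext x s t
    have : FiniteDimensional ℝ (TangentSpace 𝓘(ℝ, B) x) := finite_fibre B (TangentFamily B M) x
    rw [Finset.sum_apply, Finset.sum_apply, Finset.sum_apply]
    refine (sum_projA (w x s t)).symm.trans (Finset.sum_congr rfl fun a _ => ?_)
    change _ = (1 / 2 : ℂ) • (projA a (w x s t) +
        (-1 : ℂ) ^ (0 : ZMod 2).val • parE (projA a (w x s t))) +
      (1 / 2 : ℂ) • (projA a (w x s t) + (-1 : ℂ) ^ (1 : ZMod 2).val • parE (projA a (w x s t)))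
    rw [ZMod.val_zero, ZMod.val_one, pow_zero, pow_one]
    module
  rw [hw']
  refine Submodule.sum_mem _ fun a _ => Submodule.add_mem _ ?_ ?_
  · exact Submodule.mem_iSup_of_mem (0, (a : ℤ)) (hc 0 a)
  · exact Submodule.mem_iSup_of_mem (1, (a : ℤ)) (hc 1 a)

variable [∀ x, IsTopologicalAddGroup (E x)] [∀ x, ContinuousSMul ℝ (E x)]
  [ContMDiffVectorBundle ∞ F E 𝓘(ℝ, B)]

theorem isGradedAssociativeAlgebra_circ (hΩ : IsSymplecticForm Ω) (hq : IsFibreMetric B F q) :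
    IsGradedAssociativeAlgebra F (circ F Ω q : RawSection B E → RawSection B E → RawSection B E) where
  mem _ hv _ hw := circ_mem hΩ hq hv hw
  add_left u _ v _ w _ := circ_add_left u v w
  add_right u _ v _ w _ := circ_add_right u v w
  smul_left c v _ w _ := circ_smul_left c v w
  smul_right c v _ w _ := circ_smul_right c v w
  assoc _ hu _ hv _ hw := circ_assoc hu hv hw
  independent := iSupIndep_homogeneous B F E
  span := iSup_homogeneous B F E
  graded _ _ _ _ _ hv _ hw := circ_mem_homogeneous hΩ hq hv hw

theorem bijOn_of_involutive {Φ : RawSection B E → RawSection B E} (h : Function.Involutive Φ)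
    (hm : ∀ w ∈ fedosovAlgebra B F E, Φ w ∈ fedosovAlgebra B F E) :
    Set.BijOn Φ (fedosovAlgebra B F E) (fedosovAlgebra B F E) :=
  Set.InvOn.bijOn ⟨fun w _ => h w, fun w _ => h w⟩ hm hm

theorem isAutomorphism_PE :
    IsAutomorphism F (circ F Ω q) (PE : RawSection B E → RawSection B E) where
  mem _ := PE_mem
  add v _ w _ := by funext x s t; exact map_add _ _ _
  smul c v _ := by funext x s t; exact LinearMap.map_smul parE _ _
  bijOn := bijOn_of_involutive (fun w => by funext x s t; exact parE_parE _) fun _ => PE_mem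
  mul v _ w _ := PE_circ v w

theorem isDerivation_degA :
    IsDerivation F (circ F Ω q) (degA : RawSection B E → RawSection B E) where
  mem _ := degA_mem
  add v _ w _ := by funext x s t; exact map_add _ _ _
  smul c v _ := by funext x s t; exact LinearMap.map_smul numA _ _
  leibniz v _ w _ := degA_circ v w

/-- The parity operator `parA` in the fibrewise formula produces the sign `(-1)^a`. -/
theorem delta_circ {d : ZMod 2} {a : ℤ} {v w : RawSection B E} (hv : v ∈ homogeneous B F E d a)
    (hw : w ∈ fedosovAlgebra B F E) : delta (circ F Ω q v w) =
      circ F Ω q (delta v) w + (-1 : ℂ) ^ a • circ F Ω q v (delta w) := by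
  have h := mem_homogeneous_iff.1 hv
  rw [← circ_smul_left]
  funext x s t
  rw [Pi.add_apply, circ_eq_formalProd, circ_eq_formalProd, Pi.add_apply, Pi.add_apply]
  have h2 := formalProd_leibniz_shift (C := fibreProd F Ω q x) (D := fibreDelta (tangentBasis B x))
    (P := parA) (v := v x) (w := w x) (fun k l a b => by
      rw [fibreProd_apply, fibreProd_apply, fibreProd_apply, fibreDelta_contraction])
    (fun t => fibreDelta_of_mem_zero (hv.1.1 x 0 t)) (fun t => fibreDelta_of_mem_zero (hw.1 x 0 t))
    s t
  have h3 : (fun s t => parA (v x s t)) = ((-1 : ℂ) ^ a • v) x := by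
    funext s t
    exact parA_of_numA (h.2.2 x s t)
  rw [h3] at h2
  refine Eq.trans ?_ h2
  rw [← circ_eq_formalProd]
  rfl

theorem isSuperderivation_delta :
    IsSuperderivation F (circ F Ω q) (delta : RawSection B E → RawSection B E) 0 1 where
  mem _ := delta_mem
  add v _ w _ := by funext x s t; exact map_add _ _ _
  smul c v _ := by funext x s t; exact LinearMap.map_smul (fibreDelta _) _ _
  parity v _ := by
    rw [pow_zero, one_smul]
    funext x s t
    change parE (fibreDelta _ (parE (v x (s + 1) t))) = fibreDelta _ (v x (s + 1) t)
    rw [parE_fibreDelta, parE_parE]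
  degree v _ := by
    rw [Int.cast_one, one_smul]
    funext x s t
    change numA (fibreDelta _ (v x (s + 1) t)) - fibreDelta _ (numA (v x (s + 1) t)) =
      fibreDelta _ (v x (s + 1) t)
    rw [numA_fibreDelta, add_sub_cancel_left]
  leibniz d a v hv w hw := by
    rw [Nat.cast_zero, zero_mul, zero_add, one_mul]
    exact delta_circ hv hw

theorem Deg_apply (w : RawSection B E) (x : M) (s t : ℕ) :
    Deg w x s t = (2 * t + s : ℂ) • w x s t + numE (w x s t) := by
  change (2 : ℂ) • (t : ℂ) • w x s t + (s : ℂ) • w x s t + numE (w x s t) = _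
  module

theorem isSuperderivation_Deg :
    IsSuperderivation F (circ F Ω q) (Deg : RawSection B E → RawSection B E) 0 0 where
  mem _ := Deg_mem
  add v _ w _ := by
    funext x s t
    simp only [Deg_apply, Pi.add_apply, map_add, smul_add]
    abel
  smul c v _ := by
    funext x s t
    simp only [Deg_apply, Pi.smul_apply, map_smul, smul_add, smul_comm c]
  parity v _ := by
    rw [pow_zero, one_smul]
    funext x s t
    change parE (Deg (PE v) x s t) = _
    rw [Deg_apply, Deg_apply]
    change parE ((2 * t + s : ℂ) • parE (v x s t) + numE (parE (v x s t))) = _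
    rw [map_add, map_smul, numE_parE, parE_parE, parE_parE]
  degree v _ := by
    rw [Int.cast_zero, zero_smul, sub_eq_zero]
    funext x s t
    change numA (Deg v x s t) = _
    rw [Deg_apply, Deg_apply]
    change _ = (2 * t + s : ℂ) • numA (v x s t) + numE (numA (v x s t))
    rw [map_add, map_smul]
    congr 1
    exact (LinearMap.congr_fun (onE_commute_onForms _ _).eq (v x s t)).symm
  leibniz d a v hv w hw := by
    rw [Nat.cast_zero, zero_mul, zero_add, zero_mul, zpow_zero, one_smul]
    funext x s t
    rw [Deg_apply, Pi.add_apply, circ_eq_formalProd, circ_eq_formalProd, circ_eq_formalProd,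
      formalProd_degree (C := fibreProd F Ω q x) (N := numE) (fun k l a b => by
        simp only [fibreProd_apply, numE_contraction]) (v x) (w x) s t]
    simp only [← Deg_apply]
    rfl

theorem IsSymplecticForm.antisymm (hΩ : IsSymplecticForm Ω) (x : M)
    (X Y : TangentSpace 𝓘(ℝ, B) x) : Ω x X Y = -Ω x Y X := by
  have h := hΩ.alternating x (X + Y)
  rw [map_add (Ω x) X Y, _root_.add_apply, map_add, map_add, hΩ.alternating, hΩ.alternating,
    zero_add, add_zero] at h
  exact eq_neg_of_add_eq_zero_left h

/-- Exchange of homogeneous arguments of a contraction. -/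
theorem fibreProd_flip (hΩ : IsSymplecticForm Ω) (hq : IsFibreMetric B F q) {d₁ d₂ : ZMod 2}
    {a₁ a₂ : ℤ} {v w : RawSection B E} (hv : v ∈ homogeneous B F E d₁ a₁)
    (hw : w ∈ homogeneous B F E d₂ a₂) (x : M) (k l s t s' t' : ℕ) :
    fibreProd F Ω q x k l (v x s t) (w x s' t') = ((-1 : ℂ) ^ (k + l) *
      (-1 : ℂ) ^ ((d₁.val : ℤ) * (d₂.val : ℤ) + a₁ * a₂)) •
        fibreProd F Ω q x k l (w x s' t') (v x s t) := by
  have hv := mem_homogeneous_iff.1 hv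
  have hw := mem_homogeneous_iff.1 hw
  rw [fibreProd_apply, fibreProd_apply, neg_one_zpow_sign]
  exact contraction_flip _ _ (hΩ.antisymm x) (hq.symmetric x) k l (hv.2.1 x s t)
    (hw.2.1 x s' t') (parA_of_numA_natAbs (hv.2.2 x s t)) (parA_of_numA_natAbs (hw.2.2 x s' t'))

theorem isGradedAntiautomorphism_PLam (hΩ : IsSymplecticForm Ω) (hq : IsFibreMetric B F q) :
    IsGradedAntiautomorphism F (circ F Ω q) (RingHom.id ℂ)
      (PLam : RawSection B E → RawSection B E) where
  bijOn := bijOn_of_involutive (fun w => by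
    funext x s t
    change (-1 : ℂ) ^ t • (-1 : ℂ) ^ t • w x s t = w x s t
    rw [smul_smul, ← mul_pow, neg_one_mul, neg_neg, one_pow, one_smul]) fun _ => PLam_mem
  add v _ w _ := by funext x s t; exact smul_add _ _ _
  smul c v _ := by funext x s t; exact smul_comm ((-1 : ℂ) ^ t) c (v x s t)
  graded d a v hv := by
    have h := mem_homogeneous_iff.1 hv
    refine mem_homogeneous_iff.2 ⟨PLam_mem h.1, fun x s t => ?_, fun x s t => ?_⟩
    · refine (map_smul parE _ _).trans ?_
      rw [h.2.1, smul_comm]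
      rfl
    · refine (map_smul numA _ _).trans ?_
      rw [h.2.2, smul_comm]
      rfl
  anti d₁ d₂ a₁ a₂ v hv w hw := by
    funext x s t
    rw [Pi.smul_apply, circ_eq_formalProd, Pi.smul_apply, Pi.smul_apply]
    refine Eq.trans ?_ (formalProd_reverse (C := fibreProd F Ω q x) (v := v x) (w := w x)
      (Φ := fun n => DistribSMul.toAddMonoidHom _ ((-1 : ℂ) ^ n))
      (fun k l r r' p p' => ?_) s t)
    · rw [← circ_eq_formalProd]
      rfl
    · change (-1 : ℂ) ^ (k + l + p + p') • _ = _ • fibreProd F Ω q x k l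
        ((-1 : ℂ) ^ p' • w x r' p') ((-1 : ℂ) ^ p • v x r p)
      rw [fibreProd_flip hΩ hq hv hw, map_smul, map_smul, LinearMap.smul_apply, smul_smul,
        smul_smul, smul_smul, smul_smul]
      congr 1
      have e : (-1 : ℂ) ^ (k + l) * (-1 : ℂ) ^ (k + l) = 1 := by
        rw [← mul_pow, neg_one_mul, neg_neg, one_pow]
      rw [pow_add _ (k + l + p), pow_add _ (k + l)]
      linear_combination (((-1 : ℂ) ^ p * (-1 : ℂ) ^ p') * starCoeff k l *
        (-1 : ℂ) ^ ((d₁.val : ℤ) * (d₂.val : ℤ) + a₁ * a₂)) * e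

theorem conj_starCoeff (k l : ℕ) :
    starRingEnd ℂ (starCoeff k l) = (-1 : ℂ) ^ (k + l) * starCoeff k l := by
  rw [starCoeff, map_div₀, map_mul, map_pow, map_div₀, Complex.conj_I, Complex.conj_ofNat,
    Complex.conj_natCast, Complex.conj_natCast, neg_div, neg_pow, mul_div_assoc]

theorem isGradedAntiautomorphism_conjSection (hΩ : IsSymplecticForm Ω) (hq : IsFibreMetric B F q) :
    IsGradedAntiautomorphism F (circ F Ω q) (starRingEnd ℂ)
      (conjSection : RawSection B E → RawSection B E) where
  bijOn := bijOn_of_involutive (fun w => by funext x s t; exact conjFibre_conjFibre _)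
    fun _ => conjSection_mem
  add v _ w _ := by funext x s t; exact map_add _ _ _
  smul c v _ := by funext x s t; exact conjFibre_smul _ _
  graded d a v hv := by
    have h := mem_homogeneous_iff.1 hv
    refine mem_homogeneous_iff.2 ⟨conjSection_mem h.1, fun x s t => ?_, fun x s t => ?_⟩
    · refine (conjFibre_onE _ _).symm.trans ((congrArg _ (h.2.1 x s t)).trans ?_)
      rw [conjFibre_smul, map_pow, map_neg, map_one]
      rfl
    · refine (conjFibre_onForms _ _).symm.trans ((congrArg _ (h.2.2 x s t)).trans ?_)
      rw [conjFibre_smul, map_intCast]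
      rfl
  anti d₁ d₂ a₁ a₂ v hv w hw := by
    funext x s t
    rw [Pi.smul_apply, circ_eq_formalProd, Pi.smul_apply, Pi.smul_apply]
    refine Eq.trans ?_ (formalProd_reverse (C := fibreProd F Ω q x) (v := v x) (w := w x)
      (Φ := fun _ => conjFibre.toAddMonoidHom) (fun k l r r' p p' => ?_) s t)
    · rw [← circ_eq_formalProd]
      rfl
    · change conjFibre _ = _ • fibreProd F Ω q x k l (conjFibre (w x r' p')) (conjFibre (v x r p))
      rw [fibreProd_flip hΩ hq hv hw, smul_smul, conjFibre_smul, fibreProd_apply,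
        conjFibre_contraction, fibreProd_apply, map_mul, map_mul, conj_starCoeff, map_pow, map_neg,
        map_one, map_zpow₀, map_neg, map_one]
      congr 1
      have e : (-1 : ℂ) ^ (k + l) * (-1 : ℂ) ^ (k + l) = 1 := by
        rw [← mul_pow, neg_one_mul, neg_neg, one_pow]
      linear_combination (starCoeff k l *
        (-1 : ℂ) ^ ((d₁.val : ℤ) * (d₂.val : ℤ) + a₁ * a₂)) * e

end DeformedAlgebra

/-! ### The infinitesimal action of endomorphisms -/

section LinearAction

variable {V : Type*} [AddCommGroup V] [Module ℝ V] {F : Type*} [AddCommGroup F] [Module ℝ F]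

theorem iS_one (X : V) : iS X (1 : FibreAlg V F) = 0 := by
  have h : (1 : FibreAlg V F) = decomp 1 1 1 1 := rfl
  rw [h, iS, onSym_decomp, symContract_one, decomp, TensorProduct.zero_tmul,
    TensorProduct.tmul_zero]

theorem iA_one (X : V) : iA X (1 : FibreAlg V F) = 0 := by
  have h : (1 : FibreAlg V F) = decomp 1 1 1 1 := rfl
  rw [h, iA, onForms_decomp, CliffordAlgebra.contractLeft_one, decomp, TensorProduct.tmul_zero,
    TensorProduct.tmul_zero, TensorProduct.tmul_zero]

theorem iE_one (e : F) : iE e (1 : FibreAlg V F) = 0 := by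
  have h : (1 : FibreAlg V F) = decomp 1 1 1 1 := rfl
  rw [h, iE, onE_decomp, CliffordAlgebra.contractLeft_one, decomp, TensorProduct.zero_tmul,
    TensorProduct.tmul_zero, TensorProduct.tmul_zero]

theorem iE_iE (e e' : F) (a : FibreAlg V F) : iE e (iE e' a) = -iE e' (iE e a) := by
  have := LinearMap.congr_fun (iE_mul_iE (V := V) e e') a
  simpa only [Module.End.mul_apply, LinearMap.neg_apply] using this

theorem iE_mulE (e : F) (θ : Module.Dual ℝ F) (a : FibreAlg V F) :
    iE e (mulE θ a) = (θ e : ℂ) • a - mulE θ (iE e a) := by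
  induction a using fibre_induction with
  | hadd a a' ha ha' => simp only [map_add, smul_add, ha, ha']; abel
  | h z f φ α =>
    simp only [iE, mulE, onE_decomp, LinearMap.mulLeft_apply]
    rw [extContract_ι_mul, decomp, TensorProduct.sub_tmul, TensorProduct.tmul_sub,
      TensorProduct.tmul_sub]
    congr 1
    exact decomp_smul_E _ _ _ _ _

theorem mulE_mulA (θ : Module.Dual ℝ F) (ξ : Module.Dual ℝ V) (a : FibreAlg V F) :
    mulE θ (mulA ξ a) = mulA ξ (mulE θ a) :=
  LinearMap.congr_fun (onE_commute_onForms _ _).eq a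

theorem iE_mulA (e : F) (ξ : Module.Dual ℝ V) (a : FibreAlg V F) :
    iE e (mulA ξ a) = mulA ξ (iE e a) :=
  LinearMap.congr_fun (onE_commute_onForms _ _).eq a

theorem iE_iA (e : F) (X : V) (a : FibreAlg V F) : iE e (iA X a) = iA X (iE e a) :=
  LinearMap.congr_fun (onE_commute_onForms _ _).eq a

theorem mulS_iE (ξ : Module.Dual ℝ V) (e : F) (a : FibreAlg V F) :
    mulS ξ (iE e a) = iE e (mulS ξ a) :=
  LinearMap.congr_fun (onSym_commute_onE _ _).eq a

theorem iS_iE (X : V) (e : F) (a : FibreAlg V F) : iS X (iE e a) = iE e (iS X a) :=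
  LinearMap.congr_fun (onSym_commute_onE _ _).eq a

theorem iS_mulE (X : V) (θ : Module.Dual ℝ F) (a : FibreAlg V F) :
    iS X (mulE θ a) = mulE θ (iS X a) :=
  LinearMap.congr_fun (onSym_commute_onE _ _).eq a

/-- Induction over an algebra of fibres through its generators. -/
theorem fibre_induction_generators {p : FibreAlg V F → Prop} (a : FibreAlg V F) (one : p 1)
    (hS : ∀ ξ, p (mulS ξ 1)) (hE : ∀ θ, p (mulE θ 1)) (hA : ∀ ξ, p (mulA ξ 1))
    (smul : ∀ (c : ℂ) a, p a → p (c • a)) (add : ∀ a b, p a → p b → p (a + b))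
    (mul : ∀ a b, p a → p b → p (a * b)) : p a := by
  have h1 : ∀ f, p (decomp 1 f 1 1) := fun f => by
    induction f using SymmetricAlgebra.induction with
    | algebraMap r =>
      have : decomp 1 (algebraMap ℝ _ r) 1 1 = (r : ℂ) • (1 : FibreAlg V F) := by
        rw [Algebra.algebraMap_eq_smul_one, decomp_smul_S]; rfl
      rw [this]
      exact smul _ _ one
    | ι ξ =>
      have : decomp 1 (SymmetricAlgebra.ι ℝ _ ξ) 1 1 = mulS ξ (1 : FibreAlg V F) := by
        refine Eq.symm ((onSym_decomp _ _ _ _ _).trans ?_)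
        rw [LinearMap.mulLeft_apply, mul_one]
      rw [this]
      exact hS ξ
    | mul f g hf hg =>
      have : decomp 1 (f * g) 1 1 = (decomp 1 f 1 1 * decomp 1 g 1 1 : FibreAlg V F) := by
        rw [decomp_mul, mul_one, mul_one, mul_one]
      rw [this]
      exact mul _ _ hf hg
    | add f g hf hg =>
      have : decomp 1 (f + g) 1 1 = (decomp 1 f 1 1 + decomp 1 g 1 1 : FibreAlg V F) := by
        rw [decomp, TensorProduct.add_tmul, TensorProduct.tmul_add]
      rw [this]
      exact add _ _ hf hg
  have h2 : ∀ φ, p (decomp 1 1 φ 1) := fun φ => by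
    induction φ using ExteriorAlgebra.induction with
    | algebraMap r =>
      have : decomp 1 1 (algebraMap ℝ _ r) 1 = (r : ℂ) • (1 : FibreAlg V F) := by
        rw [Algebra.algebraMap_eq_smul_one, decomp_smul_E]; rfl
      rw [this]
      exact smul _ _ one
    | ι ξ =>
      have : decomp 1 1 (ExteriorAlgebra.ι ℝ ξ) 1 = mulE ξ (1 : FibreAlg V F) := by
        refine Eq.symm ((onE_decomp _ _ _ _ _).trans ?_)
        rw [LinearMap.mulLeft_apply, mul_one]
      rw [this]
      exact hE ξ
    | mul f g hf hg =>
      have : decomp 1 1 (f * g) 1 = (decomp 1 1 f 1 * decomp 1 1 g 1 : FibreAlg V F) := by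
        rw [decomp_mul, mul_one, mul_one, mul_one]
      rw [this]
      exact mul _ _ hf hg
    | add f g hf hg =>
      have : decomp 1 1 (f + g) 1 = (decomp 1 1 f 1 + decomp 1 1 g 1 : FibreAlg V F) := by
        rw [decomp, TensorProduct.add_tmul, TensorProduct.tmul_add, TensorProduct.tmul_add]
      rw [this]
      exact add _ _ hf hg
  have h3 : ∀ α, p (decomp 1 1 1 α) := fun α => by
    induction α using ExteriorAlgebra.induction with
    | algebraMap r =>
      have : decomp 1 1 1 (algebraMap ℝ _ r) = (r : ℂ) • (1 : FibreAlg V F) := by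
        rw [Algebra.algebraMap_eq_smul_one, decomp_smul_forms]; rfl
      rw [this]
      exact smul _ _ one
    | ι ξ =>
      have : decomp 1 1 1 (ExteriorAlgebra.ι ℝ ξ) = mulA ξ (1 : FibreAlg V F) := by
        refine Eq.symm ((onForms_decomp _ _ _ _ _).trans ?_)
        rw [LinearMap.mulLeft_apply, mul_one]
      rw [this]
      exact hA ξ
    | mul f g hf hg =>
      have : decomp 1 1 1 (f * g) = (decomp 1 1 1 f * decomp 1 1 1 g : FibreAlg V F) := by
        rw [decomp_mul, mul_one, mul_one, mul_one]
      rw [this]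
      exact mul _ _ hf hg
    | add f g hf hg =>
      have : decomp 1 1 1 (f + g) = (decomp 1 1 1 f + decomp 1 1 1 g : FibreAlg V F) := by
        rw [decomp, TensorProduct.tmul_add, TensorProduct.tmul_add, TensorProduct.tmul_add]
      rw [this]
      exact add _ _ hf hg
  induction a using fibre_induction with
  | hadd a b ha hb => exact add a b ha hb
  | h z f φ α =>
    have : decomp z f φ α = z • (decomp 1 f 1 1 * decomp 1 1 φ 1 * decomp 1 1 1 α) := by
      simp only [decomp_mul, mul_one, one_mul]
      rw [decomp, decomp, TensorProduct.smul_tmul', smul_eq_mul, mul_one]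
    rw [this]
    exact smul _ _ (mul _ _ (mul _ _ (h1 f) (h2 φ)) (h3 α))

variable {ι κ : Type*} [Fintype ι] [Fintype κ]

/-- The infinitesimal action of a pair of endomorphisms of `V` and `F` on
`Sym V* ⊗ Λ F* ⊗ Λ V*`: the derivation which maps covectors `ξ` to `ξ ∘ A` and `θ` to `θ ∘ C`. -/
def linAction (b : Module.Basis ι ℝ V) (c : Module.Basis κ ℝ F) (A : Module.End ℝ V)
    (C : Module.End ℝ F) : Module.End ℂ (FibreAlg V F) :=
  ∑ l, mulS (b.coord l) * iS (A (b l)) + ∑ l, mulA (b.coord l) * iA (A (b l)) +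
    ∑ l, mulE (c.coord l) * iE (C (c l))

variable (b : Module.Basis ι ℝ V) (c : Module.Basis κ ℝ F) (A : Module.End ℝ V)
  (C : Module.End ℝ F)

theorem linAction_apply (a : FibreAlg V F) : linAction b c A C a =
    ∑ l, mulS (b.coord l) (iS (A (b l)) a) + ∑ l, mulA (b.coord l) (iA (A (b l)) a) +
      ∑ l, mulE (c.coord l) (iE (C (c l)) a) := by
  simp only [linAction, LinearMap.add_apply, LinearMap.sum_apply, Module.End.mul_apply]

theorem linAction_mul (a a' : FibreAlg V F) :
    linAction b c A C (a * a') = linAction b c A C a * a' + a * linAction b c A C a' := by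
  simp only [linAction_apply, mulS_leibniz_iS, mulA_leibniz_iA, mulE_leibniz_iE,
    Finset.sum_add_distrib, add_mul, mul_add, Finset.sum_mul, Finset.mul_sum]
  abel

theorem sum_coord_smul_map {N N' : Type*} [AddCommGroup N] [Module ℝ N] [AddCommGroup N']
    [Module ℝ N'] (b : Module.Basis ι ℝ N) (A : N →ₗ[ℝ] N') (Y : N) :
    ∑ l, b.coord l Y • A (b l) = A Y := by
  conv_rhs => rw [← b.sum_repr Y, map_sum]
  simp only [map_smul, Module.Basis.coord_apply]

theorem sum_apply_smul_coord {N : Type*} [AddCommGroup N] [Module ℝ N] (b : Module.Basis ι ℝ N)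
    (A : Module.End ℝ N) (ξ : Module.Dual ℝ N) : ∑ l, ξ (A (b l)) • b.coord l = ξ ∘ₗ A := by
  classical
  refine b.ext fun j => ?_
  simp [LinearMap.sum_apply, Finsupp.single_apply]

/-- Insertions are equivariant under the infinitesimal action. -/
theorem linAction_iS (Y : V) (a : FibreAlg V F) :
    linAction b c A C (iS Y a) = iS Y (linAction b c A C a) - iS (A Y) a := by
  have h : ∀ l, iS Y (mulS (b.coord l) (iS (A (b l)) a)) =
      mulS (b.coord l) (iS (A (b l)) (iS Y a)) + (b.coord l Y : ℂ) • iS (A (b l)) a := fun l => by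
    rw [iS_mulS, iS_iS]
  rw [linAction_apply, linAction_apply, map_add, map_add, map_sum, map_sum, map_sum,
    ← sum_coord_smul_map b A Y, iS_sum_smul]
  simp only [h, LinearMap.sum_apply, LinearMap.smul_apply, Finset.sum_add_distrib, iS_mulA, iS_iA,
    iS_mulE, iS_iE]
  abel

theorem linAction_iE (e : F) (a : FibreAlg V F) :
    linAction b c A C (iE e a) = iE e (linAction b c A C a) - iE (C e) a := by
  have h : ∀ l, iE e (mulE (c.coord l) (iE (C (c l)) a)) =
      mulE (c.coord l) (iE (C (c l)) (iE e a)) + (c.coord l e : ℂ) • iE (C (c l)) a := fun l => by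
    rw [iE_mulE, iE_iE e, map_neg]
    abel
  rw [linAction_apply, linAction_apply, map_add, map_add, map_sum, map_sum, map_sum,
    ← sum_coord_smul_map c C e, iE_sum_smul]
  simp only [h, LinearMap.sum_apply, LinearMap.smul_apply, Finset.sum_add_distrib, iE_mulA, iE_iA,
    ← mulS_iE, iS_iE]
  abel

theorem linAction_mulA (ξ : Module.Dual ℝ V) (a : FibreAlg V F) :
    linAction b c A C (mulA ξ a) = mulA ξ (linAction b c A C a) + mulA (ξ ∘ₗ A) a := by
  have h : ∀ l, mulA (b.coord l) (iA (A (b l)) (mulA ξ a)) =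
      mulA ξ (mulA (b.coord l) (iA (A (b l)) a)) + (ξ (A (b l)) : ℂ) • mulA (b.coord l) a :=
    fun l => by
      rw [iA_mulA, map_sub, map_smul, mulA_mulA ξ]
      abel
  rw [linAction_apply, linAction_apply, map_add, map_add, map_sum, map_sum, map_sum,
    ← sum_apply_smul_coord b A ξ, mulA_sum_smul]
  simp only [h, LinearMap.sum_apply, LinearMap.smul_apply, Finset.sum_add_distrib, iS_mulA,
    mulS_mulA, iE_mulA, mulE_mulA]
  abel

theorem linAction_fibreDelta (a : FibreAlg V F) :
    linAction b c A C (fibreDelta b a) = fibreDelta b (linAction b c A C a) := by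
  have h : ∑ k, mulA (b.coord k ∘ₗ A) (iS (b k) a) = ∑ k, mulA (b.coord k) (iS (A (b k)) a) := by
    have h1 : ∀ k, mulA (b.coord k ∘ₗ A) (iS (b k) a) = ∑ l, (b.coord k (A (b l)) : ℂ) •
        mulA (b.coord l) (iS (b k) a) := fun k => by
      rw [← sum_apply_smul_coord b A, mulA_sum_smul]
      simp only [LinearMap.sum_apply, LinearMap.smul_apply]
    have h2 : ∀ k, mulA (b.coord k) (iS (A (b k)) a) = ∑ l, (b.coord l (A (b k)) : ℂ) •
        mulA (b.coord k) (iS (b l) a) := fun k => by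
      have : A (b k) = ∑ l, b.coord l (A (b k)) • b l :=
        (sum_coord_smul_map b LinearMap.id (A (b k))).symm
      rw [this, iS_sum_smul, ← this]
      simp only [LinearMap.sum_apply, LinearMap.smul_apply, map_sum, map_smul]
    simp only [h1, h2]
    exact Finset.sum_comm
  simp only [fibreDelta, LinearMap.sum_apply, Module.End.mul_apply, map_sum, linAction_mulA,
    linAction_iS, map_sub, Finset.sum_add_distrib, Finset.sum_sub_distrib, h]
  abel

theorem linAction_parE (a : FibreAlg V F) :
    linAction b c A C (parE a) = parE (linAction b c A C a) := by
  have h1 : ∀ ξ a, (mulS ξ (parE a) : FibreAlg V F) = parE (mulS ξ a) := fun ξ a =>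
    LinearMap.congr_fun (onSym_commute_onE _ _).eq a
  have h2 : ∀ X a, (iA X (parE a) : FibreAlg V F) = parE (iA X a) := fun ξ a =>
    (LinearMap.congr_fun (onE_commute_onForms _ _).eq a).symm
  have h3 : ∀ e a, (iE e (parE a) : FibreAlg V F) = -parE (iE e a) := fun e a => by
    simpa only [Module.End.mul_apply, LinearMap.neg_apply] using
      LinearMap.congr_fun (iE_mul_parE (V := V) e) a
  have h4 : ∀ θ a, (mulE θ (parE a) : FibreAlg V F) = -parE (mulE θ a) := fun θ a => by
    have e : ∀ a : FibreAlg V F, mulE θ a = decomp 1 1 (ExteriorAlgebra.ι ℝ θ) 1 * a := fun a => by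
      induction a using fibre_induction with
      | hadd a b ha hb => rw [map_add, mul_add, ha, hb]
      | h z f φ α => rw [mulE, onE_decomp, decomp_mul, one_mul, one_mul, one_mul,
          LinearMap.mulLeft_apply]
    rw [e, e, parE_mul, parE_decomp (d := 1) (by
      rw [ExteriorAlgebra.exteriorPower, pow_one]; exact LinearMap.mem_range_self _ θ), pow_one,
      neg_smul, one_smul, neg_mul, neg_neg]
  simp only [linAction_apply, map_add, map_sum, ← parE_iS, h1, h2, h3, ← parE_mulA, map_neg, h4,
    neg_neg]

theorem linAction_jE (e : F) (a : FibreAlg V F) :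
    linAction b c A C (jE e a) = jE e (linAction b c A C a) - jE (C e) a := by
  rw [jE, jE, Module.End.mul_apply, Module.End.mul_apply, Module.End.mul_apply, linAction_parE,
    linAction_iE, map_sub]

theorem linAction_numA (a : FibreAlg V F) :
    linAction b c A C (numA a) = numA (linAction b c A C a) := by
  classical
  have h1 : ∀ ξ a, (mulS ξ (numA a) : FibreAlg V F) = numA (mulS ξ a) := fun ξ a =>
    LinearMap.congr_fun (onSym_commute_onForms _ _).eq a
  have h2 : ∀ e a, (iE e (numA a) : FibreAlg V F) = numA (iE e a) := fun e a =>
    LinearMap.congr_fun (onE_commute_onForms _ _).eq a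
  have h3 : ∀ θ a, (mulE θ (numA a) : FibreAlg V F) = numA (mulE θ a) := fun θ a =>
    LinearMap.congr_fun (onE_commute_onForms _ _).eq a
  have h4 : ∀ ξ X a, (mulA ξ (iA X (numA a)) : FibreAlg V F) = numA (mulA ξ (iA X a)) :=
    fun ξ X a => by
      have : numA (iA X a) = iA X (numA a) - iA X a := by
        obtain ⟨r, rfl⟩ : ∃ r : ι → ℝ, X = ∑ l, r l • b l :=
          ⟨fun l => b.coord l X, (sum_coord_smul_map b LinearMap.id X).symm⟩
        rw [iA_sum_smul]
        simp only [LinearMap.sum_apply, LinearMap.smul_apply, map_sum,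
          map_smul, numA_iA_basis, smul_sub, Finset.sum_sub_distrib]
      rw [numA_mulA, this, map_sub, sub_add_cancel]
  simp only [linAction_apply, map_add, map_sum, ← numA_iS, h1, h2, h3, h4]

variable {V' : Type*} [AddCommGroup V'] [Module ℝ V'] {F' : Type*} [AddCommGroup F'] [Module ℝ F']

theorem pull_linAction (g : V ≃ₗ[ℝ] V') (h : F ≃ₗ[ℝ] F') (A : Module.End ℝ V')
    (C : Module.End ℝ F') (a : FibreAlg V' F') :
    pull g.toLinearMap h.toLinearMap (linAction (b.map g) (c.map h) A C a) =
      linAction b c (g.symm.toLinearMap ∘ₗ A ∘ₗ g.toLinearMap)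
        (h.symm.toLinearMap ∘ₗ C ∘ₗ h.toLinearMap) (pull g.toLinearMap h.toLinearMap a) := by
  have hb : ∀ l, (b.map g).coord l ∘ₗ g.toLinearMap = b.coord l := fun l => by
    ext X; simp
  have hc : ∀ l, (c.map h).coord l ∘ₗ h.toLinearMap = c.coord l := fun l => by
    ext X; simp
  have eS : ∀ X a, pull g.toLinearMap h.toLinearMap (iS X a) =
      iS (g.symm X) (pull g.toLinearMap h.toLinearMap a) := fun X a => by
    rw [← pull_iS, LinearEquiv.coe_coe, LinearEquiv.apply_symm_apply]
  have eA : ∀ X a, pull g.toLinearMap h.toLinearMap (iA X a) =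
      iA (g.symm X) (pull g.toLinearMap h.toLinearMap a) := fun X a => by
    rw [← pull_iA, LinearEquiv.coe_coe, LinearEquiv.apply_symm_apply]
  have eE : ∀ X a, pull g.toLinearMap h.toLinearMap (iE X a) =
      iE (h.symm X) (pull g.toLinearMap h.toLinearMap a) := fun X a => by
    rw [← pull_iE, LinearEquiv.coe_coe, LinearEquiv.apply_symm_apply]
  simp only [linAction_apply, map_add, map_sum, pull_mulS, pull_mulA, pull_mulE, eS, eA, eE, hb, hc,
    Module.Basis.map_apply]
  rfl

/-- The infinitesimal action does not depend on the bases used to write it down. -/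
theorem linAction_change_basis (b' : Module.Basis ι ℝ V) (c' : Module.Basis κ ℝ F) :
    (linAction b' c' A C : Module.End ℂ (FibreAlg V F)) = linAction b c A C := by
  classical
  refine LinearMap.ext fun a => ?_
  rw [linAction_apply, linAction_apply]
  congr 1
  · congr 1
    · refine sum_coord_change_basis (fun ξ X => mulS ξ (iS (A X) a)) ?_ ?_ b b'
      · intro r ξ X
        simp only [mulS_sum_smul, LinearMap.sum_apply, LinearMap.smul_apply]
      · intro r Y ξ
        simp only [map_sum, map_smul]
        simp only [iS_sum_smul, LinearMap.sum_apply, LinearMap.smul_apply, map_sum, map_smul]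
    · refine sum_coord_change_basis (fun ξ X => mulA ξ (iA (A X) a)) ?_ ?_ b b'
      · intro r ξ X
        simp only [mulA_sum_smul, LinearMap.sum_apply, LinearMap.smul_apply]
      · intro r Y ξ
        simp only [map_sum, map_smul]
        simp only [iA_sum_smul, LinearMap.sum_apply, LinearMap.smul_apply, map_sum, map_smul]
  · refine sum_coord_change_basis (fun ξ X => mulE ξ (iE (C X) a)) ?_ ?_ c c'
    · intro r ξ X
      simp only [mulE_sum_smul, LinearMap.sum_apply, LinearMap.smul_apply]
    · intro r Y ξ
      simp only [map_sum, map_smul]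
      simp only [iE_sum_smul, LinearMap.sum_apply, LinearMap.smul_apply, map_sum, map_smul]

end LinearAction

/-! ### Derivatives of pull-backs -/

section LinearActionGenerators

variable {V : Type*} [AddCommGroup V] [Module ℝ V] {F : Type*} [AddCommGroup F] [Module ℝ F]
  {ι κ : Type*} [Fintype ι] [Fintype κ] (b : Module.Basis ι ℝ V) (c : Module.Basis κ ℝ F)
  (A : Module.End ℝ V) (C : Module.End ℝ F)

theorem iS_add (X Y : V) : (iS (X + Y) : Module.End ℂ (FibreAlg V F)) = iS X + iS Y := by
  simpa [Fin.sum_univ_two] using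
    iS_sum_smul (V := V) (F := F) Finset.univ (fun _ : Fin 2 => 1) ![X, Y]

theorem iA_add (X Y : V) : (iA (X + Y) : Module.End ℂ (FibreAlg V F)) = iA X + iA Y := by
  simpa [Fin.sum_univ_two] using
    iA_sum_smul (V := V) (F := F) Finset.univ (fun _ : Fin 2 => 1) ![X, Y]

theorem iE_add (X Y : F) : (iE (X + Y) : Module.End ℂ (FibreAlg V F)) = iE X + iE Y := by
  simpa [Fin.sum_univ_two] using
    iE_sum_smul (V := V) (F := F) Finset.univ (fun _ : Fin 2 => 1) ![X, Y]

theorem linAction_one : linAction b c A C (1 : FibreAlg V F) = 0 := by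
  simp only [linAction_apply, iS_one, iA_one, iE_one, map_zero, Finset.sum_const_zero, add_zero]

theorem linAction_mulS_one (ξ : Module.Dual ℝ V) :
    linAction b c A C (mulS ξ (1 : FibreAlg V F)) = mulS (ξ ∘ₗ A) 1 := by
  rw [← sum_apply_smul_coord b A ξ, mulS_sum_smul]
  simp only [linAction_apply, iS_mulS, iS_one, map_zero, map_smul, zero_add, ← mulS_iE,
    iE_one, Finset.sum_const_zero, add_zero, LinearMap.sum_apply, LinearMap.smul_apply,
    ← mulS_iA, iA_one]

theorem linAction_mulA_one (ξ : Module.Dual ℝ V) :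
    linAction b c A C (mulA ξ (1 : FibreAlg V F)) = mulA (ξ ∘ₗ A) 1 := by
  rw [linAction_mulA, linAction_one, map_zero, zero_add]

theorem linAction_mulE_one (θ : Module.Dual ℝ F) :
    linAction b c A C (mulE θ (1 : FibreAlg V F)) = mulE (θ ∘ₗ C) 1 := by
  have h : ∀ X, (iA X (mulE θ (1 : FibreAlg V F))) = mulE θ (iA X 1) := fun X =>
    (LinearMap.congr_fun (onE_commute_onForms _ _).eq (1 : FibreAlg V F)).symm
  rw [← sum_apply_smul_coord c C θ, mulE_sum_smul]
  simp only [linAction_apply, iS_mulE, iS_one, map_zero, map_smul, h, iA_one, iE_mulE, iE_one,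
    sub_zero, Finset.sum_const_zero, zero_add, LinearMap.sum_apply, LinearMap.smul_apply]

theorem linAction_add (A' : Module.End ℝ V) (C' : Module.End ℝ F) (a : FibreAlg V F) :
    linAction b c (A + A') (C + C') a = linAction b c A C a + linAction b c A' C' a := by
  simp only [linAction_apply, LinearMap.add_apply, iS_add, iA_add, iE_add, map_add,
    Finset.sum_add_distrib]
  abel

theorem linAction_mem_symDegree {s : ℕ} {a : FibreAlg V F} (ha : a ∈ symDegree V F s) :
    linAction b c A C a ∈ symDegree V F s := by
  rw [linAction_apply]
  refine Submodule.add_mem _ (Submodule.add_mem _ ?_ ?_) ?_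
  · cases s with
    | zero =>
      refine Submodule.sum_mem _ fun l _ => ?_
      rw [iS_of_mem_zero _ ha, map_zero]
      exact Submodule.zero_mem _
    | succ s => exact Submodule.sum_mem _ fun l _ => mulS_mem_symDegree _ (iS_mem_symDegree _ ha)
  · exact Submodule.sum_mem _ fun l _ => onForms_mem_symDegree _ (onForms_mem_symDegree _ ha)
  · exact Submodule.sum_mem _ fun l _ => onE_mem_symDegree _ (onE_mem_symDegree _ ha)

end LinearActionGenerators

section PullDerivative

variable {B : Type*} [NormedAddCommGroup B] [NormedSpace ℝ B]
  {M : Type*} [TopologicalSpace M] [ChartedSpace B M] {y : M}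
  {V : Type*} [AddCommGroup V] [Module ℝ V] {F : Type*} [AddCommGroup F] [Module ℝ F]

/-- The family `N` of endomorphisms has smooth matrix coefficients at `y`, and derivative `N'`
there. -/
def HasEndDeriv (y : M) (N : M → Module.End ℝ V)
    (N' : TangentSpace 𝓘(ℝ, B) y → Module.End ℝ V) : Prop :=
  ∀ (ξ : Module.Dual ℝ V) (v : V), ContMDiffAt 𝓘(ℝ, B) 𝓘(ℝ, ℝ) ∞ (fun z => ξ (N z v)) y ∧
    ∀ X, mvfderiv 𝓘(ℝ, B) (fun z => ξ (N z v)) y X = ξ (N' X v)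

variable {ι κ : Type*} [Fintype ι] [Fintype κ] (b : Module.Basis ι ℝ V) (c : Module.Basis κ ℝ F)
  {N : M → Module.End ℝ V} {N' : TangentSpace 𝓘(ℝ, B) y → Module.End ℝ V}
  {P : M → Module.End ℝ F} {P' : TangentSpace 𝓘(ℝ, B) y → Module.End ℝ F}

/-- The derivative of the pull-back along a family of endomorphisms is the infinitesimal action. -/
theorem HasEndDeriv.pull_const (hN : HasEndDeriv y N N') (hP : HasEndDeriv y P P')
    (hN1 : N y = LinearMap.id) (hP1 : P y = LinearMap.id) (a : FibreAlg V F) :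
    HasFiniteDeriv y (fun z => pull (N z) (P z) a) (fun X => linAction b c (N' X) (P' X) a) := by
  induction a using fibre_induction_generators with
  | one => simpa only [map_one, linAction_one] using HasFiniteDeriv.const (1 : FibreAlg V F)
  | hS ξ =>
    refine ((HasFiniteDeriv.sum Finset.univ fun l _ => HasFiniteDeriv.smul_const _
      (hN ξ (b l)).1 (mulS (b.coord l) (1 : FibreAlg V F))).congr
        (Filter.Eventually.of_forall fun z => ?_)).congr_deriv fun X => ?_
    · rw [pull_mulS, map_one, ← sum_apply_smul_coord b, mulS_sum_smul]
      simp only [LinearMap.sum_apply, LinearMap.smul_apply]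
    · rw [linAction_mulS_one, ← sum_apply_smul_coord b, mulS_sum_smul]
      simp only [LinearMap.sum_apply, LinearMap.smul_apply, (hN ξ _).2]
  | hA ξ =>
    refine ((HasFiniteDeriv.sum Finset.univ fun l _ => HasFiniteDeriv.smul_const _
      (hN ξ (b l)).1 (mulA (b.coord l) (1 : FibreAlg V F))).congr
        (Filter.Eventually.of_forall fun z => ?_)).congr_deriv fun X => ?_
    · rw [pull_mulA, map_one, ← sum_apply_smul_coord b, mulA_sum_smul]
      simp only [LinearMap.sum_apply, LinearMap.smul_apply]
    · rw [linAction_mulA_one, ← sum_apply_smul_coord b, mulA_sum_smul]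
      simp only [LinearMap.sum_apply, LinearMap.smul_apply, (hN ξ _).2]
  | hE θ =>
    refine ((HasFiniteDeriv.sum Finset.univ fun l _ => HasFiniteDeriv.smul_const _
      (hP θ (c l)).1 (mulE (c.coord l) (1 : FibreAlg V F))).congr
        (Filter.Eventually.of_forall fun z => ?_)).congr_deriv fun X => ?_
    · rw [pull_mulE, map_one, ← sum_apply_smul_coord c, mulE_sum_smul]
      simp only [LinearMap.sum_apply, LinearMap.smul_apply]
    · rw [linAction_mulE_one, ← sum_apply_smul_coord c, mulE_sum_smul]
      simp only [LinearMap.sum_apply, LinearMap.smul_apply, (hP θ _).2]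
  | smul r a ha =>
    simp only [map_smul]
    exact ha.map (r • LinearMap.id)
  | add a a' ha ha' => simpa only [map_add] using ha.add ha'
  | mul a a' ha ha' =>
    refine ((ha.bilinear ha' (LinearMap.mul ℂ (FibreAlg V F))).congr
      (Filter.Eventually.of_forall fun z => map_mul _ _ _)).congr_deriv fun X => ?_
    simp only [hN1, hP1, pull_id, linAction_mul, LinearMap.mul_apply']

/-- The derivative of a pull-back along a moving map, at a point where that map is the identity:
the infinitesimal action of the derivative of the map, plus the derivative of the argument. -/
theorem HasEndDeriv.pull (hN : HasEndDeriv y N N') (hP : HasEndDeriv y P P')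
    (hN1 : N y = LinearMap.id) (hP1 : P y = LinearMap.id) {f : M → FibreAlg V F}
    {f' : TangentSpace 𝓘(ℝ, B) y → FibreAlg V F} (hf : HasFiniteDeriv y f f') :
    HasFiniteDeriv y (fun z => pull (N z) (P z) (f z))
      (fun X => linAction b c (N' X) (P' X) (f y) + f' X) := by
  induction hf with
  | smul_const r hr w =>
    refine (((hN.pull_const b c hP hN1 hP1 w).real_smul hr).congr
      (Filter.Eventually.of_forall fun z => map_smul _ _ _)).congr_deriv fun X => ?_
    rw [hN1, hP1, pull_id, map_smul, add_comm]
  | add _ _ h1 h2 =>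
    refine ((h1.add h2).congr (Filter.Eventually.of_forall fun z => map_add _ _ _)).congr_deriv
      fun X => ?_
    rw [map_add]
    exact add_add_add_comm _ _ _ _
  | congr _ h ih =>
    rw [h.self_of_nhds]
    exact ih.congr (h.mono fun z hz => by rw [hz])

end PullDerivative

/-! ### Connections in local frames -/

section Frames

variable {B : Type*} [NormedAddCommGroup B] [NormedSpace ℝ B]
  {M : Type*} [TopologicalSpace M] [ChartedSpace B M] [IsManifold 𝓘(ℝ, B) ∞ M]
  (F : Type*) [NormedAddCommGroup F] [NormedSpace ℝ F]
  (E : M → Type*) [∀ x, AddCommGroup (E x)] [∀ x, Module ℝ (E x)]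
  [∀ x, TopologicalSpace (E x)] [TopologicalSpace (Bundle.TotalSpace F E)]
  [FiberBundle F E] [VectorBundle ℝ F E]

/-- The inverse of `fibreTransport F E x z` (if `z` is in the domain of the frame around `x`). -/
def transportBack (x z : M) : E z →ₗ[ℝ] E x :=
  ((trivializationAt F E x).symmL ℝ x).toLinearMap ∘ₗ
    ((trivializationAt F E x).continuousLinearMapAt ℝ z).toLinearMap

theorem transportBack_eq (x : M) {z : M} (hz : z ∈ frameDomain F E x) :
    transportBack F E x z = (transportEquiv F E x hz).symm.toLinearMap := by
  ext e
  have h1 := (trivializationAt F E x).linearMapAt_def_of_mem (R := ℝ) hz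
  have h2 := (trivializationAt F E x).symmₗ_apply (R := ℝ) (mem_frameDomain F E x)
  change (trivializationAt F E x).symmₗ ℝ x ((trivializationAt F E x).linearMapAt ℝ z e) =
    ((trivializationAt F E x).linearEquivAt ℝ x (mem_frameDomain F E x)).symm
    ((trivializationAt F E x).linearEquivAt ℝ z hz e)
  rw [h1, h2]
  rfl

theorem fibreTransport_transportBack (x : M) {z : M} (hz : z ∈ frameDomain F E x) (e : E z) :
    fibreTransport F E x z (transportBack F E x z e) = e := by
  rw [transportBack_eq F E x hz, ← transportEquiv_toLinearMap F E x hz]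
  exact LinearEquiv.apply_symm_apply _ _

theorem transportBack_fibreTransport (x : M) {z : M} (hz : z ∈ frameDomain F E x) (e : E x) :
    transportBack F E x z (fibreTransport F E x z e) = e := by
  rw [transportBack_eq F E x hz, ← transportEquiv_toLinearMap F E x hz]
  exact LinearEquiv.symm_apply_apply _ _

theorem transportBack_self (x : M) (e : E x) : transportBack F E x x e = e := by
  have h := fibreTransport_transportBack F E x (mem_frameDomain F E x) e
  rwa [fibreTransport_self] at h

variable [FiniteDimensional ℝ F]

theorem transportBack_fibreFrame (x : M) {z : M} (hz : z ∈ frameDomain F E x)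
    (A : Fin (Module.finrank ℝ F)) :
    transportBack F E x z (fibreFrame F E x A z) = fibreBasis F E x A := by
  rw [← fibreTransport_fibreBasis F E x hz, transportBack_fibreTransport F E x hz]

variable {E} in
/-- Sections in terms of the local frame. -/
theorem sum_coord_transportBack (x : M) {z : M} (hz : z ∈ frameDomain F E x) (e : E z) :
    ∑ C, (fibreBasis F E x).coord C (transportBack F E x z e) • fibreFrame F E x C z = e := by
  conv_rhs => rw [← fibreTransport_transportBack F E x hz e,
    ← (fibreBasis F E x).sum_repr (transportBack F E x z e), map_sum]
  simp only [map_smul, fibreTransport_fibreBasis F E x hz, Module.Basis.coord_apply]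

variable {F E}
variable [ContMDiffVectorBundle ∞ F E 𝓘(ℝ, B)]

theorem contMDiffAt_transportBack {x y : M} (hy : y ∈ frameDomain F E x) {σ : (z : M) → E z}
    (hσ : CMDiffAt ∞ (T% σ) y) (ξ : Module.Dual ℝ (E x)) :
    ContMDiffAt 𝓘(ℝ, B) 𝓘(ℝ, ℝ) ∞ (fun z => ξ (transportBack F E x z (σ z))) y := by
  have : ContMDiffVectorBundle 1 F E 𝓘(ℝ, B) := .of_le (n := ∞) (by simp)
  have h1 : ∀ C, ContMDiffAt 𝓘(ℝ, B) 𝓘(ℝ, ℝ) ∞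
      (fun z => (fibreBasis F E x).coord C (transportBack F E x z (σ z))) y := fun C => by
    refine (contMDiffAt_localFrameCoeff (I := 𝓘(ℝ, B)) (Module.finBasis ℝ F) hy hσ
      C).congr_of_eventuallyEq ?_
    filter_upwards [(trivializationAt F E x).open_baseSet.mem_nhds hy] with z hz
    refine Eq.trans ?_ ((trivializationAt F E x).localFrameCoeff_apply_of_mem_baseSet
      (I := 𝓘(ℝ, B)) (Module.finBasis ℝ F) hz σ C).symm
    rw [← fibreBasis_map_transportEquiv, transportBack_eq F E x hz]
    rfl
  have h2 : ContMDiffAt 𝓘(ℝ, B) 𝓘(ℝ, ℝ) ∞ (fun z => ∑ C, ξ (fibreBasis F E x C) *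
      (fibreBasis F E x).coord C (transportBack F E x z (σ z))) y :=
    ContMDiffAt.sum fun C _ => contMDiffAt_const.mul (h1 C)
  refine h2.congr_of_eventuallyEq (Filter.Eventually.of_forall fun z => ?_)
  beta_reduce
  conv_lhs => rw [← (fibreBasis F E x).sum_repr (transportBack F E x z (σ z)), map_sum]
  refine Finset.sum_congr rfl fun C _ => ?_
  rw [map_smul, smul_eq_mul, mul_comm]
  rfl

/-- A section which is smooth near `y` agrees near `y` with a global smooth section. -/
theorem exists_global_section [FiniteDimensional ℝ B] [T2Space M] {σ : (z : M) → E z} {U : Set M}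
    (hU : IsOpen U) {y : M} (hy : y ∈ U) (hσ : ∀ z ∈ U, CMDiffAt ∞ (T% σ) z) :
    ∃ τ : (z : M) → E z, CMDiff ∞ (T% τ) ∧ ∀ᶠ z in nhds y, τ z = σ z := by
  obtain ⟨f, -, hf⟩ := (SmoothBumpFunction.nhds_basis_tsupport (I := 𝓘(ℝ, B)) y).mem_iff.1
    (hU.mem_nhds hy)
  refine ⟨fun z => f z • σ z, ?_, ?_⟩
  · exact ContMDiffOn.smul_section_of_tsupport f.contMDiff.contMDiffOn hU hf
      fun z hz => (hσ z hz).contMDiffWithinAt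
  · filter_upwards [f.eventuallyEq_one] with z hz
    rw [hz, Pi.one_apply, one_smul]

variable [∀ x, IsTopologicalAddGroup (E x)] [∀ x, ContinuousSMul ℝ (E x)]
  (cov : CovariantDerivative 𝓘(ℝ, B) F E)

/-- A covariant derivative at `y` depends only on the germ of the section. -/
theorem cov_congr {σ τ : (z : M) → E z} {y : M} (hσ : CMDiffAt ∞ (T% σ) y)
    (h : ∀ᶠ z in nhds y, τ z = σ z) : cov τ y = cov σ y := by
  have hτ : CMDiffAt ∞ (T% τ) y := hσ.congr_of_eventuallyEq (h.mono fun z hz => by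
    simp only [hz])
  exact cov.isCovariantDerivativeOn.congr_of_eventuallyEq (hτ.mdifferentiableAt (by simp))
    (hσ.mdifferentiableAt (by simp)) Filter.univ_mem h

theorem cov_sum_smul {σ : Type*} (s : Finset σ) {c : σ → M → ℝ} {τ : σ → (z : M) → E z} {y : M}
    (hc : ∀ i, ContMDiffAt 𝓘(ℝ, B) 𝓘(ℝ, ℝ) ∞ (c i) y) (hτ : ∀ i, CMDiffAt ∞ (T% (τ i)) y)
    (X : TangentSpace 𝓘(ℝ, B) y) : CMDiffAt ∞ (T% (fun z => ∑ i ∈ s, c i z • τ i z)) y ∧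
      cov (fun z => ∑ i ∈ s, c i z • τ i z) y X =
        ∑ i ∈ s, (mvfderiv 𝓘(ℝ, B) (c i) y X • τ i y + c i y • cov (τ i) y X) := by
  classical
  induction s using Finset.induction_on with
  | empty =>
    simp only [Finset.sum_empty]
    refine ⟨Bundle.contMDiff_zeroSection ℝ E y, ?_⟩
    have := congrFun (cov.zero) y
    exact congrArg (fun L : TangentSpace 𝓘(ℝ, B) y →L[ℝ] E y => L X) this
  | insert a s ha ih =>
    have h1 : CMDiffAt ∞ (T% (fun z => c a z • τ a z)) y := (hc a).smul_section (hτ a)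
    simp only [Finset.sum_insert ha]
    refine ⟨h1.add_section ih.1, ?_⟩
    have h2 := cov.isCovariantDerivativeOnUniv.add (h1.mdifferentiableAt (by simp))
      (ih.1.mdifferentiableAt (by simp))
    have h3 := cov.isCovariantDerivativeOnUniv.leibniz ((hτ a).mdifferentiableAt (by simp))
      ((hc a).mdifferentiableAt (by simp))
    refine (congrArg (fun L : TangentSpace 𝓘(ℝ, B) y →L[ℝ] E y => L X) h2).trans ?_
    rw [_root_.add_apply, ih.2]
    congr 1
    refine (congrArg (fun L : TangentSpace 𝓘(ℝ, B) y →L[ℝ] E y => L X) h3).trans ?_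
    rw [_root_.add_apply, add_comm]
    rfl

/-- The derivative of a smooth section along a smooth vector field is smooth. -/
theorem contMDiffAt_cov [FiniteDimensional ℝ B] [T2Space M]
    (hcov : CovariantDerivative.ContMDiffCovariantDerivative cov ∞)
    {σ : (z : M) → E z} {U : Set M} (hU : IsOpen U) {y : M} (hy : y ∈ U)
    (hσ : ∀ z ∈ U, CMDiffAt ∞ (T% σ) z) {X : (z : M) → TangentSpace 𝓘(ℝ, B) z}
    (hX : CMDiffAt ∞ (T% X) y) : CMDiffAt ∞ (T% (fun z => cov σ z (X z))) y := by
  obtain ⟨τ, hτ, h⟩ := exists_global_section hU hy hσ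
  have h1 := hcov.contMDiff.contMDiff (σ := τ) hτ.contMDiffOn
  have h2 : CMDiffAt ∞ (T% (fun z => cov τ z (X z))) y :=
    ContMDiffAt.clm_bundle_apply (F₁ := B) (F₂ := F) (h1.contMDiffAt Filter.univ_mem) hX
  refine h2.congr_of_eventuallyEq ?_
  filter_upwards [h.eventually_nhds, hU.mem_nhds hy] with z hz hz'
  rw [cov_congr cov (hσ z hz') hz]

end Frames

section Real

variable {B : Type*} [NormedAddCommGroup B] [NormedSpace ℝ B]
  {M : Type*} [TopologicalSpace M] [ChartedSpace B M]

theorem mvfderiv_sum_const_mul {σ : Type*} (s : Finset σ) (r : σ → ℝ) {c : σ → M → ℝ} {y : M}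
    (hc : ∀ i, ContMDiffAt 𝓘(ℝ, B) 𝓘(ℝ, ℝ) ∞ (c i) y) (X : TangentSpace 𝓘(ℝ, B) y) :
    mvfderiv 𝓘(ℝ, B) (fun z => ∑ i ∈ s, r i * c i z) y X =
      ∑ i ∈ s, r i * mvfderiv 𝓘(ℝ, B) (c i) y X := by
  have h0 : ∀ i, ContMDiffAt 𝓘(ℝ, B) 𝓘(ℝ, ℝ) ∞ (fun z => r i * c i z) y :=
    fun i => contMDiffAt_const.mul (hc i)
  have h := (HasFiniteDeriv.sum s fun i _ => HasFiniteDeriv.of_real (h0 i)).apply_complex.2 X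
  have h1 : ContMDiffAt 𝓘(ℝ, B) 𝓘(ℝ, ℝ) ∞ (fun z => ∑ i ∈ s, r i * c i z) y :=
    ContMDiffAt.sum fun i _ => contMDiffAt_const.mul (hc i)
  have h2 := ((HasFiniteDeriv.of_real h1).congr (g := fun z => ∑ i ∈ s, ((r i * c i z : ℝ) : ℂ))
    (Filter.Eventually.of_forall fun z => by push_cast; rfl)).apply_complex.2 X
  have h3 := h2.symm.trans h
  have h4 : ∀ i, mvfderiv 𝓘(ℝ, B) (fun z => r i * c i z) y X = r i * mvfderiv 𝓘(ℝ, B) (c i) y X :=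
    fun i => by
      rw [mvfderiv_fun_mul mdifferentiableAt_const ((hc i).mdifferentiableAt (by simp)),
        mvfderiv_const]
      simp
  simp only [h4] at h3
  exact_mod_cast h3

variable {W : Type*} [AddCommGroup W] [Module ℂ W] {x : M} {f : M → W}
  {f' g' : TangentSpace 𝓘(ℝ, B) x → W}

theorem HasFiniteDeriv.unique (hf : HasFiniteDeriv x f f') (hg : HasFiniteDeriv x f g')
    (X : TangentSpace 𝓘(ℝ, B) x) : f' X = g' X := by
  rw [← sub_eq_zero, ← Module.forall_dual_apply_eq_zero_iff ℂ]
  intro ℓ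
  rw [map_sub, ← hf.dual_deriv ℓ X, ← hg.dual_deriv ℓ X, sub_self]

end Real

section Connection

variable {B : Type*} [NormedAddCommGroup B] [NormedSpace ℝ B]
  {M : Type*} [TopologicalSpace M] [ChartedSpace B M] [IsManifold 𝓘(ℝ, B) ∞ M]
  {F : Type*} [NormedAddCommGroup F] [NormedSpace ℝ F] [FiniteDimensional ℝ F]
  {E : M → Type*} [∀ x, AddCommGroup (E x)] [∀ x, Module ℝ (E x)]
  [∀ x, TopologicalSpace (E x)] [TopologicalSpace (Bundle.TotalSpace F E)]
  [∀ x, IsTopologicalAddGroup (E x)] [∀ x, ContinuousSMul ℝ (E x)]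
  [FiberBundle F E] [VectorBundle ℝ F E]
  (cov : CovariantDerivative 𝓘(ℝ, B) F E)

/-- The connection form in direction `X ∈ T_y M`, in the local frame around `x`, as an endomorphism
of `E_x`. -/
def connEnd (x y : M) (X : TangentSpace 𝓘(ℝ, B) y) : Module.End ℝ (E x) :=
  (fibreBasis F E x).constr ℝ fun A => transportBack F E x y (cov (fibreFrame F E x A) y X)

theorem connEnd_fibreBasis (x y : M) (X : TangentSpace 𝓘(ℝ, B) y)
    (A : Fin (Module.finrank ℝ F)) : connEnd cov x y X (fibreBasis F E x A) =
      transportBack F E x y (cov (fibreFrame F E x A) y X) :=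
  Module.Basis.constr_basis _ _ _ _

theorem connEnd_self_fibreBasis (x : M) (X : TangentSpace 𝓘(ℝ, B) x)
    (A : Fin (Module.finrank ℝ F)) : connEnd cov x x X (fibreBasis F E x A) =
      cov (fibreFrame F E x A) x X := by
  rw [connEnd_fibreBasis, transportBack_self]

theorem connEnd_sum_smul (x y : M) {σ : Type*} (s : Finset σ) (r : σ → ℝ)
    (X : σ → TangentSpace 𝓘(ℝ, B) y) :
    connEnd cov x y (∑ k ∈ s, r k • X k) = ∑ k ∈ s, r k • connEnd cov x y (X k) := by
  refine (fibreBasis F E x).ext fun A => ?_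
  simp only [connEnd_fibreBasis, LinearMap.sum_apply, LinearMap.smul_apply]
  simp only [map_sum, map_smul]

variable (F E) in
/-- The isomorphism `E_x ≃ E_z` of the frame around `x` compared with the isomorphism `E_y ≃ E_z` of
the frame around `y`, as an endomorphism of `E_y` which is the identity for `z = y`. -/
def frameChange (x y z : M) : Module.End ℝ (E y) :=
  transportBack F E y z ∘ₗ fibreTransport F E x z ∘ₗ transportBack F E x y

variable (F E) in
theorem frameChange_self {x y : M} (hy : y ∈ frameDomain F E x) :
    frameChange F E x y y = LinearMap.id := by
  ext v
  rw [frameChange, LinearMap.comp_apply, LinearMap.comp_apply,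
    fibreTransport_transportBack F E x hy, transportBack_self, LinearMap.id_apply]

variable (F E) in
theorem fibreTransport_frameChange {x y z : M} (hy : y ∈ frameDomain F E x)
    (hz : z ∈ frameDomain F E y) :
    fibreTransport F E y z ∘ₗ frameChange F E x y z ∘ₗ fibreTransport F E x y =
      fibreTransport F E x z := by
  ext v
  simp only [frameChange, LinearMap.comp_apply]
  rw [fibreTransport_transportBack F E y hz, transportBack_fibreTransport F E x hy]

variable (F E) in
/-- The derivative of `frameChange F E x y` at `y`. -/
def frameChangeDeriv (x y : M) (X : TangentSpace 𝓘(ℝ, B) y) : Module.End ℝ (E y) :=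
  ((fibreBasis F E x).constr ℝ fun A => ∑ C, mvfderiv 𝓘(ℝ, B) (fun z =>
    (fibreBasis F E y).coord C (transportBack F E y z (fibreFrame F E x A z))) y X •
      fibreBasis F E y C) ∘ₗ transportBack F E x y

variable [ContMDiffVectorBundle ∞ F E 𝓘(ℝ, B)]

theorem hasEndDeriv_frameChange {x y : M} (hy : y ∈ frameDomain F E x) :
    HasEndDeriv (B := B) y (frameChange F E x y) (frameChangeDeriv F E x y) := by
  intro ξ v
  have hc : ∀ p : Fin (Module.finrank ℝ F) × Fin (Module.finrank ℝ F),
      ContMDiffAt 𝓘(ℝ, B) 𝓘(ℝ, ℝ) ∞ (fun z =>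
        (fibreBasis F E y).coord p.2 (transportBack F E y z (fibreFrame F E x p.1 z))) y :=
    fun p => contMDiffAt_transportBack (mem_frameDomain F E y) (contMDiffAt_fibreFrame x hy _) _
  have hN : ∀ᶠ z in nhds y, ξ (frameChange F E x y z v) =
      ∑ p : Fin (Module.finrank ℝ F) × Fin (Module.finrank ℝ F),
        ((fibreBasis F E x).coord p.1 (transportBack F E x y v) * ξ (fibreBasis F E y p.2)) *
        (fibreBasis F E y).coord p.2 (transportBack F E y z (fibreFrame F E x p.1 z)) := by
    filter_upwards [(trivializationAt F E x).open_baseSet.mem_nhds hy] with z hz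
    rw [frameChange, LinearMap.comp_apply, LinearMap.comp_apply]
    conv_lhs => rw [← (fibreBasis F E x).sum_repr (transportBack F E x y v)]
    simp only [map_sum, map_smul, fibreTransport_fibreBasis F E x hz]
    rw [Fintype.sum_prod_type]
    refine Finset.sum_congr rfl fun A _ => ?_
    conv_lhs => rw [← (fibreBasis F E y).sum_repr (transportBack F E y z (fibreFrame F E x A z))]
    simp only [map_sum, map_smul, smul_eq_mul, Finset.mul_sum, Module.Basis.coord_apply]
    refine Finset.sum_congr rfl fun C _ => by ring
  refine ⟨(ContMDiffAt.sum fun p _ => contMDiffAt_const.mul (hc p)).congr_of_eventuallyEq hN,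
    fun X => ?_⟩
  rw [mvfderiv_congr (B := B) hN, mvfderiv_sum_const_mul _ _ hc, frameChangeDeriv, LinearMap.comp_apply,
    Module.Basis.constr_apply_fintype, Fintype.sum_prod_type, map_sum]
  refine Finset.sum_congr rfl fun A _ => ?_
  simp only [map_smul, map_sum, smul_eq_mul, Finset.mul_sum, Module.Basis.coord_apply,
    Module.Basis.equivFun_apply]
  refine Finset.sum_congr rfl fun C _ => by ring

/-- The transformation law of connection forms. -/
theorem connEnd_change {x y : M} (hy : y ∈ frameDomain F E x) (X : TangentSpace 𝓘(ℝ, B) y)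
    (v : E x) : fibreTransport F E x y (connEnd cov x y X v) =
      (frameChangeDeriv F E x y X + connEnd cov y y X) (fibreTransport F E x y v) := by
  suffices h : fibreTransport F E x y ∘ₗ connEnd cov x y X =
      (frameChangeDeriv F E x y X + connEnd cov y y X) ∘ₗ fibreTransport F E x y from
    LinearMap.congr_fun h v
  refine (fibreBasis F E x).ext fun A => ?_
  have hc : ∀ C, ContMDiffAt 𝓘(ℝ, B) 𝓘(ℝ, ℝ) ∞ (fun z =>
        (fibreBasis F E y).coord C (transportBack F E y z (fibreFrame F E x A z))) y :=
    fun p => contMDiffAt_transportBack (mem_frameDomain F E y) (contMDiffAt_fibreFrame x hy _) _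
  have hs := cov_sum_smul cov Finset.univ hc
    (fun C => contMDiffAt_fibreFrame (F := F) (E := E) y (mem_frameDomain F E y) C) X
  have he : cov (fibreFrame F E x A) y = cov (fun z => ∑ C, (fibreBasis F E y).coord C
      (transportBack F E y z (fibreFrame F E x A z)) • fibreFrame F E y C z) y := by
    refine cov_congr cov hs.1 ?_
    filter_upwards [frameDomain_mem_nhds F E y] with z hz
    exact (sum_coord_transportBack F y hz _).symm
  rw [LinearMap.comp_apply, LinearMap.comp_apply, connEnd_fibreBasis,
    fibreTransport_transportBack F E x hy, he, hs.2, Finset.sum_add_distrib, LinearMap.add_apply,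
    fibreTransport_fibreBasis F E x hy]
  congr 1
  · rw [frameChangeDeriv, LinearMap.comp_apply, transportBack_fibreFrame F E x hy,
      Module.Basis.constr_basis]
    simp only [fibreFrame_self]
  · conv_rhs => rw [← sum_coord_transportBack F y (mem_frameDomain F E y) (fibreFrame F E x A y)]
    simp only [map_sum, map_smul, fibreFrame_self, connEnd_self_fibreBasis]

theorem contMDiffAt_connEnd [FiniteDimensional ℝ B] [T2Space M]
    (hcov : CovariantDerivative.ContMDiffCovariantDerivative cov ∞) (x : M)
    {X : (z : M) → TangentSpace 𝓘(ℝ, B) z} (hX : CMDiffAt ∞ (T% X) x)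
    (ξ : Module.Dual ℝ (E x)) (v : E x) :
    ContMDiffAt 𝓘(ℝ, B) 𝓘(ℝ, ℝ) ∞ (fun z => ξ (connEnd cov x z (X z) v)) x := by
  have h : ContMDiffAt 𝓘(ℝ, B) 𝓘(ℝ, ℝ) ∞ (fun z => ∑ A, (fibreBasis F E x).coord A v *
      ξ (transportBack F E x z (cov (fibreFrame F E x A) z (X z)))) x :=
    ContMDiffAt.sum fun A _ => contMDiffAt_const.mul (contMDiffAt_transportBack
      (mem_frameDomain F E x) (contMDiffAt_cov cov hcov (trivializationAt F E x).open_baseSet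
        (mem_frameDomain F E x) (fun z hz => contMDiffAt_fibreFrame x hz A) hX) ξ)
  refine h.congr_of_eventuallyEq (Filter.Eventually.of_forall fun z => ?_)
  beta_reduce
  rw [connEnd, Module.Basis.constr_apply_fintype, map_sum]
  simp only [map_smul, smul_eq_mul, Module.Basis.coord_apply, Module.Basis.equivFun_apply]

end Connection

/-! ### The induced connection on the bundle of fibre algebras -/

section LinearActionSums

variable {V : Type*} [AddCommGroup V] [Module ℝ V] {F : Type*} [AddCommGroup F] [Module ℝ F]
  {ι κ : Type*} [Fintype ι] [Fintype κ] (b : Module.Basis ι ℝ V) (c : Module.Basis κ ℝ F)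

theorem linAction_sum_smul {σ : Type*} (s : Finset σ) (r : σ → ℝ) (A : σ → Module.End ℝ V)
    (C : σ → Module.End ℝ F) (a : FibreAlg V F) :
    linAction b c (∑ k ∈ s, r k • A k) (∑ k ∈ s, r k • C k) a =
      ∑ k ∈ s, (r k : ℂ) • linAction b c (A k) (C k) a := by
  simp only [linAction_apply, LinearMap.sum_apply, LinearMap.smul_apply, iS_sum_smul, iA_sum_smul,
    iE_sum_smul, map_sum, map_smul, smul_add, Finset.sum_add_distrib, Finset.smul_sum]
  congr 1
  · congr 1
    · exact Finset.sum_comm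
    · exact Finset.sum_comm
  · exact Finset.sum_comm

/-- The exterior derivative of the coordinate differentials `dxⁱ` in terms of a torsion-free
connection. -/
theorem sum_mulA_sum_mulA_iA {Γ : ι → Module.End ℝ V} (hΓ : ∀ i l, Γ i (b l) = Γ l (b i))
    (a : FibreAlg V F) :
    ∑ i, mulA (b.coord i) (∑ l, mulA (b.coord l) (iA (Γ i (b l)) a)) = 0 := by
  simp only [map_sum]
  exact sum_sum_antisymm fun i l => by rw [mulA_mulA, hΓ]

end LinearActionSums

section Covariant

variable {B : Type*} [NormedAddCommGroup B] [NormedSpace ℝ B] [FiniteDimensional ℝ B]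
  {M : Type*} [TopologicalSpace M] [ChartedSpace B M] [IsManifold 𝓘(ℝ, B) ∞ M]
  (F : Type*) [NormedAddCommGroup F] [NormedSpace ℝ F] [FiniteDimensional ℝ F]
  {E : M → Type*} [∀ x, AddCommGroup (E x)] [∀ x, Module ℝ (E x)]
  [∀ x, TopologicalSpace (E x)] [TopologicalSpace (Bundle.TotalSpace F E)]
  [∀ x, IsTopologicalAddGroup (E x)] [∀ x, ContinuousSMul ℝ (E x)]
  [FiberBundle F E] [VectorBundle ℝ F E]
  (covM : CovariantDerivative 𝓘(ℝ, B) B (TangentSpace 𝓘(ℝ, B) : M → Type _))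
  (covE : CovariantDerivative 𝓘(ℝ, B) F E)

/-- The local form of the connection on the bundle of fibre algebras, at `y` in direction `X` and in
the local frames around `x`. -/
def connAction (x y : M) (X : TangentSpace 𝓘(ℝ, B) y) :
    Module.End ℂ (FibreAlg (TangentSpace 𝓘(ℝ, B) x) (E x)) :=
  linAction (tangentBasis B x) (fibreBasis F E x)
    (connEnd (F := B) (E := TangentFamily B M) covM x y X) (connEnd covE x y X)

/-- The covariant derivative of a section at `x`, with all three tensor factors differentiated. -/
def covFull (x : M) (u : (y : M) → FibreAlg (TangentSpace 𝓘(ℝ, B) y) (E y))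
    (X : TangentSpace 𝓘(ℝ, B) x) : FibreAlg (TangentSpace 𝓘(ℝ, B) x) (E x) :=
  fibreDeriv x (localRep B F x u) X - connAction F covM covE x x X (u x)

variable {F} {covM covE}

theorem fibreDeriv_eq {x : M} {f : M → FibreAlg (TangentSpace 𝓘(ℝ, B) x) (E x)}
    {f' : TangentSpace 𝓘(ℝ, B) x → FibreAlg (TangentSpace 𝓘(ℝ, B) x) (E x)}
    (h : HasFiniteDeriv x f f') (X : TangentSpace 𝓘(ℝ, B) x) : fibreDeriv x f X = f' X := by
  have hex : ∃ a, ∀ ℓ : Module.Dual ℂ (FibreAlg (TangentSpace 𝓘(ℝ, B) x) (E x)),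
      ℓ a = mvfderiv 𝓘(ℝ, B) (fun y => ℓ (f y)) x X := ⟨f' X, fun ℓ => (h.dual_deriv ℓ X).symm⟩
  rw [fibreDeriv, dif_pos hex, ← sub_eq_zero, ← Module.forall_dual_apply_eq_zero_iff ℂ]
  intro ℓ
  rw [map_sub, hex.choose_spec, h.dual_deriv, sub_self]

theorem covFull_eq {x : M} {u : (y : M) → FibreAlg (TangentSpace 𝓘(ℝ, B) y) (E y)}
    {u' : TangentSpace 𝓘(ℝ, B) x → FibreAlg (TangentSpace 𝓘(ℝ, B) x) (E x)}
    (h : HasFiniteDeriv x (localRep B F x u) u') (X : TangentSpace 𝓘(ℝ, B) x) :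
    covFull F covM covE x u X = u' X - connAction F covM covE x x X (u x) := by
  rw [covFull, fibreDeriv_eq h]

theorem covFull_hasFiniteDeriv {x : M} {u : (y : M) → FibreAlg (TangentSpace 𝓘(ℝ, B) y) (E y)}
    (h : IsFiniteSmoothAt (B := B) x (localRep B F x u)) :
    HasFiniteDeriv x (localRep B F x u)
      (fun X => connAction F covM covE x x X (localRep B F x u x) + covFull F covM covE x u X) := by
  obtain ⟨u', hu⟩ := h
  exact hu.congr_deriv fun X => by rw [covFull_eq hu, localRep_self, add_sub_cancel]

theorem covFull_eq_of_hasFiniteDeriv {x : M}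
    {u : (y : M) → FibreAlg (TangentSpace 𝓘(ℝ, B) y) (E y)}
    {u' : TangentSpace 𝓘(ℝ, B) x → FibreAlg (TangentSpace 𝓘(ℝ, B) x) (E x)}
    (h : HasFiniteDeriv x (localRep B F x u)
      (fun X => connAction F covM covE x x X (localRep B F x u x) + u' X))
    (X : TangentSpace 𝓘(ℝ, B) x) : covFull F covM covE x u X = u' X := by
  rw [covFull_eq h, localRep_self, add_sub_cancel_left]

/-- The Christoffel symbols in the preferred chart at `x` are symmetric at `x`. -/
abbrev IsSymmetricAt (covM : CovariantDerivative 𝓘(ℝ, B) B (TangentSpace 𝓘(ℝ, B) : M → Type _))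
    (x : M) : Prop :=
  ∀ i l, covM (tangentFrame B x l) x (tangentBasis B x i) =
    covM (tangentFrame B x i) x (tangentBasis B x l)

/-- `∇` is the antisymmetrization of the full covariant derivative. The latter also differentiates the
form factor; these terms are `Γ^l_{ik} dxⁱ ∧ dxᵏ ∧ i_a(∂_l)`, and cancel by symmetry of `Γ`. -/
theorem nabla_eq_sum (w : RawSection B E) {x : M} (hx : IsSymmetricAt covM x) (s t : ℕ) :
    nabla F covM covE w x s t = ∑ i, mulA ((tangentBasis B x).coord i)
      (covFull F covM covE x (fun y => w y s t) (tangentBasis B x i)) := by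
  have hM : ∀ i l, connEnd (F := B) (E := TangentFamily B M) covM x x (tangentBasis B x i)
      (tangentBasis B x l) = covM (tangentFrame B x l) x (tangentBasis B x i) := fun i l =>
    connEnd_self_fibreBasis (F := B) (E := TangentFamily B M) covM x _ l
  have hE : ∀ i C, connEnd covE x x (tangentBasis B x i) (fibreBasis F E x C) =
      covE (fibreFrame F E x C) x (tangentBasis B x i) := fun i C =>
    connEnd_self_fibreBasis covE x _ C
  have h0 := sum_mulA_sum_mulA_iA (F := E x) (tangentBasis B x)
    (Γ := fun i => connEnd (F := B) (E := TangentFamily B M) covM x x (tangentBasis B x i))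
    (fun i l => by rw [hM, hM, hx]) (w x s t)
  have hS : ∀ i, ∑ l, mulS ((tangentBasis B x).coord l) (iS (connEnd (F := B)
      (E := TangentFamily B M) covM x x (tangentBasis B x i) (tangentBasis B x l)) (w x s t)) =
      ∑ j, ∑ l, (((tangentBasis B x).coord j
        (covM (tangentFrame B x l) x (tangentBasis B x i)) : ℝ) : ℂ) •
      mulS ((tangentBasis B x).coord l) (iS (tangentBasis B x j) (w x s t)) := fun i => by
    rw [Finset.sum_comm]
    refine Finset.sum_congr rfl fun l _ => ?_
    rw [hM]
    conv_lhs => rw [← (tangentBasis B x).sum_repr (covM (tangentFrame B x l) x (tangentBasis B x i)),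
      iS_sum_smul]
    simp only [LinearMap.sum_apply, LinearMap.smul_apply, map_sum, map_smul,
      Module.Basis.coord_apply]
  have hF : ∀ i, ∑ l, mulE ((fibreBasis F E x).coord l) (iE (connEnd covE x x
      (tangentBasis B x i) (fibreBasis F E x l)) (w x s t)) =
      ∑ A, ∑ C, (((fibreBasis F E x).coord A
        (covE (fibreFrame F E x C) x (tangentBasis B x i)) : ℝ) : ℂ) •
      mulE ((fibreBasis F E x).coord C) (iE (fibreBasis F E x A) (w x s t)) := fun i => by
    rw [Finset.sum_comm]
    refine Finset.sum_congr rfl fun l _ => ?_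
    rw [hE]
    conv_lhs => rw [← (fibreBasis F E x).sum_repr (covE (fibreFrame F E x l) x (tangentBasis B x i)),
      iE_sum_smul]
    simp only [LinearMap.sum_apply, LinearMap.smul_apply, map_sum, map_smul,
      Module.Basis.coord_apply]
  simp only [nabla, covDir, covFull, connAction, linAction_apply, ← hS, ← hF, map_sub, map_add,
    Finset.sum_sub_distrib, Finset.sum_add_distrib, h0]
  abel

end Covariant

/-! ### `∇` preserves the Fedosov algebra -/

section Linear

variable {B : Type*} [NormedAddCommGroup B] [NormedSpace ℝ B]
  {M : Type*} [TopologicalSpace M] [ChartedSpace B M] {W : Type*} [AddCommGroup W] [Module ℂ W]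
  {x : M} {f : M → W} {f' : TangentSpace 𝓘(ℝ, B) x → W}

theorem HasFiniteDeriv.sum_smul (h : HasFiniteDeriv x f f') {σ : Type*} (s : Finset σ) (r : σ → ℝ)
    (X : σ → TangentSpace 𝓘(ℝ, B) x) :
    f' (∑ k ∈ s, r k • X k) = ∑ k ∈ s, (r k : ℂ) • f' (X k) := by
  rw [← sub_eq_zero, ← Module.forall_dual_apply_eq_zero_iff ℂ]
  intro ℓ
  simp only [map_sub, map_sum, map_smul, ← h.dual_deriv ℓ, sub_eq_zero]
  exact Finset.sum_congr rfl fun k _ => Complex.real_smul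

theorem HasFiniteDeriv.mem (h : HasFiniteDeriv x f f') {S : Submodule ℂ W} (hf : ∀ y, f y ∈ S)
    (X : TangentSpace 𝓘(ℝ, B) x) : f' X ∈ S := by
  rw [← Subspace.forall_mem_dualAnnihilator_apply_eq_zero_iff]
  intro ℓ hℓ
  rw [← h.dual_deriv ℓ X]
  have : (fun y => ℓ (f y)) = fun _ => 0 :=
    funext fun y => (Submodule.mem_dualAnnihilator ℓ).1 hℓ _ (hf y)
  rw [this, mvfderiv_const]
  rfl

variable {V : Type*} [AddCommGroup V] [Module ℝ V] {F : Type*} [AddCommGroup F] [Module ℝ F]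
  {ι κ : Type*} [Fintype ι] [Fintype κ] (b : Module.Basis ι ℝ V) (c : Module.Basis κ ℝ F)

theorem isFiniteSmoothAt_linAction {A : M → Module.End ℝ V} {C : M → Module.End ℝ F}
    {f : M → FibreAlg V F}
    (hA : ∀ (ξ : Module.Dual ℝ V) v, ContMDiffAt 𝓘(ℝ, B) 𝓘(ℝ, ℝ) ∞ (fun z => ξ (A z v)) x)
    (hC : ∀ (ξ : Module.Dual ℝ F) v, ContMDiffAt 𝓘(ℝ, B) 𝓘(ℝ, ℝ) ∞ (fun z => ξ (C z v)) x)
    (hf : IsFiniteSmoothAt (B := B) x f) :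
    IsFiniteSmoothAt (B := B) x (fun z => linAction b c (A z) (C z) (f z)) := by
  have h : ∀ z, linAction b c (A z) (C z) (f z) =
      ∑ l, ∑ j, ((b.coord j (A z (b l)) : ℝ) : ℂ) • mulS (b.coord l) (iS (b j) (f z)) +
      ∑ l, ∑ j, ((b.coord j (A z (b l)) : ℝ) : ℂ) • mulA (b.coord l) (iA (b j) (f z)) +
      ∑ l, ∑ j, ((c.coord j (C z (c l)) : ℝ) : ℂ) • mulE (c.coord l) (iE (c j) (f z)) := fun z => by
    rw [linAction_apply]
    congr 1
    · congr 1
      · refine Finset.sum_congr rfl fun l _ => ?_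
        conv_lhs => rw [← b.sum_repr (A z (b l)), iS_sum_smul]
        simp only [LinearMap.sum_apply, LinearMap.smul_apply, map_sum, map_smul,
          Module.Basis.coord_apply]
      · refine Finset.sum_congr rfl fun l _ => ?_
        conv_lhs => rw [← b.sum_repr (A z (b l)), iA_sum_smul]
        simp only [LinearMap.sum_apply, LinearMap.smul_apply, map_sum, map_smul,
          Module.Basis.coord_apply]
    · refine Finset.sum_congr rfl fun l _ => ?_
      conv_lhs => rw [← c.sum_repr (C z (c l)), iE_sum_smul]
      simp only [LinearMap.sum_apply, LinearMap.smul_apply, map_sum, map_smul,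
        Module.Basis.coord_apply]
  simp only [h]
  exact ((IsFiniteSmoothAt.sum _ fun l _ => IsFiniteSmoothAt.sum _ fun j _ =>
      ((hf.map (iS (b j))).map (mulS (b.coord l))).real_smul (hA _ _)).add
    (IsFiniteSmoothAt.sum _ fun l _ => IsFiniteSmoothAt.sum _ fun j _ =>
      ((hf.map (iA (b j))).map (mulA (b.coord l))).real_smul (hA _ _))).add
    (IsFiniteSmoothAt.sum _ fun l _ => IsFiniteSmoothAt.sum _ fun j _ =>
      ((hf.map (iE (c j))).map (mulE (c.coord l))).real_smul (hC _ _))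

end Linear

section Change

variable {B : Type*} [NormedAddCommGroup B] [NormedSpace ℝ B] [FiniteDimensional ℝ B]
  {M : Type*} [TopologicalSpace M] [ChartedSpace B M] [IsManifold 𝓘(ℝ, B) ∞ M]
  {F : Type*} [NormedAddCommGroup F] [NormedSpace ℝ F] [FiniteDimensional ℝ F]
  {E : M → Type*} [∀ x, AddCommGroup (E x)] [∀ x, Module ℝ (E x)]
  [∀ x, TopologicalSpace (E x)] [TopologicalSpace (Bundle.TotalSpace F E)]
  [∀ x, IsTopologicalAddGroup (E x)] [∀ x, ContinuousSMul ℝ (E x)]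
  [FiberBundle F E] [VectorBundle ℝ F E]
  {covM : CovariantDerivative 𝓘(ℝ, B) B (TangentSpace 𝓘(ℝ, B) : M → Type _)}
  {covE : CovariantDerivative 𝓘(ℝ, B) F E}

theorem covFull_sum_smul {x : M} {u : (y : M) → FibreAlg (TangentSpace 𝓘(ℝ, B) y) (E y)}
    (hu : IsFiniteSmoothAt (B := B) x (localRep B F x u)) {σ : Type*} (s : Finset σ) (r : σ → ℝ)
    (X : σ → TangentSpace 𝓘(ℝ, B) x) :
    covFull F covM covE x u (∑ k ∈ s, r k • X k) =
      ∑ k ∈ s, (r k : ℂ) • covFull F covM covE x u (X k) := by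
  obtain ⟨u', hu⟩ := hu
  simp only [covFull_eq hu, hu.sum_smul, smul_sub, Finset.sum_sub_distrib, connAction]
  rw [connEnd_sum_smul, connEnd_sum_smul, linAction_sum_smul]

theorem covFull_mem_symDegree {x : M} {s : ℕ}
    {u : (y : M) → FibreAlg (TangentSpace 𝓘(ℝ, B) y) (E y)}
    (hu : IsFiniteSmoothAt (B := B) x (localRep B F x u))
    (hs : ∀ y, u y ∈ symDegree (TangentSpace 𝓘(ℝ, B) y) (E y) s) (X : TangentSpace 𝓘(ℝ, B) x) :
    covFull F covM covE x u X ∈ symDegree (TangentSpace 𝓘(ℝ, B) x) (E x) s := by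
  obtain ⟨u', hu⟩ := hu
  rw [covFull_eq hu]
  exact Submodule.sub_mem _ (hu.mem (fun y => pull_mem_symDegree _ _ (hs y)) X)
    (linAction_mem_symDegree _ _ _ _ (hs x))

variable (F) in
/-- The cocycle relation: local representatives in the frames around `x` and around `y` differ by the
change of frames. -/
theorem localRep_change (u : (y : M) → FibreAlg (TangentSpace 𝓘(ℝ, B) y) (E y)) {x y z : M}
    (hy : y ∈ commonDomain B F E x) (hz : z ∈ commonDomain B F E y) :
    localRep B F x u z = pull (fibreTransport B (TangentFamily B M) x y) (fibreTransport F E x y)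
      (pull (frameChange B (TangentFamily B M) x y z) (frameChange F E x y z)
        (localRep B F y u z)) := by
  have h1 := fibreTransport_frameChange B (TangentFamily B M) hy.1 hz.1
  have h2 := fibreTransport_frameChange F E hy.2 hz.2
  refine Eq.trans ?_ ((pull_pull _ _ _ _ _).trans (pull_pull _ _ _ _ _)).symm
  rw [localRep, ← h2]
  refine congrArg (fun g => pull g _ _) ?_
  exact h1.symm

variable [ContMDiffVectorBundle ∞ F E 𝓘(ℝ, B)]

/-- The covariant derivative does not depend on the frame in which it is computed. -/
theorem hasFiniteDeriv_localRep {u : (y : M) → FibreAlg (TangentSpace 𝓘(ℝ, B) y) (E y)} {x y : M}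
    (hy : y ∈ commonDomain B F E x) (hu : IsFiniteSmoothAt (B := B) y (localRep B F y u)) :
    HasFiniteDeriv y (localRep B F x u) (fun X => connAction F covM covE x y X (localRep B F x u y) +
      pull (transportEquiv B (TangentFamily B M) x hy.1).toLinearMap
        (transportEquiv F E x hy.2).toLinearMap (covFull F covM covE y u X)) := by
  have h1 := (HasEndDeriv.pull (tangentBasis B y) (fibreBasis F E y)
    (hasEndDeriv_frameChange (F := B) (E := TangentFamily B M) hy.1)
    (hasEndDeriv_frameChange (F := F) (E := E) hy.2) (frameChange_self B (TangentFamily B M) hy.1)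
    (frameChange_self F E hy.2) (covFull_hasFiniteDeriv (covM := covM) (covE := covE) hu)).map
    (pull (fibreTransport B (TangentFamily B M) x y) (fibreTransport F E x y)).toLinearMap
  refine (h1.congr (Filter.mem_of_superset (commonDomain_mem_nhds B F E y) fun z hz =>
    localRep_change F u hy hz)).congr_deriv fun X => ?_
  set g := transportEquiv B (TangentFamily B M) x hy.1 with hg
  set h := transportEquiv F E x hy.2 with hh
  have eM : g.symm.toLinearMap ∘ₗ (frameChangeDeriv B (TangentFamily B M) x y X +
      connEnd (F := B) (E := TangentFamily B M) covM y y X) ∘ₗ g.toLinearMap =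
      connEnd (F := B) (E := TangentFamily B M) covM x y X := by
    ext v
    have := connEnd_change (F := B) (E := TangentFamily B M) covM hy.1 X v
    rw [← transportEquiv_toLinearMap B (TangentFamily B M) x hy.1, ← hg] at this
    exact (LinearEquiv.symm_apply_eq g).2 this.symm
  have eE : h.symm.toLinearMap ∘ₗ (frameChangeDeriv F E x y X +
      connEnd covE y y X) ∘ₗ h.toLinearMap = connEnd covE x y X := by
    ext v
    have := connEnd_change covE hy.2 X v
    rw [← transportEquiv_toLinearMap F E x hy.2, ← hh] at this
    exact (LinearEquiv.symm_apply_eq h).2 this.symm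
  rw [← transportEquiv_toLinearMap B (TangentFamily B M) x hy.1,
    ← transportEquiv_toLinearMap F E x hy.2, ← hg, ← hh, localRep_self, AlgHom.toLinearMap_apply,
    ← add_assoc, map_add, connAction, ← linAction_add, connAction,
    ← linAction_change_basis (tangentBasis B y) (fibreBasis F E y) _ _
      ((tangentBasis B x).map g) ((fibreBasis F E x).map h), pull_linAction, eM, eE,
    localRep_eq F x u hy]

variable (F covM covE) in
/-- The connection in the frames around `x`. -/
theorem localRep_nabla {x y : M} (hy : y ∈ commonDomain B F E x) (hs : IsSymmetricAt covM y)
    {w : RawSection B E} {s t : ℕ}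
    (hu : IsFiniteSmoothAt (B := B) y (localRep B F y fun y => w y s t))
    {u' : TangentSpace 𝓘(ℝ, B) y → FibreAlg (TangentSpace 𝓘(ℝ, B) x) (E x)}
    (h : HasFiniteDeriv y (localRep B F x fun y => w y s t) u') :
    localRep B F x (fun y => nabla F covM covE w y s t) y = ∑ i, mulA ((tangentBasis B x).coord i)
      (u' (tangentFrame B x i y) - connAction F covM covE x y (tangentFrame B x i y)
        (localRep B F x (fun y => w y s t) y)) := by
  set g := transportEquiv B (TangentFamily B M) x hy.1 with hg
  have h1 : nabla F covM covE w y s t = ∑ i, mulA (((tangentBasis B x).map g).coord i)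
      (covFull F covM covE y (fun y => w y s t) (tangentFrame B x i y)) := by
    rw [nabla_eq_sum w hs]
    refine (sum_coord_change_basis (fun ξ X => mulA ξ (covFull F covM covE y (fun y => w y s t) X))
      ?_ ?_ ((tangentBasis B x).map g) (tangentBasis B y)).trans ?_
    · intro r ξ X
      simp only [mulA_sum_smul, LinearMap.sum_apply, LinearMap.smul_apply]
    · intro r Y ξ
      simp only [covFull_sum_smul hu, map_sum, map_smul]
    · refine Finset.sum_congr rfl fun i _ => ?_
      rw [Module.Basis.map_apply]
      congr 2
      exact transportEquiv_fibreBasis B (TangentFamily B M) x hy.1 i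
  have hb : ∀ i, ((tangentBasis B x).map g).coord i ∘ₗ g.toLinearMap =
      (tangentBasis B x).coord i := fun i => by
    ext X; simp
  rw [localRep_eq F x _ hy, h1, map_sum]
  refine Finset.sum_congr rfl fun i _ => ?_
  rw [pull_mulA, hb, h.unique (hasFiniteDeriv_localRep (covM := covM) (covE := covE) hy hu),
    add_sub_cancel_left]

/-- Near `x`, `∇` is given by the derivative of the local representative and by the connection matrices
in the frame around `x`, both of which are smooth. -/
theorem isFiniteSmoothAt_nabla [T2Space M]
    (hcovM : CovariantDerivative.ContMDiffCovariantDerivative covM ∞)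
    (hcovE : CovariantDerivative.ContMDiffCovariantDerivative covE ∞)
    (hs : ∀ y, IsSymmetricAt covM y) {w : RawSection B E} (hw : w ∈ fedosovAlgebra B F E) (s t : ℕ)
    (x : M) : IsFiniteSmoothAt (B := B) x (localRep B F x fun y => nabla F covM covE w y s t) := by
  have hsm := (mem_fedosovAlgebra_iff F).1 hw
  have := finite_fibre F E x
  have : FiniteDimensional ℝ (TangentSpace 𝓘(ℝ, B) x) := finite_fibre B (TangentFamily B M) x
  obtain ⟨D, hD, hD'⟩ := exists_deriv_field (f := localRep B F x fun y => w y s t)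
    (symDegree (TangentSpace 𝓘(ℝ, B) x) (E x) s) (U := commonDomain B F E x)
    (fun y => pull_mem_symDegree _ _ (hsm.1 y s t))
    (fun y hy => (hasFiniteDeriv_localRep (covM := covM) (covE := covE) hy (hsm.2 s t y)).dual)
  refine IsFiniteSmoothAt.congr (IsFiniteSmoothAt.sum Finset.univ fun i _ =>
    IsFiniteSmoothAt.map (IsFiniteSmoothAt.add
      (hD' x (mem_of_mem_nhds (commonDomain_mem_nhds B F E x)) (Module.finBasis ℝ B i))
      (IsFiniteSmoothAt.map (isFiniteSmoothAt_linAction (tangentBasis B x) (fibreBasis F E x)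
        (contMDiffAt_connEnd (F := B) (E := TangentFamily B M) covM hcovM x
          (contMDiffAt_fibreFrame (F := B) (E := TangentFamily B M) x (mem_frameDomain _ _ x) i))
        (contMDiffAt_connEnd covE hcovE x
          (contMDiffAt_fibreFrame (F := B) (E := TangentFamily B M) x (mem_frameDomain _ _ x) i))
        (hsm.2 s t x)) (-LinearMap.id))) (mulA ((tangentBasis B x).coord i))) ?_
  filter_upwards [commonDomain_mem_nhds B F E x] with y hy
  rw [localRep_nabla F covM covE hy (hs y) (hsm.2 s t y) (hD y hy)]
  refine Finset.sum_congr rfl fun i _ => ?_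
  rw [LinearMap.neg_apply, LinearMap.id_apply, ← sub_eq_add_neg]
  congr 3
  exact fibreFrame_eq_symmL B (TangentFamily B M) x hy.1 i

theorem nabla_mem [T2Space M]
    (hcovM : CovariantDerivative.ContMDiffCovariantDerivative covM ∞)
    (hcovE : CovariantDerivative.ContMDiffCovariantDerivative covE ∞)
    (hs : ∀ y, IsSymmetricAt covM y) {w : RawSection B E} (hw : w ∈ fedosovAlgebra B F E) :
    nabla F covM covE w ∈ fedosovAlgebra B F E := by
  have hsm := (mem_fedosovAlgebra_iff F).1 hw
  refine (mem_fedosovAlgebra_iff F).2 ⟨fun x s t => ?_, fun s t x =>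
    isFiniteSmoothAt_nabla hcovM hcovE hs hw s t x⟩
  rw [nabla_eq_sum w (hs x)]
  exact Submodule.sum_mem _ fun i _ => onForms_mem_symDegree _
    (covFull_mem_symDegree (hsm.2 s t x) (fun y => hsm.1 y s t) _)

end Change

/-! ### Torsion-free connections -/

section Torsion

variable {B : Type*} [NormedAddCommGroup B] [NormedSpace ℝ B] [FiniteDimensional ℝ B]
  {M : Type*} [TopologicalSpace M] [ChartedSpace B M] [IsManifold 𝓘(ℝ, B) ∞ M]

/-- Coordinate vector fields commute. -/
theorem mlieBracket_tangentFrame (x : M) (i l : Fin (Module.finrank ℝ B)) :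
    VectorField.mlieBracket 𝓘(ℝ, B) (tangentFrame B x i) (tangentFrame B x l) x = 0 := by
  have : IsManifold 𝓘(ℝ, B) 1 M := .of_le (n := ∞) (by simp)
  have h : ∀ i, VectorField.mpullbackWithin 𝓘(ℝ, B) 𝓘(ℝ, B) (extChartAt 𝓘(ℝ, B) x).symm
      (tangentFrame B x i) (Set.range 𝓘(ℝ, B)) =ᶠ[nhds (extChartAt 𝓘(ℝ, B) x x)]
        fun _ => Module.finBasis ℝ B i := fun i => by
    filter_upwards [(isOpen_extChartAt_target (I := 𝓘(ℝ, B)) x).mem_nhds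
      (mem_extChartAt_target x)] with p hp
    have hy : (extChartAt 𝓘(ℝ, B) x).symm p ∈ (chartAt B x).source := by
      have := (extChartAt 𝓘(ℝ, B) x).map_target hp
      rwa [extChartAt_source] at this
    have e := fibreFrame_eq_symmL B (TangentFamily B M) x
      (y := (extChartAt 𝓘(ℝ, B) x).symm p) hy i
    rw [TangentBundle.symmL_trivializationAt hy] at e
    rw [VectorField.mpullbackWithin_apply, tangentFrame_eq, e]
    rw [(extChartAt 𝓘(ℝ, B) x).right_inv hp]
    obtain ⟨L, hL⟩ := isInvertible_mfderivWithin_extChartAt_symm (I := 𝓘(ℝ, B)) hp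
    rw [← hL, ContinuousLinearMap.inverse_equiv]
    exact L.symm_apply_apply _
  rw [VectorField.mlieBracket, VectorField.mlieBracketWithin_apply,
    (h i).lieBracketWithin_vectorField_eq_nhds (h l)]
  refine Eq.trans (congrArg _ ?_) (ContinuousLinearMap.map_zero _)
  simp [VectorField.lieBracketWithin]
  rfl

/-- Vanishing torsion is a condition on globally defined vector fields. Bump functions extend the
coordinate fields of a chart to the whole manifold without change near `x`, where they commute. -/
theorem isSymmetricAt_of_torsionFree [T2Space M]
    {covM : CovariantDerivative 𝓘(ℝ, B) B (TangentSpace 𝓘(ℝ, B) : M → Type _)}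
    (h : TorsionFree covM) (x : M) : IsSymmetricAt covM x := by
  intro i l
  have hs : ∀ i, ∀ z ∈ frameDomain B (TangentFamily B M) x,
      CMDiffAt ∞ (T% (tangentFrame B x i)) z := fun i z hz =>
    contMDiffAt_fibreFrame (F := B) (E := TangentFamily B M) x hz i
  have hx := mem_frameDomain B (TangentFamily B M) x
  have ho := (trivializationAt B (TangentFamily B M) x).open_baseSet
  obtain ⟨X, hX, hX'⟩ := exists_global_section (F := B) (E := TangentFamily B M) ho hx (hs i)
  obtain ⟨Y, hY, hY'⟩ := exists_global_section (F := B) (E := TangentFamily B M) ho hx (hs l)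
  have h1 := h X Y hX hY x
  rw [cov_congr (F := B) (E := TangentFamily B M) covM (hs l x hx) hY',
    cov_congr (F := B) (E := TangentFamily B M) covM (hs i x hx) hX',
    hX'.self_of_nhds, hY'.self_of_nhds, tangentFrame_eq, tangentFrame_eq, fibreFrame_self,
    fibreFrame_self,
    Filter.EventuallyEq.mlieBracket_vectorField_eq hX' hY'] at h1
  exact sub_eq_zero.1 (h1.trans (mlieBracket_tangentFrame x i l))

end Torsion

/-! ### Parallel bilinear forms -/

section Pairing

variable {A : Type*} [Ring A] [Algebra ℂ A] {α : Type*} [Fintype α]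

/-- If `k` is the derivative of `K` and `k = -(W K + K Wᵀ)`, that is, if the bivector `K` is parallel
for the connection form `W`, then so is the corresponding operator on the tensor square. -/
theorem pairing_parallel {K k : α → α → ℝ} {W : α → α → ℝ} {ρ : Module.End ℂ A}
    {u v : α → Module.End ℂ A}
    (hK : ∀ i j, k i j = -(∑ m, W i m * K m j + ∑ m, K i m * W j m))
    (hu : ∀ i a, ρ (u i a) = u i (ρ a) - ∑ m, (W m i : ℂ) • u m a)
    (hv : ∀ i a, ρ (v i a) = v i (ρ a) - ∑ m, (W m i : ℂ) • v m a) (z : A ⊗[ℂ] A) :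
    pairing (fun i j => ((k i j : ℝ) : ℂ)) u v z =
      diagonal ρ (pairing (fun i j => ((K i j : ℝ) : ℂ)) u v z) -
        pairing (fun i j => ((K i j : ℝ) : ℂ)) u v (diagonal ρ z) := by
  induction z with
  | zero => simp only [map_zero, sub_zero]
  | add a b ha hb => rw [map_add, ha, hb, map_add, map_add, map_add, map_add]; abel
  | tmul a b =>
    have e1 : ∑ i, ∑ j, (K i j : ℂ) • ((∑ m, (W m i : ℂ) • u m a) ⊗ₜ[ℂ] v j b) =
        ∑ i, ∑ j, (((∑ m, W i m * K m j : ℝ) : ℝ) : ℂ) • (u i a ⊗ₜ[ℂ] v j b) := by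
      simp only [TensorProduct.sum_tmul, ← TensorProduct.smul_tmul', Finset.smul_sum, smul_smul,
        Complex.ofReal_sum, Complex.ofReal_mul, Finset.sum_smul]
      rw [Finset.sum_congr rfl fun i _ => Finset.sum_comm, Finset.sum_comm]
      refine Finset.sum_congr rfl fun m _ => ?_
      rw [Finset.sum_comm]
      refine Finset.sum_congr rfl fun j _ => Finset.sum_congr rfl fun i _ => ?_
      rw [mul_comm]
    have e2 : ∑ i, ∑ j, (K i j : ℂ) • (u i a ⊗ₜ[ℂ] (∑ m, (W m j : ℂ) • v m b)) =
        ∑ i, ∑ j, (((∑ m, K i m * W j m : ℝ) : ℝ) : ℂ) • (u i a ⊗ₜ[ℂ] v j b) := by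
      simp only [TensorProduct.tmul_sum, TensorProduct.tmul_smul, Finset.smul_sum, smul_smul,
        Complex.ofReal_sum, Complex.ofReal_mul, Finset.sum_smul]
      exact Finset.sum_congr rfl fun i _ => Finset.sum_comm
    have e3 : ∀ i j, (k i j : ℂ) • (u i a ⊗ₜ[ℂ] v j b) =
        -((((∑ m, W i m * K m j : ℝ) : ℝ) : ℂ) • (u i a ⊗ₜ[ℂ] v j b)) -
        (((∑ m, K i m * W j m : ℝ) : ℝ) : ℂ) • (u i a ⊗ₜ[ℂ] v j b) := fun i j => by
      rw [hK, Complex.ofReal_neg, Complex.ofReal_add, neg_smul, add_smul, neg_add, sub_eq_add_neg]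
    rw [diagonal, LinearMap.add_apply, LinearMap.add_apply, TensorProduct.map_tmul,
      TensorProduct.map_tmul, map_add, pairing_tmul, pairing_tmul, pairing_tmul, pairing_tmul]
    simp only [e3, map_sum, map_smul, TensorProduct.map_tmul, Module.End.one_apply, hu, hv,
      TensorProduct.sub_tmul, TensorProduct.tmul_sub, smul_sub, Finset.sum_sub_distrib,
      Finset.sum_neg_distrib, e1, e2]
    abel

end Pairing

section Parallel

variable {B : Type*} [NormedAddCommGroup B] [NormedSpace ℝ B] [FiniteDimensional ℝ B]
  {M : Type*} [TopologicalSpace M] [T2Space M] [ChartedSpace B M] [IsManifold 𝓘(ℝ, B) ∞ M]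
  {F : Type*} [NormedAddCommGroup F] [NormedSpace ℝ F] [FiniteDimensional ℝ F]
  {E : M → Type*} [∀ x, AddCommGroup (E x)] [∀ x, Module ℝ (E x)]
  [∀ x, TopologicalSpace (E x)] [TopologicalSpace (Bundle.TotalSpace F E)]
  [∀ x, IsTopologicalAddGroup (E x)] [∀ x, ContinuousSMul ℝ (E x)]
  [FiberBundle F E] [VectorBundle ℝ F E] [ContMDiffVectorBundle ∞ F E 𝓘(ℝ, B)]
  {cov : CovariantDerivative 𝓘(ℝ, B) F E} {β : (x : M) → E x →L[ℝ] E x →L[ℝ] ℝ}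

/-- The connection matrix at `x`: column `A` holds the components of the derivative of the `A`-th
frame section in the direction `X`. -/
def connMatrix (cov : CovariantDerivative 𝓘(ℝ, B) F E) (x : M) (X : TangentSpace 𝓘(ℝ, B) x) :
    Matrix (Fin (Module.finrank ℝ F)) (Fin (Module.finrank ℝ F)) ℝ :=
  Matrix.of fun D A => (fibreBasis F E x).coord D (connEnd cov x x X (fibreBasis F E x A))

theorem connEnd_eq_sum (x : M) (X : TangentSpace 𝓘(ℝ, B) x) (A : Fin (Module.finrank ℝ F)) :
    connEnd cov x x X (fibreBasis F E x A) =
      ∑ D, connMatrix cov x X D A • fibreBasis F E x D :=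
  ((fibreBasis F E x).sum_repr _).symm

/-- The derivative of the Gram matrix of a parallel form. -/
theorem mvfderiv_frameGram (h : Preserves cov β) (x : M) (X : TangentSpace 𝓘(ℝ, B) x) :
    (Matrix.of fun A C => mvfderiv 𝓘(ℝ, B) (fun y => frameGram (F := F) β x y A C) x X) =
      (connMatrix cov x X).transpose * frameGram β x x + frameGram β x x * connMatrix cov x X := by
  ext A C
  have hs : ∀ A, ∀ z ∈ frameDomain F E x, CMDiffAt ∞ (T% (fibreFrame F E x A)) z :=
    fun A z hz => contMDiffAt_fibreFrame x hz A
  have hx := mem_frameDomain F E x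
  have ho := (trivializationAt F E x).open_baseSet
  obtain ⟨σ, hσ, hσ'⟩ := exists_global_section (F := F) ho hx (hs A)
  obtain ⟨τ, hτ, hτ'⟩ := exists_global_section (F := F) ho hx (hs C)
  have h1 := h σ τ hσ hτ x X
  have e : (fun z => β z (σ z) (τ z)) =ᶠ[nhds x] fun z => frameGram (F := F) β x z A C :=
    (hσ'.and hτ').mono fun z hz => congrArg₂ (fun a b => β z a b) hz.1 hz.2
  rw [mvfderiv_congr (B := B) e, cov_congr cov (hs A x hx) hσ', cov_congr cov (hs C x hx) hτ', hσ'.self_of_nhds,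
    hτ'.self_of_nhds, ← connEnd_self_fibreBasis, ← connEnd_self_fibreBasis, connEnd_eq_sum,
    connEnd_eq_sum] at h1
  rw [Matrix.of_apply, h1, Matrix.add_apply, Matrix.mul_apply, Matrix.mul_apply]
  simp only [map_sum, map_smul, _root_.sum_apply, _root_.smul_apply,
    smul_eq_mul, Matrix.transpose_apply, frameGram, Matrix.of_apply, fibreFrame_self]
  congr 1
  exact Finset.sum_congr rfl fun D _ => mul_comm _ _

/-- The inverse of the Gram matrix of a parallel form is a parallel bivector. -/
theorem mvfderiv_inv_of_parallel {ι : Type*} [Fintype ι] [DecidableEq ι] {x : M}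
    {G : M → Matrix ι ι ℝ} {W : Matrix ι ι ℝ} {X : TangentSpace 𝓘(ℝ, B) x}
    (hG : ∀ i j, ContMDiffAt 𝓘(ℝ, B) 𝓘(ℝ, ℝ) ∞ (fun y => G y i j) x) (h : IsUnit (G x).det)
    (hW : (Matrix.of fun i j => mvfderiv 𝓘(ℝ, B) (fun y => G y i j) x X) =
      W.transpose * G x + G x * W) (i j : ι) :
    mvfderiv 𝓘(ℝ, B) (fun y => (G y)⁻¹ i j) x X =
      -(∑ m, W i m * (G x)⁻¹ m j + ∑ m, (G x)⁻¹ i m * W j m) := by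
  have h1 := mvfderiv_inv_matrix hG h X
  rw [hW, Matrix.mul_add, Matrix.add_mul, ← Matrix.mul_assoc, ← Matrix.mul_assoc,
    Matrix.nonsing_inv_mul _ h, Matrix.one_mul, Matrix.mul_assoc _ (G x),
    Matrix.mul_nonsing_inv _ h, Matrix.mul_one, add_comm] at h1
  have h2 := congrFun (congrFun h1 i) j
  simpa only [Matrix.of_apply, Matrix.neg_apply, Matrix.add_apply, Matrix.mul_apply,
    Matrix.transpose_apply] using h2

end Parallel

/-! ### Parallelism of the contractions -/

section ParallelContraction

variable {B : Type*} [NormedAddCommGroup B] [NormedSpace ℝ B] [FiniteDimensional ℝ B]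
  {M : Type*} [TopologicalSpace M] [T2Space M] [ChartedSpace B M] [IsManifold 𝓘(ℝ, B) ∞ M]
  {F : Type*} [NormedAddCommGroup F] [NormedSpace ℝ F] [FiniteDimensional ℝ F]
  {E : M → Type*} [∀ x, AddCommGroup (E x)] [∀ x, Module ℝ (E x)]
  [∀ x, TopologicalSpace (E x)] [TopologicalSpace (Bundle.TotalSpace F E)]
  [∀ x, IsTopologicalAddGroup (E x)] [∀ x, ContinuousSMul ℝ (E x)]
  [FiberBundle F E] [VectorBundle ℝ F E] [ContMDiffVectorBundle ∞ F E 𝓘(ℝ, B)]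
  {Ω : (x : M) → TangentSpace 𝓘(ℝ, B) x →L[ℝ] TangentSpace 𝓘(ℝ, B) x →L[ℝ] ℝ}
  {q : (x : M) → E x →L[ℝ] E x →L[ℝ] ℝ}
  {covM : CovariantDerivative 𝓘(ℝ, B) B (TangentSpace 𝓘(ℝ, B) : M → Type _)}
  {covE : CovariantDerivative 𝓘(ℝ, B) F E}

variable (covE) in
/-- The Poisson tensor is parallel if the symplectic form is. -/
theorem localR_parallel (hΩ : IsSymplecticForm Ω) (hM : Preserves covM Ω) (x : M)
    (X : TangentSpace 𝓘(ℝ, B) x)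
    (z : FibreAlg (TangentSpace 𝓘(ℝ, B) x) (E x) ⊗[ℂ] FibreAlg (TangentSpace 𝓘(ℝ, B) x) (E x)) :
    pairing (fun i j => ((mvfderiv 𝓘(ℝ, B) (fun y => localPoisson Ω x y i j) x X : ℝ) : ℂ))
      (fun i => iS (tangentBasis B x i)) (fun i => iS (tangentBasis B x i)) z =
    diagonal (connAction F covM covE x x X) (localR Ω x x z) -
      localR Ω x x (diagonal (connAction F covM covE x x X) z) := by
  have h0 : ∀ i a, connAction F covM covE x x X (iS (tangentBasis B x i) a) =
      iS (tangentBasis B x i) (connAction F covM covE x x X a) -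
        ∑ m, (connMatrix (F := B) (E := TangentFamily B M) covM x X m i : ℂ) •
          iS (tangentBasis B x m) a := fun i a => by
    have e : connEnd (F := B) (E := TangentFamily B M) covM x x X (tangentBasis B x i) =
        ∑ m, connMatrix (F := B) (E := TangentFamily B M) covM x X m i • tangentBasis B x m :=
      connEnd_eq_sum (F := B) (E := TangentFamily B M) x X i
    rw [connAction, linAction_iS, e, iS_sum_smul]
    simp only [LinearMap.sum_apply, LinearMap.smul_apply]
  refine pairing_parallel (W := connMatrix (F := B) (E := TangentFamily B M) covM x X)
    (K := localPoisson Ω x x) (fun i j => ?_) h0 h0 z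
  refine mvfderiv_inv_of_parallel
    (G := fun y => (frameGram (F := B) (E := TangentFamily B M) Ω x y).transpose)
    (fun i j => contMDiffAt_frameGram (E := TangentFamily B M) hΩ.smooth x
      (mem_frameDomain _ _ x) j i) ?_ ?_ i j
  · rw [Matrix.det_transpose]
    exact isUnit_det_frameGram (E := TangentFamily B M) hΩ.nondegenerate x (mem_frameDomain _ _ x)
  · have h := congrArg Matrix.transpose
      (mvfderiv_frameGram (F := B) (E := TangentFamily B M) (cov := covM) hM x X)
    rw [Matrix.transpose_add, Matrix.transpose_mul, Matrix.transpose_mul, Matrix.transpose_transpose,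
      add_comm] at h
    exact h

variable (covM) in
/-- The dual metric is parallel if the metric is. -/
theorem localS_parallel (hq : IsFibreMetric B F q) (hE : Preserves covE q) (x : M)
    (X : TangentSpace 𝓘(ℝ, B) x)
    (z : FibreAlg (TangentSpace 𝓘(ℝ, B) x) (E x) ⊗[ℂ] FibreAlg (TangentSpace 𝓘(ℝ, B) x) (E x)) :
    pairing (fun i j => ((mvfderiv 𝓘(ℝ, B) (fun y => localMetric F q x y i j) x X : ℝ) : ℂ))
      (fun A => jE (fibreBasis F E x A)) (fun A => iE (fibreBasis F E x A)) z =
    diagonal (connAction F covM covE x x X) (localS F q x x z) -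
      localS F q x x (diagonal (connAction F covM covE x x X) z) := by
  refine pairing_parallel (W := connMatrix covE x X)
    (K := localMetric F q x x) (fun i j => ?_) (fun i a => ?_) (fun i a => ?_) z
  · exact mvfderiv_inv_of_parallel
      (fun i j => contMDiffAt_frameGram hq.smooth x (mem_frameDomain _ _ x) i j)
      (isUnit_det_frameGram hq.nondegenerate x (mem_frameDomain _ _ x))
      (mvfderiv_frameGram hE x X) i j
  · rw [connAction, linAction_jE, connEnd_eq_sum, jE_sum_smul]
    simp only [LinearMap.sum_apply, LinearMap.smul_apply]
  · rw [connAction, linAction_iE, connEnd_eq_sum, iE_sum_smul]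
    simp only [LinearMap.sum_apply, LinearMap.smul_apply]

theorem fibreProd_eq_bidiff (x : M) (k l : ℕ) (a b : FibreAlg (TangentSpace 𝓘(ℝ, B) x) (E x)) :
    fibreProd F Ω q x k l a b = bidiff (localR Ω x x) (localS F q x x) k l a b := by
  have e1 : poissonMatrix (fun X Y => Ω x X Y) (tangentBasis B x) = localPoisson Ω x x := by
    rw [poissonMatrix, localPoisson]
    congr 1
    ext i j
    rw [Matrix.transpose_apply, frameGram, Matrix.of_apply, Matrix.of_apply, fibreFrame_self,
      fibreFrame_self]
    rfl
  have e2 : inverseMetric (fun e e' => q x e e') (fibreBasis F E x) = localMetric F q x x := by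
    rw [inverseMetric, localMetric]
    congr 1
    ext i j
    rw [frameGram, Matrix.of_apply, Matrix.of_apply, fibreFrame_self, fibreFrame_self]
  rw [fibreProd_apply, contraction_eq_bidiff, fibreR_eq_pairing, fibreS_eq_pairing, e1, e2, localR,
    localS]

/-- The Leibniz rule for the fibrewise contractions, which are built from parallel tensors. -/
theorem hasFiniteDeriv_fibreProd (hΩ : IsSymplecticForm Ω) (hq : IsFibreMetric B F q)
    (hM : Preserves covM Ω) (hE : Preserves covE q) (k l : ℕ) {x : M}
    {u v : (y : M) → FibreAlg (TangentSpace 𝓘(ℝ, B) y) (E y)}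
    (hu : IsFiniteSmoothAt (B := B) x (localRep B F x u))
    (hv : IsFiniteSmoothAt (B := B) x (localRep B F x v)) :
    HasFiniteDeriv x (localRep B F x fun y => fibreProd F Ω q y k l (u y) (v y)) fun X =>
      connAction F covM covE x x X (fibreProd F Ω q x k l (u x) (v x)) +
        (fibreProd F Ω q x k l (covFull F covM covE x u X) (v x) +
          fibreProd F Ω q x k l (u x) (covFull F covM covE x v X)) := by
  have hR := HasFiniteDeriv.pairing (A := FibreAlg (TangentSpace 𝓘(ℝ, B) x) (E x))
    (fun i => iS (tangentBasis B x i)) (fun i => iS (tangentBasis B x i))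
    (contMDiffAt_localPoisson hΩ x)
  have hS := HasFiniteDeriv.pairing (A := FibreAlg (TangentSpace 𝓘(ℝ, B) x) (E x))
    (fun A => jE (fibreBasis F E x A)) (fun A => iE (fibreBasis F E x A))
    (contMDiffAt_localMetric F hq x)
  have h := HasFiniteDeriv.bidiff (ρ := fun X => connAction F covM covE x x X)
    (R := localR Ω x) (S := localS F q x)
    (fun X a b => linAction_mul _ _ _ _ a b) hR hS (localR_parallel covE hΩ hM x)
    (localS_parallel covM hq hE x) k l (covFull_hasFiniteDeriv hu) (covFull_hasFiniteDeriv hv)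
  simp only [localRep_self, ← fibreProd_eq_bidiff] at h
  refine h.congr (Filter.mem_of_superset (commonDomain_mem_nhds B F E x) fun y hy => ?_)
  simp only [fibreProd_apply]
  exact localRep_contraction F Ω q hy k l u v

/-- The connection is a derivation of the deformed product. -/
theorem covFull_circ (hΩ : IsSymplecticForm Ω) (hq : IsFibreMetric B F q)
    (hM : Preserves covM Ω) (hE : Preserves covE q) {v w : RawSection B E}
    (hv : v ∈ fedosovAlgebra B F E) (hw : w ∈ fedosovAlgebra B F E) (x : M) (s t : ℕ)
    (X : TangentSpace 𝓘(ℝ, B) x) :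
    covFull F covM covE x (fun y => circ F Ω q v w y s t) X =
      formalProd (fibreProd F Ω q x) (fun s t => covFull F covM covE x (fun y => v y s t) X) (w x)
          s t +
        formalProd (fibreProd F Ω q x) (v x)
          (fun s t => covFull F covM covE x (fun y => w y s t) X) s t := by
  have hv' := ((mem_fedosovAlgebra_iff F).1 hv).2
  have hw' := ((mem_fedosovAlgebra_iff F).1 hw).2
  have h := HasFiniteDeriv.sum (Finset.range (t + 1)) fun k _ =>
    HasFiniteDeriv.sum (Finset.range (t + 1 - k)) fun l _ =>
    HasFiniteDeriv.sum (Finset.HasAntidiagonal.antidiagonal (t - (k + l))) fun p _ =>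
    HasFiniteDeriv.sum (Finset.HasAntidiagonal.antidiagonal (s + 2 * k)) fun r _ =>
    (hasFiniteDeriv_fibreProd (covM := covM) (covE := covE) hΩ hq hM hE k l (hv' r.1 p.1 x) (hw' r.2 p.2 x)).map
      (starCoeff k l • LinearMap.id)
  refine covFull_eq_of_hasFiniteDeriv ((h.congr (Filter.Eventually.of_forall fun y => ?_)).congr_deriv
    (g' := fun X => connAction F covM covE x x X
        (localRep B F x (fun y => circ F Ω q v w y s t) x) +
      (formalProd (fibreProd F Ω q x) (fun s t => covFull F covM covE x (fun y => v y s t) X) (w x)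
          s t +
        formalProd (fibreProd F Ω q x) (v x)
          (fun s t => covFull F covM covE x (fun y => w y s t) X) s t)) fun X => ?_) X
  · simp only [circ_eq_formalProd, formalProd_eq_sum, localRep_sum, localRep_smul]
    rfl
  · simp only [LinearMap.smul_apply, LinearMap.id_apply, smul_add, Finset.sum_add_distrib,
      localRep_self, circ_eq_formalProd, formalProd_eq_sum, map_sum, map_smul]

end ParallelContraction

/-! ### The connection as a superderivation -/

theorem fibreDelta_mulA {V : Type*} [AddCommGroup V] [Module ℝ V] {F : Type*} [AddCommGroup F]
    [Module ℝ F] {ι : Type*} [Fintype ι] (b : Module.Basis ι ℝ V) (ξ : Module.Dual ℝ V)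
    (a : FibreAlg V F) : fibreDelta b (mulA ξ a) = -mulA ξ (fibreDelta b a) := by
  simp only [fibreDelta, LinearMap.sum_apply, Module.End.mul_apply, map_sum, iS_mulA]
  rw [← Finset.sum_neg_distrib]
  exact Finset.sum_congr rfl fun i _ => mulA_mulA _ _ _

section Sums

variable {W : Type*} [AddCommGroup W] [Module ℂ W] (C : ℕ → ℕ → W →ₗ[ℂ] W →ₗ[ℂ] W) {σ : Type*}

theorem formalProd_sum_left (S : Finset σ) (u : σ → ℕ → ℕ → W) (w : ℕ → ℕ → W) :
    formalProd C (∑ i ∈ S, u i) w = ∑ i ∈ S, formalProd C (u i) w :=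
  map_sum (AddMonoidHom.mk' (fun u => formalProd C u w) fun a b => formalProd_add_left C a b w) u S

theorem formalProd_sum_right (S : Finset σ) (v : ℕ → ℕ → W) (u : σ → ℕ → ℕ → W) :
    formalProd C v (∑ i ∈ S, u i) = ∑ i ∈ S, formalProd C v (u i) :=
  map_sum (AddMonoidHom.mk' (formalProd C v) (formalProd_add_right C v)) u S

end Sums

section Nabla

variable {B : Type*} [NormedAddCommGroup B] [NormedSpace ℝ B] [FiniteDimensional ℝ B]
  {M : Type*} [TopologicalSpace M] [T2Space M] [ChartedSpace B M] [IsManifold 𝓘(ℝ, B) ∞ M]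
  {F : Type*} [NormedAddCommGroup F] [NormedSpace ℝ F] [FiniteDimensional ℝ F]
  {E : M → Type*} [∀ x, AddCommGroup (E x)] [∀ x, Module ℝ (E x)]
  [∀ x, TopologicalSpace (E x)] [TopologicalSpace (Bundle.TotalSpace F E)]
  [∀ x, IsTopologicalAddGroup (E x)] [∀ x, ContinuousSMul ℝ (E x)]
  [FiberBundle F E] [VectorBundle ℝ F E] [ContMDiffVectorBundle ∞ F E 𝓘(ℝ, B)]
  {Ω : (x : M) → TangentSpace 𝓘(ℝ, B) x →L[ℝ] TangentSpace 𝓘(ℝ, B) x →L[ℝ] ℝ}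
  {q : (x : M) → E x →L[ℝ] E x →L[ℝ] ℝ}
  {covM : CovariantDerivative 𝓘(ℝ, B) B (TangentSpace 𝓘(ℝ, B) : M → Type _)}
  {covE : CovariantDerivative 𝓘(ℝ, B) F E}

/-- The covariant derivative commutes with natural fibrewise operators. -/
theorem covFull_map {x : M} {u u' : (y : M) → FibreAlg (TangentSpace 𝓘(ℝ, B) y) (E y)}
    (T : Module.End ℂ (FibreAlg (TangentSpace 𝓘(ℝ, B) x) (E x)))
    (hT : ∀ A C a, linAction (tangentBasis B x) (fibreBasis F E x) A C (T a) =
      T (linAction (tangentBasis B x) (fibreBasis F E x) A C a))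
    (h : ∀ y ∈ commonDomain B F E x, localRep B F x u' y = T (localRep B F x u y))
    (hu : IsFiniteSmoothAt (B := B) x (localRep B F x u)) (X : TangentSpace 𝓘(ℝ, B) x) :
    covFull F covM covE x u' X = T (covFull F covM covE x u X) := by
  have hx := h x (mem_of_mem_nhds (commonDomain_mem_nhds B F E x))
  have h1 := ((covFull_hasFiniteDeriv (covM := covM) (covE := covE) hu).map T).congr
    (Filter.mem_of_superset (commonDomain_mem_nhds B F E x) h)
  refine covFull_eq_of_hasFiniteDeriv (u' := fun X => T (covFull F covM covE x u X))
    (h1.congr_deriv fun X => ?_) X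
  rw [map_add, hx, connAction, hT]

theorem covFull_add {x : M} {u v : (y : M) → FibreAlg (TangentSpace 𝓘(ℝ, B) y) (E y)}
    (hu : IsFiniteSmoothAt (B := B) x (localRep B F x u))
    (hv : IsFiniteSmoothAt (B := B) x (localRep B F x v)) (X : TangentSpace 𝓘(ℝ, B) x) :
    covFull F covM covE x (fun y => u y + v y) X =
      covFull F covM covE x u X + covFull F covM covE x v X := by
  have h1 := ((covFull_hasFiniteDeriv (covM := covM) (covE := covE) hu).add
    (covFull_hasFiniteDeriv (covM := covM) (covE := covE) hv)).congr
      (g := localRep B F x fun y => u y + v y)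
      (Filter.Eventually.of_forall fun y => localRep_add x y u v)
  refine covFull_eq_of_hasFiniteDeriv
    (u' := fun X => covFull F covM covE x u X + covFull F covM covE x v X)
    (h1.congr_deriv fun X => ?_) X
  rw [localRep_add, map_add, add_add_add_comm]

/-- `∇` commutes with fibrewise operators up to the sign with which they pass the factors `dxⁱ`. -/
theorem nabla_map (hs : ∀ y, IsSymmetricAt covM y) {v w : RawSection B E} {x : M} {s t s' t' : ℕ}
    (T : Module.End ℂ (FibreAlg (TangentSpace 𝓘(ℝ, B) x) (E x)))
    (hT : ∀ A C a, linAction (tangentBasis B x) (fibreBasis F E x) A C (T a) =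
      T (linAction (tangentBasis B x) (fibreBasis F E x) A C a))
    (h : ∀ y ∈ commonDomain B F E x, localRep B F x (fun y => w y s t) y =
      T (localRep B F x (fun y => v y s' t') y))
    (hv : v ∈ fedosovAlgebra B F E) :
    nabla F covM covE w x s t = ∑ i, mulA ((tangentBasis B x).coord i)
      (T (covFull F covM covE x (fun y => v y s' t') (tangentBasis B x i))) := by
  rw [nabla_eq_sum w (hs x)]
  exact Finset.sum_congr rfl fun i _ => congrArg _ (covFull_map T hT h
    (((mem_fedosovAlgebra_iff F).1 hv).2 s' t' x) _)

theorem delta_nabla_add_nabla_delta (hs : ∀ y, IsSymmetricAt covM y) {w : RawSection B E}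
    (hw : w ∈ fedosovAlgebra B F E) :
    delta (nabla F covM covE w) + nabla F covM covE (delta w) = 0 := by
  funext x s t
  have h := nabla_map (covE := covE) hs (v := w) (w := delta w) (x := x) (s := s) (t := t)
    (s' := s + 1) (t' := t)
    (fibreDelta (tangentBasis B x)) (linAction_fibreDelta _ _) (fun y hy => localRep_fibreDelta F hy _)
    hw
  rw [Pi.add_apply, Pi.add_apply, Pi.add_apply, h, delta, nabla_eq_sum w (hs x), map_sum,
    ← Finset.sum_add_distrib]
  exact Finset.sum_eq_zero fun i _ => by rw [fibreDelta_mulA, neg_add_cancel]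

theorem nabla_add (hs : ∀ y, IsSymmetricAt covM y) {v w : RawSection B E}
    (hv : v ∈ fedosovAlgebra B F E) (hw : w ∈ fedosovAlgebra B F E) :
    nabla F covM covE (v + w) = nabla F covM covE v + nabla F covM covE w := by
  funext x s t
  rw [Pi.add_apply, Pi.add_apply, Pi.add_apply, nabla_eq_sum _ (hs x), nabla_eq_sum _ (hs x),
    nabla_eq_sum _ (hs x), ← Finset.sum_add_distrib]
  refine Finset.sum_congr rfl fun i _ => ?_
  rw [← map_add]
  exact congrArg _ (covFull_add (((mem_fedosovAlgebra_iff F).1 hv).2 s t x)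
    (((mem_fedosovAlgebra_iff F).1 hw).2 s t x) _)

theorem nabla_smul (hs : ∀ y, IsSymmetricAt covM y) (c : ℂ) {v : RawSection B E}
    (hv : v ∈ fedosovAlgebra B F E) : nabla F covM covE (c • v) = c • nabla F covM covE v := by
  funext x s t
  rw [nabla_map hs (v := v) (s' := s) (t' := t) (c • LinearMap.id)
    (fun A C a => map_smul _ c a) (fun y _ => localRep_smul x y c _) hv, Pi.smul_apply,
    Pi.smul_apply, Pi.smul_apply, nabla_eq_sum _ (hs x), Finset.smul_sum]
  exact Finset.sum_congr rfl fun i _ => map_smul _ c _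

theorem nabla_PE (hs : ∀ y, IsSymmetricAt covM y) {v : RawSection B E}
    (hv : v ∈ fedosovAlgebra B F E) : nabla F covM covE (PE v) = PE (nabla F covM covE v) := by
  funext x s t
  rw [nabla_map hs (v := v) (s' := s) (t' := t) parE (linAction_parE _ _)
    (fun y _ => localRep_onE_extWeight F x y _ _) hv, PE, nabla_eq_sum _ (hs x), map_sum]
  exact Finset.sum_congr rfl fun i _ => (parE_mulA _ _).symm

theorem degA_nabla (hs : ∀ y, IsSymmetricAt covM y) {v : RawSection B E}
    (hv : v ∈ fedosovAlgebra B F E) :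
    degA (nabla F covM covE v) = nabla F covM covE (degA v) + nabla F covM covE v := by
  funext x s t
  rw [Pi.add_apply, Pi.add_apply, Pi.add_apply, nabla_map hs (v := v) (w := degA v) (s' := s)
    (t' := t) numA (linAction_numA _ _) (fun y _ => localRep_onForms_extWeight F x y _ _) hv,
    nabla_eq_sum v (hs x), ← Finset.sum_add_distrib]
  change numA (nabla F covM covE v x s t) = _
  rw [nabla_eq_sum v (hs x), map_sum]
  exact Finset.sum_congr rfl fun i _ => numA_mulA _ _

/-- The parity operator which appears when `dxⁱ` passes the first factor is the sign `(-1)^a` on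
elements of antisymmetric degree `a`. -/
theorem nabla_circ (hs : ∀ y, IsSymmetricAt covM y) (hΩ : IsSymplecticForm Ω)
    (hq : IsFibreMetric B F q) (hM : Preserves covM Ω) (hE : Preserves covE q) {d : ZMod 2} {a : ℤ}
    {v w : RawSection B E} (hv : v ∈ homogeneous B F E d a) (hw : w ∈ fedosovAlgebra B F E) :
    nabla F covM covE (circ F Ω q v w) = circ F Ω q (nabla F covM covE v) w +
      (-1 : ℂ) ^ a • circ F Ω q v (nabla F covM covE w) := by
  have hsum : ∀ (w : RawSection B E) x, nabla F covM covE w x =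
      ∑ i, fun s t => mulA ((tangentBasis B x).coord i)
        (covFull F covM covE x (fun y => w y s t) (tangentBasis B x i)) := fun w x => by
    funext s t
    rw [nabla_eq_sum w (hs x), Finset.sum_apply, Finset.sum_apply]
  have hP : ∀ x, (fun s t => parA (v x s t)) = ((-1 : ℂ) ^ a • v) x := fun x => by
    funext s t
    exact parA_of_numA ((mem_homogeneous_iff.1 hv).2.2 x s t)
  rw [← circ_smul_left]
  funext x s t
  have h1 : ∀ (i : Fin (Module.finrank ℝ B)) (u u' : ℕ → ℕ →
      FibreAlg (TangentSpace 𝓘(ℝ, B) x) (E x)),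
      mulA ((tangentBasis B x).coord i) (formalProd (fibreProd F Ω q x) u u' s t) =
        formalProd (fibreProd F Ω q x) (fun s t => mulA ((tangentBasis B x).coord i) (u s t)) u'
          s t := fun i u u' =>
    formalProd_map (g := 1) (fun k l a b => by
      rw [fibreProd_apply, fibreProd_apply, mulA_contraction, Module.End.one_apply]) u u' s t
  have h2 : ∀ (i : Fin (Module.finrank ℝ B)) (u u' : ℕ → ℕ →
      FibreAlg (TangentSpace 𝓘(ℝ, B) x) (E x)),
      mulA ((tangentBasis B x).coord i) (formalProd (fibreProd F Ω q x) u u' s t) =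
        formalProd (fibreProd F Ω q x) (fun s t => parA (u s t))
          (fun s t => mulA ((tangentBasis B x).coord i) (u' s t)) s t := fun i u u' =>
    formalProd_map (fun k l a b => by
      rw [fibreProd_apply, fibreProd_apply, contraction_mulA, parA_parA]) u u' s t
  rw [nabla_eq_sum _ (hs x), Pi.add_apply, Pi.add_apply, Pi.add_apply, circ_eq_formalProd,
    circ_eq_formalProd, hsum, hsum, ← hP]
  simp only [covFull_circ hΩ hq hM hE hv.1 hw, map_add, Finset.sum_add_distrib]
  congr 1
  · rw [formalProd_sum_left, Finset.sum_apply, Finset.sum_apply]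
    exact Finset.sum_congr rfl fun i _ => h1 i _ _
  · rw [formalProd_sum_right, Finset.sum_apply, Finset.sum_apply]
    exact Finset.sum_congr rfl fun i _ => h2 i _ _

theorem isSuperderivation_nabla (hcovM : CovariantDerivative.ContMDiffCovariantDerivative covM ∞)
    (hcovE : CovariantDerivative.ContMDiffCovariantDerivative covE ∞)
    (hs : ∀ y, IsSymmetricAt covM y) (hΩ : IsSymplecticForm Ω) (hq : IsFibreMetric B F q)
    (hM : Preserves covM Ω) (hE : Preserves covE q) :
    IsSuperderivation F (circ F Ω q) (nabla F covM covE) 0 1 where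
  mem _ := nabla_mem hcovM hcovE hs
  add _ hv _ hw := nabla_add hs hv hw
  smul c _ hv := nabla_smul hs c hv
  parity v hv := by
    rw [pow_zero, one_smul, nabla_PE hs hv]
    funext x s t
    exact parE_parE _
  degree v hv := by
    rw [Int.cast_one, one_smul, degA_nabla hs hv, add_sub_cancel_left]
  leibniz d a v hv w hw := by
    rw [Nat.cast_zero, zero_mul, zero_add, one_mul]
    exact nabla_circ hs hΩ hq hM hE hv hw

end Nabla

end Fedosov

end

/-- Structure maps of the Fedosov algebra of a symplectic manifold `(M, Ω)` with a torsion-free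
symplectic connection and of a real vector bundle `E` over `M` with a nondegenerate fibre metric
`q` and a metric connection. `M` is modelled on the finite-dimensional space `B`, and `F` is the
typical fibre of `E`. -/
theorem mainTheorem7
    {B : Type*} [NormedAddCommGroup B] [NormedSpace ℝ B] [FiniteDimensional ℝ B]
    {M : Type*} [TopologicalSpace M] [T2Space M] [SecondCountableTopology M]
    [ChartedSpace B M] [IsManifold 𝓘(ℝ, B) ∞ M]
    {F : Type*} [NormedAddCommGroup F] [NormedSpace ℝ F] [FiniteDimensional ℝ F]
    {E : M → Type*} [∀ x, AddCommGroup (E x)] [∀ x, Module ℝ (E x)]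
    [∀ x, TopologicalSpace (E x)] [∀ x, IsTopologicalAddGroup (E x)]
    [∀ x, ContinuousSMul ℝ (E x)] [TopologicalSpace (Bundle.TotalSpace F E)]
    [FiberBundle F E] [VectorBundle ℝ F E] [ContMDiffVectorBundle ∞ F E 𝓘(ℝ, B)]
    (Ω : (x : M) → TangentSpace 𝓘(ℝ, B) x →L[ℝ] TangentSpace 𝓘(ℝ, B) x →L[ℝ] ℝ)
    (hΩ : IsSymplecticForm Ω)
    (covM : CovariantDerivative 𝓘(ℝ, B) B (TangentSpace 𝓘(ℝ, B) : M → Type _))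
    (hcovM : CovariantDerivative.ContMDiffCovariantDerivative covM ∞)
    (htorsion : TorsionFree covM) (hcovMΩ : Preserves covM Ω)
    (q : (x : M) → E x →L[ℝ] E x →L[ℝ] ℝ) (hq : IsFibreMetric B F q)
    (covE : CovariantDerivative 𝓘(ℝ, B) F E)
    (hcovE : CovariantDerivative.ContMDiffCovariantDerivative covE ∞)
    (hcovEq : Preserves covE q) :
    -- the differentials `δ` and `δ*`
    (∀ w ∈ fedosovAlgebra B F E, delta w ∈ fedosovAlgebra B F E ∧
      deltaStar w ∈ fedosovAlgebra B F E ∧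
      delta (delta w) = 0 ∧ deltaStar (deltaStar w) = 0 ∧
      delta (deltaStar w) + deltaStar (delta w) = degS w + degA w) ∧
    -- `δ` and `∇` anticommute
    (∀ w ∈ fedosovAlgebra B F E, nabla F covM covE w ∈ fedosovAlgebra B F E ∧
      delta (nabla F covM covE w) + nabla F covM covE (delta w) = 0) ∧
    -- the kernel of `δ` in antisymmetric degree zero
    {w | w ∈ fedosovAlgebra B F E ∧ delta w = 0 ∧ degA w = 0} = classicalSeries B F E ∧
    -- `∘` is `μ ∘ exp ((iλ/2) (R + S))`
    (∀ v ∈ fedosovAlgebra B F E, ∀ w ∈ fedosovAlgebra B F E, ∀ x,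
      circ F Ω q v w x = muSeries (expLam (halfRS F Ω q x) (tensorSeries v w x))) ∧
    -- `∘` is a bilinear, associative, `ℤ₂ × ℤ`-graded multiplication
    IsGradedAssociativeAlgebra F (circ F Ω q : RawSection B E → RawSection B E → RawSection B E) ∧
    -- `P_E` is an automorphism and `deg_a` is a derivation of `∘`
    IsAutomorphism F (circ F Ω q) (PE : RawSection B E → RawSection B E) ∧
    IsDerivation F (circ F Ω q) (degA : RawSection B E → RawSection B E) ∧
    -- the superderivations `δ`, `∇`, `Deg`, of types `(1,1)`, `(1,1)`, `(1,0)`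
    IsSuperderivation F (circ F Ω q) (delta : RawSection B E → RawSection B E) 0 1 ∧
    IsSuperderivation F (circ F Ω q) (nabla F covM covE) 0 1 ∧
    IsSuperderivation F (circ F Ω q) (Deg : RawSection B E → RawSection B E) 0 0 ∧
    -- `P_λ` and complex conjugation are graded antiautomorphisms
    IsGradedAntiautomorphism F (circ F Ω q) (RingHom.id ℂ)
      (PLam : RawSection B E → RawSection B E) ∧
    IsGradedAntiautomorphism F (circ F Ω q) (starRingEnd ℂ)
      (conjSection : RawSection B E → RawSection B E) := by
  have hs := isSymmetricAt_of_torsionFree htorsion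
  exact ⟨fun w hw => ⟨delta_mem hw, deltaStar_mem hw, delta_identities hw⟩,
    fun w hw => ⟨nabla_mem hcovM hcovE hs hw, delta_nabla_add_nabla_delta hs hw⟩,
    ker_delta_eq_classicalSeries B F E, fun v hv w hw x => circ_eq_exp hv hw x,
    isGradedAssociativeAlgebra_circ hΩ hq, isAutomorphism_PE, isDerivation_degA,
    isSuperderivation_delta, isSuperderivation_nabla hcovM hcovE hs hΩ hq hcovMΩ hcovEq,
    isSuperderivation_Deg, isGradedAntiautomorphism_PLam hΩ hq,
    isGradedAntiautomorphism_conjSection hΩ hq⟩
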